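/- **Setting.** Let $x_1,x_2,\dots$ be free variables, $x_{i\to j}=\prod_{r=i}^{j-1}x_r$ for $i<j$. Let $\mathbb H$ be the free commutative $\mathbb Q$-algebra on symbols $[x_r]_0$ (weight $1$) and regular symbols $[x_{i_1\to i_2},\dots,x_{i_d\to i_{d+1}}]_{n_1,\dots,n_d}$ (weight $n_1+\dots+n_d$), where $d\ge 1$, $1\le i_1<\dots<i_{d+1}$, $n_k\ge1$. Let $\overline{\mathbb H}\supset\mathbb H$ be the free commutative $\mathbb Q$-algebra with additional inverted symbols $[x_{i_d\to i_{d+1}}^{-1},\dots,x_{i_1\to i_2}^{-1}]_{n_d,\dots,n_1}$ of the same weight. Put $[x_{i\to j}]_0=-[x_{i\to j}^{-1}]_0=\sum_{r=i}^{j-1}[x_r]_0$, $[\emptyset|\emptyset]=1$ and $$[y_1,\dots,y_d|t_1,\dots,t_d]=\sum_{n_k\ge1}[y_1,\dots,y_d]_{n_1,\dots,n_d}\,t_1^{n_1-1}\cdots t_d^{n_d-1}.$$ *Coproduct of $\overline{\mathbb H}$.* $\Delta$ is the algebra homomorphism with $\Delta[x_r]_0=[x_r]_0\otimes1+1\otimes[x_r]_0$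 and, for regular and for inverted symbols, $$\Delta[y_1,\dots,y_d|t_1,\dots,t_d]=\sum[y_{i_1\to i_2},\dots,y_{i_k\to i_{k+1}}|t_{j_1},\dots,t_{j_k}]\otimes[y_1,\dots,y_{i_1-1}|t_1,\dots,t_{i_1-1}]\prod_{\alpha=1}^kB_\alpha,$$ $$B_\alpha=(-1)^{j_\alpha-i_\alpha}\exp([y_{i_\alpha\to i_{\alpha+1}}]_0t_{j_\alpha})\,[y_{j_\alpha-1}^{-1},\dots,y_{i_\alpha}^{-1}|t_{j_\alpha}-t_{j_\alpha-1},\dots,t_{j_\alpha}-t_{i_\alpha}]\,[y_{j_\alpha+1},\dots,y_{i_{\alpha+1}-1}|t_{j_\alpha+1}-t_{j_\alpha},\dots,t_{i_{\alpha+1}-1}-t_{j_\alpha}],$$ summed over $k\ge0$ and $1\le i_1\le j_1<i_2\le j_2<\dots<i_k\le j_k<i_{k+1}=d+1$, with $y_{i\to j}=\prod_{r=i}^{j-1}y_r$. *Coproduct of $\mathbb H$.* $\mathrm{INV}\colon\overline{\mathbb H}\to\mathbb H$ is the algebra homomorphism that fixes $[x_r]_0$ and the regular symbols and is defined on inverted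 symbols by recursion on $d$: with $K_j(t_1,\dots,t_j)=\mathrm{INV}[y_j^{-1},\dots,y_1^{-1}|-t_j,\dots,-t_1]$ and $K_0=1$, $$K_d=\sum_{j=0}^{d-1}(-1)^{d-1+j}K_j(t_1,\dots,t_j)[y_{j+1},\dots,y_d|t_{j+1},\dots,t_d]+\sum_{j=1}^d\frac{(-1)^{d-1+j}}{t_j}\Big(K_{j-1}(t_1,\dots,t_{j-1})[y_{j+1},\dots,y_d|t_{j+1},\dots,t_d]$$ $$\qquad-K_{j-1}(t_1-t_j,\dots,t_{j-1}-t_j)\exp([y_{1\to d+1}]_0t_j)[y_{j+1},\dots,y_d|t_{j+1}-t_j,\dots,t_d-t_j]\Big).$$ The coproduct of $\mathbb H$ is the restriction of $(\mathrm{INV}\otimes\mathrm{INV})\circ\Delta$ to $\mathbb H$. The counits are the projections to weight $0$. *Derivation.* $d\mathbb H$ is the free $\mathbb H$-module on $d[x_r]_0$ and $d[x_{i\to j}]_1$ $(i<j)$; $d\overline{\mathbb H}$ is the free $\overline{\mathbb H}$-module on these and $d[x_{i\to j}^{-1}]_1$. The derivation $d$ sends $[x_r]_0$ to $d[x_r]_0$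 and satisfies $$d[y_1,\dots,y_d|t_1,\dots,t_d]=[y_1,\dots,y_d|t_1,\dots,t_d]\sum_{k=1}^dt_k\,d[y_k]_0+[y_2,\dots,y_d|t_2,\dots,t_d]\,d[y_1]_1$$ $$+\sum_{k=2}^d[y_1,\dots,y_{k-1}y_k,\dots,y_d|t_1,\dots,\widehat{t_k},\dots,t_d]\,d[y_k]_1-\sum_{k=1}^{d-1}[y_1,\dots,y_ky_{k+1},\dots,y_d|t_1,\dots,\widehat{t_k},\dots,t_d]\,\delta(y_k),$$ where $\delta(y)=d[y]_1+d[y]_0$ for $\mathbb H$ and $\delta(y)=d[y^{-1}]_1$ for $\overline{\mathbb H}$. *Index vectors.* Let $\mathbb Z^\infty_{\ge0}=\bigcup_\ell\mathbb Z^\ell_{\ge0}$ with all zero vectors identified. The vector $(0^{i_1-1},n_1,0^{i_2-i_1-1},n_2,\dots,n_d,0^{i_{d+1}-i_d-1})$ is identified with the regular symbol $[x_{i_1\to i_2},\dots,x_{i_d\to i_{d+1}}]_{n_1,\dots,n_d}$, and $0$ with $1$. Write $k\prec l$ if $\|k\|<\|l\|$ (sums of entries), or the sums agree and $\dim k<\dim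 l$, or both agree and the rightmost non-zero entry of $l-k$ is negative. **Theorem.** Let $A$ be $\mathbb H$ or $\overline{\mathbb H}$, with its coproduct $\Delta$. 1. There is a unique matrix $V$ over $A$, with rows and columns indexed by $\mathbb Z^\infty_{\ge0}$ and finitely many non-zero entries in each row, such that $\Delta(v)=\sum_w w\otimes V_{v,w}$ for all $v$ (the variation matrix). It satisfies $$\Delta(V^T)=V^T\otimes V^T,\qquad\text{i.e. } \Delta(V_{w,v})=\sum_uV_{u,v}\otimes V_{w,u}.$$ 2. $A$ is a Hopf algebra whose antipode $S$ is the only linear map with $\mu(S\otimes\mathrm{id})\Delta=\eta\varepsilon$, and $S(V)=V^{-1}$, that is $S(V)V=VS(V)=I$. 3. $dV=\omega V$, where $\omega=dV_1$ and $V_1$ is the weight $1$ part of $V$. 4. Let $\mathbf n=(n_1,\dots,n_d)$ with $d\ge1$ and all $n_i\ge1$. Let $V_{\mathbf n}$ be the submatrix of $V$ indexed by those $v\preceq\mathbf n$ which are zero or have dimension $d$, and for which every non-zero entry $v_p$ satisfies $v_p\le\max\{n_r: p\le r<q\}$, where $q$ is the position of the next non-zero entry of $v$ (and $q=d+1$ if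 there is none). This index set is finite, and $\Delta(V_{\mathbf n}^T)=V_{\mathbf n}^T\otimes V_{\mathbf n}^T$, $S(V_{\mathbf n})=V_{\mathbf n}^{-1}$ and $dV_{\mathbf n}=\omega_{\mathbf n}V_{\mathbf n}$ with $\omega_{\mathbf n}=d(V_{\mathbf n})_1$. If $n_1\ge n_2\ge\dots\ge n_d$, the same holds for the submatrix indexed by the $v\preceq\mathbf n$ that are zero or of dimension $d$ and satisfy $v_p\le n_p$ for all $p$. -/

import Mathlib

open scoped TensorProduct

noncomputable section

namespace SymbPolylog

/-! ### The algebras of symbolic polylogarithms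

The free variables are `x 0, x 1, x 2, …`.  For `a < b` we write `x_{a→b} = ∏_{a ≤ r < b} x r`, and
`x_{b→a} = x_{a→b}⁻¹`.  A string of arguments `y_0, …, y_{d-1}` is always recorded by its `d + 1`
break points `e 0, …, e d`, meaning `y_k = x_{e k → e (k+1)}`; hence `y_a ⋯ y_{b-1} = x_{e a → e b}`.
Break points increase for the strings `x_{i_1→i_2}, …, x_{i_d→i_{d+1}}`, and decrease for the
inverted strings `x_{i_d→i_{d+1}}⁻¹, …, x_{i_1→i_2}⁻¹`. -/

/-- The data of `[x_{e 0 → e 1}, …, x_{e (d-1) → e d}]_{n 0, …, n (d-1)}` with `d ≥ 1`, `e` strictly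
increasing and `n k ≥ 1`. -/
structure PolySymbol where
  depth : ℕ
  depth_pos : 0 < depth
  e : Fin (depth + 1) → ℕ
  e_strictMono : StrictMono e
  n : Fin depth → ℕ
  n_pos : ∀ k, 0 < n k

/-- The break points as a sequence (only the values at `0, …, depth` matter). -/
def PolySymbol.seq (s : PolySymbol) (a : ℕ) : ℕ :=
  if h : a < s.depth + 1 then s.e ⟨a, h⟩ else 0

/-- The weight `n 0 + ⋯ + n (d-1)`. -/
def PolySymbol.weight (s : PolySymbol) : ℕ := ∑ k, s.n k

/-- Generators of `ℍ`: `log r` is `[x_r]_0`, and `reg s` is the polylogarithm symbol `s`. -/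
inductive Gen : Type
  | log (r : ℕ)
  | reg (s : PolySymbol)

/-- Generators of `ℍ̄`: those of `ℍ`, and for each symbol `s` with data `e, n` the inverted symbol
`inv s = [x_{e (d-1) → e d}⁻¹, …, x_{e 0 → e 1}⁻¹]_{n (d-1), …, n 0}`. -/
inductive GenBar : Type
  | log (r : ℕ)
  | reg (s : PolySymbol)
  | inv (s : PolySymbol)

/-- The free commutative `ℚ`-algebra `ℍ` of symbolic polylogarithms. -/
abbrev H : Type := MvPolynomial Gen ℚ

/-- The auxiliary free commutative `ℚ`-algebra `ℍ̄`, with inverted symbols. -/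
abbrev HBar : Type := MvPolynomial GenBar ℚ

/-- Weights of the generators; `[x_r]_0` has weight one. -/
def Gen.weight : Gen → ℕ
  | .log _ => 1
  | .reg s => s.weight

/-- Weights of the generators; `[x_r]_0` has weight one. -/
def GenBar.weight : GenBar → ℕ
  | .log _ => 1
  | .reg s => s.weight
  | .inv s => s.weight

/-- The inclusion of `ℍ` in `ℍ̄`. -/
def incl : H →ₐ[ℚ] HBar :=
  MvPolynomial.aeval fun g => match g with
    | .log r => MvPolynomial.X (.log r)
    | .reg s => MvPolynomial.X (.reg s)

/-! ### Brackets and generating series -/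

/-- `[x_{a→b}]_0`, which is `∑_{a ≤ r < b} [x_r]_0` for `a ≤ b`, and `-[x_{b→a}]_0` for `b ≤ a`. -/
def logH (a b : ℕ) : H :=
  ∑ r ∈ Finset.Ico a b, MvPolynomial.X (.log r) - ∑ r ∈ Finset.Ico b a, MvPolynomial.X (.log r)

/-- `[x_{a→b}]_0` in `ℍ̄`. -/
def logHBar (a b : ℕ) : HBar :=
  ∑ r ∈ Finset.Ico a b, MvPolynomial.X (.log r) - ∑ r ∈ Finset.Ico b a, MvPolynomial.X (.log r)

open Classical in
/-- The element `[y_0, …, y_{d-1}]_{n 0, …, n (d-1)}` of `ℍ`, for increasing break points `e`; it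
is `1` for `d = 0`.  (The value `0` for other `e` is never used.) -/
def bracketH (d : ℕ) (e : Fin (d + 1) → ℕ) (n : Fin d → ℕ) : H :=
  if d = 0 then 1
  else if h : 0 < d ∧ StrictMono e ∧ ∀ k, 0 < n k then
    MvPolynomial.X (.reg ⟨d, h.1, e, h.2.1, n, h.2.2⟩)
  else 0

open Classical in
/-- The element `[y_0, …, y_{d-1}]_{n 0, …, n (d-1)}` of `ℍ̄`, for break points `e` that increase
(regular symbol) or decrease (inverted symbol); it is `1` for `d = 0`.  (The value `0` for other
`e` is never used.) -/
def bracketHBar (d : ℕ) (e : Fin (d + 1) → ℕ) (n : Fin d → ℕ) : HBar :=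
  if d = 0 then 1
  else if h : 0 < d ∧ StrictMono e ∧ ∀ k, 0 < n k then
    MvPolynomial.X (.reg ⟨d, h.1, e, h.2.1, n, h.2.2⟩)
  else if h : 0 < d ∧ StrictMono (fun a : Fin (d + 1) => e a.rev) ∧ ∀ k : Fin d, 0 < n k.rev then
    MvPolynomial.X (.inv ⟨d, h.1, fun a => e a.rev, h.2.1, fun k => n k.rev, h.2.2⟩)
  else 0

section series

variable {A : Type} [CommRing A] [Algebra ℚ A]

/-- The generating series `[y_0, …, y_{d-1} | s 0, …, s (d-1)]
= ∑_{n k ≥ 1} [y_0, …, y_{d-1}]_{n 0, …, n (d-1)} ∏ (s k)^(n k - 1)`, where the `s k` are power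
series in the variables `t_0, t_1, …` without constant term. -/
def genSeries (br : ∀ d : ℕ, (Fin (d + 1) → ℕ) → (Fin d → ℕ) → A) (d : ℕ)
    (e : Fin (d + 1) → ℕ) (s : Fin d → MvPowerSeries ℕ A) : MvPowerSeries ℕ A :=
  MvPowerSeries.subst s
    ((fun m : Fin d →₀ ℕ => br d e (fun k => m k + 1)) : MvPowerSeries (Fin d) A)

/-- `exp (a s) = ∑ a^n s^n / n!` for a power series `s` without constant term. -/
def expSeries (a : A) (s : MvPowerSeries ℕ A) : MvPowerSeries ℕ A :=
  PowerSeries.subst s (PowerSeries.mk fun n => algebraMap ℚ A (1 / (n.factorial : ℚ)) * a ^ n)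

/-- The variable `t_k`. -/
def t (k : ℕ) : MvPowerSeries ℕ A := MvPowerSeries.X k

/-- Division by `t_k` (of a series that is divisible by `t_k`). -/
def divT (k : ℕ) (f : MvPowerSeries ℕ A) : MvPowerSeries ℕ A :=
  fun m => MvPowerSeries.coeff (m + Finsupp.single k 1) f

end series

/-- The exponent of the monomial `∏_k t_k^(n k - 1)`. -/
def expVec {d : ℕ} (n : Fin d → ℕ) : ℕ →₀ ℕ := ∑ k : Fin d, Finsupp.single (k : ℕ) (n k - 1)

/-! ### The coproduct on `ℍ̄` -/

/-- The pairs of sequences `i_1 ≤ j_1 < i_2 ≤ j_2 < ⋯ < i_k ≤ j_k < i_{k+1} = d`, with `i_1 ≥ 0`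
(as the letters are numbered from `0`, they are `y_0, …, y_{d-1}`).  The sequences themselves are
numbered from `0` in the code. -/
def cuts (d k : ℕ) : Finset ((Fin (k + 1) → Fin (d + 1)) × (Fin k → Fin (d + 1))) :=
  Finset.univ.filter fun p =>
    p.1 (Fin.last k) = Fin.last d ∧ ∀ α : Fin k, p.1 α.castSucc ≤ p.2 α ∧ p.2 α < p.1 α.succ

/-- The factor
`(-1)^(j-i) exp([y_i ⋯ y_{i'-1}]_0 t_j) [y_{j-1}⁻¹, …, y_i⁻¹ | t_j - t_{j-1}, …, t_j - t_i]
[y_{j+1}, …, y_{i'-1} | t_{j+1} - t_j, …, t_{i'-1} - t_j]` of the coproduct. -/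
def blockFactor (e : ℕ → ℕ) (i j i' : ℕ) : MvPowerSeries ℕ HBar :=
  (-1) ^ (j - i) * expSeries (logHBar (e i) (e i')) (t j)
    * genSeries bracketHBar (j - i) (fun a => e (j - a)) (fun a => t j - t (j - 1 - a))
    * genSeries bracketHBar (i' - 1 - j) (fun a => e (j + 1 + a)) (fun a => t (j + 1 + a) - t j)

/-- The generating series `Δ [y_0, …, y_{d-1} | t_0, …, t_{d-1}]` of the coproducts, as a power
series with coefficients in `ℍ̄ ⊗ ℍ̄`. -/
def coprodSeries (d : ℕ) (e : ℕ → ℕ) : MvPowerSeries ℕ (HBar ⊗[ℚ] HBar) :=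
  ∑ k ∈ Finset.range (d + 1), ∑ p ∈ cuts d k,
    MvPowerSeries.map
        (Algebra.TensorProduct.includeLeft : HBar →ₐ[ℚ] HBar ⊗[ℚ] HBar).toRingHom
        (genSeries bracketHBar k (fun a => e (p.1 a)) (fun a => t (p.2 a)))
      * MvPowerSeries.map
        (Algebra.TensorProduct.includeRight : HBar →ₐ[ℚ] HBar ⊗[ℚ] HBar).toRingHom
        (genSeries bracketHBar (p.1 0) (fun a => e a) (fun a => t a)
          * ∏ α : Fin k, blockFactor e (p.1 α.castSucc) (p.2 α) (p.1 α.succ))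

/-- The coproduct of `ℍ̄`. -/
def coprodHBar : HBar →ₐ[ℚ] HBar ⊗[ℚ] HBar :=
  MvPolynomial.aeval fun g => match g with
    | .log r => MvPolynomial.X (.log r) ⊗ₜ 1 + 1 ⊗ₜ MvPolynomial.X (.log r)
    | .reg s => MvPowerSeries.coeff (expVec s.n) (coprodSeries s.depth s.seq)
    | .inv s => MvPowerSeries.coeff (expVec fun k => s.n k.rev)
        (coprodSeries s.depth fun a => s.seq (s.depth - a))

/-! ### The inversion map and the coproduct on `ℍ` -/

/-- For `y_k = x_{f k → f (k+1)}` with `f` increasing, the series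
`INV [y_{d-1}⁻¹, …, y_0⁻¹ | -t_{d-1}, …, -t_0]`, by recursion on the depth `d`. -/
def invSeries (f : ℕ → ℕ) (d : ℕ) : MvPowerSeries ℕ H :=
  if d = 0 then 1
  else
    ∑ j : Fin d, (-1) ^ (d + 1 + (j : ℕ)) * invSeries f j
        * genSeries bracketH (d - j) (fun a => f (j + a)) (fun a => t (j + a))
    + ∑ j : Fin d, (-1) ^ (d + (j : ℕ)) * divT j
        (invSeries f j
            * genSeries bracketH (d - 1 - j) (fun a => f (j + 1 + a)) (fun a => t (j + 1 + a))
          - MvPowerSeries.subst (fun r : ℕ => if r < j then t r - t (j : ℕ) else 0) (invSeries f j)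
            * expSeries (logH (f 0) (f d)) (t j)
            * genSeries bracketH (d - 1 - j) (fun a => f (j + 1 + a))
                (fun a => t (j + 1 + a) - t j))
termination_by d
decreasing_by all_goals exact j.2

/-- The inversion map `INV : ℍ̄ → ℍ`. -/
def INV : HBar →ₐ[ℚ] H :=
  MvPolynomial.aeval fun g => match g with
    | .log r => MvPolynomial.X (.log r)
    | .reg s => MvPolynomial.X (.reg s)
    | .inv s => (-1) ^ (∑ k, (s.n k - 1))
        * MvPowerSeries.coeff (expVec s.n) (invSeries s.seq s.depth)

/-- The coproduct of `ℍ`: apply `INV` to the inverted symbols in the coproduct of `ℍ̄`. -/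
def coprodH : H →ₐ[ℚ] H ⊗[ℚ] H :=
  (Algebra.TensorProduct.map INV INV).comp (coprodHBar.comp incl)

/-- The counit of `ℍ`: projection to weight zero. -/
def counitH : H →ₐ[ℚ] ℚ := MvPolynomial.aeval fun _ => 0

/-- The counit of `ℍ̄`: projection to weight zero. -/
def counitHBar : HBar →ₐ[ℚ] ℚ := MvPolynomial.aeval fun _ => 0

/-! ### Hopf algebras -/

section Hopf

variable {A : Type} [CommRing A] [Algebra ℚ A]

/-- `μ ∘ (S ⊗ id) ∘ Δ = η ∘ ε`. -/
def IsLeftAntipode (Δ : A →ₐ[ℚ] A ⊗[ℚ] A) (ε : A →ₐ[ℚ] ℚ) (S : A →ₗ[ℚ] A) : Prop :=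
  LinearMap.mul' ℚ A ∘ₗ S.rTensor A ∘ₗ Δ.toLinearMap = Algebra.linearMap ℚ A ∘ₗ ε.toLinearMap

/-- `μ ∘ (id ⊗ S) ∘ Δ = η ∘ ε`. -/
def IsRightAntipode (Δ : A →ₐ[ℚ] A ⊗[ℚ] A) (ε : A →ₐ[ℚ] ℚ) (S : A →ₗ[ℚ] A) : Prop :=
  LinearMap.mul' ℚ A ∘ₗ S.lTensor A ∘ₗ Δ.toLinearMap = Algebra.linearMap ℚ A ∘ₗ ε.toLinearMap

/-- `Δ`, `ε`, `S` make the algebra `A` a Hopf algebra. -/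
structure IsHopf (Δ : A →ₐ[ℚ] A ⊗[ℚ] A) (ε : A →ₐ[ℚ] ℚ) (S : A →ₗ[ℚ] A) : Prop where
  coassoc : TensorProduct.assoc ℚ A A A ∘ₗ Δ.toLinearMap.rTensor A ∘ₗ Δ.toLinearMap =
    Δ.toLinearMap.lTensor A ∘ₗ Δ.toLinearMap
  counit_left : ε.toLinearMap.rTensor A ∘ₗ Δ.toLinearMap = TensorProduct.mk ℚ ℚ A 1
  counit_right : ε.toLinearMap.lTensor A ∘ₗ Δ.toLinearMap = (TensorProduct.mk ℚ A ℚ).flip 1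
  antipode_left : IsLeftAntipode Δ ε S
  antipode_right : IsRightAntipode Δ ε S

end Hopf

/-! ### Index vectors -/

/-- The union of all `ℤ_{≥0}^ℓ`, with all zero vectors identified: a vector is a list of natural
numbers, and `[]` is the only zero vector. -/
abbrev Zinf : Type := {l : List ℕ // l = [] ∨ ∃ a ∈ l, a ≠ 0}

namespace Zinf

/-- The zero vector. -/
def zero : Zinf := ⟨[], Or.inl rfl⟩

/-- The entry at position `p` (positions are numbered from `0`); it is `0` out of range. -/
def entry (v : Zinf) (p : ℕ) : ℕ := v.1.getD p 0

/-- The dimension of a non-zero vector. -/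
def dim (v : Zinf) : ℕ := v.1.length

/-- The sum of the entries. -/
def norm (v : Zinf) : ℕ := v.1.sum

/-- The increasing list of the positions of the non-zero entries. -/
def pos (v : Zinf) : List ℕ := (List.range v.1.length).filter fun p => v.1.getD p 0 ≠ 0

/-- The strict order on index vectors. -/
def Lt (k l : Zinf) : Prop :=
  k.norm < l.norm ∨ (k.norm = l.norm ∧ k.dim < l.dim) ∨
    (k.norm = l.norm ∧ k.dim = l.dim ∧
      ∃ p, l.entry p < k.entry p ∧ ∀ q, p < q → l.entry q = k.entry q)

/-- The order on index vectors. -/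
def Le (k l : Zinf) : Prop := Zinf.Lt k l ∨ k = l

/-- The element `[x_{i_1→i_2}, …, x_{i_d→i_{d+1}}]_{n_1, …, n_d}` with index vector `v`: its weights
`n_1, …, n_d` are the non-zero entries of `v`, their positions are `i_1, …, i_d`, and `i_{d+1}` is
the dimension of `v`.  The zero vector gives `1`. -/
def symbol {A : Type} (br : ∀ d : ℕ, (Fin (d + 1) → ℕ) → (Fin d → ℕ) → A) (v : Zinf) : A :=
  br v.pos.length (fun a => (v.pos ++ [v.dim]).getD a 0) (fun k => v.entry (v.pos.getD k 0))

/-- `n = (n_1, …, n_d)` with `d ≥ 1` and all `n_i ≥ 1`. -/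
def IsPositive (n : Zinf) : Prop := n.1 ≠ [] ∧ ∀ a ∈ n.1, 0 < a

/-- `n_1 ≥ n_2 ≥ ⋯ ≥ n_d`. -/
def IsDecreasing (n : Zinf) : Prop := ∀ p q, p ≤ q → n.entry q ≤ n.entry p

/-- The index set of the submatrix `V_n`: the `v ⪯ n` of dimension `d` (or zero) such that every
non-zero entry `v_p` is at most `max {n_r | p ≤ r < q}`, where `q` is the position of the next
non-zero entry of `v`, or the end of `v`. -/
def finIndex (n : Zinf) : Set Zinf :=
  {v | v.Le n ∧ (v = zero ∨ v.dim = n.dim) ∧ ∀ p, v.entry p ≠ 0 →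
    ∃ r, p ≤ r ∧ (∀ q, p < q → q ≤ r → v.entry q = 0) ∧ v.entry p ≤ n.entry r}

/-- The `v ⪯ n` of dimension `d` (or zero) with `v_p ≤ n_p` for all `p`. -/
def boxIndex (n : Zinf) : Set Zinf :=
  {v | v.Le n ∧ (v = zero ∨ v.dim = n.dim) ∧ ∀ p, v.entry p ≤ n.entry p}

end Zinf

/-! ### Matrices -/

section matrices

variable {A : Type} [CommRing A] [Algebra ℚ A]

/-- The tensor product of matrices, by the formula for matrix multiplication.  As for the product
below, the sums are finite for the matrices that are considered. -/
def tensorMul {I : Type} (M N : Matrix I I A) : Matrix I I (A ⊗[ℚ] A) :=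
  fun v w => ∑ᶠ u, M v u ⊗ₜ[ℚ] N u w

/-- The product of matrices over an index set that may be infinite. -/
def infMul {I : Type} (M N : Matrix I I A) : Matrix I I A := fun v w => ∑ᶠ u, M v u * N u w

/-- `V` has finite rows and `Δ v = ∑_w w ⊗ V_{v,w}` for all index vectors `v`. -/
def IsVariationMatrix (Δ : A →ₐ[ℚ] A ⊗[ℚ] A) (sym : Zinf → A) (V : Matrix Zinf Zinf A) : Prop :=
  ∀ v, {w | V v w ≠ 0}.Finite ∧ Δ (sym v) = ∑ᶠ w, sym w ⊗ₜ[ℚ] V v w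

/-- The submatrix with rows and columns in `J`. -/
def restrict (V : Matrix Zinf Zinf A) (J : Set Zinf) : Matrix J J A :=
  fun v w => V v w

/-- `Δ (Vᵀ) = Vᵀ ⊗ Vᵀ`. -/
def CoproductFormula {I : Type} (Δ : A →ₐ[ℚ] A ⊗[ℚ] A) (V : Matrix I I A) : Prop :=
  V.transpose.map Δ = tensorMul V.transpose V.transpose

open Classical in
/-- `S(V) = V⁻¹`. -/
def AntipodeFormula {I : Type} (S : A →ₗ[ℚ] A) (V : Matrix I I A) : Prop :=
  infMul (V.map S) V = 1 ∧ infMul V (V.map S) = 1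

/-- `dV = ω V` with `ω = d V_1`, where `V_1` is the image of `V` under the projection `pr` to
weight one. -/
def DifferentialEquation {I M : Type} [AddCommGroup M] [Module ℚ M] [Module A M]
    (D : Derivation ℚ A M) (pr : A →ₗ[ℚ] A) (V : Matrix I I A) : Prop :=
  ∀ v w, D (V v w) = ∑ᶠ u, V u w • D (pr (V v u))

end matrices

/-! ### The derivations -/

/-- Basis of `dℍ`: `one a b` is `d[x_{a→b}]_1`, and `log r` is `d[x_r]_0`. -/
inductive DGen : Type
  | one (a b : ℕ) (h : a < b)
  | log (r : ℕ)

/-- Basis of `dℍ̄`: `one a b` is `d[x_{a→b}]_1`, where `x_{a→b} = x_{b→a}⁻¹` for `b < a`, and `log r`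
is `d[x_r]_0`. -/
inductive DGenBar : Type
  | one (a b : ℕ) (h : a ≠ b)
  | log (r : ℕ)

/-- The free `ℍ`-module `dℍ`. -/
abbrev DH : Type := DGen →₀ H

/-- The free `ℍ̄`-module `dℍ̄`. -/
abbrev DHBar : Type := DGenBar →₀ HBar

/-- `d[x_{a→b}]_1` for `a < b`. -/
def dOne (a b : ℕ) : DH := if h : a < b then Finsupp.single (.one a b h) 1 else 0

/-- `d[x_{a→b}]_1` for `a ≠ b`. -/
def dOneBar (a b : ℕ) : DHBar := if h : a ≠ b then Finsupp.single (.one a b h) 1 else 0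

/-- `d[x_{a→b}]_0`. -/
def dLog (a b : ℕ) : DH :=
  ∑ r ∈ Finset.Ico a b, Finsupp.single (.log r) 1 - ∑ r ∈ Finset.Ico b a, Finsupp.single (.log r) 1

/-- `d[x_{a→b}]_0`. -/
def dLogBar (a b : ℕ) : DHBar :=
  ∑ r ∈ Finset.Ico a b, Finsupp.single (.log r) 1 - ∑ r ∈ Finset.Ico b a, Finsupp.single (.log r) 1

/-- The sequence `f` with the term `f k` left out. -/
def skip {α : Type} (k : ℕ) (f : ℕ → α) : ℕ → α := fun a => if a < k then f a else f (a + 1)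

/-- The coefficient at `m` of the series `d[y_0, …, y_{d-1} | t_0, …, t_{d-1}]`, which is
`[y | t] ∑_k t_k d[y_k]_0
+ [y_1, …, y_{d-1} | t_1, …, t_{d-1}] d[y_0]_1
+ ∑_{1 ≤ k < d} [y_0, …, y_{k-1} y_k, …, y_{d-1} | t_0, …, t_{k-1}, t_{k+1}, …, t_{d-1}] d[y_k]_1
- ∑_{0 ≤ k < d-1} [y_0, …, y_k y_{k+1}, …, y_{d-1} | t_0, …, t_{k-1}, t_{k+1}, …, t_{d-1}] δ(y_k)`.
Multiplying `y_{k-1}` and `y_k` amounts to leaving out the break point `e k`, and dropping `y_0` to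
leaving out `e 0`. -/
def derivCoeff {A M : Type} [CommRing A] [Algebra ℚ A] [AddCommGroup M] [Module A M]
    (br : ∀ d : ℕ, (Fin (d + 1) → ℕ) → (Fin d → ℕ) → A) (dlog done δ : ℕ → ℕ → M)
    (d : ℕ) (e : ℕ → ℕ) (m : ℕ →₀ ℕ) : M :=
  ∑ k ∈ Finset.range d,
      MvPowerSeries.coeff m (genSeries br d (fun a => e a) (fun a => t a) * t k)
        • dlog (e k) (e (k + 1))
    + ∑ k ∈ Finset.range d,
      MvPowerSeries.coeff m (genSeries br (d - 1) (fun a => skip k e a) (fun a => skip k t a))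
        • done (e k) (e (k + 1))
    - ∑ k ∈ Finset.range (d - 1),
      MvPowerSeries.coeff m (genSeries br (d - 1) (fun a => skip (k + 1) e a) (fun a => skip k t a))
        • δ (e k) (e (k + 1))

/-- The derivation `d : ℍ → dℍ`, where `δ(y) = d[y]_1 + d[y]_0`. -/
def derivH : Derivation ℚ H DH :=
  MvPolynomial.mkDerivation ℚ fun g => match g with
    | .log r => Finsupp.single (.log r) 1
    | .reg s => derivCoeff bracketH dLog dOne (fun a b => dOne a b + dLog a b)
        s.depth s.seq (expVec s.n)

/-- The derivation `d : ℍ̄ → dℍ̄`, where `δ(y) = d[y⁻¹]_1`. -/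
def derivHBar : Derivation ℚ HBar DHBar :=
  MvPolynomial.mkDerivation ℚ fun g => match g with
    | .log r => Finsupp.single (.log r) 1
    | .reg s => derivCoeff bracketHBar dLogBar dOneBar (fun a b => dOneBar b a)
        s.depth s.seq (expVec s.n)
    | .inv s => derivCoeff bracketHBar dLogBar dOneBar (fun a b => dOneBar b a)
        s.depth (fun a => s.seq (s.depth - a)) (expVec fun k => s.n k.rev)

/-- The projection of `ℍ` to weight one. -/
def weightOneH : H →ₗ[ℚ] H := MvPolynomial.weightedHomogeneousComponent Gen.weight 1

/-- The projection of `ℍ̄` to weight one. -/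
def weightOneHBar : HBar →ₗ[ℚ] HBar := MvPolynomial.weightedHomogeneousComponent GenBar.weight 1

end SymbPolylog

end

open SymbPolylog

open scoped TensorProduct

noncomputable section

namespace SymbPolylog

open MvPowerSeries

/-! ### Rational parameters and substitution -/

/-! Coordinates of `d` in its free basis are derivations D of the algebra into itself: d[x_{a→b}]_1
is replaced by a rational number `o a b` and d[x_{a→b}]_0 by `l b - l a` (`dbar` on ℍ̄, `dH` on ℍ).
With `o` and `l` arbitrary these form a large family, and three properties of it, collected in
`HopfData` together with the counit laws, imply the theorem.

(1) (id ⊗ D)Δ = ΔD (`lTensor_dbar_coprod`). This is checked on generating series. Differentiating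
the right factor of a cut deletes an unmarked letter together with an adjacent break that is not a
block boundary. The cuts that avoid a given letter and break are exactly the cuts of the shortened
word (`sum_cuts_omit`), so the terms regroup into Δ of the derivative.

(2) An element killed by all D is constant (`HBar.eq_C_of_dbar`, `HBar.eq_C_of_dbar_ext`).
Commutators of D with partial derivatives act like further partial derivatives. They eliminate the
symbols of maximal span one after another, by increasing depth and last weight.

(3) D lowers the weight of a symbol by one, and Δv - v ⊗ 1 has left factors of smaller weight
(`dbar_bracket_mem`, `coprod_bracket_mem`).

Coassociativity follows by induction on the weight: on a generator, the difference of the two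
iterated coproducts is killed by every D in the last factor and by the counit there, hence it
vanishes. By triangularity an antipode is constructed recursively as an algebra homomorphism, and in
a commutative bialgebra such a left antipode is two-sided and unique. The symbols are distinct
monomials, so there are functionals dual to them. Slicing coassociativity with these gives the
formula for Δ(Vᵀ), and the antipode axioms evaluated on the entries of V give S(V) = V⁻¹. Finally Dx
= (id ⊗ ε)ΔDx = (id ⊗ εD)Δx, and εD equals D after the projection to weight one
(`derivation_weightOne`); this is dV = ωV. In row v, the non-zero entries of V lie in columns w
whose non-zero entries sit at block starts and are bounded by weights of marked letters. The finite
index sets are closed under this relation (`Zinf.Below`), so all formulas restrict.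

For ℍ the new point is that `INV` intertwines the derivations (`dH_INV`), where δ(y) = d[y]_1 +
d[y]_0 is read as the value at y⁻¹ (`ext`). The recursion for K_d says that the alternating sum of
the products K_j[y_{j+1}, …, y_d] is an alternating sum of quotients by the t_j. Differentiating
both sides determines the derivative of K_d (`cm_invWord`). Properties (1) to (3) then pass from ℍ̄
to ℍ. -/

/-- Power series in the variables `t_0, t_1, …` with coefficients in `A`. -/
abbrev PS (A : Type) : Type := MvPowerSeries ℕ A

/-- Rational power series without constant term, the admissible parameters of words. -/
abbrev Par : Type := ↥(RingHom.ker (constantCoeff (σ := ℕ) (R := ℚ)))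

/-- The parameter `t_k`. -/
def par (k : ℕ) : Par := ⟨X k, by simp [RingHom.mem_ker]⟩

theorem Par.const (s : Par) : constantCoeff (s : PS ℚ) = 0 := s.2

/-- The first `d` members of a sequence of parameters, and zeros afterwards. -/
def truncPar (d : ℕ) (τ : ℕ → Par) : ℕ → PS ℚ := fun r => if r < d then (τ r : PS ℚ) else 0

/-- Only finitely many of the substituted series are non-zero. An arbitrary sequence of parameters,
for instance a constant one, need not satisfy the finiteness condition, which is the reason for
truncating. -/
theorem hasSubst_truncPar (d : ℕ) (τ : ℕ → Par) : HasSubst (truncPar d τ) where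
  const_coeff r := by
    unfold truncPar
    split_ifs
    · rw [(τ r).const]; exact IsNilpotent.zero
    · simp
  coeff_zero m := by
    refine (Set.finite_lt_nat d).subset fun r hr => ?_
    by_contra h
    exact hr (by simp [truncPar, show ¬ r < d from h])

section coefficients

variable {A B : Type} [CommRing A] [Algebra ℚ A] [CommRing B] [Algebra ℚ B]

/-- Apply a linear map to the coefficients of a power series. -/
def cm {σ : Type} (L : A →ₗ[ℚ] B) : MvPowerSeries σ A →ₗ[ℚ] MvPowerSeries σ B where
  toFun f := fun m => L (coeff m f)
  map_add' f g := by
    funext m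
    change L (coeff m (f + g)) = L (coeff m f) + L (coeff m g)
    simp
  map_smul' c f := by
    funext m
    change L (coeff m (c • f)) = c • L (coeff m f)
    rw [← map_smul]; rfl

@[simp] theorem coeff_cm {σ : Type} (L : A →ₗ[ℚ] B) (f : MvPowerSeries σ A) (m : σ →₀ ℕ) :
    coeff m (cm L f) = L (coeff m f) := rfl

theorem coeff_prod_map {σ : Type} (q : σ → PS ℚ) (n : σ →₀ ℕ) (m : ℕ →₀ ℕ) :
    coeff m (n.prod fun s e => (map (algebraMap ℚ A) (q s)) ^ e) =
      algebraMap ℚ A (coeff m (n.prod fun s e => q s ^ e)) := by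
  rw [← coeff_map]
  congr 1
  simp [Finsupp.prod, map_prod]

/-- The substituted series have rational coefficients, so substitution only forms ℚ-linear
combinations of the coefficients of `f`, and these commute with `L`. This is why parameters are
taken over ℚ. -/
theorem cm_subst {σ : Type} (L : A →ₗ[ℚ] B) {q : σ → PS ℚ} (hq : HasSubst q)
    (f : MvPowerSeries σ A) :
    cm L (subst (fun s => map (algebraMap ℚ A) (q s)) f) =
      subst (fun s => map (algebraMap ℚ B) (q s)) (cm L f) := by
  ext m
  have h1 := hq.map (algebraMap ℚ A)
  have h2 := hq.map (algebraMap ℚ B)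
  rw [coeff_cm, coeff_subst h1, coeff_subst h2]
  have h3 := coeff_subst_finite h1 f m
  simp only [smul_eq_mul, coeff_cm] at h3 ⊢
  have h4 : ∀ n : σ →₀ ℕ, L (coeff n f * coeff m (n.prod fun s e => (map (algebraMap ℚ A) (q s)) ^ e))
      = L (coeff n f) * coeff m (n.prod fun s e => (map (algebraMap ℚ B) (q s)) ^ e) := by
    intro n
    rw [coeff_prod_map, coeff_prod_map, mul_comm, ← Algebra.smul_def, map_smul, Algebra.smul_def,
      mul_comm]
  simp only [← h4]
  exact L.toAddMonoidHom.map_finsum h3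

theorem cm_eq_map {σ : Type} (φ : A →ₐ[ℚ] B) (f : MvPowerSeries σ A) :
    cm φ.toLinearMap f = map φ.toRingHom f := by
  ext m; simp

theorem cm_mul {σ : Type} (D : Derivation ℚ A A) (f g : MvPowerSeries σ A) :
    cm (D : A →ₗ[ℚ] A) (f * g) = cm (D : A →ₗ[ℚ] A) f * g + f * cm (D : A →ₗ[ℚ] A) g := by
  classical
  ext m
  simp only [coeff_cm, coeff_mul, map_add, map_sum, ← Finset.sum_add_distrib]
  refine Finset.sum_congr rfl fun p _ => ?_
  simp only [Derivation.coeFn_coe, Derivation.leibniz, smul_eq_mul]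
  ring

variable (A) in
/-- A parameter as a power series with coefficients in `A`. -/
def Par.cast (s : Par) : PS A := map (algebraMap ℚ A) (s : PS ℚ)

theorem cast_par (k : ℕ) : (par k).cast A = t k := by simp [Par.cast, par, t]

theorem cast_sub (s s' : Par) : (s - s').cast A = s.cast A - s'.cast A := by simp [Par.cast]

theorem cast_neg (s : Par) : (-s).cast A = - s.cast A := by simp [Par.cast]

theorem map_cast (φ : A →ₐ[ℚ] B) (s : Par) : map φ.toRingHom (s.cast A) = s.cast B := by
  ext m; simp [Par.cast]

/-- Substitution of `τ 0, …, τ (d-1)` for `t_0, …, t_{d-1}`, and of zero for the other variables. -/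
def rep (d : ℕ) (τ : ℕ → Par) : PS A →ₐ[A] PS A :=
  substAlgHom ((hasSubst_truncPar d τ).map (algebraMap ℚ A))

theorem rep_apply (d : ℕ) (τ : ℕ → Par) (f : PS A) :
    rep d τ f = subst (fun r => map (algebraMap ℚ A) (truncPar d τ r)) f := by
  simp only [rep, substAlgHom_apply]

theorem map_comp_algebraMap (φ : A →ₐ[ℚ] B) (q : PS ℚ) :
    map φ.toRingHom (map (algebraMap ℚ A) q) = map (algebraMap ℚ B) q := by
  ext m; simp

/-- Substitution in a parameter. -/
def Par.rep (d : ℕ) (τ : ℕ → Par) (s : Par) : Par :=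
  ⟨SymbPolylog.rep d τ (s : PS ℚ), by
    rw [RingHom.mem_ker, rep_apply]
    refine constantCoeff_subst_eq_zero ((hasSubst_truncPar d τ).map _) (fun r => ?_) s.const
    unfold truncPar
    split_ifs <;> simp [(τ r).const]⟩

theorem rep_cast (d : ℕ) (τ : ℕ → Par) (s : Par) :
    rep d τ (s.cast A) = (s.rep d τ).cast A := by
  simp only [Par.cast, Par.rep, rep_apply]
  rw [map_subst ((hasSubst_truncPar d τ).map _)]
  congr 1

theorem rep_map (φ : A →ₐ[ℚ] B) (d : ℕ) (τ : ℕ → Par) (f : PS A) :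
    map φ.toRingHom (rep d τ f) = rep d τ (map φ.toRingHom f) := by
  simp only [rep_apply]
  rw [map_subst ((hasSubst_truncPar d τ).map _)]
  simp only [map_comp_algebraMap]

theorem cm_rep (L : A →ₗ[ℚ] B) (d : ℕ) (τ : ℕ → Par) (f : PS A) :
    cm L (rep d τ f) = rep d τ (cm L f) := by
  simp only [rep_apply]
  exact cm_subst L (hasSubst_truncPar d τ) f

theorem Par.rep_sub (d : ℕ) (τ : ℕ → Par) (s s' : Par) :
    (s - s').rep d τ = s.rep d τ - s'.rep d τ := by
  apply Subtype.ext; simp [Par.rep]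

theorem Par.rep_par {d k : ℕ} (τ : ℕ → Par) (h : k < d) : (par k).rep d τ = τ k := by
  apply Subtype.ext
  simp only [Par.rep, rep_apply, par]
  rw [subst_X ((hasSubst_truncPar d τ).map _)]
  simp [truncPar, h]

theorem Par.rep_par_of_le {d k : ℕ} (τ : ℕ → Par) (h : d ≤ k) : (par k).rep d τ = 0 := by
  apply Subtype.ext
  simp only [Par.rep, rep_apply, par]
  rw [subst_X ((hasSubst_truncPar d τ).map _)]
  simp [truncPar, h.not_gt]

/-! ### Words -/

variable (br : ∀ d : ℕ, (Fin (d + 1) → ℕ) → (Fin d → ℕ) → A)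

/-- The generating series of symbols with break points `e 0, …, e d` and parameters
`s 0, …, s (d-1)`. -/
def word (d : ℕ) (e : ℕ → ℕ) (s : ℕ → Par) : PS A :=
  genSeries br d (fun a => e a) (fun a => (s a).cast A)

theorem hasSubst_cast {d : ℕ} (s : Fin d → Par) : HasSubst fun a => ((s a : Par) : PS ℚ) :=
  hasSubst_of_constantCoeff_zero fun a => (s a).const

/-- The power series in `d` variables underlying `word`. -/
def wordBase (d : ℕ) (e : ℕ → ℕ) : MvPowerSeries (Fin d) A :=
  fun m => br d (fun a => e a) fun k => m k + 1

theorem word_eq (d : ℕ) (e : ℕ → ℕ) (s : ℕ → Par) : word br d e s =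
    subst (fun a : Fin d => map (algebraMap ℚ A) (s a : PS ℚ)) (wordBase br d e) := rfl

theorem cm_word (L : A →ₗ[ℚ] B) (d : ℕ) (e : ℕ → ℕ) (s : ℕ → Par) :
    cm L (word br d e s) = word (fun d e n => L (br d e n)) d e s := by
  exact cm_subst L (hasSubst_cast fun a : Fin d => s a) _

theorem map_word (φ : A →ₐ[ℚ] B) (d : ℕ) (e : ℕ → ℕ) (s : ℕ → Par) :
    map φ.toRingHom (word br d e s) = word (fun d e n => φ (br d e n)) d e s := by
  rw [← cm_eq_map, cm_word]; rfl

theorem rep_word (d' : ℕ) (τ : ℕ → Par) (d : ℕ) (e : ℕ → ℕ) (s : ℕ → Par) :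
    rep d' τ (word br d e s) = word br d e fun k => (s k).rep d' τ := by
  rw [word_eq, word_eq, rep_apply, subst_comp_subst_apply ((hasSubst_cast fun a : Fin d => s a).map _)
    ((hasSubst_truncPar d' τ).map _)]
  congr 1
  funext k
  rw [← rep_apply]
  exact rep_cast d' τ (s k)

theorem word_congr {d : ℕ} {e e' : ℕ → ℕ} {s s' : ℕ → Par} (he : ∀ a ≤ d, e a = e' a)
    (hs : ∀ a < d, s a = s' a) : word br d e s = word br d e' s' := by
  unfold word
  congr 1
  · funext a; exact he a (Nat.lt_succ_iff.mp a.2)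
  · funext a; rw [hs a a.2]

/-- Every word specializes the one whose parameters are the variables, so identities between words
need only be verified for independent variables, where coefficients can be read off. -/
theorem rep_word_par {d d' : ℕ} (h : d ≤ d') (τ : ℕ → Par) (e : ℕ → ℕ) :
    rep d' τ (word br d e par) = word br d e τ := by
  rw [rep_word]
  exact word_congr br (fun _ _ => rfl) fun a ha => Par.rep_par τ (ha.trans_le h)

theorem word_zero (hbr : ∀ e n, br 0 e n = 1) (e : ℕ → ℕ) (s : ℕ → Par) : word br 0 e s = 1 := by
  have h : wordBase br 0 e = 1 := by
    ext m
    have : m = 0 := Subsingleton.elim _ _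
    subst this
    exact (hbr _ _).trans coeff_zero_one.symm
  rw [word_eq, h, ← coe_substAlgHom ((hasSubst_cast fun a : Fin 0 => s a).map (algebraMap ℚ A)),
    map_one]

end coefficients

end SymbPolylog

/-! ### Coefficients of words and exponential series. -/

namespace SymbPolylog

open MvPowerSeries

section coefficients

variable {A B : Type} [CommRing A] [Algebra ℚ A] [CommRing B] [Algebra ℚ B]
variable (br : ∀ d : ℕ, (Fin (d + 1) → ℕ) → (Fin d → ℕ) → A)

/-- Each variable goes to itself or to zero, so a monomial either survives unchanged or disappears.
The trivial `P` detects series in `t_0, …, t_{d-1}`; the condition `r ≠ j` detects divisibility by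
`t_j`. -/
theorem coeff_rep_indicator (d : ℕ) (P : ℕ → Prop) [DecidablePred P] (f : PS A) (m : ℕ →₀ ℕ) :
    coeff m (rep d (fun r => if P r then par r else 0) f) =
      if ∀ r ∈ m.support, r < d ∧ P r then coeff m f else 0 := by
  classical
  rw [rep_apply, coeff_subst ((hasSubst_truncPar d _).map _)]
  have key : ∀ n : ℕ →₀ ℕ, (n.prod fun r e => (map (algebraMap ℚ A)
      (truncPar d (fun r => if P r then par r else 0) r)) ^ e) =
      if ∀ r ∈ n.support, r < d ∧ P r then monomial n (1 : A) else 0 := by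
    intro n
    split_ifs with h
    · rw [monomial_one_eq]
      refine Finset.prod_congr rfl fun r hr => ?_
      simp [truncPar, h r hr, par]
    · push Not at h
      obtain ⟨r, hr, h⟩ := h
      refine Finset.prod_eq_zero hr ?_
      have : n r ≠ 0 := Finsupp.mem_support_iff.mp hr
      by_cases h1 : r < d
      · simp [truncPar, h1, h h1, this]
      · simp [truncPar, h1, this]
  simp only [key]
  rw [finsum_eq_single _ m]
  · split_ifs <;> simp
  · intro n hn
    split_ifs
    · rw [coeff_monomial_ne hn.symm, smul_zero]
    · simp

theorem coeff_rep_par (d : ℕ) (f : PS A) (m : ℕ →₀ ℕ) :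
    coeff m (rep d par f) = if ∀ r ∈ m.support, r < d then coeff m f else 0 := by
  simpa only [if_true, and_true] using! coeff_rep_indicator d (fun _ => True) f m

/-- The exponent vector of `∏ t_k ^ (n k - 1)`, for `k < d`. -/
def ev (d : ℕ) (n : ℕ → ℕ) : ℕ →₀ ℕ := expVec fun k : Fin d => n k

theorem expVec_apply {d : ℕ} (n : Fin d → ℕ) (r : ℕ) :
    expVec n r = if h : r < d then n ⟨r, h⟩ - 1 else 0 := by
  classical
  simp only [expVec, Finsupp.coe_finsetSum, Finset.sum_apply, Finsupp.single_apply]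
  split_ifs with h
  · rw [Finset.sum_eq_single ⟨r, h⟩]
    · simp
    · intro k _ hk
      rw [if_neg]
      rintro rfl
      exact hk rfl
    · simp
  · exact Finset.sum_eq_zero fun k _ => if_neg fun hk => h (by have := k.2; omega)

theorem ev_apply (d : ℕ) (n : ℕ → ℕ) (r : ℕ) : ev d n r = if r < d then n r - 1 else 0 := by
  simp [ev, expVec_apply]

theorem eq_ev {d : ℕ} {m : ℕ →₀ ℕ} (h : ∀ r ∈ m.support, r < d) :
    m = ev d fun k => m k + 1 := by
  ext r
  rw [ev_apply]
  split_ifs with hr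
  · simp
  · by_contra hm
    exact hr (h r (Finsupp.mem_support_iff.mpr hm))

/-- Invariance under `rep d par` means that only the first `d` variables occur, so every relevant
exponent has the form `ev d n`. Because of the shift by one, positive `n` suffice. -/
theorem ext_ev {d : ℕ} {f g : PS A} (hf : rep d par f = f) (hg : rep d par g = g)
    (h : ∀ n : ℕ → ℕ, (∀ k, 0 < n k) → coeff (ev d n) f = coeff (ev d n) g) : f = g := by
  ext m
  rw [← hf, ← hg, coeff_rep_par, coeff_rep_par]
  split_ifs with hm
  · rw [eq_ev hm]
    exact h _ fun k => Nat.succ_pos _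
  · rfl

/-- For distinct variables as parameters the substitution is a renaming along an injection, so no
two brackets contribute to the same monomial. -/
theorem coeff_word_of_injOn {d : ℕ} (e : ℕ → ℕ) {s : ℕ → Par} {J : ℕ → ℕ}
    (hJ : ∀ a < d, ∀ b < d, J a = J b → a = b) (hs : ∀ a < d, s a = par (J a)) (m : ℕ →₀ ℕ)
    [Decidable (∀ r ∈ m.support, ∃ a < d, J a = r)] :
    coeff m (word br d e s) = if ∀ r ∈ m.support, ∃ a < d, J a = r then
      br d (fun a => e a) (fun k => m (J k) + 1) else 0 := by
  let J' : Fin d ↪ ℕ := ⟨fun a => J a, fun a b h => Fin.ext (hJ a a.2 b b.2 h)⟩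
  have hw : word br d e s = rename J' (wordBase br d e) := by
    rw [rename_eq_subst, word_eq]
    congr 1
    funext a
    rw [hs a a.2]
    simp [par]
    rfl
  rw [hw]
  split_ifs with h
  · have hm : m = Finsupp.embDomain J' (m.comapDomain J' J'.injective.injOn) := by
      rw [Finsupp.embDomain_comapDomain]
      intro r hr
      obtain ⟨a, ha, hr⟩ := h r hr
      exact ⟨⟨a, ha⟩, hr⟩
    conv_lhs => rw [hm]
    rw [coeff_embDomain_rename]
    rfl
  · apply coeff_rename_eq_zero
    rintro ⟨x, rfl⟩
    apply h
    intro r hr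
    rw [← Finsupp.embDomain_eq_mapDomain, Finsupp.support_embDomain, Finset.mem_map] at hr
    obtain ⟨a, -, rfl⟩ := hr
    exact ⟨a, a.2, rfl⟩

theorem coeff_word_par (d : ℕ) (e : ℕ → ℕ) (n : ℕ → ℕ) (hn : ∀ k, 0 < n k) :
    coeff (ev d n) (word br d e par) = br d (fun a => e a) fun k => n k := by
  classical
  rw [coeff_word_of_injOn br e (s := par) (J := id) (fun a _ b _ h => h) fun a _ => rfl, if_pos]
  · congr 1
    funext k
    have := hn k
    simp only [id, ev_apply, k.2, if_true]
    omega
  · intro r hr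
    refine ⟨r, ?_, rfl⟩
    by_contra h
    simp [ev_apply, h] at hr

/-! ### Exponential series -/

/-- `exp (a s)` for a parameter `s`. -/
def ex (a : A) (s : Par) : PS A := expSeries a (s.cast A)

/-- The power series of `exp (a X)`. -/
def exBase (a : A) : PowerSeries A := PowerSeries.mk fun n =>
  algebraMap ℚ A (1 / (n.factorial : ℚ)) * a ^ n

theorem ex_eq (a : A) (s : Par) :
    ex a s = subst (fun _ : Unit => map (algebraMap ℚ A) (s : PS ℚ)) (exBase a) := rfl

theorem hasSubst_const (s : Par) : HasSubst fun _ : Unit => (s : PS ℚ) :=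
  hasSubst_of_constantCoeff_zero fun _ => s.const

theorem rep_ex (d : ℕ) (τ : ℕ → Par) (a : A) (s : Par) : rep d τ (ex a s) = ex a (s.rep d τ) := by
  rw [ex_eq, ex_eq, rep_apply, subst_comp_subst_apply ((hasSubst_const s).map _)
    ((hasSubst_truncPar d τ).map _)]
  congr 1
  funext _
  rw [← rep_apply]
  exact rep_cast d τ s

theorem map_ex (φ : A →ₐ[ℚ] B) (a : A) (s : Par) : map φ.toRingHom (ex a s) = ex (φ a) s := by
  rw [ex_eq, ex_eq, map_subst ((hasSubst_const s).map _)]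
  have h : map φ.toRingHom (exBase a : MvPowerSeries Unit A) = exBase (φ a) := by
    refine (PowerSeries.ext fun n => ?_ : PowerSeries.map φ.toRingHom (exBase a) = exBase (φ a))
    rw [PowerSeries.coeff_map, exBase, exBase, PowerSeries.coeff_mk, PowerSeries.coeff_mk]
    simp
  simp only [map_comp_algebraMap, h]

theorem ex_zero_left (s : Par) : ex (0 : A) s = 1 := by
  have h : exBase (0 : A) = (1 : PowerSeries A) := by
    ext n
    rw [exBase, PowerSeries.coeff_mk, PowerSeries.coeff_one]
    rcases n with _ | n <;> simp
  rw [ex_eq, h]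
  exact (congrFun (coe_substAlgHom ((hasSubst_const s).map (algebraMap ℚ A))) 1).symm.trans
    (map_one _)

theorem constantCoeff_exBase (a : A) : PowerSeries.constantCoeff (exBase a) = 1 := by
  rw [← PowerSeries.coeff_zero_eq_constantCoeff_apply, exBase, PowerSeries.coeff_mk]
  simp

theorem constantCoeff_ex (a : A) (s : Par) : constantCoeff (ex a s) = 1 := by
  have hs := (hasSubst_const s).map (algebraMap ℚ A)
  have h : exBase a = PowerSeries.C (1 : A) + (exBase a - 1) := by simp
  have h1 : constantCoeff (subst (fun _ : Unit => map (algebraMap ℚ A) (s : PS ℚ))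
      (exBase a - 1 : MvPowerSeries Unit A)) = 0 := by
    refine constantCoeff_subst_eq_zero hs (fun _ => by simp [s.const]) ?_
    change PowerSeries.constantCoeff (exBase a - 1) = 0
    rw [map_sub, constantCoeff_exBase, map_one, sub_self]
  rw [ex_eq, h, subst_add hs, map_add]
  have h2 : subst (fun _ : Unit => map (algebraMap ℚ A) (s : PS ℚ))
      (PowerSeries.C (1 : A) : MvPowerSeries Unit A) = 1 := subst_C _
  rw [h2, map_one]
  erw [h1]
  rw [add_zero]

/-- The chain rule for `exp (a s)`. The parameter is killed coefficientwise because it is rational,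
and `D a` is a constant, so it comes out as a scalar. -/
theorem cm_ex (D : Derivation ℚ A A) {a : A} {c : ℚ} (h : D a = algebraMap ℚ A c) (s : Par) :
    cm (D : A →ₗ[ℚ] A) (ex a s) = c • (ex a s * s.cast A) := by
  have hs := (hasSubst_const s).map (algebraMap ℚ A)
  have h1 : cm (D : A →ₗ[ℚ] A) (exBase a : MvPowerSeries Unit A) =
      (algebraMap ℚ A c) • ((exBase a : MvPowerSeries Unit A) * X ()) := by
    have h2 : ∀ n : ℕ, D (algebraMap ℚ A (1 / (n.factorial : ℚ)) * a ^ n) =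
        algebraMap ℚ A c * PowerSeries.coeff n (exBase a * PowerSeries.X) := by
      intro n
      rw [Derivation.leibniz, Derivation.leibniz_pow, h, Derivation.map_algebraMap]
      rcases n with _ | n
      · simp
      · rw [PowerSeries.coeff_succ_mul_X, exBase, PowerSeries.coeff_mk, Nat.factorial_succ]
        have : (algebraMap ℚ A) (1 / ((n + 1 : ℕ) * n.factorial : ℕ)) * ((n + 1 : ℕ) : A) =
            algebraMap ℚ A (1 / n.factorial) := by
          rw [← map_natCast (algebraMap ℚ A), ← map_mul]
          congr 1
          have : ((n : ℚ) + 1) ≠ 0 := by positivity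
          push_cast
          field_simp
        simp only [smul_eq_mul, nsmul_eq_mul, Nat.add_sub_cancel]
        rw [← this]
        ring
    refine PowerSeries.ext fun n => (Eq.trans ?_ (h2 n)).trans rfl
    rw [← PowerSeries.coeff_mk n fun n => algebraMap ℚ A (1 / (n.factorial : ℚ)) * a ^ n]
    rfl
  rw [ex_eq]
  rw [cm_subst (D : A →ₗ[ℚ] A) (hasSubst_const s), h1]
  rw [subst_smul hs, subst_mul hs, subst_X hs, algebraMap_smul]
  rfl

end coefficients

end SymbPolylog

namespace SymbPolylog

open MvPowerSeries

/-! ### Derivations of words -/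

section derivations

variable {A : Type} [CommRing A] [Algebra ℚ A]

/-- The sequence `e` increases on `0, …, d`. -/
def Up (d : ℕ) (e : ℕ → ℕ) : Prop := ∀ a b, a < b → b ≤ d → e a < e b

/-- The sequence `e` decreases on `0, …, d`. -/
def Down (d : ℕ) (e : ℕ → ℕ) : Prop := ∀ a b, a < b → b ≤ d → e b < e a

/-- The formula for the derivative of words, with values of `F` in place of words. -/
def dRHS (o : ℕ → ℕ → ℚ) (l : ℕ → ℚ) (F : ℕ → (ℕ → ℕ) → (ℕ → Par) → PS A) (d : ℕ) (e : ℕ → ℕ)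
    (s : ℕ → Par) : PS A :=
  F d e s * ∑ k ∈ Finset.range d, (l (e (k + 1)) - l (e k)) • (s k).cast A
    + ∑ k ∈ Finset.range d, o (e k) (e (k + 1)) • F (d - 1) (skip k e) (skip k s)
    - ∑ k ∈ Finset.range (d - 1), o (e (k + 1)) (e k) • F (d - 1) (skip (k + 1) e) (skip k s)

/-- Derivation coefficients depending on scalars `o a b` in place of `d[x_{a→b}]_1` and
`l b - l a` in place of `d[x_{a→b}]_0`. -/
def scalarCoeff (br : ∀ d : ℕ, (Fin (d + 1) → ℕ) → (Fin d → ℕ) → A) (o : ℕ → ℕ → ℚ) (l : ℕ → ℚ)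
    (d : ℕ) (e : ℕ → ℕ) (m : ℕ →₀ ℕ) : A :=
  derivCoeff br (fun a b => algebraMap ℚ A (l b - l a)) (fun a b => algebraMap ℚ A (o a b))
    (fun a b => algebraMap ℚ A (o b a)) d e m

theorem skip_of_lt {α : Type} {k a : ℕ} (f : ℕ → α) (h : a < k) : skip k f a = f a := if_pos h

theorem skip_of_le {α : Type} {k a : ℕ} (f : ℕ → α) (h : k ≤ a) : skip k f a = f (a + 1) :=
  if_neg h.not_gt

/-- Translates the derivation, which is prescribed coefficient by coefficient, into an identity of
generating series. All later computations take place on that level. -/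
theorem scalarCoeff_eq (br : ∀ d : ℕ, (Fin (d + 1) → ℕ) → (Fin d → ℕ) → A) (o : ℕ → ℕ → ℚ)
    (l : ℕ → ℚ) (d : ℕ) (e : ℕ → ℕ) (m : ℕ →₀ ℕ) :
    scalarCoeff br o l d e m = coeff m (dRHS o l (word br) d e par) := by
  have hw : ∀ d e, genSeries br d (fun a => e a) (fun a => t a) = word br d e par := by
    intro d e
    simp [word, cast_par]
  have hs : ∀ d e k, genSeries br d (fun a => e a) (fun a => skip k t a) =
      word br d e (skip k par) := by
    intro d e k
    simp only [word]
    congr 1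
    funext a
    unfold skip
    split_ifs <;> rw [cast_par]
  have hsub : ∀ f g : PS A, coeff m (f - g) = coeff m f - coeff m g := map_sub _
  simp only [scalarCoeff, derivCoeff, dRHS, map_add, hsub, map_sum, Finset.mul_sum]
  congr 1
  · congr 1
    · refine Finset.sum_congr rfl fun k _ => ?_
      rw [hw, cast_par, smul_eq_mul, mul_smul_comm, mul_comm, ← Algebra.smul_def, map_rat_smul]
    · refine Finset.sum_congr rfl fun k _ => ?_
      rw [hs _ (skip k e), smul_eq_mul, mul_comm, ← Algebra.smul_def, map_rat_smul]
  · refine Finset.sum_congr rfl fun k _ => ?_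
    rw [hs _ (skip (k + 1) e), smul_eq_mul, mul_comm, ← Algebra.smul_def, map_rat_smul]

theorem dRHS_congr (br : ∀ d : ℕ, (Fin (d + 1) → ℕ) → (Fin d → ℕ) → A) (o : ℕ → ℕ → ℚ)
    (l : ℕ → ℚ) {d : ℕ} {e e' : ℕ → ℕ} {s s' : ℕ → Par} (he : ∀ a ≤ d, e a = e' a)
    (hs : ∀ a < d, s a = s' a) :
    dRHS o l (word br) d e s = dRHS o l (word br) d e' s' := by
  have hskip : ∀ k j, k < d → j < d → word br (d - 1) (skip j e) (skip k s) =
      word br (d - 1) (skip j e') (skip k s') := by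
    intro k j hk hj
    refine word_congr br (fun a ha => ?_) fun a ha => ?_
    · unfold skip
      rw [he a (by omega), he (a + 1) (by omega)]
    · unfold skip
      rw [hs a (by omega), hs (a + 1) (by omega)]
  unfold dRHS
  rw [word_congr br he hs]
  congr 1
  · congr 1
    · congr 1
      refine Finset.sum_congr rfl fun k hk => ?_
      have := Finset.mem_range.mp hk
      rw [he (k + 1) (by omega), he k (by omega), hs k this]
    · refine Finset.sum_congr rfl fun k hk => ?_
      have := Finset.mem_range.mp hk
      rw [he (k + 1) (by omega), he k (by omega), hskip k k this this]
  · refine Finset.sum_congr rfl fun k hk => ?_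
    have := Finset.mem_range.mp hk
    rw [he (k + 1) (by omega), he k (by omega), hskip k (k + 1) (by omega) (by omega)]

theorem scalarCoeff_congr (br : ∀ d : ℕ, (Fin (d + 1) → ℕ) → (Fin d → ℕ) → A) (o : ℕ → ℕ → ℚ)
    (l : ℕ → ℚ) {d : ℕ} {e e' : ℕ → ℕ} (he : ∀ a ≤ d, e a = e' a) (m : ℕ →₀ ℕ) :
    scalarCoeff br o l d e m = scalarCoeff br o l d e' m := by
  rw [scalarCoeff_eq, scalarCoeff_eq, dRHS_congr br o l he fun _ _ => rfl]

theorem Par.rep_skip {d : ℕ} (τ : ℕ → Par) {k a : ℕ} (h : a + 1 < d) :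
    (skip k par a).rep d τ = skip k τ a := by
  unfold skip
  split_ifs
  · exact Par.rep_par τ (by omega)
  · exact Par.rep_par τ h

theorem rep_rat_smul (d : ℕ) (τ : ℕ → Par) (c : ℚ) (f : PS A) :
    rep d τ (c • f) = c • rep d τ f := by
  rw [map_rat_smul]

theorem rep_dRHS {o : ℕ → ℕ → ℚ} {l : ℕ → ℚ} {F : ℕ → (ℕ → ℕ) → (ℕ → Par) → PS A} {d : ℕ}
    {e : ℕ → ℕ} (τ : ℕ → Par) (h0 : rep d τ (F d e par) = F d e τ)
    (h1 : ∀ j k, rep d τ (F (d - 1) (skip j e) (skip k par)) = F (d - 1) (skip j e) (skip k τ)) :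
    rep d τ (dRHS o l F d e par) = dRHS o l F d e τ := by
  unfold dRHS
  simp only [map_sub, map_add, map_mul, map_sum, rep_rat_smul, h0, h1, rep_cast]
  congr 3
  refine Finset.sum_congr rfl fun k hk => ?_
  rw [Par.rep_par τ (Finset.mem_range.mp hk)]

theorem rep_dRHS_word (br : ∀ d : ℕ, (Fin (d + 1) → ℕ) → (Fin d → ℕ) → A) (o : ℕ → ℕ → ℚ)
    (l : ℕ → ℚ) (d : ℕ) (e : ℕ → ℕ) (τ : ℕ → Par) :
    rep d τ (dRHS o l (word br) d e par) = dRHS o l (word br) d e τ := by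
  refine rep_dRHS τ (rep_word_par br le_rfl τ e) fun j k => ?_
  rw [rep_word]
  exact word_congr br (fun _ _ => rfl) fun a ha => Par.rep_skip τ (by omega)

/-- Both sides are specializations under `rep` of their versions in independent variables, where the
hypothesis gives equality of coefficients. -/
theorem cm_word_eq_dRHS {br : ∀ d : ℕ, (Fin (d + 1) → ℕ) → (Fin d → ℕ) → A} {o : ℕ → ℕ → ℚ}
    {l : ℕ → ℚ} (D : A →ₗ[ℚ] A) {d : ℕ} {e : ℕ → ℕ}
    (h : ∀ n : ℕ → ℕ, (∀ k, 0 < n k) →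
      D (br d (fun a => e a) fun k => n k) = scalarCoeff br o l d e (ev d n)) (s : ℕ → Par) :
    cm D (word br d e s) = dRHS o l (word br) d e s := by
  rw [← rep_word_par br le_rfl s, cm_rep, ← rep_dRHS_word]
  congr 1
  have hid := rep_word_par br (le_refl d) par e
  refine ext_ev (d := d) ?_ (rep_dRHS_word br o l d e par) fun n hn => ?_
  · rw [← cm_rep, hid]
  · rw [coeff_cm, coeff_word_par br d e n hn, h n hn, scalarCoeff_eq]

end derivations

/-! ### Symbols with given break points -/

theorem Up.strictMono {d : ℕ} {e : ℕ → ℕ} (h : Up d e) : StrictMono fun a : Fin (d + 1) => e a :=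
  fun a b hab => h a b hab (Nat.lt_succ_iff.mp b.2)

theorem Down.strictMono {d : ℕ} {e : ℕ → ℕ} (h : Down d e) :
    StrictMono fun a : Fin (d + 1) => e (a.rev : Fin (d + 1)) :=
  fun a _ hab => h _ _ (Fin.rev_lt_rev.mpr hab) (Nat.lt_succ_iff.mp (Fin.rev a).2)

/-- The symbol with increasing break points `e` and weights `n`. -/
def upSymbol {d : ℕ} (hd : 0 < d) {e : ℕ → ℕ} (he : Up d e) {n : ℕ → ℕ} (hn : ∀ k, 0 < n k) :
    PolySymbol := ⟨d, hd, fun a => e a, he.strictMono, fun k => n k, fun _ => hn _⟩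

/-- The symbol underlying the inverted symbol with decreasing break points `e` and weights `n`. -/
def downSymbol {d : ℕ} (hd : 0 < d) {e : ℕ → ℕ} (he : Down d e) {n : ℕ → ℕ} (hn : ∀ k, 0 < n k) :
    PolySymbol := ⟨d, hd, fun a => e (a.rev : Fin (d + 1)), he.strictMono,
      fun k => n (k.rev : Fin d), fun _ => hn _⟩

theorem upSymbol_seq {d : ℕ} (hd : 0 < d) {e : ℕ → ℕ} (he : Up d e) {n : ℕ → ℕ}
    (hn : ∀ k, 0 < n k) {a : ℕ} (ha : a ≤ d) : (upSymbol hd he hn).seq a = e a :=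
  dif_pos (Nat.lt_succ_iff.mpr ha)

theorem downSymbol_seq {d : ℕ} (hd : 0 < d) {e : ℕ → ℕ} (he : Down d e) {n : ℕ → ℕ}
    (hn : ∀ k, 0 < n k) {a : ℕ} (ha : a ≤ d) : (downSymbol hd he hn).seq a = e (d - a) := by
  refine (dif_pos (Nat.lt_succ_iff.mpr ha)).trans ?_
  simp [downSymbol, Fin.val_rev]

theorem bracketHBar_up {d : ℕ} (hd : 0 < d) {e : ℕ → ℕ} (he : Up d e) {n : ℕ → ℕ}
    (hn : ∀ k, 0 < n k) : bracketHBar d (fun a => e a) (fun k => n k) =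
      MvPolynomial.X (.reg (upSymbol hd he hn)) := by
  unfold bracketHBar
  rw [if_neg hd.ne', dif_pos ⟨hd, he.strictMono, fun k => hn k⟩]
  rfl

theorem bracketH_up {d : ℕ} (hd : 0 < d) {e : ℕ → ℕ} (he : Up d e) {n : ℕ → ℕ}
    (hn : ∀ k, 0 < n k) : bracketH d (fun a => e a) (fun k => n k) =
      MvPolynomial.X (.reg (upSymbol hd he hn)) := by
  unfold bracketH
  rw [if_neg hd.ne', dif_pos ⟨hd, he.strictMono, fun k => hn k⟩]
  rfl

theorem bracketHBar_down {d : ℕ} (hd : 0 < d) {e : ℕ → ℕ} (he : Down d e) {n : ℕ → ℕ}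
    (hn : ∀ k, 0 < n k) : bracketHBar d (fun a => e a) (fun k => n k) =
      MvPolynomial.X (.inv (downSymbol hd he hn)) := by
  unfold bracketHBar
  rw [if_neg hd.ne', dif_neg, dif_pos ⟨hd, he.strictMono, fun k => hn _⟩]
  · rfl
  · rintro ⟨-, h, -⟩
    have h1 : (fun a : Fin (d + 1) => e a) 0 < (fun a : Fin (d + 1) => e a) (Fin.last d) :=
      h (by simpa [Fin.lt_def] using hd)
    exact lt_asymm h1 (he 0 d hd le_rfl)

@[simp] theorem bracketHBar_zero (e : Fin (0 + 1) → ℕ) (n : Fin 0 → ℕ) : bracketHBar 0 e n = 1 :=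
  if_pos rfl

@[simp] theorem bracketH_zero (e : Fin (0 + 1) → ℕ) (n : Fin 0 → ℕ) : bracketH 0 e n = 1 :=
  if_pos rfl

/-! ### Derivations of `ℍ̄` -/

/-- The derivation of `ℍ̄` with `o a b` in place of `d[x_{a→b}]_1` and `l b - l a` in place of
`d[x_{a→b}]_0`. -/
def dbar (o : ℕ → ℕ → ℚ) (l : ℕ → ℚ) : Derivation ℚ HBar HBar :=
  MvPolynomial.mkDerivation ℚ fun g => match g with
    | .log r => algebraMap ℚ HBar (l (r + 1) - l r)
    | .reg s => scalarCoeff bracketHBar o l s.depth s.seq (expVec s.n)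
    | .inv s => scalarCoeff bracketHBar o l s.depth (fun a => s.seq (s.depth - a))
        (expVec fun k => s.n k.rev)

theorem dbar_reg (o : ℕ → ℕ → ℚ) (l : ℕ → ℚ) (s : PolySymbol) :
    dbar o l (MvPolynomial.X (.reg s)) = scalarCoeff bracketHBar o l s.depth s.seq (expVec s.n) :=
  MvPolynomial.mkDerivation_X _ _ _

theorem dbar_inv (o : ℕ → ℕ → ℚ) (l : ℕ → ℚ) (s : PolySymbol) :
    dbar o l (MvPolynomial.X (.inv s)) = scalarCoeff bracketHBar o l s.depth
      (fun a => s.seq (s.depth - a)) (expVec fun k => s.n k.rev) :=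
  MvPolynomial.mkDerivation_X _ _ _

theorem dbar_log (o : ℕ → ℕ → ℚ) (l : ℕ → ℚ) (r : ℕ) :
    dbar o l (MvPolynomial.X (.log r)) = algebraMap ℚ HBar (l (r + 1) - l r) :=
  MvPolynomial.mkDerivation_X _ _ _

/-- An inverted symbol is stored through its increasing reversal. Reversing a second time restores
the original order, so a single formula covers both kinds of symbols. -/
theorem dbar_bracket (o : ℕ → ℕ → ℚ) (l : ℕ → ℚ) {d : ℕ} (hd : 0 < d) {e : ℕ → ℕ}
    (he : Up d e ∨ Down d e) {n : ℕ → ℕ} (hn : ∀ k, 0 < n k) :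
    dbar o l (bracketHBar d (fun a => e a) fun k => n k) =
      scalarCoeff bracketHBar o l d e (ev d n) := by
  rcases he with he | he
  · rw [bracketHBar_up hd he hn, dbar_reg]
    exact scalarCoeff_congr bracketHBar o l (d := d) (fun a ha => upSymbol_seq hd he hn ha) (ev d n)
  · rw [bracketHBar_down hd he hn, dbar_inv]
    have h1 : (expVec fun k => (downSymbol hd he hn).n k.rev) = ev d n := by
      change expVec (d := d) (fun k => n (k.rev.rev : Fin d)) = ev d n
      simp only [Fin.rev_rev, ev]
    rw [h1]
    refine scalarCoeff_congr bracketHBar o l (d := d) (fun a ha => ?_) (ev d n)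
    refine (downSymbol_seq hd he hn (Nat.sub_le _ _)).trans ?_
    rw [Nat.sub_sub_self ha]

theorem cm_dbar_word (o : ℕ → ℕ → ℚ) (l : ℕ → ℚ) {d : ℕ} {e : ℕ → ℕ} (he : Up d e ∨ Down d e)
    (s : ℕ → Par) : cm (dbar o l : HBar →ₗ[ℚ] HBar) (word bracketHBar d e s) =
      dRHS o l (word bracketHBar) d e s := by
  rcases Nat.eq_zero_or_pos d with rfl | hd
  · rw [word_zero bracketHBar bracketHBar_zero]
    ext m
    have : coeff m (1 : PS HBar) = if m = 0 then 1 else 0 := coeff_one ..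
    rw [coeff_cm, this]
    split_ifs <;> simp [dRHS]
  · exact cm_word_eq_dRHS _ (fun n hn => dbar_bracket o l hd he hn) s

theorem dbar_logHBar (o : ℕ → ℕ → ℚ) (l : ℕ → ℚ) (a b : ℕ) :
    dbar o l (logHBar a b) = algebraMap ℚ HBar (l b - l a) := by
  have h : ∀ a b, a ≤ b → ∑ r ∈ Finset.Ico a b, dbar o l (MvPolynomial.X (.log r)) =
      algebraMap ℚ HBar (l b - l a) := by
    intro a b hab
    rw [← Finset.sum_Ico_sub l hab, map_sum]
    refine Finset.sum_congr rfl fun r _ => ?_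
    rw [dbar_log]
  rw [logHBar, map_sub, map_sum, map_sum]
  rcases le_total a b with hab | hab
  · rw [h a b hab, Finset.Ico_eq_empty_of_le hab]; simp
  · rw [h b a hab, Finset.Ico_eq_empty_of_le hab]; simp

end SymbPolylog

namespace SymbPolylog

open MvPowerSeries

/-! ### The blocks of the coproduct -/

/-- The inverse of the increasing map that omits the value `r + 1` or `r`. -/
def pull (r x : ℕ) : ℕ := if x ≤ r then x else x - 1

/-- The factor of the coproduct belonging to a block of letters `0, …, b - 1` with marked
letter `a`. -/
def blk (e : ℕ → ℕ) (s : ℕ → Par) (a b : ℕ) : PS HBar :=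
  ((-1 : ℚ) ^ a) • (ex (logHBar (e 0) (e b)) (s a)
    * word bracketHBar a (fun x => e (a - x)) (fun x => s a - s (a - 1 - x))
    * word bracketHBar (b - 1 - a) (fun x => e (a + 1 + x)) (fun x => s (a + 1 + x) - s a))

theorem blk_congr {e e' : ℕ → ℕ} {s s' : ℕ → Par} {a b : ℕ} (hab : a < b)
    (he : ∀ x ≤ b, e x = e' x) (hs : ∀ x < b, s x = s' x) : blk e s a b = blk e' s' a b := by
  unfold blk
  rw [he 0 (by omega), he b le_rfl, hs a hab]
  congr 2
  · congr 1
    exact word_congr _ (fun x _ => he _ (by omega)) fun x _ => by rw [hs _ (by omega)]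
  · exact word_congr _ (fun x _ => he _ (by omega)) fun x _ => by rw [hs _ (by omega)]

/-- The part in front of the marked index `a` is listed backwards, as the inverted word of a block
reads its letters backwards. -/
theorem sum_range_split {M : Type} [AddCommMonoid M] {a b : ℕ} (hab : a < b) (f : ℕ → M) :
    ∑ r ∈ Finset.range b, f r = ∑ x ∈ Finset.range a, f (a - 1 - x) + f a
      + ∑ x ∈ Finset.range (b - 1 - a), f (a + 1 + x) := by
  obtain ⟨c, rfl⟩ : ∃ c, b = a + 1 + c := ⟨b - (a + 1), by omega⟩
  rw [Finset.sum_range_add, Finset.sum_range_succ, Finset.sum_range_reflect]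
  congr 3
  omega

section blocks

variable (e : ℕ → ℕ) (s : ℕ → Par) {a b : ℕ}

/-- A letter in front of the mark belongs to the inverted word. Deleting it moves the mark down by
one, which changes the sign `(-1) ^ a`, and break `j` of the block is break `a - j` of the inverted
word. Behind the mark there is neither a sign nor a reversal. -/
theorem blk_skip_of_lt {r j : ℕ} (hj : j = r ∨ j = r + 1) (hr : r < a) (hj0 : 0 < j) (hab : a < b) :
    blk (skip j e) (skip r s) (pull r a) (b - 1) = -(((-1 : ℚ) ^ a) •
      (ex (logHBar (e 0) (e b)) (s a)
      * word bracketHBar (a - 1) (skip (a - j) fun x => e (a - x))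
          (skip (a - 1 - r) fun x => s a - s (a - 1 - x))
      * word bracketHBar (b - 1 - a) (fun x => e (a + 1 + x)) (fun x => s (a + 1 + x) - s a))) := by
  have hp : pull r a = a - 1 := if_neg (by omega)
  have hs : skip r s (a - 1) = s a := by
    rw [skip_of_le s (by omega)]; congr 1; omega
  unfold blk
  rw [hp, skip_of_lt e hj0, skip_of_le e (show j ≤ b - 1 by omega), hs,
    show b - 1 - 1 - (a - 1) = b - 1 - a by omega, show b - 1 + 1 = b by omega, ← neg_smul,
    show (-1 : ℚ) ^ (a - 1) = -(-1) ^ a by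
      conv_rhs => rw [show a = a - 1 + 1 by omega, pow_succ]
      ring]
  congr 2
  · congr 1
    refine word_congr _ (fun x hx => ?_) fun x hx => ?_
    · unfold skip
      split_ifs <;> first | omega | (congr 1; omega)
    · unfold skip
      split_ifs <;> first | omega | (congr 2; omega)
  · refine word_congr _ (fun x hx => ?_) fun x hx => ?_
    · rw [skip_of_le e (by omega)]; congr 1; omega
    · rw [skip_of_le s (by omega)]; congr 2; omega

theorem blk_skip_of_gt {r j : ℕ} (hj : j = r ∨ j = r + 1) (hr : a < r) (hjb : j < b) :
    blk (skip j e) (skip r s) (pull r a) (b - 1) = ((-1 : ℚ) ^ a) •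
      (ex (logHBar (e 0) (e b)) (s a)
      * word bracketHBar a (fun x => e (a - x)) (fun x => s a - s (a - 1 - x))
      * word bracketHBar (b - 1 - a - 1) (skip (j - (a + 1)) fun x => e (a + 1 + x))
          (skip (r - (a + 1)) fun x => s (a + 1 + x) - s a)) := by
  have hp : pull r a = a := if_pos (by omega)
  unfold blk
  rw [hp, skip_of_lt e (show 0 < j by omega), skip_of_le e (show j ≤ b - 1 by omega),
    skip_of_lt s hr, show b - 1 - 1 - a = b - 1 - a - 1 by omega, show b - 1 + 1 = b by omega]
  congr 2
  · congr 1
    refine word_congr _ (fun x hx => ?_) fun x hx => ?_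
    · rw [skip_of_lt e (by omega)]
    · rw [skip_of_lt s (by omega)]
  · refine word_congr _ (fun x hx => ?_) fun x hx => ?_
    · unfold skip
      split_ifs <;> first | omega | rfl
    · unfold skip
      split_ifs <;> first | omega | rfl

/-- The two words of a block have parameters relative to `s a`. The subtracted multiples of `s a`
are compensated by the exponential, since the differences of `l` telescope to `l (e b) - l (e 0)`.
-/
theorem sum_log_block (l : ℕ → ℚ) (hab : a < b) :
    ∑ r ∈ Finset.range b, (l (e (r + 1)) - l (e r)) • (s r).cast HBar =
      (l (e b) - l (e 0)) • (s a).cast HBar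
      + ∑ x ∈ Finset.range a, (l (e (a - (x + 1))) - l (e (a - x))) •
          (s a - s (a - 1 - x)).cast HBar
      + ∑ x ∈ Finset.range (b - 1 - a), (l (e (a + 1 + (x + 1))) - l (e (a + 1 + x))) •
          (s (a + 1 + x) - s a).cast HBar := by
  have htel : l (e b) - l (e 0) = ∑ r ∈ Finset.range b, (l (e (r + 1)) - l (e r)) :=
    (Finset.sum_range_sub (fun r => l (e r)) b).symm
  rw [htel, Finset.sum_smul, sum_range_split hab, sum_range_split hab]
  have h1 : ∀ x ∈ Finset.range a, (l (e (a - (x + 1))) - l (e (a - x))) •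
      (s a - s (a - 1 - x)).cast HBar =
      (l (e (a - 1 - x + 1)) - l (e (a - 1 - x))) • (s (a - 1 - x)).cast HBar
      - (l (e (a - 1 - x + 1)) - l (e (a - 1 - x))) • (s a).cast HBar := by
    intro x hx
    have := Finset.mem_range.mp hx
    rw [show a - (x + 1) = a - 1 - x by omega, show a - 1 - x + 1 = a - x by omega, cast_sub]
    module
  have h2 : ∀ x ∈ Finset.range (b - 1 - a), (l (e (a + 1 + (x + 1))) - l (e (a + 1 + x))) •
      (s (a + 1 + x) - s a).cast HBar =
      (l (e (a + 1 + x + 1)) - l (e (a + 1 + x))) • (s (a + 1 + x)).cast HBar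
      - (l (e (a + 1 + x + 1)) - l (e (a + 1 + x))) • (s a).cast HBar := by
    intro x _
    rw [cast_sub, smul_sub]
    rfl
  rw [Finset.sum_congr rfl h1, Finset.sum_congr rfl h2, Finset.sum_sub_distrib,
    Finset.sum_sub_distrib]
  abel

/-- Leibniz rule for the exponential and the two words. In the inverted word the letters run
backwards, which exchanges the two kinds of deletion terms; the sign from lowering the mark
compensates. What remains are the deletions of an unmarked letter with an adjacent break interior to
the block. -/
theorem cm_dbar_blk (o : ℕ → ℕ → ℚ) (l : ℕ → ℚ) (hab : a < b) (he : Up b e ∨ Down b e) :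
    cm (dbar o l : HBar →ₗ[ℚ] HBar) (blk e s a b) =
      blk e s a b * ∑ r ∈ Finset.range b, (l (e (r + 1)) - l (e r)) • (s r).cast HBar
      + ∑ r ∈ Finset.range b, (if r ≠ 0 ∧ r ≠ a then o (e r) (e (r + 1)) •
          blk (skip r e) (skip r s) (pull r a) (b - 1) else 0)
      - ∑ r ∈ Finset.range b, (if r ≠ a ∧ r + 1 ≠ b then o (e (r + 1)) (e r) •
          blk (skip (r + 1) e) (skip r s) (pull r a) (b - 1) else 0) := by
  set E := ex (logHBar (e 0) (e b)) (s a) with hE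
  set e1 : ℕ → ℕ := fun x => e (a - x) with he1
  set s1 : ℕ → Par := fun x => s a - s (a - 1 - x) with hs1
  set e2 : ℕ → ℕ := fun x => e (a + 1 + x) with he2
  set s2 : ℕ → Par := fun x => s (a + 1 + x) - s a with hs2
  have hadm1 : Up a e1 ∨ Down a e1 := by
    rcases he with he | he
    · exact Or.inr fun x y hxy hy => he _ _ (by omega) (by omega)
    · exact Or.inl fun x y hxy hy => he _ _ (by omega) (by omega)
  have hadm2 : Up (b - 1 - a) e2 ∨ Down (b - 1 - a) e2 := by
    rcases he with he | he
    · exact Or.inl fun x y hxy hy => he _ _ (by omega) (by omega)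
    · exact Or.inr fun x y hxy hy => he _ _ (by omega) (by omega)
  -- In front of the mark these terms come from the negative sum in the derivative of the inverted
  -- word. That sum has only `a - 1` terms, which accounts for the exclusion of `r = 0`.
  have hP : ∑ r ∈ Finset.range b, (if r ≠ 0 ∧ r ≠ a then o (e r) (e (r + 1)) •
          blk (skip r e) (skip r s) (pull r a) (b - 1) else 0) =
      -(((-1 : ℚ) ^ a) • (E * (∑ x ∈ Finset.range (a - 1), o (e1 (x + 1)) (e1 x) •
          word bracketHBar (a - 1) (skip (x + 1) e1) (skip x s1)) *
          word bracketHBar (b - 1 - a) e2 s2)) +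
        ((-1 : ℚ) ^ a) • (E * word bracketHBar a e1 s1 *
          (∑ x ∈ Finset.range (b - 1 - a), o (e2 x) (e2 (x + 1)) •
          word bracketHBar (b - 1 - a - 1) (skip x e2) (skip x s2))) := by
    rw [sum_range_split hab, if_neg (by simp), add_zero]
    congr 1
    · rw [Finset.mul_sum, Finset.sum_mul, Finset.smul_sum, ← Finset.sum_neg_distrib]
      have hsub : Finset.range (a - 1) ⊆ Finset.range a :=
        Finset.range_subset_range.mpr (Nat.sub_le _ _)
      symm
      refine Finset.sum_subset_zero_on_sdiff hsub (fun x hx => ?_) fun x hx => ?_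
      · simp only [Finset.mem_sdiff, Finset.mem_range] at hx
        exact if_neg (by omega)
      · have := Finset.mem_range.mp hx
        rw [if_pos (by omega), blk_skip_of_lt e s (Or.inl rfl) (by omega) (by omega) hab,
          show a - (a - 1 - x) = x + 1 by omega, show a - 1 - (a - 1 - x) = x by omega,
          he1]
        simp only [show a - (x + 1) = a - 1 - x by omega, show a - 1 - x + 1 = a - x by omega]
        rw [mul_smul_comm, smul_mul_assoc, smul_comm, smul_neg]
    · rw [Finset.mul_sum, Finset.smul_sum]
      refine Finset.sum_congr rfl fun x hx => ?_
      have := Finset.mem_range.mp hx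
      rw [if_pos (by omega), blk_skip_of_gt e s (Or.inl rfl) (by omega) (by omega),
        show a + 1 + x - (a + 1) = x by omega, mul_smul_comm, smul_comm]
      rfl
  -- Here the roles are exchanged: the second word contributes through its negative sum, which is
  -- one term shorter, and this accounts for the exclusion of `r + 1 = b`.
  have hM : ∑ r ∈ Finset.range b, (if r ≠ a ∧ r + 1 ≠ b then o (e (r + 1)) (e r) •
          blk (skip (r + 1) e) (skip r s) (pull r a) (b - 1) else 0) =
      -(((-1 : ℚ) ^ a) • (E * (∑ x ∈ Finset.range a, o (e1 x) (e1 (x + 1)) •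
          word bracketHBar (a - 1) (skip x e1) (skip x s1)) *
          word bracketHBar (b - 1 - a) e2 s2)) +
        ((-1 : ℚ) ^ a) • (E * word bracketHBar a e1 s1 *
          (∑ x ∈ Finset.range (b - 1 - a - 1), o (e2 (x + 1)) (e2 x) •
          word bracketHBar (b - 1 - a - 1) (skip (x + 1) e2) (skip x s2))) := by
    rw [sum_range_split hab, if_neg (by simp), add_zero]
    congr 1
    · rw [Finset.mul_sum, Finset.sum_mul, Finset.smul_sum, ← Finset.sum_neg_distrib]
      refine Finset.sum_congr rfl fun x hx => ?_
      have := Finset.mem_range.mp hx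
      rw [if_pos (by omega), blk_skip_of_lt e s (Or.inr rfl) (by omega) (by omega) hab,
        show a - (a - 1 - x + 1) = x by omega, show a - 1 - (a - 1 - x) = x by omega,
        he1]
      simp only [show a - (x + 1) = a - 1 - x by omega, show a - 1 - x + 1 = a - x by omega]
      rw [mul_smul_comm, smul_mul_assoc, smul_comm, smul_neg]
    · rw [Finset.mul_sum, Finset.smul_sum]
      have hsub : Finset.range (b - 1 - a - 1) ⊆ Finset.range (b - 1 - a) :=
        Finset.range_subset_range.mpr (Nat.sub_le _ _)
      symm
      refine Finset.sum_subset_zero_on_sdiff hsub (fun x hx => ?_) fun x hx => ?_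
      · simp only [Finset.mem_sdiff, Finset.mem_range] at hx
        exact if_neg (by omega)
      · have := Finset.mem_range.mp hx
        rw [if_pos (by omega), blk_skip_of_gt e s (Or.inr rfl) (by omega) (by omega),
          show a + 1 + x - (a + 1) = x by omega, show a + 1 + x + 1 - (a + 1) = x + 1 by omega,
          mul_smul_comm, smul_comm]
        rfl
  rw [hP, hM, sum_log_block e s l hab]
  unfold blk
  rw [map_smul, cm_mul, cm_mul, cm_ex _ (dbar_logHBar o l _ _), cm_dbar_word o l hadm1,
    cm_dbar_word o l hadm2]
  simp only [dRHS]
  simp only [Algebra.smul_def]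
  ring

end blocks

end SymbPolylog

namespace SymbPolylog

open MvPowerSeries

/-! ### The right factors of the coproduct -/

/-- The block of letters `i, …, i' - 1` with marked letter `j`. -/
def block (e : ℕ → ℕ) (s : ℕ → Par) (i j i' : ℕ) : PS HBar :=
  blk (fun x => e (i + x)) (fun x => s (i + x)) (j - i) (i' - i)

/-- The right factor of the coproduct for the cut with block starts `I 0, …, I n` and marks
`J 0, …, J (n-1)`. -/
def rightFactor (e : ℕ → ℕ) (s : ℕ → Par) (I J : ℕ → ℕ) (n : ℕ) : PS HBar :=
  word bracketHBar (I 0) e s * ∏ α ∈ Finset.range n, block e s (I α) (J α) (I (α + 1))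

theorem block_congr {e e' : ℕ → ℕ} {s s' : ℕ → Par} {i j i' : ℕ} (hij : i ≤ j) (hj : j < i')
    (he : ∀ x ≤ i', e x = e' x) (hs : ∀ x < i', s x = s' x) :
    block e s i j i' = block e' s' i j i' :=
  blk_congr (by omega) (fun x _ => he _ (by omega)) fun x _ => hs _ (by omega)

/-- The sequences `I`, `J` interlace: `I 0 ≤ J 0 < I 1 ≤ J 1 < ⋯ < I n`. -/
def Interlaced (n : ℕ) (I J : ℕ → ℕ) : Prop := ∀ α < n, I α ≤ J α ∧ J α < I (α + 1)

theorem Interlaced.mono {n : ℕ} {I J : ℕ → ℕ} (h : Interlaced n I J) {α : ℕ} (hα : α ≤ n) :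
    I α ≤ I n := by
  induction n, hα using Nat.le_induction with
  | base => exact le_rfl
  | succ n hn ih =>
    have h1 := h n (by omega)
    have h2 := ih fun β _ => h β (by omega)
    omega

theorem Interlaced.lt {n : ℕ} {I J : ℕ → ℕ} (h : Interlaced n I J) {α : ℕ} (hα : α < n) :
    J α < I n :=
  (h α hα).2.trans_le (h.mono hα)

theorem Interlaced.of_succ {n : ℕ} {I J : ℕ → ℕ} (h : Interlaced (n + 1) I J) :
    Interlaced n I J := fun α hα => h α (hα.trans n.lt_succ_self)

theorem rightFactor_congr {e e' : ℕ → ℕ} {s s' : ℕ → Par} {I J I' J' : ℕ → ℕ} {n : ℕ}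
    (hI : ∀ α ≤ n, I α = I' α) (hJ : ∀ α < n, J α = J' α)
    (hIJ : Interlaced n I J)
    (he : ∀ x ≤ I n, e x = e' x) (hs : ∀ x < I n, s x = s' x) :
    rightFactor e s I J n = rightFactor e' s' I' J' n := by
  unfold rightFactor
  rw [← hI 0 (Nat.zero_le _)]
  congr 1
  · have := hIJ.mono (Nat.zero_le n)
    exact word_congr _ (fun x _ => he x (by omega)) fun x _ => hs x (by omega)
  · refine Finset.prod_congr rfl fun α hα => ?_
    have hα := Finset.mem_range.mp hα
    have : I (α + 1) ≤ I n := hIJ.mono hα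
    rw [← hI α hα.le, ← hI (α + 1) hα, ← hJ α hα]
    exact block_congr (hIJ α hα).1 (hIJ α hα).2 (fun x _ => he x (by omega))
      fun x _ => hs x (by omega)

theorem pull_of_le {r x : ℕ} (h : x ≤ r) : pull r x = x := if_pos h

theorem pull_of_lt {r x : ℕ} (h : r < x) : pull r x = x - 1 := if_neg h.not_ge

theorem block_skip_of_lt {r r' i j i' : ℕ} (e : ℕ → ℕ) (s : ℕ → Par) (h : r < i) (h' : r' < i)
    (hij : i ≤ j) (hj : j < i') : block (skip r' e) (skip r s) (pull r' i) (pull r j) (pull r' i') =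
      block e s i j i' := by
  rw [pull_of_lt h', pull_of_lt (show r < j by omega), pull_of_lt (show r' < i' by omega)]
  unfold block
  rw [show j - 1 - (i - 1) = j - i by omega, show i' - 1 - (i - 1) = i' - i by omega]
  refine blk_congr (by omega) (fun x _ => ?_) fun x _ => ?_
  · rw [skip_of_le e (by omega)]; congr 1; omega
  · rw [skip_of_le s (by omega)]; congr 1; omega

theorem cm_dbar_block (o : ℕ → ℕ → ℚ) (l : ℕ → ℚ) (e : ℕ → ℕ) (s : ℕ → Par) {i j i' : ℕ}
    (hij : i ≤ j) (hj : j < i') (he : Up i' e ∨ Down i' e) :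
    cm (dbar o l : HBar →ₗ[ℚ] HBar) (block e s i j i') =
      block e s i j i' *
        ∑ x ∈ Finset.range (i' - i), (l (e (i + x + 1)) - l (e (i + x))) • (s (i + x)).cast HBar
      + ∑ x ∈ Finset.range (i' - i), (if i + x ≠ i ∧ i + x ≠ j then o (e (i + x)) (e (i + x + 1)) •
          block (skip (i + x) e) (skip (i + x) s) i (pull (i + x) j) (i' - 1) else 0)
      - ∑ x ∈ Finset.range (i' - i), (if i + x ≠ j ∧ i + x + 1 ≠ i' then
          o (e (i + x + 1)) (e (i + x)) •
          block (skip (i + x + 1) e) (skip (i + x) s) i (pull (i + x) j) (i' - 1) else 0) := by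
  have hadm : Up (i' - i) (fun x => e (i + x)) ∨ Down (i' - i) (fun x => e (i + x)) := by
    rcases he with he | he
    · exact Or.inl fun x y hxy hy => he _ _ (by omega) (by omega)
    · exact Or.inr fun x y hxy hy => he _ _ (by omega) (by omega)
  have hskip : ∀ {α : Type} (f : ℕ → α) (x : ℕ), skip x (fun y => f (i + y)) =
      fun y => skip (i + x) f (i + y) := by
    intro α f x
    funext y
    unfold skip
    simp only [add_lt_add_iff_left, add_assoc]
  have hp : ∀ x, pull x (j - i) = pull (i + x) j - i := by
    intro x
    unfold pull
    split_ifs <;> omega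
  have := cm_dbar_blk (fun x => e (i + x)) (fun x => s (i + x)) o l
    (show j - i < i' - i by omega) hadm
  unfold block
  rw [this]
  congr 1
  · congr 1
    refine Finset.sum_congr rfl fun x hx => ?_
    rw [hskip, hskip, hp, show i' - i - 1 = i' - 1 - i by omega]
    refine if_congr ?_ rfl rfl
    omega
  · refine Finset.sum_congr rfl fun x hx => ?_
    have := Finset.mem_range.mp hx
    rw [hskip, hskip, hp, show i' - i - 1 = i' - 1 - i by omega]
    refine if_congr ?_ rfl rfl
    omega

section succ

variable {n : ℕ} {I J : ℕ → ℕ} {r j : ℕ}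

theorem omits_succ_of_lt (hIJ : Interlaced (n + 1) I J) (hr : r < I n) (hj : j ≤ I n) :
    ((∀ α ≤ n + 1, I α ≠ j) ∧ ∀ α < n + 1, J α ≠ r) ↔
      (∀ α ≤ n, I α ≠ j) ∧ ∀ α < n, J α ≠ r := by
  have hn := hIJ n n.lt_succ_self
  refine and_congr ⟨fun h α hα => h α (by omega), fun h α hα => ?_⟩
    ⟨fun h α hα => h α (by omega), fun h α hα => ?_⟩
  · rcases Nat.lt_or_ge n α with h1 | h1
    · rw [show α = n + 1 by omega]; omega
    · exact h α h1
  · rcases Nat.lt_or_ge α n with h1 | h1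
    · exact h α h1
    · rw [show α = n by omega]; omega

/-- All earlier starts and marks lie below or at `I n`, so for a deletion in the last block only its
own two boundaries and its mark have to be avoided. -/
theorem omits_succ_of_le (hIJ : Interlaced (n + 1) I J) (hr : I n ≤ r) (hj : I n ≤ j) :
    ((∀ α ≤ n + 1, I α ≠ j) ∧ ∀ α < n + 1, J α ≠ r) ↔
      j ≠ I n ∧ r ≠ J n ∧ j ≠ I (n + 1) := by
  constructor
  · rintro ⟨h1, h2⟩
    exact ⟨(h1 n (by omega)).symm, (h2 n (by omega)).symm, (h1 (n + 1) le_rfl).symm⟩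
  · rintro ⟨h1, h2, h3⟩
    refine ⟨fun α hα => ?_, fun α hα => ?_⟩
    · rcases Nat.lt_or_ge n α with h4 | h4
      · rw [show α = n + 1 by omega]; omega
      · have := hIJ.of_succ.mono h4; omega
    · rcases Nat.lt_or_ge α n with h4 | h4
      · have := hIJ.of_succ.lt h4; omega
      · rw [show α = n by omega]; omega

theorem rightFactor_succ_of_lt (hIJ : Interlaced (n + 1) I J) (e : ℕ → ℕ) (s : ℕ → Par) (hr : r < I n) (hj : j < I n) :
    rightFactor (skip j e) (skip r s) (fun α => pull j (I α)) (fun α => pull r (J α)) (n + 1) =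
      rightFactor (skip j e) (skip r s) (fun α => pull j (I α)) (fun α => pull r (J α)) n *
        block e s (I n) (J n) (I (n + 1)) := by
  have hn := hIJ n n.lt_succ_self
  rw [← block_skip_of_lt e s hr hj hn.1 hn.2, rightFactor, Finset.prod_range_succ, ← mul_assoc]
  rfl

theorem rightFactor_succ_of_le (hIJ : Interlaced (n + 1) I J) (e : ℕ → ℕ) (s : ℕ → Par) (hr : I n ≤ r) (hj : I n < j)
    (hj' : j < I (n + 1)) :
    rightFactor (skip j e) (skip r s) (fun α => pull j (I α)) (fun α => pull r (J α)) (n + 1) =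
      rightFactor e s I J n *
        block (skip j e) (skip r s) (I n) (pull r (J n)) (I (n + 1) - 1) := by
  have h1 : rightFactor e s I J n =
      rightFactor (skip j e) (skip r s) (fun α => pull j (I α)) (fun α => pull r (J α)) n := by
    refine rightFactor_congr (fun α hα => (pull_of_le ?_).symm) (fun α hα => (pull_of_le ?_).symm)
      hIJ.of_succ (fun y hy => (skip_of_lt e ?_).symm) fun y hy => (skip_of_lt s ?_).symm
    · have := hIJ.of_succ.mono hα; omega
    · have := hIJ.of_succ.lt hα; omega
    · omega
    · omega
  rw [h1, rightFactor, Finset.prod_range_succ, ← mul_assoc, pull_of_le hj.le, pull_of_lt hj']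
  rfl

end succ

/-- A sum of right factors with the break `j r` and the parameter `r` omitted. -/
def omitSum (c : ℕ → ℚ) (j : ℕ → ℕ) (e : ℕ → ℕ) (s : ℕ → Par) (I J : ℕ → ℕ) (n : ℕ) : PS HBar :=
  open Classical in
  ∑ r ∈ Finset.range (I n), (if (∀ α ≤ n, I α ≠ j r) ∧ (∀ α < n, J α ≠ r) then
    c r • rightFactor (skip (j r) e) (skip r s) (fun α => pull (j r) (I α))
      (fun α => pull r (J α)) n else 0)

/-- A deletion takes place either before the last block or inside it; the boundary `I n` itself is
never deleted. The function `j` covers at once the two cases in which the break before or after the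
deleted letter is removed. -/
theorem omitSum_succ (c : ℕ → ℚ) {j : ℕ → ℕ} (hj : ∀ r, r ≤ j r ∧ j r ≤ r + 1) (e : ℕ → ℕ)
    (s : ℕ → Par) {I J : ℕ → ℕ} {n : ℕ} (hIJ : Interlaced (n + 1) I J) :
    omitSum c j e s I J (n + 1) = omitSum c j e s I J n * block e s (I n) (J n) (I (n + 1)) +
        rightFactor e s I J n * ∑ x ∈ Finset.range (I (n + 1) - I n),
          (if j (I n + x) ≠ I n ∧ I n + x ≠ J n ∧ j (I n + x) ≠ I (n + 1) then
            c (I n + x) • block (skip (j (I n + x)) e) (skip (I n + x) s) (I n)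
              (pull (I n + x) (J n)) (I (n + 1) - 1) else 0) := by
  classical
  have hn := hIJ n n.lt_succ_self
  obtain ⟨c, hc⟩ : ∃ c, I (n + 1) = I n + c := ⟨I (n + 1) - I n, by omega⟩
  unfold omitSum
  rw [show I (n + 1) - I n = c by omega]
  conv_lhs => rw [hc]
  rw [Finset.sum_range_add, Finset.sum_mul, Finset.mul_sum]
  congr 1
  · refine Finset.sum_congr rfl fun r hr => ?_
    have hr := Finset.mem_range.mp hr
    have hjr := hj r
    rw [ite_mul, zero_mul]
    by_cases hcond : (∀ α ≤ n, I α ≠ j r) ∧ ∀ α < n, J α ≠ r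
    · have := hcond.1 n le_rfl
      rw [if_pos hcond, if_pos ((omits_succ_of_lt hIJ hr (by omega)).mpr hcond),
        rightFactor_succ_of_lt hIJ e s hr (by omega), smul_mul_assoc]
    · rw [if_neg hcond, if_neg (mt (omits_succ_of_lt hIJ hr (by omega)).mp hcond)]
  · refine Finset.sum_congr rfl fun x hx => ?_
    have hx := Finset.mem_range.mp hx
    have hjr := hj (I n + x)
    rw [mul_ite, mul_zero]
    refine (if_congr (omits_succ_of_le hIJ (by omega) (by omega)) rfl rfl).trans ?_
    by_cases hcond : j (I n + x) ≠ I n ∧ I n + x ≠ J n ∧ j (I n + x) ≠ I (n + 1)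
    · rw [if_pos hcond, if_pos hcond, rightFactor_succ_of_le hIJ e s (by omega) (by omega)
        (by omega), mul_smul_comm]
    · rw [if_neg hcond, if_neg hcond]

/-- Induction on the number of blocks by the Leibniz rule. Every deletion in one factor is a
deletion in the whole string that respects all starts and marks, so the terms combine into
`omitSum`. -/
theorem cm_dbar_rightFactor (o : ℕ → ℕ → ℚ) (l : ℕ → ℚ) (e : ℕ → ℕ) (s : ℕ → Par) {I J : ℕ → ℕ}
    {n : ℕ} (hIJ : Interlaced n I J) (he : Up (I n) e ∨ Down (I n) e) :
    cm (dbar o l : HBar →ₗ[ℚ] HBar) (rightFactor e s I J n) =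
      rightFactor e s I J n *
        ∑ r ∈ Finset.range (I n), (l (e (r + 1)) - l (e r)) • (s r).cast HBar
      + omitSum (fun r => o (e r) (e (r + 1))) id e s I J n
      - omitSum (fun r => o (e (r + 1)) (e r)) Nat.succ e s I J n := by
  induction n with
  | zero =>
    have h0 : ∀ e s (I J : ℕ → ℕ), rightFactor e s I J 0 = word bracketHBar (I 0) e s := by
      intro e s I J
      simp [rightFactor]
    simp only [h0, cm_dbar_word o l he, dRHS, omitSum, Nat.le_zero, forall_eq, Nat.not_lt_zero,
      IsEmpty.forall_iff, implies_true, and_true, id, Nat.succ_eq_add_one]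
    congr 1
    · congr 1
      refine Finset.sum_congr rfl fun r hr => ?_
      have := Finset.mem_range.mp hr
      rw [if_pos (by omega), pull_of_lt (by omega)]
    -- The break behind the last letter of the initial word is `I 0`, which may not be omitted. This
    -- matches the shorter negative sum in `dRHS`.
    · have hsub : Finset.range (I 0 - 1) ⊆ Finset.range (I 0) :=
        Finset.range_subset_range.mpr (Nat.sub_le _ _)
      refine Finset.sum_subset_zero_on_sdiff hsub (fun x hx => ?_) fun x hx => ?_
      · simp only [Finset.mem_sdiff, Finset.mem_range] at hx
        exact if_neg (by omega)
      · have := Finset.mem_range.mp hx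
        rw [if_pos (by omega), pull_of_lt (by omega)]
  | succ n ih =>
    have hn := hIJ n n.lt_succ_self
    have he' : Up (I n) e ∨ Down (I n) e := by
      rcases he with he | he
      · exact Or.inl fun x y hxy hy => he _ _ (by omega) (by omega)
      · exact Or.inr fun x y hxy hy => he _ _ (by omega) (by omega)
    have hsucc : rightFactor e s I J (n + 1) = rightFactor e s I J n *
        block e s (I n) (J n) (I (n + 1)) := by
      rw [rightFactor, Finset.prod_range_succ, ← mul_assoc]; rfl
    have hL : ∑ r ∈ Finset.range (I (n + 1)), (l (e (r + 1)) - l (e r)) • (s r).cast HBar =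
        ∑ r ∈ Finset.range (I n), (l (e (r + 1)) - l (e r)) • (s r).cast HBar +
        ∑ x ∈ Finset.range (I (n + 1) - I n),
          (l (e (I n + x + 1)) - l (e (I n + x))) • (s (I n + x)).cast HBar := by
      obtain ⟨c, hc⟩ : ∃ c, I (n + 1) = I n + c := ⟨I (n + 1) - I n, by omega⟩
      rw [show I (n + 1) - I n = c by omega]
      conv_lhs => rw [hc]
      rw [Finset.sum_range_add]
    rw [omitSum_succ _ (j := id) (fun r => ⟨le_rfl, Nat.le_succ r⟩) e s hIJ,
      omitSum_succ _ (j := Nat.succ) (fun r => ⟨Nat.le_succ r, le_rfl⟩) e s hIJ, hL, hsucc, cm_mul,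
      ih hIJ.of_succ he', cm_dbar_block o l e s hn.1 hn.2 he]
    have h1 : ∀ x ∈ Finset.range (I (n + 1) - I n),
        ((I n + x ≠ I n ∧ I n + x ≠ J n) ↔
        (id (I n + x) ≠ I n ∧ I n + x ≠ J n ∧ id (I n + x) ≠ I (n + 1))) := by
      intro x hx
      have := Finset.mem_range.mp hx
      simp only [id]
      omega
    have h2 : ∀ x ∈ Finset.range (I (n + 1) - I n),
        ((I n + x ≠ J n ∧ I n + x + 1 ≠ I (n + 1)) ↔
        (Nat.succ (I n + x) ≠ I n ∧ I n + x ≠ J n ∧ Nat.succ (I n + x) ≠ I (n + 1))) := by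
      intro x hx
      have := Finset.mem_range.mp hx
      omega
    rw [Finset.sum_congr rfl fun x hx => if_congr (h1 x hx) rfl rfl,
      Finset.sum_congr rfl fun x hx => if_congr (h2 x hx) rfl rfl]
    simp only [id, Nat.succ_eq_add_one]
    ring

end SymbPolylog

namespace SymbPolylog

open MvPowerSeries

/-! ### The coproduct series with general parameters -/

theorem rep_rightFactor {d : ℕ} (τ : ℕ → Par) (e : ℕ → ℕ) {s : ℕ → Par} {I J : ℕ → ℕ} {n : ℕ} :
    rep d τ (rightFactor e s I J n) = rightFactor e (fun k => (s k).rep d τ) I J n := by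
  unfold rightFactor
  rw [map_mul, map_prod, rep_word]
  congr 1
  refine Finset.prod_congr rfl fun α _ => ?_
  unfold block blk
  rw [rep_rat_smul, map_mul, map_mul, rep_ex, rep_word, rep_word]
  simp only [Par.rep_sub]

theorem rightFactor_congr_index (e : ℕ → ℕ) (s : ℕ → Par) {I J I' J' : ℕ → ℕ} {n : ℕ}
    (hI : ∀ α ≤ n, I α = I' α) (hJ : ∀ α < n, J α = J' α) :
    rightFactor e s I J n = rightFactor e s I' J' n := by
  unfold rightFactor
  rw [hI 0 (Nat.zero_le _)]
  refine congrArg (_ * ·) (Finset.prod_congr rfl fun α hα => ?_)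
  have hα := Finset.mem_range.mp hα
  rw [hI α hα.le, hI (α + 1) hα, hJ α hα]

/-- A finite sequence as a sequence. -/
def raw {k d : ℕ} (f : Fin k → Fin (d + 1)) (a : ℕ) : ℕ := if h : a < k then f ⟨a, h⟩ else 0

theorem raw_coe {k d : ℕ} (f : Fin k → Fin (d + 1)) (a : Fin k) : raw f a = f a := dif_pos a.2

theorem mem_cuts {d k : ℕ} {p : (Fin (k + 1) → Fin (d + 1)) × (Fin k → Fin (d + 1))} :
    p ∈ cuts d k ↔ raw p.1 k = d ∧ Interlaced k (raw p.1) (raw p.2) := by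
  simp only [cuts, Finset.mem_filter, Finset.mem_univ, true_and]
  have h1 : raw p.1 k = p.1 (Fin.last k) := raw_coe p.1 (Fin.last k)
  rw [h1]
  refine and_congr ⟨fun h => by rw [h]; rfl, fun h => Fin.ext h⟩ ⟨fun h α hα => ?_, fun h α => ?_⟩
  · have h2 := h ⟨α, hα⟩
    have h3 := raw_coe p.1 (Fin.castSucc ⟨α, hα⟩)
    have h4 := raw_coe p.1 (Fin.succ ⟨α, hα⟩)
    have h5 := raw_coe p.2 ⟨α, hα⟩
    simp only [Fin.val_castSucc, Fin.val_succ, Fin.le_def, Fin.lt_def] at h2 h3 h4 h5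
    omega
  · have h2 := h α α.2
    have h3 := raw_coe p.1 (Fin.castSucc α)
    have h4 := raw_coe p.1 (Fin.succ α)
    have h5 := raw_coe p.2 α
    simp only [Fin.val_castSucc, Fin.val_succ, Fin.le_def, Fin.lt_def] at h2 h3 h4 h5 ⊢
    omega

theorem Interlaced.le_apply {n : ℕ} {I J : ℕ → ℕ} (h : Interlaced n I J) {α : ℕ} (hα : α ≤ n) :
    α ≤ I α := by
  induction α with
  | zero => exact Nat.zero_le _
  | succ α ih =>
    have := h α hα
    have := ih (by omega)
    omega

/-- Coefficients in the left factor of `ℍ̄ ⊗ ℍ̄`. -/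
def inL : PS HBar →+* PS (HBar ⊗[ℚ] HBar) :=
  map (Algebra.TensorProduct.includeLeft : HBar →ₐ[ℚ] HBar ⊗[ℚ] HBar).toRingHom

/-- Coefficients in the right factor of `ℍ̄ ⊗ ℍ̄`. -/
def inR : PS HBar →+* PS (HBar ⊗[ℚ] HBar) :=
  map (Algebra.TensorProduct.includeRight : HBar →ₐ[ℚ] HBar ⊗[ℚ] HBar).toRingHom

/-- The term of the coproduct for a cut. -/
def cutTerm (e : ℕ → ℕ) (s : ℕ → Par) (I J : ℕ → ℕ) (k : ℕ) : PS (HBar ⊗[ℚ] HBar) :=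
  inL (word bracketHBar k (fun a => e (I a)) fun a => s (J a)) * inR (rightFactor e s I J k)

/-- The series `Δ [y_0, …, y_{d-1} | s 0, …, s (d-1)]`. -/
def coprodWord (d : ℕ) (e : ℕ → ℕ) (s : ℕ → Par) : PS (HBar ⊗[ℚ] HBar) :=
  ∑ k ∈ Finset.range (d + 1), ∑ p ∈ cuts d k, cutTerm e s (raw p.1) (raw p.2) k

theorem smul_pow_neg_one {A : Type} [CommRing A] [Algebra ℚ A] (a : ℕ) (f : PS A) :
    ((-1 : ℚ) ^ a) • f = (-1) ^ a * f := by
  rw [Algebra.smul_def]; simp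

theorem blockFactor_eq (e : ℕ → ℕ) {i j i' : ℕ} (hij : i ≤ j) (hj : j < i') :
    blockFactor e i j i' = block e par i j i' := by
  unfold blockFactor block blk
  rw [smul_pow_neg_one]
  simp only [mul_assoc]
  congr 1
  congr 1
  · simp only [ex, cast_par, add_zero]
    congr 2
    · congr 1; omega
    · omega
  congr 1
  · unfold word
    congr 1
    · funext a; congr 1; have := a.2; omega
    · funext a
      have := a.2
      simp only [cast_sub, cast_par]
      congr 2 <;> omega
  · rw [show i' - i - 1 - (j - i) = i' - 1 - j by omega]
    unfold word
    congr 1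
    · funext a; congr 1; omega
    · funext a
      have := a.2
      simp only [cast_sub, cast_par]
      congr 2 <;> omega

theorem coprodSeries_eq (d : ℕ) (e : ℕ → ℕ) : coprodSeries d e = coprodWord d e par := by
  refine Finset.sum_congr rfl fun k _ => Finset.sum_congr rfl fun p hp => ?_
  rw [mem_cuts] at hp
  have h1 : genSeries bracketHBar k (fun a => e (p.1 a)) (fun a => t (p.2 a)) =
      word bracketHBar k (fun a => e (raw p.1 a)) fun a => par (raw p.2 a) := by
    unfold word
    congr 1
    · funext a; exact congrArg e (raw_coe p.1 a).symm
    · funext a; rw [cast_par]; exact congrArg t (raw_coe p.2 a).symm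
  have h2 : genSeries bracketHBar (p.1 0) (fun a => e a) (fun a => t a)
          * ∏ α : Fin k, blockFactor e (p.1 α.castSucc) (p.2 α) (p.1 α.succ) =
      rightFactor e par (raw p.1) (raw p.2) k := by
    have h0 : raw p.1 0 = p.1 0 := raw_coe p.1 0
    unfold rightFactor
    rw [Finset.prod_range, h0]
    refine congrArg₂ (· * ·) ?_ ?_
    · simp only [word, cast_par]
    · refine Finset.prod_congr rfl fun α _ => ?_
      have h := hp.2 α α.2
      rw [← blockFactor_eq e h.1 h.2]
      have h3 := raw_coe p.1 (Fin.castSucc α)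
      have h4 := raw_coe p.1 (Fin.succ α)
      rw [← h3, ← h4, raw_coe p.2 α]
      rfl
  rw [h1, h2]
  rfl

theorem cutTerm_congr {e e' : ℕ → ℕ} {s s' : ℕ → Par} {I J : ℕ → ℕ} {k : ℕ}
    (hIJ : Interlaced k I J) (he : ∀ x ≤ I k, e x = e' x) (hs : ∀ x < I k, s x = s' x) :
    cutTerm e s I J k = cutTerm e' s' I J k := by
  unfold cutTerm
  rw [word_congr _ (fun a ha => he _ (hIJ.mono ha)) fun a ha => hs _ (hIJ.lt ha),
    rightFactor_congr (fun _ _ => rfl) (fun _ _ => rfl) hIJ he hs]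

theorem coprodWord_congr {d : ℕ} {e e' : ℕ → ℕ} {s s' : ℕ → Par} (he : ∀ a ≤ d, e a = e' a)
    (hs : ∀ a < d, s a = s' a) : coprodWord d e s = coprodWord d e' s' := by
  refine Finset.sum_congr rfl fun k _ => Finset.sum_congr rfl fun p hp => ?_
  rw [mem_cuts] at hp
  exact cutTerm_congr hp.2 (fun x hx => he x (by omega)) fun x hx => hs x (by omega)

theorem rep_coprodWord (d' : ℕ) (τ : ℕ → Par) (d : ℕ) (e : ℕ → ℕ) (s : ℕ → Par) :
    rep d' τ (coprodWord d e s) = coprodWord d e fun k => (s k).rep d' τ := by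
  unfold coprodWord
  simp only [map_sum]
  refine Finset.sum_congr rfl fun k _ => Finset.sum_congr rfl fun p _ => ?_
  unfold cutTerm inL inR
  rw [map_mul, ← rep_map, ← rep_map, rep_word, rep_rightFactor]

theorem rep_coprodWord_par (d : ℕ) (τ : ℕ → Par) (e : ℕ → ℕ) :
    rep d τ (coprodWord d e par) = coprodWord d e τ := by
  rw [rep_coprodWord]
  exact coprodWord_congr (fun _ _ => rfl) fun a ha => Par.rep_par τ ha

/-! ### Derivations of the coproduct series -/

/-- The inverse of `pull`, omitting the value `j`. -/
def push (j x : ℕ) : ℕ := if x < j then x else x + 1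

theorem skip_eq_push {α : Type} (j : ℕ) (f : ℕ → α) (x : ℕ) : skip j f x = f (push j x) := by
  unfold skip push
  split_ifs <;> rfl

theorem pull_push (j x : ℕ) : pull j (push j x) = x := by
  unfold pull push
  split_ifs <;> omega

theorem push_pull {j x : ℕ} (h : x ≠ j) : push j (pull j x) = x := by
  unfold pull push
  split_ifs <;> omega

theorem push_ne (j x : ℕ) : push j x ≠ j := by
  unfold push
  split_ifs <;> omega

/-- Sequences with values raised to omit `j`. -/
def pushFin {k d : ℕ} (j : ℕ) (f : Fin k → Fin (d + 1)) : Fin k → Fin (d + 1 + 1) :=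
  fun a => ⟨push j (f a), by unfold push; split_ifs <;> omega⟩

/-- Sequences with values lowered at `j`. -/
def pullFin {k d : ℕ} (j : ℕ) (f : Fin k → Fin (d + 1 + 1)) : Fin k → Fin (d + 1) :=
  fun a => ⟨min (pull j (f a)) d, by omega⟩

theorem raw_pushFin {k d : ℕ} (j : ℕ) (f : Fin k → Fin (d + 1)) {a : ℕ} (ha : a < k) :
    raw (pushFin j f) a = push j (raw f a) := by
  simp [raw, pushFin, ha]

theorem raw_pullFin {k d : ℕ} {j : ℕ} (hj : j ≤ d) (f : Fin k → Fin (d + 1 + 1)) {a : ℕ}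
    (ha : a < k) : raw (pullFin j f) a = pull j (raw f a) := by
  simp only [raw, pullFin, ha, dif_pos]
  have := (f ⟨a, ha⟩).2
  -- The cap in `pullFin` is inactive: since `j ≤ d`, `pull j` lowers the top value `d + 1` to `d`.
  refine min_eq_left ?_
  unfold pull
  split_ifs <;> omega

/-- Closing the gap left by the unused break `j` and the unused letter `r` is a bijection onto the
cuts of the shorter string. The interlacing is preserved because `j` is one of the two breaks
adjacent to the letter `r`. -/
theorem sum_cuts_omit {M : Type} [AddCommMonoid M] {d k r j : ℕ} (hr : r ≤ j) (hj : j ≤ r + 1)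
    (hjd : j ≤ d) (f : (ℕ → ℕ) → (ℕ → ℕ) → M)
    (hf : ∀ I J I' J', (∀ α ≤ k, I α = I' α) → (∀ α < k, J α = J' α) → f I J = f I' J')
    [∀ p : (Fin (k + 1) → Fin (d + 1 + 1)) × (Fin k → Fin (d + 1 + 1)),
      Decidable ((∀ α ≤ k, raw p.1 α ≠ j) ∧ ∀ α < k, raw p.2 α ≠ r)] :
    ∑ p ∈ cuts (d + 1) k, (if (∀ α ≤ k, raw p.1 α ≠ j) ∧ (∀ α < k, raw p.2 α ≠ r) then
      f (raw p.1) (raw p.2) else 0) =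
    ∑ p ∈ cuts d k, f (fun α => push j (raw p.1 α)) fun α => push r (raw p.2 α) := by
  rw [← Finset.sum_filter]
  symm
  refine Finset.sum_nbij' (fun p => (pushFin j p.1, pushFin r p.2))
    (fun p => (pullFin j p.1, pullFin r p.2)) ?_ ?_ ?_ ?_ ?_
  · intro p hp
    rw [mem_cuts] at hp
    obtain ⟨h1, h2⟩ := hp
    rw [Finset.mem_filter, mem_cuts]
    refine ⟨⟨?_, fun α hα => ?_⟩, fun α hα => ?_, fun α hα => ?_⟩
    · rw [raw_pushFin _ _ (Nat.lt_succ_self k), h1, push, if_neg (by omega)]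
    · dsimp only
      rw [raw_pushFin j p.1 (show α < k + 1 by omega), raw_pushFin r p.2 hα,
        raw_pushFin j p.1 (show α + 1 < k + 1 by omega)]
      have := h2 α hα
      unfold push
      split_ifs <;> omega
    · rw [raw_pushFin _ _ (by omega)]; exact push_ne _ _
    · rw [raw_pushFin _ _ hα]; exact push_ne _ _
  · intro p hp
    rw [Finset.mem_filter, mem_cuts] at hp
    obtain ⟨⟨h1, h2⟩, h3, h4⟩ := hp
    rw [mem_cuts]
    refine ⟨?_, fun α hα => ?_⟩
    · rw [raw_pullFin hjd _ (Nat.lt_succ_self k), h1, pull, if_neg (by omega)]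
      omega
    · have h5 := h3 α hα.le
      have h6 := h3 (α + 1) hα
      have h7 := h4 α hα
      rw [raw_pullFin hjd _ (by omega), raw_pullFin hjd _ (by omega),
        raw_pullFin (by omega) _ hα]
      have := h2 α hα
      unfold pull
      split_ifs <;> omega
  · intro p _
    refine Prod.ext ?_ ?_
    · funext a
      apply Fin.ext
      simp only [pullFin, pushFin, pull_push]
      have := (p.1 a).2
      omega
    · funext a
      apply Fin.ext
      simp only [pullFin, pushFin, pull_push]
      have := (p.2 a).2
      omega
  · intro p hp
    rw [Finset.mem_filter, mem_cuts] at hp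
    obtain ⟨-, h3, h4⟩ := hp
    refine Prod.ext ?_ ?_
    · funext a
      apply Fin.ext
      have h5 := h3 a (by have := a.2; omega)
      have h6 := raw_pullFin hjd p.1 a.2
      rw [raw_coe] at h5 h6
      rw [raw_coe] at h6
      change push j (pullFin j p.1 a) = p.1 a
      rw [h6, push_pull h5]
    · funext a
      apply Fin.ext
      have h5 := h4 a a.2
      have h6 := raw_pullFin (show r ≤ d by omega) p.2 a.2
      rw [raw_coe] at h5 h6
      rw [raw_coe] at h6
      change push r (pullFin r p.2 a) = p.2 a
      rw [h6, push_pull h5]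
  · intro p _
    exact hf _ _ _ _ (fun α hα => (raw_pushFin _ _ (by omega)).symm)
      fun α hα => (raw_pushFin _ _ hα).symm

theorem inR_smul (c : ℚ) (f : PS HBar) : inR (c • f) = c • inR f := map_rat_smul inR c f

theorem inR_cast (s : Par) : inR (s.cast HBar) = s.cast (HBar ⊗[ℚ] HBar) := map_cast _ s

theorem cm_lTensor_inL_inR (D : HBar →ₗ[ℚ] HBar) (f g : PS HBar) :
    cm (D.lTensor HBar) (inL f * inR g) = inL f * inR (cm D g) := by
  classical
  ext m
  simp only [coeff_cm, coeff_mul, map_sum, inL, inR, coeff_map]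
  refine Finset.sum_congr rfl fun p _ => ?_
  simp

/-- The terms of a derivative of the coproduct series with one letter omitted. -/
theorem sum_omitSum (c : ℕ → ℚ) {j : ℕ → ℕ} (hj : ∀ r, r ≤ j r ∧ j r ≤ r + 1) (d : ℕ) (e : ℕ → ℕ)
    (s : ℕ → Par) :
    ∑ k ∈ Finset.range (d + 1), ∑ p ∈ cuts d k,
      inL (word bracketHBar k (fun a => e (raw p.1 a)) fun a => s (raw p.2 a)) *
        inR (omitSum c j e s (raw p.1) (raw p.2) k) =
    ∑ r ∈ Finset.range d, if j r < d then c r • coprodWord (d - 1) (skip (j r) e) (skip r s)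
      else 0 := by
  classical
  have h1 : ∀ k, ∀ p ∈ cuts d k,
      inL (word bracketHBar k (fun a => e (raw p.1 a)) fun a => s (raw p.2 a)) *
        inR (omitSum c j e s (raw p.1) (raw p.2) k) =
      ∑ r ∈ Finset.range d, if (∀ α ≤ k, raw p.1 α ≠ j r) ∧ (∀ α < k, raw p.2 α ≠ r) then
        c r • (inL (word bracketHBar k (fun a => e (raw p.1 a)) fun a => s (raw p.2 a)) *
          inR (rightFactor (skip (j r) e) (skip r s) (fun α => pull (j r) (raw p.1 α))
            (fun α => pull r (raw p.2 α)) k)) else 0 := by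
    intro k p hp
    rw [mem_cuts] at hp
    unfold omitSum
    rw [hp.1, map_sum, Finset.mul_sum]
    refine Finset.sum_congr rfl fun r _ => ?_
    split_ifs
    · rw [inR_smul, mul_smul_comm]
    · rw [map_zero, mul_zero]
  rw [Finset.sum_congr rfl fun k _ => Finset.sum_congr rfl (h1 k)]
  rw [Finset.sum_congr rfl fun k _ => Finset.sum_comm, Finset.sum_comm]
  refine Finset.sum_congr rfl fun r hr => ?_
  have hr := Finset.mem_range.mp hr
  have hjr := hj r
  split_ifs with hjd
  · obtain ⟨D, rfl⟩ : ∃ D, d = D + 1 := ⟨d - 1, by omega⟩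
    rw [Finset.sum_range_succ, coprodWord, Finset.smul_sum, Nat.add_sub_cancel]
    -- A cut of `D + 1` letters into `D + 1` blocks consists of single letters and uses every break,
    -- so none can be omitted.
    have hlast : ∀ f : (Fin (D + 1 + 1) → Fin (D + 1 + 1)) × (Fin (D + 1) → Fin (D + 1 + 1)) →
        PS (HBar ⊗[ℚ] HBar), ∑ p ∈ cuts (D + 1) (D + 1),
        (if (∀ α ≤ D + 1, raw p.1 α ≠ j r) ∧ (∀ α < D + 1, raw p.2 α ≠ r) then f p else 0) = 0 := by
      intro f
      refine Finset.sum_eq_zero fun p hp => if_neg ?_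
      rintro ⟨h2, -⟩
      rw [mem_cuts] at hp
      have key : ∀ α ≤ D + 1, raw p.1 (D + 1 - α) ≤ D + 1 - α := by
        intro α hα
        induction α with
        | zero => rw [Nat.sub_zero]; omega
        | succ α ih =>
          have h3 := ih (by omega)
          have h4 := hp.2 (D + 1 - (α + 1)) (by omega)
          rw [show D + 1 - (α + 1) + 1 = D + 1 - α by omega] at h4
          omega
      have h5 := key (D + 1 - j r) (by omega)
      rw [show D + 1 - (D + 1 - j r) = j r by omega] at h5
      have h6 := hp.2.le_apply (show j r ≤ D + 1 by omega)
      exact h2 (j r) (by omega) (by omega)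
    rw [hlast, add_zero]
    refine Finset.sum_congr rfl fun k hk => ?_
    rw [Finset.smul_sum]
    have hcongr := sum_cuts_omit (k := k) hjr.1 hjr.2 (show j r ≤ D by omega)
      (fun I J => c r • (inL (word bracketHBar k (fun a => e (I a)) fun a => s (J a)) *
          inR (rightFactor (skip (j r) e) (skip r s) (fun α => pull (j r) (I α))
            (fun α => pull r (J α)) k))) ?_
    · rw [hcongr]
      refine Finset.sum_congr rfl fun p _ => ?_
      unfold cutTerm
      simp only [pull_push, skip_eq_push]
    · intro I J I' J' hI hJ
      rw [word_congr _ (fun a ha => congrArg e (hI a ha)) fun a ha => congrArg s (hJ a ha)]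
      rw [rightFactor_congr_index _ _ (fun α hα => congrArg (pull (j r)) (hI α hα))
        fun α hα => congrArg (pull r) (hJ α hα)]
  -- Here the break to be omitted is `d`, the endpoint of every cut.
  · refine Finset.sum_eq_zero fun k _ => Finset.sum_eq_zero fun p hp => if_neg ?_
    rintro ⟨h2, -⟩
    rw [mem_cuts] at hp
    have := h2 k le_rfl
    omega

/-- The derivation acts on the right factors only. The left factor of a cut involves just its starts
and marks, which the deletions avoid, so it is also the left factor of the corresponding cut of the
shortened word. Exchanging the sums over cuts and deletions gives coproduct series of shortened
words. -/
theorem cm_lTensor_coprodWord (o : ℕ → ℕ → ℚ) (l : ℕ → ℚ) {d : ℕ} {e : ℕ → ℕ}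
    (he : Up d e ∨ Down d e) (s : ℕ → Par) :
    cm ((dbar o l : HBar →ₗ[ℚ] HBar).lTensor HBar) (coprodWord d e s) =
      dRHS o l coprodWord d e s := by
  have h1 : cm ((dbar o l : HBar →ₗ[ℚ] HBar).lTensor HBar) (coprodWord d e s) =
      coprodWord d e s * (∑ r ∈ Finset.range d, (l (e (r + 1)) - l (e r)) •
        (s r).cast (HBar ⊗[ℚ] HBar))
      + ∑ k ∈ Finset.range (d + 1), ∑ p ∈ cuts d k,
        inL (word bracketHBar k (fun a => e (raw p.1 a)) fun a => s (raw p.2 a)) *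
        inR (omitSum (fun r => o (e r) (e (r + 1))) id e s (raw p.1) (raw p.2) k)
      - ∑ k ∈ Finset.range (d + 1), ∑ p ∈ cuts d k,
        inL (word bracketHBar k (fun a => e (raw p.1 a)) fun a => s (raw p.2 a)) *
        inR (omitSum (fun r => o (e (r + 1)) (e r)) Nat.succ e s (raw p.1) (raw p.2) k) := by
    unfold coprodWord
    simp only [map_sum, Finset.sum_mul]
    simp only [← Finset.sum_add_distrib, ← Finset.sum_sub_distrib]
    refine Finset.sum_congr rfl fun k _ => Finset.sum_congr rfl fun p hp => ?_
    rw [mem_cuts] at hp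
    unfold cutTerm
    rw [cm_lTensor_inL_inR, cm_dbar_rightFactor o l e s hp.2 (by rw [hp.1]; exact he), hp.1]
    simp only [map_sub, map_add, map_mul, map_sum, inR_smul, inR_cast]
    ring
  rw [h1, sum_omitSum _ (j := id) (fun r => ⟨le_rfl, Nat.le_succ r⟩),
    sum_omitSum _ (j := Nat.succ) (fun r => ⟨Nat.le_succ r, le_rfl⟩), dRHS]
  congr 1
  · congr 1
    refine Finset.sum_congr rfl fun r hr => ?_
    exact if_pos (Finset.mem_range.mp hr)
  · have hsub : Finset.range (d - 1) ⊆ Finset.range d :=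
      Finset.range_subset_range.mpr (Nat.sub_le _ _)
    symm
    refine Finset.sum_subset_zero_on_sdiff hsub (fun x hx => ?_) fun x hx => ?_
    · simp only [Finset.mem_sdiff, Finset.mem_range] at hx
      exact if_neg (by omega)
    · have := Finset.mem_range.mp hx
      rw [if_pos (by omega)]

end SymbPolylog

namespace SymbPolylog

open MvPowerSeries

/-! ### Compatibility of the coproduct with derivations -/

theorem Up.skip {d : ℕ} {e : ℕ → ℕ} (h : Up d e) (k : ℕ) : Up (d - 1) (skip k e) := by
  intro a b hab hb
  rcases Nat.eq_zero_or_pos d with rfl | hd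
  · omega
  unfold SymbPolylog.skip
  split_ifs <;> exact h _ _ (by omega) (by omega)

theorem Down.skip {d : ℕ} {e : ℕ → ℕ} (h : Down d e) (k : ℕ) : Down (d - 1) (skip k e) := by
  intro a b hab hb
  rcases Nat.eq_zero_or_pos d with rfl | hd
  · omega
  unfold SymbPolylog.skip
  split_ifs <;> exact h _ _ (by omega) (by omega)

theorem upDown_skip {d : ℕ} {e : ℕ → ℕ} (h : Up d e ∨ Down d e) (k : ℕ) :
    Up (d - 1) (skip k e) ∨ Down (d - 1) (skip k e) :=
  h.imp (fun h => h.skip k) fun h => h.skip k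

theorem coprodHBar_log (r : ℕ) : coprodHBar (MvPolynomial.X (.log r)) =
    MvPolynomial.X (.log r) ⊗ₜ 1 + 1 ⊗ₜ MvPolynomial.X (.log r) :=
  MvPolynomial.aeval_X _ _

theorem coprodHBar_reg (s : PolySymbol) : coprodHBar (MvPolynomial.X (.reg s)) =
    coeff (expVec s.n) (coprodSeries s.depth s.seq) :=
  MvPolynomial.aeval_X _ _

theorem coprodHBar_inv (s : PolySymbol) : coprodHBar (MvPolynomial.X (.inv s)) =
    coeff (expVec fun k => s.n k.rev) (coprodSeries s.depth fun a => s.seq (s.depth - a)) :=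
  MvPolynomial.aeval_X _ _

theorem coprodHBar_bracket {d : ℕ} (hd : 0 < d) {e : ℕ → ℕ}
    (he : Up d e ∨ Down d e) {n : ℕ → ℕ} (hn : ∀ k, 0 < n k) :
    coprodHBar (bracketHBar d (fun a => e a) fun k => n k) =
      coeff (ev d n) (coprodWord d e par) := by
  rcases he with he | he
  · rw [bracketHBar_up hd he hn, coprodHBar_reg, coprodSeries_eq]
    rw [coprodWord_congr (d := (upSymbol hd he hn).depth) (e' := e) (s' := par)
      (fun a ha => upSymbol_seq hd he hn ha) fun _ _ => rfl]
    rfl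
  · rw [bracketHBar_down hd he hn, coprodHBar_inv, coprodSeries_eq]
    have h1 : (expVec fun k => (downSymbol hd he hn).n k.rev) = ev d n := by
      change expVec (d := d) (fun k => n (k.rev.rev : Fin d)) = ev d n
      simp only [Fin.rev_rev, ev]
    rw [h1, coprodWord_congr (d := (downSymbol hd he hn).depth) (e' := e) (s' := par)
      (fun a ha => ?_) fun _ _ => rfl]
    · rfl
    · refine (downSymbol_seq hd he hn (Nat.sub_le _ _)).trans ?_
      exact congrArg e (Nat.sub_sub_self ha)

theorem coprodWord_zero (e : ℕ → ℕ) (s : ℕ → Par) : coprodWord 0 e s = 1 := by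
  have h1 : cuts 0 0 = {(fun _ => 0, fun a => a.elim0)} := by
    ext p
    rw [mem_cuts, Finset.mem_singleton]
    constructor
    · intro _
      refine Prod.ext (funext fun a => Fin.ext (by have := (p.1 a).2; change (p.1 a : ℕ) = 0; omega)) (funext fun a => a.elim0)
    · rintro rfl
      exact ⟨rfl, fun α hα => absurd hα (Nat.not_lt_zero α)⟩
  simp only [coprodWord, Finset.sum_range_one, zero_add, h1, Finset.sum_singleton, cutTerm,
    rightFactor, Finset.prod_range_zero, mul_one]
  have h2 : raw (fun _ : Fin 1 => (0 : Fin 1)) 0 = 0 := rfl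
  rw [h2, word_zero _ bracketHBar_zero, word_zero _ bracketHBar_zero, map_one, map_one, one_mul]

/-- The coproduct on the coefficients of series. -/
theorem map_coprod_word {d : ℕ} {e : ℕ → ℕ} (he : Up d e ∨ Down d e) (s : ℕ → Par) :
    map coprodHBar.toRingHom (word bracketHBar d e s) = coprodWord d e s := by
  rcases Nat.eq_zero_or_pos d with rfl | hd
  · rw [word_zero _ bracketHBar_zero, coprodWord_zero, map_one]
  rw [← rep_word_par bracketHBar le_rfl s, ← rep_coprodWord_par, rep_map]
  congr 1
  refine ext_ev (d := d) ?_ (rep_coprodWord_par d par e) fun n hn => ?_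
  · rw [← rep_map, rep_word_par bracketHBar le_rfl par e]
  · rw [coeff_map, coeff_word_par bracketHBar d e n hn]
    exact coprodHBar_bracket hd he hn

theorem map_dRHS (o : ℕ → ℕ → ℚ) (l : ℕ → ℚ) {d : ℕ} {e : ℕ → ℕ}
    (he : Up d e ∨ Down d e) (s : ℕ → Par) :
    map coprodHBar.toRingHom (dRHS o l (word bracketHBar) d e s) = dRHS o l coprodWord d e s := by
  have hsmul : ∀ (c : ℚ) (f : PS HBar), map coprodHBar.toRingHom (c • f) =
    c • map coprodHBar.toRingHom f := fun c f => map_rat_smul _ c f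
  unfold dRHS
  simp only [map_sub, map_add, map_mul, map_sum, hsmul, map_cast, map_coprod_word he,
    map_coprod_word (upDown_skip he _)]

/-- The coproduct series satisfies the same derivative formula as the word; compare the coefficients
at `ev d n`. -/
theorem lTensor_coprod_bracket (o : ℕ → ℕ → ℚ) (l : ℕ → ℚ) {d : ℕ} {e : ℕ → ℕ}
    (he : Up d e ∨ Down d e) {n : ℕ → ℕ} (hn : ∀ k, 0 < n k) :
    (dbar o l : HBar →ₗ[ℚ] HBar).lTensor HBar
      (coprodHBar (bracketHBar d (fun a => e a) fun k => n k)) =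
    coprodHBar (dbar o l (bracketHBar d (fun a => e a) fun k => n k)) := by
  have h1 : cm ((dbar o l : HBar →ₗ[ℚ] HBar).lTensor HBar)
      (map coprodHBar.toRingHom (word bracketHBar d e par)) =
      map coprodHBar.toRingHom (cm (dbar o l : HBar →ₗ[ℚ] HBar) (word bracketHBar d e par)) := by
    rw [map_coprod_word he, cm_lTensor_coprodWord o l he, cm_dbar_word o l he, map_dRHS o l he]
  have h2 := congrArg (coeff (ev d n)) h1
  rw [coeff_cm, coeff_map, coeff_map, coeff_cm, coeff_word_par bracketHBar d e n hn] at h2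
  exact h2

/-! ### Generalities on derivations and coproducts -/

section general

variable {A B : Type} [CommRing A] [Algebra ℚ A] [CommRing B] [Algebra ℚ B]

theorem lTensor_mul (D : Derivation ℚ A A) (x y : B ⊗[ℚ] A) :
    (D : A →ₗ[ℚ] A).lTensor B (x * y) =
      x * (D : A →ₗ[ℚ] A).lTensor B y + y * (D : A →ₗ[ℚ] A).lTensor B x := by
  induction x using TensorProduct.induction_on with
  | zero => simp
  | add x x' hx hx' => rw [add_mul, map_add, hx, hx', map_add]; ring
  | tmul a b =>
    induction y using TensorProduct.induction_on with
    | zero => simp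
    | add y y' hy hy' => rw [mul_add, map_add, hy, hy', map_add]; ring
    | tmul c d =>
      simp only [Algebra.TensorProduct.tmul_mul_tmul, LinearMap.lTensor_tmul,
        Derivation.coeFn_coe, Derivation.leibniz, smul_eq_mul, TensorProduct.tmul_add]
      rw [mul_comm c a]

/-- Two maps satisfying the Leibniz rule over the same homomorphism agree if they agree on the
generators of a polynomial algebra. -/
theorem leibniz_ext {σ : Type} (φ : MvPolynomial σ ℚ →ₐ[ℚ] B) {f g : MvPolynomial σ ℚ →ₗ[ℚ] B}
    (hf : ∀ a b, f (a * b) = φ a * f b + φ b * f a) (hg : ∀ a b, g (a * b) = φ a * g b + φ b * g a)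
    (h : ∀ s, f (MvPolynomial.X s) = g (MvPolynomial.X s)) : f = g := by
  have h1 : ∀ f : MvPolynomial σ ℚ →ₗ[ℚ] B, (∀ a b, f (a * b) = φ a * f b + φ b * f a) →
      f 1 = 0 := by
    intro f hf
    have := hf 1 1
    simpa using this
  refine LinearMap.ext fun p => ?_
  induction p using MvPolynomial.induction_on with
  | C a =>
    rw [← mul_one (MvPolynomial.C a), ← MvPolynomial.smul_eq_C_mul, map_smul, map_smul, h1 f hf,
      h1 g hg]
  | add p q hp hq => rw [map_add, map_add, hp, hq]
  | mul_X p s hp => rw [hf, hg, hp, h]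

end general

theorem PolySymbol.seq_up (s : PolySymbol) : Up s.depth s.seq := by
  intro a b hab hb
  rw [PolySymbol.seq, PolySymbol.seq, dif_pos (by omega), dif_pos (by omega)]
  exact s.e_strictMono hab

/-- The weights as a sequence of positive numbers. -/
def PolySymbol.wt (s : PolySymbol) (k : ℕ) : ℕ := if h : k < s.depth then s.n ⟨k, h⟩ else 1

theorem PolySymbol.wt_pos (s : PolySymbol) (k : ℕ) : 0 < s.wt k := by
  unfold wt
  split_ifs with h
  · exact s.n_pos _
  · exact Nat.one_pos

theorem PolySymbol.upSymbol_eq (s : PolySymbol) :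
    upSymbol s.depth_pos s.seq_up s.wt_pos = s := by
  obtain ⟨d, hd, e, he, n, hn⟩ := s
  unfold upSymbol
  congr 1
  · funext a
    exact dif_pos a.2
  · funext a
    exact dif_pos a.2

theorem downSymbol_eq (s : PolySymbol) :
    downSymbol s.depth_pos (e := fun a => s.seq (s.depth - a))
      (fun a b hab hb => s.seq_up _ _ (by omega) (by omega))
      (n := fun k => s.wt (s.depth - 1 - k)) (fun _ => s.wt_pos _) = s := by
  obtain ⟨d, hd, e, he, n, hn⟩ := s
  unfold downSymbol
  congr 1
  · funext a
    simp only [PolySymbol.seq, Fin.val_rev]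
    rw [dif_pos (by omega)]
    congr 1
    apply Fin.ext
    have : (a : ℕ) < d + 1 := a.2
    change d - (d + 1 - (a + 1)) = (a : ℕ)
    omega
  · funext a
    have : (a : ℕ) < d := a.2
    simp only [PolySymbol.wt, Fin.val_rev]
    rw [dif_pos (by omega)]
    congr 1
    apply Fin.ext
    change d - 1 - (d - (a + 1)) = (a : ℕ)
    omega

theorem X_reg_eq (s : PolySymbol) : (MvPolynomial.X (.reg s) : HBar) =
    bracketHBar s.depth (fun a => s.seq a) fun k => s.wt k := by
  rw [bracketHBar_up s.depth_pos s.seq_up s.wt_pos, s.upSymbol_eq]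

theorem X_inv_eq (s : PolySymbol) : (MvPolynomial.X (.inv s) : HBar) =
    bracketHBar s.depth (fun a => s.seq (s.depth - a)) fun k => s.wt (s.depth - 1 - k) := by
  have h := bracketHBar_down s.depth_pos (e := fun a => s.seq (s.depth - a))
      (fun a b hab hb => s.seq_up _ _ (by omega) (by omega))
      (n := fun k => s.wt (s.depth - 1 - k)) (fun _ => s.wt_pos _)
  rw [downSymbol_eq] at h
  exact h.symm

theorem X_reg_eqH (s : PolySymbol) : (MvPolynomial.X (.reg s) : H) =
    bracketH s.depth (fun a => s.seq a) fun k => s.wt k := by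
  rw [bracketH_up s.depth_pos s.seq_up s.wt_pos, s.upSymbol_eq]

/-- Every inverted or regular symbol of `ℍ̄` is given by a monotone sequence of break points. -/
theorem HBar.induction_gen {P : HBar → Prop} (hlog : ∀ r, P (MvPolynomial.X (.log r)))
    (hbr : ∀ (d : ℕ) (e : ℕ → ℕ) (n : ℕ → ℕ), 0 < d → (Up d e ∨ Down d e) → (∀ k, 0 < n k) →
      P (bracketHBar d (fun a => e a) fun k => n k)) (g : GenBar) : P (MvPolynomial.X g) := by
  cases g with
  | log r => exact hlog r
  | reg s =>
    rw [X_reg_eq]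
    exact hbr _ _ _ s.depth_pos (Or.inl s.seq_up) s.wt_pos
  | inv s =>
    rw [X_inv_eq]
    exact hbr _ _ (fun k => s.wt (s.depth - 1 - k)) s.depth_pos
      (Or.inr fun a b hab hb => s.seq_up _ _ (by omega) (by omega)) fun _ => s.wt_pos _

/-- Both composites satisfy the Leibniz rule over the coproduct, so generators suffice. For a
logarithm only the summand `1 ⊗ [x_r]_0` is differentiated, and its derivative is a constant. -/
theorem lTensor_dbar_coprod (o : ℕ → ℕ → ℚ) (l : ℕ → ℚ) :
    (dbar o l : HBar →ₗ[ℚ] HBar).lTensor HBar ∘ₗ coprodHBar.toLinearMap =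
      coprodHBar.toLinearMap ∘ₗ (dbar o l : HBar →ₗ[ℚ] HBar) := by
  refine leibniz_ext coprodHBar (fun a b => ?_) (fun a b => ?_) fun g => ?_
  · simp only [LinearMap.comp_apply, AlgHom.toLinearMap_apply, map_mul]
    exact lTensor_mul _ _ _
  · simp only [LinearMap.comp_apply, AlgHom.toLinearMap_apply, Derivation.coeFn_coe,
      Derivation.leibniz, map_add, smul_eq_mul, map_mul]
  · simp only [LinearMap.comp_apply, AlgHom.toLinearMap_apply, Derivation.coeFn_coe]
    refine HBar.induction_gen (P := fun x => (dbar o l : HBar →ₗ[ℚ] HBar).lTensor HBar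
      (coprodHBar x) = coprodHBar (dbar o l x)) (fun r => ?_) (fun d e n _ he hn => ?_) g
    · rw [coprodHBar_log, dbar_log, map_add, LinearMap.lTensor_tmul, LinearMap.lTensor_tmul,
        Derivation.coeFn_coe, dbar_log, Derivation.map_one_eq_zero, TensorProduct.tmul_zero,
        zero_add, AlgHom.commutes, Algebra.TensorProduct.algebraMap_apply,
        Algebra.algebraMap_eq_smul_one, TensorProduct.tmul_smul, TensorProduct.smul_tmul']
    · exact lTensor_coprod_bracket o l he hn

end SymbPolylog

namespace SymbPolylog

open MvPowerSeries

/-! ### The augmentation of series -/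

/-- The counit of `ℍ̄`, as an endomorphism. -/
def augBar : HBar →ₐ[ℚ] HBar := (Algebra.ofId ℚ HBar).comp counitHBar

theorem counitHBar_X (g : GenBar) : counitHBar (MvPolynomial.X g) = 0 := MvPolynomial.aeval_X _ _

theorem counitHBar_bracket {d : ℕ} (hd : 0 < d) (e : Fin (d + 1) → ℕ) (n : Fin d → ℕ) :
    counitHBar (bracketHBar d e n) = 0 := by
  unfold bracketHBar
  rw [if_neg hd.ne']
  split_ifs
  · exact counitHBar_X _
  · exact counitHBar_X _
  · exact map_zero _

theorem counitHBar_logHBar (a b : ℕ) : counitHBar (logHBar a b) = 0 := by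
  simp [logHBar, counitHBar_X]

section vanishing

variable {A B : Type} [CommRing A] [Algebra ℚ A] [CommRing B] [Algebra ℚ B]

/-- A homomorphism that kills all symbols kills words of positive depth. -/
theorem map_word_eq_ite {br : ∀ d : ℕ, (Fin (d + 1) → ℕ) → (Fin d → ℕ) → A} (φ : A →ₐ[ℚ] B)
    (h0 : ∀ e n, br 0 e n = 1) (h : ∀ d, 0 < d → ∀ e n, φ (br d e n) = 0) (d : ℕ) (e : ℕ → ℕ)
    (s : ℕ → Par) : map φ.toRingHom (word br d e s) = if d = 0 then 1 else 0 := by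
  rcases Nat.eq_zero_or_pos d with rfl | hd
  · rw [word_zero br h0, map_one, if_pos rfl]
  rw [map_word, if_neg hd.ne', word_eq]
  have h1 : wordBase (fun d e n => φ (br d e n)) d e = 0 := by
    ext m
    exact h d hd _ _
  rw [h1, ← coe_substAlgHom ((hasSubst_cast fun a : Fin d => s a).map (algebraMap ℚ B)), map_zero]

end vanishing

theorem map_augBar_word (d : ℕ) (e : ℕ → ℕ) (s : ℕ → Par) :
    map augBar.toRingHom (word bracketHBar d e s) = if d = 0 then 1 else 0 :=
  map_word_eq_ite augBar bracketHBar_zero (fun d hd e n => by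
    rw [augBar, AlgHom.comp_apply, counitHBar_bracket hd, map_zero]) d e s

/-- The counit turns the exponential into `1` and kills words of positive depth, so a block survives
only if its marked letter is its only letter. -/
theorem map_augBar_block (e : ℕ → ℕ) (s : ℕ → Par) {i j i' : ℕ} (hij : i ≤ j) (hj : j < i') :
    map augBar.toRingHom (block e s i j i') = if j = i ∧ i' = j + 1 then 1 else 0 := by
  have h : augBar (logHBar (e (i + 0)) (e (i + (i' - i)))) = 0 := by
    rw [augBar, AlgHom.comp_apply, counitHBar_logHBar, map_zero]
  unfold block blk
  rw [map_rat_smul, map_mul, map_mul, map_ex, h, ex_zero_left, map_augBar_word, map_augBar_word]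
  by_cases h1 : j = i
  · by_cases h2 : i' = j + 1
    · rw [if_pos (by omega), if_pos (by omega), if_pos ⟨h1, h2⟩, show j - i = 0 by omega]
      simp
    · rw [if_neg (show ¬ i' - i - 1 - (j - i) = 0 by omega),
        if_neg (show ¬ (j = i ∧ i' = j + 1) by omega)]
      simp
  · rw [if_neg (show ¬ j - i = 0 by omega), if_neg (show ¬ (j = i ∧ i' = j + 1) by omega)]
    simp

/-- The cut into single letters. -/
def IsDiag (k : ℕ) (I J : ℕ → ℕ) : Prop := I 0 = 0 ∧ ∀ α < k, J α = I α ∧ I (α + 1) = J α + 1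

theorem IsDiag.apply {k : ℕ} {I J : ℕ → ℕ} (h : IsDiag k I J) {α : ℕ} (hα : α ≤ k) : I α = α := by
  induction α with
  | zero => exact h.1
  | succ α ih =>
    have h1 := h.2 α hα
    have h2 := ih (by omega)
    omega

theorem map_augBar_rightFactor (e : ℕ → ℕ) (s : ℕ → Par) {I J : ℕ → ℕ} {k : ℕ}
    (hIJ : Interlaced k I J) [Decidable (IsDiag k I J)] :
    map augBar.toRingHom (rightFactor e s I J k) = if IsDiag k I J then 1 else 0 := by
  classical
  unfold rightFactor
  rw [map_mul, map_prod, map_augBar_word, Finset.prod_congr rfl fun α hα =>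
    map_augBar_block e s (hIJ α (Finset.mem_range.mp hα)).1 (hIJ α (Finset.mem_range.mp hα)).2]
  split_ifs with h0 h1 h1
  · rw [one_mul]
    exact Finset.prod_eq_one fun α hα => if_pos (h1.2 α (Finset.mem_range.mp hα))
  · rw [one_mul]
    have : ¬ ∀ α < k, J α = I α ∧ I (α + 1) = J α + 1 := fun h => h1 ⟨h0, h⟩
    push Not at this
    obtain ⟨α, hα, h2⟩ := this
    refine Finset.prod_eq_zero (Finset.mem_range.mpr hα) (if_neg ?_)
    exact fun h => h2 h.1 h.2
  · exact absurd h1.1 h0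
  · rw [zero_mul]

/-- The starts increase strictly, so `d` steps that end at `d` must all have length one and begin at
`0`. -/
theorem diag_of_mem_cuts {d : ℕ} {I J : ℕ → ℕ} (h : Interlaced d I J) (hd : I d = d) :
    IsDiag d I J := by
  have key : ∀ α ≤ d, I (d - α) ≤ d - α := by
    intro α hα
    induction α with
    | zero => rw [Nat.sub_zero]; omega
    | succ α ih =>
      have h3 := ih (by omega)
      have h4 := h (d - (α + 1)) (by omega)
      rw [show d - (α + 1) + 1 = d - α by omega] at h4
      omega
  have key' : ∀ α ≤ d, I α = α := by
    intro α hα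
    have h1 := key (d - α) (by omega)
    rw [show d - (d - α) = α by omega] at h1
    exact le_antisymm h1 (h.le_apply hα)
  refine ⟨key' 0 (Nat.zero_le _), fun α hα => ?_⟩
  have h1 := h α hα
  have h2 := key' α hα.le
  have h3 := key' (α + 1) hα
  omega

theorem cuts_self (d : ℕ) : cuts d d = {((fun a => a), fun a => a.castSucc)} := by
  ext p
  rw [Finset.mem_singleton, mem_cuts]
  constructor
  · rintro ⟨h1, h2⟩
    have h3 := diag_of_mem_cuts h2 h1
    refine Prod.ext (funext fun a => Fin.ext ?_) (funext fun a => Fin.ext ?_)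
    · rw [← raw_coe p.1 a]
      exact h3.apply (Nat.lt_succ_iff.mp a.2)
    · rw [← raw_coe p.2 a, (h3.2 a a.2).1]
      exact h3.apply a.2.le
  · rintro rfl
    refine ⟨raw_coe _ (Fin.last d), fun α hα => ?_⟩
    have h1 := raw_coe (fun a : Fin (d + 1) => a) ⟨α, by omega⟩
    have h2 := raw_coe (fun a : Fin (d + 1) => a) ⟨α + 1, by omega⟩
    have h3 := raw_coe (fun a : Fin d => a.castSucc) ⟨α, hα⟩
    simp only [Fin.castSucc_mk] at h1 h2 h3
    simp only
    omega

/-! ### The counit laws -/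

/-- `ε ⊗ id` on `ℍ̄`. -/
def counitL : HBar ⊗[ℚ] HBar →ₐ[ℚ] HBar :=
  Algebra.TensorProduct.lift augBar (AlgHom.id ℚ HBar) fun _ _ => Commute.all _ _

/-- `id ⊗ ε` on `ℍ̄`. -/
def counitR : HBar ⊗[ℚ] HBar →ₐ[ℚ] HBar :=
  Algebra.TensorProduct.lift (AlgHom.id ℚ HBar) augBar fun _ _ => Commute.all _ _

theorem map_counitL (f g : PS HBar) :
    map counitL.toRingHom (inL f * inR g) = map augBar.toRingHom f * g := by
  rw [map_mul]
  congr 1 <;> ext m <;> simp [inL, inR, counitL]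

theorem map_counitR (f g : PS HBar) :
    map counitR.toRingHom (inL f * inR g) = f * map augBar.toRingHom g := by
  rw [map_mul]
  congr 1 <;> ext m <;> simp [inL, inR, counitR]

/-- On the left only the empty word has a non-zero counit; this is the cut without blocks, whose
right factor is the full word. -/
theorem map_counitL_coprodWord (d : ℕ) (e : ℕ → ℕ) (s : ℕ → Par) :
    map counitL.toRingHom (coprodWord d e s) = word bracketHBar d e s := by
  unfold coprodWord
  simp only [map_sum, cutTerm, map_counitL, map_augBar_word]
  rw [Finset.sum_eq_single 0]
  · have hc : cuts d 0 = {((fun _ => Fin.last d), fun a => a.elim0)} := by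
      ext p
      rw [Finset.mem_singleton, mem_cuts]
      constructor
      · rintro ⟨h1, -⟩
        refine Prod.ext (funext fun a => ?_) (funext fun a => a.elim0)
        apply Fin.ext
        have h2 := raw_coe p.1 a
        have : (a : ℕ) = 0 := by omega
        rw [this, h1] at h2
        exact h2.symm
      · rintro rfl
        exact ⟨rfl, fun α hα => absurd hα (Nat.not_lt_zero α)⟩
    rw [hc, Finset.sum_singleton, if_pos rfl, one_mul, rightFactor, Finset.prod_range_zero,
      mul_one]
    rfl
  · intro k _ hk
    exact Finset.sum_eq_zero fun p _ => by rw [if_neg hk, zero_mul]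
  · intro h
    exact absurd (Finset.mem_range.mpr (Nat.succ_pos d)) h

/-- On the right only the cut into single letters survives, and its left factor is the full word. -/
theorem map_counitR_coprodWord (d : ℕ) (e : ℕ → ℕ) (s : ℕ → Par) :
    map counitR.toRingHom (coprodWord d e s) = word bracketHBar d e s := by
  classical
  unfold coprodWord
  simp only [map_sum, cutTerm, map_counitR]
  have h : ∀ k, ∀ p ∈ cuts d k, word bracketHBar k (fun a => e (raw p.1 a))
      (fun a => s (raw p.2 a)) * map augBar.toRingHom (rightFactor e s (raw p.1) (raw p.2) k) =
      if k = d then word bracketHBar d e s else 0 := by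
    intro k p hp
    rw [mem_cuts] at hp
    rw [map_augBar_rightFactor e s hp.2]
    by_cases hk : k = d
    · subst hk
      have hdiag := diag_of_mem_cuts hp.2 hp.1
      rw [if_pos hdiag, if_pos rfl, mul_one]
      refine word_congr _ (fun a ha => congrArg e (hdiag.apply ha)) fun a ha => congrArg s ?_
      rw [(hdiag.2 a ha).1, hdiag.apply ha.le]
    · rw [if_neg hk, if_neg, mul_zero]
      intro hdiag
      have h1 := hdiag.apply le_rfl
      omega
  rw [Finset.sum_congr rfl fun k _ => Finset.sum_congr rfl (h k),
    Finset.sum_eq_single d]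
  · simp [cuts_self]
  · intro k _ hk
    simp [hk]
  · intro hd
    exact absurd (Finset.mem_range.mpr (Nat.lt_succ_self d)) hd

theorem counit_comp_coprod {φ : HBar ⊗[ℚ] HBar →ₐ[ℚ] HBar}
    (hlog : ∀ r, φ (coprodHBar (MvPolynomial.X (.log r))) = MvPolynomial.X (.log r))
    (h : ∀ d e s, map φ.toRingHom (coprodWord d e s) = word bracketHBar d e s) (x : HBar) :
    φ (coprodHBar x) = x := by
  have : φ.comp coprodHBar = AlgHom.id ℚ HBar := by
    refine MvPolynomial.algHom_ext fun g => ?_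
    refine HBar.induction_gen (P := fun x => φ.comp coprodHBar x = AlgHom.id ℚ HBar x)
      (fun r => hlog r) (fun d e n hd he hn => ?_) g
    have h1 := congrArg (coeff (ev d n)) (h d e par)
    rw [coeff_word_par bracketHBar d e n hn, coeff_map] at h1
    rw [AlgHom.comp_apply, coprodHBar_bracket hd he hn]
    exact h1
  exact DFunLike.congr_fun this x

theorem counitL_coprod (x : HBar) : counitL (coprodHBar x) = x := by
  refine counit_comp_coprod (fun r => ?_) map_counitL_coprodWord x
  rw [coprodHBar_log]
  simp [counitL, augBar, counitHBar_X]

theorem counitR_coprod (x : HBar) : counitR (coprodHBar x) = x := by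
  refine counit_comp_coprod (fun r => ?_) map_counitR_coprodWord x
  rw [coprodHBar_log]
  simp [counitR, augBar, counitHBar_X]

/-! ### Triangularity of the coproduct -/

/-- The coproduct of a symbol, up to the term `v ⊗ 1`, involves on the left only symbols obtained
by merging letters, with weights bounded by those of the marked letters. -/
theorem coprod_bracket_mem {d : ℕ} (hd : 0 < d) {e : ℕ → ℕ} (he : Up d e ∨ Down d e) {n : ℕ → ℕ}
    (hn : ∀ k, 0 < n k) (S : Submodule ℚ (HBar ⊗[ℚ] HBar))
    (hS : ∀ (k : ℕ) (I J n' : ℕ → ℕ), Interlaced k I J → I k = d → (∀ α, 0 < n' α) →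
      (∀ α < k, n' α ≤ n (J α)) → (k = d → ∃ α < d, n' α < n (J α)) →
      ∀ a, bracketHBar k (fun x => e (I x)) (fun x => n' x) ⊗ₜ a ∈ S) :
    coprodHBar (bracketHBar d (fun a => e a) fun k => n k)
      - bracketHBar d (fun a => e a) (fun k => n k) ⊗ₜ 1 ∈ S := by
  classical
  have hterm : ∀ k, ∀ p ∈ cuts d k, ∀ x ∈ Finset.HasAntidiagonal.antidiagonal (ev d n),
      (k = d → x.1 ≠ ev d n) →
      coeff x.1 (inL (word bracketHBar k (fun a => e (raw p.1 a)) fun a => par (raw p.2 a))) *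
        coeff x.2 (inR (rightFactor e par (raw p.1) (raw p.2) k)) ∈ S := by
    intro k p hp x hx hne
    rw [mem_cuts] at hp
    rw [Finset.HasAntidiagonal.mem_antidiagonal] at hx
    have hJ : ∀ a < k, ∀ b < k, raw p.2 a < raw p.2 b ∨ b ≤ a := by
      intro a ha b hb
      by_cases hab : a < b
      · left
        have h1 := (hp.2 a ha).2
        have h2 := (hp.2 b hb).1
        have h3 : raw p.1 (a + 1) ≤ raw p.1 b :=
          Interlaced.mono (n := b) (fun α hα => hp.2 α (by omega)) (by omega)
        omega
      · exact Or.inr (by omega)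
    have hinj : ∀ a < k, ∀ b < k, raw p.2 a = raw p.2 b → a = b := by
      intro a ha b hb hab
      have h1 := hJ a ha b hb
      have h2 := hJ b hb a ha
      omega
    unfold inL inR
    rw [coeff_map, coeff_map, coeff_word_of_injOn bracketHBar (fun a => e (raw p.1 a)) hinj
      fun _ _ => rfl]
    -- The exponents are distributed between the two tensor factors, so the left weight at a mark
    -- cannot exceed the original weight.
    have hle : ∀ r, x.1 r ≤ ev d n r := by
      intro r
      rw [← hx]
      simp
    split_ifs with hsupp
    · have := hS k (raw p.1) (raw p.2) (fun a => x.1 (raw p.2 a) + 1) hp.2 hp.1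
        (fun _ => Nat.succ_pos _) (fun α hα => ?_) (fun hk => ?_)
        (coeff x.2 (rightFactor e par (raw p.1) (raw p.2) k))
      · simpa using this
      · have h1 := hle (raw p.2 α)
        have h2 := hp.2.lt hα
        rw [ev_apply, if_pos (by omega)] at h1
        have := hn (raw p.2 α)
        omega
      · subst hk
        by_contra hcon
        push Not at hcon
        apply hne rfl
        have hdiag := diag_of_mem_cuts hp.2 hp.1
        ext r
        refine le_antisymm (hle r) ?_
        rw [ev_apply]
        split_ifs with hr
        · have h1 := hcon r hr
          rw [(hdiag.2 r hr).1, hdiag.apply hr.le] at h1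
          omega
        · exact Nat.zero_le _
    · simp
  have hcoeff : coprodHBar (bracketHBar d (fun a => e a) fun k => n k) =
      ∑ k ∈ Finset.range (d + 1), ∑ p ∈ cuts d k, ∑ x ∈ Finset.HasAntidiagonal.antidiagonal (ev d n),
      coeff x.1 (inL (word bracketHBar k (fun a => e (raw p.1 a)) fun a => par (raw p.2 a))) *
        coeff x.2 (inR (rightFactor e par (raw p.1) (raw p.2) k)) := by
    rw [coprodHBar_bracket hd he hn, coprodWord]
    simp only [map_sum, cutTerm, coeff_mul]
  rw [hcoeff, Finset.sum_range_succ, add_sub_assoc]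
  refine S.add_mem (S.sum_mem fun k hk => S.sum_mem fun p hp => S.sum_mem fun x hx =>
    hterm k p hp x hx fun h => ?_) ?_
  · have := Finset.mem_range.mp hk
    omega
  -- For `k = d` there is one cut, the diagonal one. Giving the whole exponent to the left factor
  -- produces the subtracted term; every other distribution lowers a weight strictly.
  · have hmem : ((fun a => a), fun a => a.castSucc) ∈ cuts d d := by
      rw [cuts_self]; exact Finset.mem_singleton_self _
    have hterm' := hterm d _ hmem
    have hdiag := diag_of_mem_cuts (mem_cuts.mp hmem).2 (mem_cuts.mp hmem).1
    rw [cuts_self, Finset.sum_singleton]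
    set I := raw (fun a : Fin (d + 1) => a) with hI
    set J := raw (fun a : Fin d => a.castSucc) with hJ
    have hx0 : (ev d n, 0) ∈ Finset.HasAntidiagonal.antidiagonal (ev d n) := by simp
    rw [← Finset.add_sum_erase _ _ hx0, add_comm, add_sub_assoc]
    refine S.add_mem (S.sum_mem fun x hx => ?_) ?_
    · rw [Finset.mem_erase] at hx
      refine hterm' x hx.2 fun _ h => hx.1 ?_
      refine Prod.ext h ?_
      have := Finset.HasAntidiagonal.mem_antidiagonal.mp hx.2
      rw [h] at this
      exact (add_eq_left.mp this)
    · have hw : word bracketHBar d (fun a => e (I a)) (fun a => par (J a)) =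
          word bracketHBar d e par := by
        refine word_congr _ (fun a ha => congrArg e (hdiag.apply ha)) fun a ha => congrArg par ?_
        rw [(hdiag.2 a ha).1, hdiag.apply ha.le]
      -- For the diagonal cut the right factor is a product of exponentials, each with constant term
      -- `1`.
      have hone : coeff 0 (rightFactor e par I J d) = 1 := by
        unfold rightFactor
        rw [coeff_zero_eq_constantCoeff_apply, map_mul, map_prod, hdiag.1,
          word_zero _ bracketHBar_zero, map_one, one_mul]
        refine Finset.prod_eq_one fun α hα => ?_
        have hα := hdiag.2 α (Finset.mem_range.mp hα)
        rw [hα.2, hα.1]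
        unfold block blk
        rw [Nat.sub_self, show I α + 1 - I α - 1 - 0 = 0 by omega, pow_zero, one_smul,
          word_zero _ bracketHBar_zero, word_zero _ bracketHBar_zero, mul_one, mul_one]
        exact constantCoeff_ex _ _
      simp only [inL, inR, coeff_map, hw, coeff_word_par bracketHBar d e n hn, hone]
      simp

end SymbPolylog

namespace SymbPolylog

open MvPowerSeries

/-! ### Derivatives of single symbols -/

section explicit

variable {A : Type} [CommRing A] [Algebra ℚ A]

/-- The sequence `n` with the term `n k` lowered by one. -/
def lower (k : ℕ) (n : ℕ → ℕ) : ℕ → ℕ := fun a => if a = k then n a - 1 else n a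

/-- Multiplication by `t_k` shifts one exponent, which lowers the weight `n k`; if this weight is
`1`, no monomial is left. -/
theorem coeff_word_mul_cast (br : ∀ d : ℕ, (Fin (d + 1) → ℕ) → (Fin d → ℕ) → A) (d : ℕ)
    (e : ℕ → ℕ) {n : ℕ → ℕ} (hn : ∀ k, 0 < n k) {k : ℕ} (hk : k < d) :
    coeff (ev d n) (word br d e par * (par k).cast A) = if n k = 1 then 0 else
      br d (fun a => e a) fun a => lower k n a := by
  have hnk := hn k
  have h1 : ev d n k = n k - 1 := by rw [ev_apply, if_pos hk]
  rw [cast_par, t]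
  have hX : (X k : PS A) = monomial (Finsupp.single k 1) 1 := rfl
  rw [hX, coeff_mul_monomial]
  split_ifs with h2 h3 h3
  · have := h2 k
    rw [h1, Finsupp.single_eq_same] at this
    omega
  · have h4 : ev d n - Finsupp.single k 1 = ev d (lower k n) := by
      ext r
      rw [Finsupp.tsub_apply, ev_apply, ev_apply, Finsupp.single_apply, lower]
      split_ifs <;> omega
    rw [h4, coeff_word_par, mul_one]
    intro a
    unfold lower
    have := hn a
    split_ifs with h5
    · subst h5; omega
    · omega
  · rfl
  · exfalso
    apply h2
    intro r
    rw [Finsupp.single_apply]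
    split_ifs with h5
    · subst h5; omega
    · exact Nat.zero_le _

theorem push_injective (k : ℕ) {a b : ℕ} (h : push k a = push k b) : a = b := by
  have := congrArg (pull k) h
  rwa [pull_push, pull_push] at this

/-- The variable `t_k` is absent from this word, so a monomial can occur only if its exponent at `k`
is zero, that is, if `n k = 1`. -/
theorem coeff_word_skip (br : ∀ d : ℕ, (Fin (d + 1) → ℕ) → (Fin d → ℕ) → A) (d : ℕ)
    (e : ℕ → ℕ) {n : ℕ → ℕ} (hn : ∀ k, 0 < n k) {k : ℕ} (hk : k < d) :
    coeff (ev d n) (word br (d - 1) e (skip k par)) = if n k = 1 then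
      br (d - 1) (fun a => e a) (fun a => skip k n a) else 0 := by
  classical
  rw [coeff_word_of_injOn br e (J := push k) (fun a _ b _ h => push_injective k h)
    fun a _ => skip_eq_push k par a]
  have hnk := hn k
  have h : (∀ r ∈ (ev d n).support, ∃ a < d - 1, push k a = r) ↔ n k = 1 := by
    constructor
    · intro h
      by_contra h1
      obtain ⟨a, -, ha⟩ := h k (by
        rw [Finsupp.mem_support_iff, ev_apply, if_pos hk]; omega)
      exact push_ne k a ha
    · intro h1 r hr
      rw [Finsupp.mem_support_iff, ev_apply] at hr
      have hrd : r < d := by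
        by_contra h2
        rw [if_neg h2] at hr
        exact hr rfl
      have hrk : r ≠ k := by
        rintro rfl
        rw [if_pos hrd] at hr
        omega
      refine ⟨pull k r, ?_, push_pull hrk⟩
      unfold pull
      split_ifs <;> omega
  simp only [h]
  refine if_congr Iff.rfl ?_ rfl
  congr 1
  funext a
  rw [ev_apply, skip_eq_push, if_pos]
  · have := hn (push k a)
    omega
  · unfold push
    have := a.2
    split_ifs <;> omega

theorem scalarCoeff_ev (br : ∀ d : ℕ, (Fin (d + 1) → ℕ) → (Fin d → ℕ) → A) (o : ℕ → ℕ → ℚ)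
    (l : ℕ → ℚ) (d : ℕ) (e : ℕ → ℕ) {n : ℕ → ℕ} (hn : ∀ k, 0 < n k) :
    scalarCoeff br o l d e (ev d n) =
      ∑ k ∈ Finset.range d, (l (e (k + 1)) - l (e k)) • (if n k = 1 then 0 else
        br d (fun a => e a) fun a => lower k n a)
      + ∑ k ∈ Finset.range d, o (e k) (e (k + 1)) • (if n k = 1 then
        br (d - 1) (fun a => skip k e a) (fun a => skip k n a) else 0)
      - ∑ k ∈ Finset.range (d - 1), o (e (k + 1)) (e k) • (if n k = 1 then
        br (d - 1) (fun a => skip (k + 1) e a) (fun a => skip k n a) else 0) := by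
  have hsub : ∀ (m : ℕ →₀ ℕ) (f g : PS A), coeff m (f - g) = coeff m f - coeff m g :=
    fun m => map_sub _
  have hsmul : ∀ (m : ℕ →₀ ℕ) (c : ℚ) (f : PS A), coeff m (c • f) = c • coeff m f :=
    fun m c f => map_rat_smul _ c f
  rw [scalarCoeff_eq, dRHS, hsub, map_add, Finset.mul_sum]
  simp only [map_sum, mul_smul_comm, hsmul]
  congr 1
  · congr 1
    · refine Finset.sum_congr rfl fun k hk => ?_
      rw [coeff_word_mul_cast br d e hn (Finset.mem_range.mp hk)]
    · refine Finset.sum_congr rfl fun k hk => ?_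
      rw [coeff_word_skip br d _ hn (Finset.mem_range.mp hk)]
  · refine Finset.sum_congr rfl fun k hk => ?_
    rw [coeff_word_skip br d _ hn (by have := Finset.mem_range.mp hk; omega)]

end explicit

theorem lower_pos {n : ℕ → ℕ} (hn : ∀ k, 0 < n k) {k : ℕ} (hk : n k ≠ 1) (a : ℕ) :
    0 < lower k n a := by
  unfold lower
  have := hn a
  split_ifs with h
  · subst h; omega
  · omega

theorem skip_pos {n : ℕ → ℕ} (hn : ∀ k, 0 < n k) (k a : ℕ) : 0 < skip k n a := by
  rw [skip_eq_push]; exact hn _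

theorem sum_lower {d : ℕ} {n : ℕ → ℕ} (hn : ∀ k, 0 < n k) {k : ℕ} (hk : k < d) :
    ∑ a ∈ Finset.range d, lower k n a + 1 = ∑ a ∈ Finset.range d, n a := by
  have hk' := Finset.mem_range.mpr hk
  rw [← Finset.add_sum_erase _ _ hk', ← Finset.add_sum_erase _ n hk']
  have h : ∑ a ∈ (Finset.range d).erase k, lower k n a = ∑ a ∈ (Finset.range d).erase k, n a :=
    Finset.sum_congr rfl fun a ha => if_neg (Finset.ne_of_mem_erase ha)
  have h1 : lower k n k = n k - 1 := if_pos rfl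
  have := hn k
  omega

theorem sum_skip {d : ℕ} (n : ℕ → ℕ) {k : ℕ} (hk : k < d) :
    ∑ a ∈ Finset.range (d - 1), skip k n a + n k = ∑ a ∈ Finset.range d, n a := by
  obtain ⟨c, rfl⟩ : ∃ c, d = k + 1 + c := ⟨d - (k + 1), by omega⟩
  rw [show k + 1 + c - 1 = k + c by omega, Finset.sum_range_add, Finset.sum_range_add,
    Finset.sum_range_succ]
  have h1 : ∑ a ∈ Finset.range k, skip k n a = ∑ a ∈ Finset.range k, n a :=
    Finset.sum_congr rfl fun a ha => skip_of_lt n (Finset.mem_range.mp ha)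
  have h2 : ∑ a ∈ Finset.range c, skip k n (k + a) = ∑ a ∈ Finset.range c, n (k + 1 + a) :=
    Finset.sum_congr rfl fun a _ => by rw [skip_of_le n (by omega)]; congr 1; omega
  omega

/-- The derivative of a symbol is a linear combination of symbols of weight one less. -/
theorem dbar_bracket_mem (o : ℕ → ℕ → ℚ) (l : ℕ → ℚ) {d : ℕ} (hd : 0 < d) {e : ℕ → ℕ}
    (he : Up d e ∨ Down d e) {n : ℕ → ℕ} (hn : ∀ k, 0 < n k) (S : Submodule ℚ HBar)
    (hS : ∀ (d' : ℕ) (e' n' : ℕ → ℕ), (Up d' e' ∨ Down d' e') → (Up d e → Up d' e') →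
      (∀ k, 0 < n' k) →
      ∑ k ∈ Finset.range d', n' k + 1 = ∑ k ∈ Finset.range d, n k →
      bracketHBar d' (fun a => e' a) (fun k => n' k) ∈ S) :
    dbar o l (bracketHBar d (fun a => e a) fun k => n k) ∈ S := by
  rw [dbar_bracket o l hd he hn, scalarCoeff_ev _ o l d e hn]
  refine S.sub_mem (S.add_mem ?_ ?_) ?_
  · refine S.sum_mem fun k hk => S.smul_mem _ ?_
    split_ifs with h
    · exact S.zero_mem
    · exact hS d e _ he id (lower_pos hn h) (sum_lower hn (Finset.mem_range.mp hk))
  · refine S.sum_mem fun k hk => S.smul_mem _ ?_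
    split_ifs with h
    · refine hS (d - 1) _ _ (upDown_skip he k) (fun h => h.skip k) (skip_pos hn k) ?_
      rw [← sum_skip n (Finset.mem_range.mp hk), h]
    · exact S.zero_mem
  · refine S.sum_mem fun k hk => S.smul_mem _ ?_
    have hk := Finset.mem_range.mp hk
    split_ifs with h
    · refine hS (d - 1) _ _ (upDown_skip he (k + 1)) (fun h => h.skip _) (skip_pos hn k) ?_
      rw [← sum_skip n (show k < d by omega), h]
    · exact S.zero_mem

end SymbPolylog

namespace SymbPolylog

open MvPowerSeries

/-! ### Elements killed by all derivations are constant -/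

section kernel

variable {σ : Type}

/-- On the variables of `P` the derivation agrees with the partial derivative by `h`, and a
derivation is determined on `P` by these values. -/
theorem pderiv_eq_zero_of_derivation {D : Derivation ℚ (MvPolynomial σ ℚ) (MvPolynomial σ ℚ)}
    {P : MvPolynomial σ ℚ} {h : σ} (hP : D P = 0) (h1 : D (MvPolynomial.X h) = 1)
    (h0 : ∀ s ∈ P.vars, s ≠ h → D (MvPolynomial.X s) = 0) : MvPolynomial.pderiv h P = 0 := by
  classical
  rw [← hP]
  refine MvPolynomial.derivation_eq_of_forall_mem_vars fun s hs => ?_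
  rw [MvPolynomial.pderiv_X]
  by_cases hsh : s = h
  · subst hsh
    rw [h1, Pi.single_eq_same]
  · rw [h0 s hs hsh, Pi.single_eq_of_ne hsh]

/-- The commutator of the partial derivative by `g` with `D` kills `P`, and under these assumptions
it acts on `P` as the partial derivative by `h`. Thus the vanishing of one partial derivative is
passed on to the next. -/
theorem pderiv_eq_zero_of_commutator {D : Derivation ℚ (MvPolynomial σ ℚ) (MvPolynomial σ ℚ)}
    {P : MvPolynomial σ ℚ} {g h : σ} (hP : D P = 0) (hg : MvPolynomial.pderiv g P = 0)
    (h1 : MvPolynomial.pderiv g (D (MvPolynomial.X h)) = 1)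
    (h0 : ∀ s ∈ P.vars, s ≠ h → MvPolynomial.pderiv g (D (MvPolynomial.X s)) = 0) :
    MvPolynomial.pderiv h P = 0 := by
  classical
  have hX : ∀ s, ⁅MvPolynomial.pderiv (R := ℚ) g, D⁆ (MvPolynomial.X s) =
      MvPolynomial.pderiv g (D (MvPolynomial.X s)) := by
    intro s
    rw [Derivation.commutator_apply, MvPolynomial.pderiv_X]
    by_cases hsg : s = g
    · subst hsg
      rw [Pi.single_eq_same, Derivation.map_one_eq_zero, sub_zero]
    · rw [Pi.single_eq_of_ne hsg, map_zero, sub_zero]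
  refine pderiv_eq_zero_of_derivation (D := ⁅MvPolynomial.pderiv (R := ℚ) g, D⁆) ?_ ?_ ?_
  · rw [Derivation.commutator_apply, hP, hg, map_zero, map_zero, sub_zero]
  · rw [hX, h1]
  · intro s hs hsh
    rw [hX, h0 s hs hsh]

/-- In characteristic zero, lowering a positive exponent multiplies the coefficient by a non-zero
number, so no monomial of `P` can contain `g`. -/
theorem notMem_vars_of_pderiv {P : MvPolynomial σ ℚ} {g : σ} (h : MvPolynomial.pderiv g P = 0) :
    g ∉ P.vars := by
  classical
  intro hg
  obtain ⟨m, hm, hgm⟩ := (MvPolynomial.mem_vars_iff_mem_support g).mp hg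
  have h1 := MvPolynomial.coeff_pderiv (i := g) (p := P) (m := m - Finsupp.single g 1)
  rw [h, MvPolynomial.coeff_zero] at h1
  have hmg : m g ≠ 0 := Finsupp.mem_support_iff.mp hgm
  have h2 : m - Finsupp.single g 1 + Finsupp.single g 1 = m := by
    refine tsub_add_cancel_of_le fun r => ?_
    rw [Finsupp.single_apply]
    split_ifs with hr
    · subst hr; omega
    · exact Nat.zero_le _
  rw [h2] at h1
  have h3 : (MvPolynomial.coeff m P) ≠ 0 := MvPolynomial.mem_support_iff.mp hm
  have h4 : (((m - Finsupp.single g 1 : σ →₀ ℕ) g : ℕ) : ℚ) + 1 ≠ 0 := by positivity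
  exact mul_ne_zero h3 h4 h1.symm

end kernel

theorem upDown_inj {d : ℕ} {e : ℕ → ℕ} (he : Up d e ∨ Down d e) {a b : ℕ} (ha : a ≤ d) (hb : b ≤ d)
    (h : e a = e b) : a = b := by
  by_contra hab
  rcases he with he | he <;> rcases Nat.lt_or_gt_of_ne hab with h1 | h1
  · exact absurd (he a b h1 hb) (by omega)
  · exact absurd (he b a h1 ha) (by omega)
  · exact absurd (he a b h1 hb) (by omega)
  · exact absurd (he b a h1 ha) (by omega)

/-- The two data give the same symbol. -/
def SameSymbol (d : ℕ) (e n : ℕ → ℕ) (d' : ℕ) (e' n' : ℕ → ℕ) : Prop :=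
  d = d' ∧ (∀ a ≤ d, e a = e' a) ∧ ∀ k < d, n k = n' k

theorem bracketHBar_congr {d d' : ℕ} {e n e' n' : ℕ → ℕ} (h : SameSymbol d e n d' e' n') :
    bracketHBar d (fun a => e a) (fun k => n k) = bracketHBar d' (fun a => e' a) fun k => n' k := by
  obtain ⟨rfl, he, hn⟩ := h
  congr 1
  · funext a; exact he a (Nat.lt_succ_iff.mp a.2)
  · funext a; exact hn a a.2

theorem upSymbol_wt {d : ℕ} (hd : 0 < d) {e : ℕ → ℕ} (he : Up d e) {n : ℕ → ℕ}
    (hn : ∀ k, 0 < n k) {a : ℕ} (ha : a < d) : (upSymbol hd he hn).wt a = n a := dif_pos ha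

theorem downSymbol_wt {d : ℕ} (hd : 0 < d) {e : ℕ → ℕ} (he : Down d e) {n : ℕ → ℕ}
    (hn : ∀ k, 0 < n k) {a : ℕ} (ha : a < d) : (downSymbol hd he hn).wt a = n (d - 1 - a) := by
  refine (dif_pos ha).trans ?_
  simp only [downSymbol, Fin.val_rev]
  congr 1
  omega

theorem sameSymbol_of_bracket {d d' : ℕ} {e n e' n' : ℕ → ℕ} (hd : 0 < d)
    (he : Up d e ∨ Down d e) (hn : ∀ k, 0 < n k) (he' : Up d' e' ∨ Down d' e')
    (hn' : ∀ k, 0 < n' k)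
    (h : bracketHBar d (fun a => e a) (fun k => n k) =
      bracketHBar d' (fun a => e' a) fun k => n' k) : SameSymbol d e n d' e' n' := by
  have hd' : 0 < d' := by
    rcases Nat.eq_zero_or_pos d' with rfl | h0
    · have h1 := congrArg counitHBar h
      rw [counitHBar_bracket hd, bracketHBar_zero, map_one] at h1
      exact absurd h1 zero_ne_one
    · exact h0
  have key : ∀ s s' : PolySymbol, s = s' → s.depth = s'.depth ∧ (∀ a, s.seq a = s'.seq a) ∧
      ∀ k, s.wt k = s'.wt k := by
    rintro s _ rfl
    exact ⟨rfl, fun _ => rfl, fun _ => rfl⟩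
  rcases he with he | he <;> rcases he' with he' | he'
  · rw [bracketHBar_up hd he hn, bracketHBar_up hd' he' hn'] at h
    obtain ⟨h1, h2, h3⟩ := key _ _ (GenBar.reg.inj (MvPolynomial.X_injective h))
    change d = d' at h1
    subst h1
    refine ⟨rfl, fun a ha => ?_, fun a ha => ?_⟩
    · rw [← upSymbol_seq hd he hn ha, h2, upSymbol_seq hd he' hn' ha]
    · rw [← upSymbol_wt hd he hn ha, h3, upSymbol_wt hd he' hn' ha]
  · rw [bracketHBar_up hd he hn, bracketHBar_down hd' he' hn'] at h
    exact absurd (MvPolynomial.X_injective h) (by simp)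
  · rw [bracketHBar_down hd he hn, bracketHBar_up hd' he' hn'] at h
    exact absurd (MvPolynomial.X_injective h) (by simp)
  · rw [bracketHBar_down hd he hn, bracketHBar_down hd' he' hn'] at h
    obtain ⟨h1, h2, h3⟩ := key _ _ (GenBar.inv.inj (MvPolynomial.X_injective h))
    change d = d' at h1
    subst h1
    refine ⟨rfl, fun a ha => ?_, fun a ha => ?_⟩
    · have := h2 (d - a)
      rw [downSymbol_seq hd he hn (Nat.sub_le _ _), downSymbol_seq hd he' hn' (Nat.sub_le _ _),
        Nat.sub_sub_self ha] at this
      exact this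
    · have := h3 (d - 1 - a)
      rw [downSymbol_wt hd he hn (by omega), downSymbol_wt hd he' hn' (by omega),
        Nat.sub_sub_self (by omega)] at this
      exact this

open Classical in
theorem pderiv_bracket {g : GenBar} {d d' : ℕ} {e n e' n' : ℕ → ℕ} (hd : 0 < d)
    (he : Up d e ∨ Down d e) (hn : ∀ k, 0 < n k)
    (hg : (MvPolynomial.X g : HBar) = bracketHBar d (fun a => e a) fun k => n k)
    (he' : Up d' e' ∨ Down d' e') (hn' : ∀ k, 0 < n' k) :
    MvPolynomial.pderiv g (bracketHBar d' (fun a => e' a) fun k => n' k) =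
      if SameSymbol d e n d' e' n' then 1 else 0 := by
  split_ifs with h
  · rw [← bracketHBar_congr h, ← hg, MvPolynomial.pderiv_X_self]
  · have hne : ∀ g', (MvPolynomial.X g' : HBar) = bracketHBar d' (fun a => e' a) (fun k => n' k) →
        g' ≠ g := by
      rintro g' hg' rfl
      exact h (sameSymbol_of_bracket hd he hn he' hn' (hg.symm.trans hg'))
    rcases Nat.eq_zero_or_pos d' with rfl | hd'
    · rw [bracketHBar_zero, Derivation.map_one_eq_zero]
    · rcases he' with he' | he'
      · have h1 := bracketHBar_up hd' he' hn'
        rw [h1, MvPolynomial.pderiv_X_of_ne (hne _ h1.symm)]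
      · have h1 := bracketHBar_down hd' he' hn'
        rw [h1, MvPolynomial.pderiv_X_of_ne (hne _ h1.symm)]

open Classical in
theorem pderiv_dbar_bracket {g : GenBar} {d d' : ℕ} {e n e' n' : ℕ → ℕ} (hd : 0 < d)
    (he : Up d e ∨ Down d e) (hn : ∀ k, 0 < n k)
    (hg : (MvPolynomial.X g : HBar) = bracketHBar d (fun a => e a) fun k => n k)
    (hd' : 0 < d') (he' : Up d' e' ∨ Down d' e') (hn' : ∀ k, 0 < n' k) (o : ℕ → ℕ → ℚ)
    (l : ℕ → ℚ) :
    MvPolynomial.pderiv g (dbar o l (bracketHBar d' (fun a => e' a) fun k => n' k)) =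
      ∑ k ∈ Finset.range d', (l (e' (k + 1)) - l (e' k)) •
        (if n' k ≠ 1 ∧ SameSymbol d e n d' e' (lower k n') then (1 : HBar) else 0)
      + ∑ k ∈ Finset.range d', o (e' k) (e' (k + 1)) • (if n' k = 1 ∧
        SameSymbol d e n (d' - 1) (skip k e') (skip k n') then (1 : HBar) else 0)
      - ∑ k ∈ Finset.range (d' - 1), o (e' (k + 1)) (e' k) • (if n' k = 1 ∧
        SameSymbol d e n (d' - 1) (skip (k + 1) e') (skip k n') then (1 : HBar) else 0) := by
  rw [dbar_bracket o l hd' he' hn', scalarCoeff_ev _ o l d' e' hn', map_sub, map_add, map_sum,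
    map_sum, map_sum]
  congr 1
  · congr 1
    · refine Finset.sum_congr rfl fun k hk => ?_
      rw [Derivation.map_smul]
      congr 1
      by_cases h : n' k = 1
      · rw [if_pos h, if_neg (fun h1 => h1.1 h), map_zero]
      · rw [if_neg h, pderiv_bracket hd he hn hg he' (lower_pos hn' h)]
        exact if_congr (by simp [h]) rfl rfl
    · refine Finset.sum_congr rfl fun k hk => ?_
      rw [Derivation.map_smul]
      congr 1
      by_cases h : n' k = 1
      · rw [if_pos h, pderiv_bracket hd he hn hg (upDown_skip he' k) (skip_pos hn' k)]
        exact if_congr (by simp [h]) rfl rfl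
      · rw [if_neg h, if_neg (fun h1 => h h1.1), map_zero]
  · refine Finset.sum_congr rfl fun k hk => ?_
    rw [Derivation.map_smul]
    congr 1
    by_cases h : n' k = 1
    · rw [if_pos h, pderiv_bracket hd he hn hg (upDown_skip he' (k + 1)) (skip_pos hn' k)]
      exact if_congr (by simp [h]) rfl rfl
    · rw [if_neg h, if_neg (fun h1 => h h1.1), map_zero]

end SymbPolylog

/-! ### Successive elimination of the symbols in an element killed by the derivations. -/

namespace SymbPolylog

open MvPowerSeries

theorem exists_gen {d : ℕ} (hd : 0 < d) {e n : ℕ → ℕ} (he : Up d e ∨ Down d e)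
    (hn : ∀ k, 0 < n k) :
    ∃ g : GenBar, (MvPolynomial.X g : HBar) = bracketHBar d (fun a => e a) fun k => n k :=
  he.elim (fun he => ⟨_, (bracketHBar_up hd he hn).symm⟩)
    fun he => ⟨_, (bracketHBar_down hd he hn).symm⟩

/-- Distance of natural numbers. -/
def gap (a b : ℕ) : ℕ := (b - a) + (a - b)

/-- Since the breaks are monotone, a letter can be as long as the whole string only if it is the
only letter. -/
theorem eq_one_of_gap {d : ℕ} {e : ℕ → ℕ} (he : Up d e ∨ Down d e) {k : ℕ} (hk : k < d)
    (h : gap (e 0) (e d) ≤ gap (e k) (e (k + 1))) : k = 0 ∧ d = 1 := by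
  unfold gap at h
  rcases he with he | he
  · have h1 := he 0 d (by omega) le_rfl
    have h2 := he k (k + 1) (by omega) hk
    have h3 : e 0 ≤ e k ∧ (e 0 = e k → k = 0) := by
      rcases Nat.eq_zero_or_pos k with rfl | h0
      · simp
      · have := he 0 k h0 hk.le
        omega
    have h4 : e (k + 1) ≤ e d ∧ (e (k + 1) = e d → k + 1 = d) := by
      rcases Nat.lt_or_ge (k + 1) d with h0 | h0
      · have := he (k + 1) d h0 le_rfl
        omega
      · rw [show k + 1 = d by omega]; simp
    omega
  · have h1 := he 0 d (by omega) le_rfl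
    have h2 := he k (k + 1) (by omega) hk
    have h3 : e k ≤ e 0 ∧ (e 0 = e k → k = 0) := by
      rcases Nat.eq_zero_or_pos k with rfl | h0
      · simp
      · have := he 0 k h0 hk.le
        omega
    have h4 : e d ≤ e (k + 1) ∧ (e (k + 1) = e d → k + 1 = d) := by
      rcases Nat.lt_or_ge (k + 1) d with h0 | h0
      · have := he (k + 1) d h0 le_rfl
        omega
      · rw [show k + 1 = d by omega]; simp
    omega

/-- The element `P` is killed by sufficiently many derivations, and the symbols in it satisfy
`Adm`. -/
structure Killed (Adm : ℕ → (ℕ → ℕ) → Prop) (P : HBar) : Prop where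
  adm : ∀ d e, Adm d e → Up d e ∨ Down d e
  adm_skip : ∀ d e k, Adm d e → Adm (d - 1) (skip k e)
  vars : ∀ s ∈ P.vars, (∃ r, s = .log r) ∨ ∃ (d : ℕ) (e n : ℕ → ℕ), 0 < d ∧ Adm d e ∧
    (∀ k, 0 < n k) ∧ (MvPolynomial.X s : HBar) = bracketHBar d (fun a => e a) fun k => n k
  pair : ∀ e, Adm 1 e → ∃ o, dbar o 0 P = 0 ∧ o (e 0) (e 1) = 1 ∧
    (∀ x y, o x y ≠ 0 → (x = e 0 ∧ y = e 1) ∨ (x = e 1 ∧ y = e 0)) ∧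
    ∀ e', Adm 1 e' → e' 0 = e 1 → e' 1 = e 0 → o (e 1) (e 0) = 0
  logs : ∀ l, ∃ o, dbar o l P = 0 ∧ ∀ d e, Adm d e → ∀ k < d, o (e k) (e (k + 1)) = 0 ∧
    (o (e (k + 1)) (e k) ≠ 0 → l (e (k + 1)) ≠ l (e k))
  sym : ∀ p q, p ≠ q → ∃ o, dbar o 0 P = 0 ∧ o p q = 1 ∧
    ∀ x y, o x y ≠ 0 → (x = p ∧ y = q) ∨ (x = q ∧ y = p)

namespace Killed

variable {Adm : ℕ → (ℕ → ℕ) → Prop} {P : HBar} (H : Killed Adm P)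
include H

/-- Let `g` be `h` with its last weight lowered by one. A derivation whose logarithmic part sees the
last break of `h`, and no other break of `h`, lowers only the last weight, so among the variables of
`P` just `h` is sent to an expression containing `g` linearly. -/
theorem raise {d : ℕ} {e n : ℕ → ℕ} (hd : 0 < d) (he : Adm d e) (hn : ∀ k, 0 < n k)
    (hlast : n (d - 1) ≠ 1) {g h : GenBar}
    (hg : (MvPolynomial.X g : HBar) = bracketHBar d (fun a => e a) fun k => lower (d - 1) n k)
    (hh : (MvPolynomial.X h : HBar) = bracketHBar d (fun a => e a) fun k => n k)
    (hgP : MvPolynomial.pderiv g P = 0) : MvPolynomial.pderiv h P = 0 := by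
  classical
  have hud := H.adm d e he
  -- For this choice `l` differs on the two ends of the last letter and is constant on all earlier
  -- breaks of `e`.
  let l : ℕ → ℚ := fun x => if x = e d then 1 else 0
  obtain ⟨o, ho, ho'⟩ := H.logs l
  have hl : ∀ k < d - 1, l (e (k + 1)) = l (e k) := by
    intro k hk
    have h1 : e (k + 1) ≠ e d := fun h => by
      have := upDown_inj hud (by omega) le_rfl h; omega
    have h2 : e k ≠ e d := fun h => by
      have := upDown_inj hud (by omega) le_rfl h; omega
    simp only [l, if_neg h1, if_neg h2]
  have key : ∀ (d' : ℕ) (e' n' : ℕ → ℕ), 0 < d' → Adm d' e' → (∀ k, 0 < n' k) →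
      MvPolynomial.pderiv g (dbar o l (bracketHBar d' (fun a => e' a) fun k => n' k)) =
      if SameSymbol d e n d' e' n' then 1 else 0 := by
    intro d' e' n' hd' he' hn'
    have hud' := H.adm d' e' he'
    rw [pderiv_dbar_bracket hd hud (lower_pos hn hlast) hg hd' hud' hn']
    have h2 : ∑ k ∈ Finset.range d', o (e' k) (e' (k + 1)) • (if n' k = 1 ∧
        SameSymbol d e (lower (d - 1) n) (d' - 1) (skip k e') (skip k n') then (1 : HBar) else 0)
        = 0 := Finset.sum_eq_zero fun k hk => by
      rw [(ho' d' e' he' k (Finset.mem_range.mp hk)).1, zero_smul]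
    have h3 : ∑ k ∈ Finset.range (d' - 1), o (e' (k + 1)) (e' k) • (if n' k = 1 ∧
        SameSymbol d e (lower (d - 1) n) (d' - 1) (skip (k + 1) e') (skip k n')
        then (1 : HBar) else 0) = 0 := Finset.sum_eq_zero fun k hk => by
      have hk := Finset.mem_range.mp hk
      by_cases hc : n' k = 1 ∧
        SameSymbol d e (lower (d - 1) n) (d' - 1) (skip (k + 1) e') (skip k n')
      · have h4 : o (e' (k + 1)) (e' k) = 0 := by
          by_contra hne
          apply (ho' d' e' he' k (by omega)).2 hne
          have h5 := hc.2.2.1 d le_rfl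
          have h6 := hc.2.1
          rw [skip_of_le _ (by omega), h6, show d' - 1 + 1 = d' by omega] at h5
          have h7 : e' (k + 1) ≠ e d := fun h => by
            have := upDown_inj hud' (by omega) le_rfl (h.trans (by rw [h6, h5])); omega
          have h8 : e' k ≠ e d := fun h => by
            have := upDown_inj hud' (by omega) le_rfl (h.trans (by rw [h6, h5])); omega
          simp only [l, if_neg h7, if_neg h8]
        rw [h4, zero_smul]
      · rw [if_neg hc, smul_zero]
    rw [h2, h3, add_zero, sub_zero]
    have h1 : ∀ k ∈ Finset.range d', k ≠ d - 1 → (l (e' (k + 1)) - l (e' k)) •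
        (if n' k ≠ 1 ∧ SameSymbol d e (lower (d - 1) n) d' e' (lower k n')
          then (1 : HBar) else 0) = 0 := by
      intro k hk hkd
      have hk := Finset.mem_range.mp hk
      by_cases hc : n' k ≠ 1 ∧ SameSymbol d e (lower (d - 1) n) d' e' (lower k n')
      · obtain ⟨-, rfl, h5, -⟩ := hc
        rw [← h5 k hk.le, ← h5 (k + 1) hk, hl k (by omega), sub_self, zero_smul]
      · rw [if_neg hc, smul_zero]
    by_cases hs : SameSymbol d e n d' e' n'
    · obtain ⟨rfl, h5, h6⟩ := id hs
      rw [Finset.sum_eq_single (d - 1) h1 fun h => absurd (Finset.mem_range.mpr (by omega)) h,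
        if_pos hs, if_pos, show d - 1 + 1 = d by omega, ← h5 d le_rfl, ← h5 (d - 1) (by omega)]
      · have : e (d - 1) ≠ e d := fun h => by
          have := upDown_inj hud (by omega) le_rfl h; omega
        simp [l, this]
      · refine ⟨by rw [← h6 _ (by omega)]; exact hlast, rfl, h5, fun k hk => ?_⟩
        unfold lower
        rw [h6 k hk]
    · rw [if_neg hs]
      refine Finset.sum_eq_zero fun k hk => ?_
      by_cases hkd : k = d - 1
      · subst hkd
        rw [if_neg, smul_zero]
        rintro ⟨h4, rfl, h5, h6⟩
        refine hs ⟨rfl, h5, fun k hk => ?_⟩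
        have h7 := h6 k hk
        unfold lower at h7
        split_ifs at h7 with h8
        · subst h8
          have := hn (d - 1)
          have := hn' (d - 1)
          omega
        · exact h7
      · exact h1 k hk hkd
  refine pderiv_eq_zero_of_commutator ho hgP ?_ fun s hs hsh => ?_
  · rw [hh, key d e n hd he hn, if_pos ⟨rfl, fun _ _ => rfl, fun _ _ => rfl⟩]
  · rcases H.vars s hs with ⟨r, rfl⟩ | ⟨d', e', n', hd', he', hn', hX⟩
    · rw [dbar_log, Derivation.map_algebraMap]
    · rw [hX, key d' e' n' hd' he' hn', if_neg]
      intro hsame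
      exact hsh (MvPolynomial.X_injective (hX.trans ((bracketHBar_congr hsame).symm.trans hh.symm)))

/-- Here `g` arises from `h` by deleting the last letter, of weight one, together with the break
before it. The scalars `o` are supported on the two ends of this letter, so only its reinsertion
into `g` is detected. -/
theorem insert_break {d : ℕ} {e n : ℕ → ℕ} (hd : 0 < d) (he : Adm (d + 1) e) (hn : ∀ k, 0 < n k)
    (hlast : n d = 1) {g h : GenBar}
    (hg : (MvPolynomial.X g : HBar) = bracketHBar d (fun a => skip d e a) fun k => n k)
    (hh : (MvPolynomial.X h : HBar) = bracketHBar (d + 1) (fun a => e a) fun k => n k)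
    (hgP : MvPolynomial.pderiv g P = 0) : MvPolynomial.pderiv h P = 0 := by
  classical
  have hud := H.adm _ e he
  have hud0 := upDown_skip hud d
  rw [Nat.add_sub_cancel] at hud0
  have hne : e d ≠ e (d + 1) := fun h => by
    have := upDown_inj hud (by omega) le_rfl h; omega
  obtain ⟨o, ho, ho1, ho'⟩ := H.sym (e d) (e (d + 1)) hne
  -- All deletions in question keep the last break and remove a different one. This fixes the
  -- position of the deleted letter and excludes the opposite orientation.
  have hq : ∀ (d' : ℕ) (e' : ℕ → ℕ), (Up d' e' ∨ Down d' e') → ∀ i ≤ d', d = d' - 1 → 0 < d' →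
      (∀ a ≤ d, skip d e a = skip i e' a) → i < d' → e' d' = e (d + 1) ∧ e' i ≠ e (d + 1) := by
    intro d' e' hud' i hi hdd hd' hskip hid
    obtain rfl : d' = d + 1 := by omega
    have h1 := hskip d le_rfl
    rw [skip_of_le _ le_rfl, skip_of_le _ (by omega)] at h1
    refine ⟨h1.symm, fun h => ?_⟩
    have := upDown_inj hud' hi le_rfl (h.trans h1)
    omega
  have key : ∀ (d' : ℕ) (e' n' : ℕ → ℕ), 0 < d' → Adm d' e' → (∀ k, 0 < n' k) →
      MvPolynomial.pderiv g (dbar o 0 (bracketHBar d' (fun a => e' a) fun k => n' k)) =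
      if SameSymbol (d + 1) e n d' e' n' then 1 else 0 := by
    intro d' e' n' hd' he' hn'
    have hud' := H.adm d' e' he'
    rw [pderiv_dbar_bracket hd hud0 hn hg hd' hud' hn']
    have h1 : ∑ k ∈ Finset.range d', ((0 : ℕ → ℚ) (e' (k + 1)) - (0 : ℕ → ℚ) (e' k)) •
        (if n' k ≠ 1 ∧ SameSymbol d (skip d e) n d' e' (lower k n')
          then (1 : HBar) else 0) = 0 := Finset.sum_eq_zero fun k _ => by simp
    have h3 : ∑ k ∈ Finset.range (d' - 1), o (e' (k + 1)) (e' k) • (if n' k = 1 ∧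
        SameSymbol d (skip d e) n (d' - 1) (skip (k + 1) e') (skip k n')
        then (1 : HBar) else 0) = 0 := Finset.sum_eq_zero fun k hk => by
      have hk := Finset.mem_range.mp hk
      by_cases hc : n' k = 1 ∧ SameSymbol d (skip d e) n (d' - 1) (skip (k + 1) e') (skip k n')
      · have h4 : o (e' (k + 1)) (e' k) = 0 := by
          by_contra hne
          obtain ⟨h5, h6⟩ := hq d' e' hud' (k + 1) (by omega) hc.2.1 hd' hc.2.2.1 (by omega)
          rcases ho' _ _ hne with ⟨h7, h8⟩ | ⟨h7, h8⟩
          · have := upDown_inj hud' (by omega) le_rfl (h8.trans h5.symm)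
            omega
          · exact h6 h7
        rw [h4, zero_smul]
      · rw [if_neg hc, smul_zero]
    rw [h1, h3, zero_add, sub_zero]
    have h2 : ∀ k ∈ Finset.range d', ¬ (SameSymbol (d + 1) e n d' e' n' ∧ k = d) →
        o (e' k) (e' (k + 1)) • (if n' k = 1 ∧
        SameSymbol d (skip d e) n (d' - 1) (skip k e') (skip k n') then (1 : HBar) else 0) = 0 := by
      intro k hk hkd
      have hk := Finset.mem_range.mp hk
      by_cases hc : n' k = 1 ∧ SameSymbol d (skip d e) n (d' - 1) (skip k e') (skip k n')
      · have h4 : o (e' k) (e' (k + 1)) = 0 := by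
          by_contra hne
          obtain ⟨h5, h6⟩ := hq d' e' hud' k hk.le hc.2.1 hd' hc.2.2.1 hk
          rcases ho' _ _ hne with ⟨h7, h8⟩ | ⟨h7, h8⟩
          · have h9 := upDown_inj hud' hk le_rfl (h8.trans h5.symm)
            have h10 := hc.2.1
            have h11 : k = d := by omega
            refine hkd ⟨⟨by omega, fun a ha => ?_, fun a ha => ?_⟩, h11⟩
            · rcases Nat.lt_or_ge a d with h12 | h12
              · have := hc.2.2.1 a h12.le
                rw [skip_of_lt _ h12, skip_of_lt _ (by omega)] at this
                exact this
              · rcases Nat.eq_or_lt_of_le h12 with h13 | h13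
                · rw [← h13, ← h7, h11]
                · rw [show a = d + 1 by omega, ← h5]
                  congr 1
                  omega
            · rcases Nat.lt_or_ge a d with h12 | h12
              · have := hc.2.2.2 a h12
                rw [skip_of_lt _ (by omega)] at this
                exact this
              · rw [show a = d by omega, hlast, ← h11, hc.1]
          · exact h6 h7
        rw [h4, zero_smul]
      · rw [if_neg hc, smul_zero]
    by_cases hs : SameSymbol (d + 1) e n d' e' n'
    · rw [if_pos hs]
      obtain ⟨rfl, h5, h6⟩ := id hs
      rw [Finset.sum_eq_single d (fun k hk hkd => h2 k hk fun h => hkd h.2)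
        fun h => absurd (Finset.mem_range.mpr (by omega)) h, if_pos, ← h5 d (by omega),
        ← h5 (d + 1) le_rfl, ho1, one_smul]
      refine ⟨by rw [← h6 d (by omega), hlast], rfl, fun a ha => ?_, fun a ha => ?_⟩
      · unfold skip
        rw [h5 a (by omega), h5 (a + 1) (by omega)]
      · rw [skip_of_lt _ ha, h6 a (by omega)]
    · rw [if_neg hs]
      exact Finset.sum_eq_zero fun k hk => h2 k hk fun h => hs h.1
  refine pderiv_eq_zero_of_commutator ho hgP ?_ fun s hs hsh => ?_
  · rw [hh, key _ e n (by omega) he hn, if_pos ⟨rfl, fun _ _ => rfl, fun _ _ => rfl⟩]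
  · rcases H.vars s hs with ⟨r, rfl⟩ | ⟨d', e', n', hd', he', hn', hX⟩
    · rw [dbar_log, Derivation.map_algebraMap]
    · rw [hX, key d' e' n' hd' he' hn', if_neg]
      intro hsame
      exact hsh (MvPolynomial.X_injective (hX.trans ((bracketHBar_congr hsame).symm.trans hh.symm)))

/-- The scalars are supported on the ends of one interval that is at least as long as every span in
`P`. Deleting such a letter is possible only in a symbol of depth one, so the derivation itself acts
as the partial derivative by `h`. The last condition in `pair` separates `h` from the symbol with
inverted argument. -/
theorem base {e n : ℕ → ℕ} (he : Adm 1 e) (hn : n 0 = 1) {h : GenBar}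
    (hh : (MvPolynomial.X h : HBar) = bracketHBar 1 (fun a => e a) fun k => n k)
    (hmax : ∀ s ∈ P.vars, ∀ (d : ℕ) (e' n' : ℕ → ℕ), 0 < d → Adm d e' → (∀ k, 0 < n' k) →
      (MvPolynomial.X s : HBar) = bracketHBar d (fun a => e' a) (fun k => n' k) →
      gap (e' 0) (e' d) ≤ gap (e 0) (e 1)) : MvPolynomial.pderiv h P = 0 := by
  classical
  have hud := H.adm _ e he
  obtain ⟨o, ho, ho1, ho', ho''⟩ := H.pair e he
  have key : ∀ (d : ℕ) (e' n' : ℕ → ℕ), 0 < d → Adm d e' → (∀ k, 0 < n' k) →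
      gap (e' 0) (e' d) ≤ gap (e 0) (e 1) →
      dbar o 0 (bracketHBar d (fun a => e' a) fun k => n' k) =
      if SameSymbol 1 e n d e' n' then 1 else 0 := by
    intro d e' n' hd he' hn' hgap
    have hud' := H.adm d e' he'
    have hgap' : ∀ x y, o x y ≠ 0 → gap (e' 0) (e' d) ≤ gap x y ∧ gap (e' 0) (e' d) ≤ gap y x := by
      intro x y hxy
      unfold gap at hgap ⊢
      rcases ho' x y hxy with ⟨rfl, rfl⟩ | ⟨rfl, rfl⟩ <;> omega
    rw [dbar_bracket o 0 hd hud' hn', scalarCoeff_ev _ o 0 d e' hn']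
    have h1 : ∑ k ∈ Finset.range d, ((0 : ℕ → ℚ) (e' (k + 1)) - (0 : ℕ → ℚ) (e' k)) •
        (if n' k = 1 then 0 else bracketHBar d (fun a => e' a) fun a => lower k n' a) = 0 :=
      Finset.sum_eq_zero fun k _ => by simp
    have h3 : ∑ k ∈ Finset.range (d - 1), o (e' (k + 1)) (e' k) • (if n' k = 1 then
        bracketHBar (d - 1) (fun a => skip (k + 1) e' a) (fun a => skip k n' a) else 0) = 0 :=
      Finset.sum_eq_zero fun k hk => by
        have hk := Finset.mem_range.mp hk
        have h4 : o (e' (k + 1)) (e' k) = 0 := by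
          by_contra hne
          have := eq_one_of_gap hud' (k := k) (by omega) (hgap' _ _ hne).2
          omega
        rw [h4, zero_smul]
    rw [h1, h3, zero_add, sub_zero]
    rcases Nat.lt_or_ge 1 d with hd1 | hd1
    · rw [if_neg fun hs => by have := hs.1; omega]
      refine Finset.sum_eq_zero fun k hk => ?_
      have hk := Finset.mem_range.mp hk
      have h4 : o (e' k) (e' (k + 1)) = 0 := by
        by_contra hne
        have := eq_one_of_gap hud' hk (hgap' _ _ hne).1
        omega
      rw [h4, zero_smul]
    · obtain rfl : d = 1 := by omega
      rw [Finset.sum_range_one, zero_add]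
      by_cases hs : SameSymbol 1 e n 1 e' n'
      · rw [if_pos hs, ← hs.2.1 0 (by omega), ← hs.2.1 1 le_rfl, ho1, ← hs.2.2 0 (by omega),
          if_pos hn, one_smul]
        exact bracketHBar_zero _ _
      · rw [if_neg hs]
        by_cases hn0 : n' 0 = 1
        · have h4 : o (e' 0) (e' 1) = 0 := by
            by_contra hne
            rcases ho' _ _ hne with ⟨h5, h6⟩ | ⟨h5, h6⟩
            · refine hs ⟨rfl, fun a ha => ?_, fun a ha => ?_⟩
              · interval_cases a
                · exact h5.symm
                · exact h6.symm
              · obtain rfl : a = 0 := by omega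
                rw [hn, hn0]
            · rw [h5, h6] at hne
              exact hne (ho'' e' he' h5 h6)
          rw [h4, zero_smul]
        · rw [if_neg hn0, smul_zero]
  have hn' : ∀ k, 0 < (fun _ => 1 : ℕ → ℕ) k := fun _ => Nat.one_pos
  have hsame : SameSymbol 1 e n 1 e fun _ => 1 :=
    ⟨rfl, fun _ _ => rfl, fun k hk => by rw [show k = 0 by omega, hn]⟩
  have hh' : (MvPolynomial.X h : HBar) = bracketHBar 1 (fun a => e a)
      fun k => (fun _ => 1 : ℕ → ℕ) k := by
    rw [hh]
    exact bracketHBar_congr (n := n) (n' := fun _ => 1) hsame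
  refine pderiv_eq_zero_of_derivation ho ?_ fun s hs hsh => ?_
  · rw [hh', key 1 e _ Nat.one_pos he hn' le_rfl, if_pos hsame]
  · rcases H.vars s hs with ⟨r, rfl⟩ | ⟨d', e', n', hd', he', hn', hX⟩
    · rw [dbar_log]
      simp
    · rw [hX, key d' e' n' hd' he' hn' (hmax s hs d' e' n' hd' he' hn' hX), if_neg]
      intro hsame
      exact hsh (MvPolynomial.X_injective (hX.trans ((bracketHBar_congr hsame).symm.trans hh.symm)))

/-- Double induction on the depth and on the last weight: `raise` increases the last weight,
`insert_break` the depth, and `base` starts the induction. The outer breaks never change, so the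
span stays maximal throughout. -/
theorem pderiv_of_max {M : ℕ}
    (hmax : ∀ s ∈ P.vars, ∀ (d : ℕ) (e' n' : ℕ → ℕ), 0 < d → Adm d e' → (∀ k, 0 < n' k) →
      (MvPolynomial.X s : HBar) = bracketHBar d (fun a => e' a) (fun k => n' k) →
      gap (e' 0) (e' d) ≤ M) (d : ℕ) : ∀ (m : ℕ) (e n : ℕ → ℕ) (h : GenBar), Adm (d + 1) e →
      (∀ k, 0 < n k) → n d = m + 1 → gap (e 0) (e (d + 1)) = M →
      (MvPolynomial.X h : HBar) = bracketHBar (d + 1) (fun a => e a) (fun k => n k) →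
      MvPolynomial.pderiv h P = 0 := by
  induction d with
  | zero =>
    intro m
    induction m with
    | zero =>
      intro e n h he hn hn0 hM hh
      exact H.base he hn0 hh (hM ▸ hmax)
    | succ m ih =>
      intro e n h he hn hn0 hM hh
      have hl : n (0 + 1 - 1) ≠ 1 := by rw [Nat.add_sub_cancel]; omega
      obtain ⟨g, hg⟩ := exists_gen (Nat.succ_pos 0) (H.adm _ e he) (lower_pos hn hl)
      refine H.raise (Nat.succ_pos 0) he hn hl hg hh
        (ih e (lower (0 + 1 - 1) n) g he (lower_pos hn hl) ?_ hM hg)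
      simp [lower, hn0]
  | succ d ihd =>
    intro m
    induction m with
    | zero =>
      intro e n h he hn hn0 hM hh
      have he1 := H.adm_skip _ e (d + 1) he
      rw [Nat.add_sub_cancel] at he1
      obtain ⟨g, hg⟩ := exists_gen (Nat.succ_pos d) (H.adm _ _ he1) hn
      refine H.insert_break (Nat.succ_pos d) he hn hn0 hg hh
        (ihd (n d - 1) (skip (d + 1) e) n g he1 hn ?_ ?_ hg)
      · have := hn d; omega
      · rw [skip_of_lt _ (by omega), skip_of_le _ le_rfl, hM]
    | succ m ih =>
      intro e n h he hn hn0 hM hh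
      have hl : n (d + 1 + 1 - 1) ≠ 1 := by rw [Nat.add_sub_cancel]; omega
      obtain ⟨g, hg⟩ := exists_gen (Nat.succ_pos _) (H.adm _ e he) (lower_pos hn hl)
      refine H.raise (Nat.succ_pos _) he hn hl hg hh
        (ih e (lower (d + 1 + 1 - 1) n) g he (lower_pos hn hl) ?_ hM hg)
      simp [lower, hn0]

open Classical in
/-- The length of the interval spanned by a symbol. -/
def _root_.SymbPolylog.spanLength (Adm : ℕ → (ℕ → ℕ) → Prop) (s : GenBar) : ℕ :=
  if h : ∃ m : ℕ, ∃ (d : ℕ) (e n : ℕ → ℕ), 0 < d ∧ Adm d e ∧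
    (∀ k, 0 < n k) ∧ (MvPolynomial.X s : HBar) = bracketHBar d (fun a => e a) (fun k => n k) ∧
      gap (e 0) (e d) = m then h.choose else 0

theorem spanLength_eq {s : GenBar} {d : ℕ} {e n : ℕ → ℕ} (hd : 0 < d) (he : Adm d e)
    (hn : ∀ k, 0 < n k)
    (hX : (MvPolynomial.X s : HBar) = bracketHBar d (fun a => e a) (fun k => n k)) :
    spanLength Adm s = gap (e 0) (e d) := by
  have h : ∃ m : ℕ, ∃ (d : ℕ) (e n : ℕ → ℕ), 0 < d ∧ Adm d e ∧
    (∀ k, 0 < n k) ∧ (MvPolynomial.X s : HBar) = bracketHBar d (fun a => e a) (fun k => n k) ∧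
      gap (e 0) (e d) = m := ⟨_, d, e, n, hd, he, hn, hX, rfl⟩
  rw [spanLength, dif_pos h]
  obtain ⟨d', e', n', hd', he', hn', hX', hm⟩ := h.choose_spec
  obtain ⟨rfl, h1, -⟩ := sameSymbol_of_bracket hd (H.adm _ _ he) hn (H.adm _ _ he') hn'
    (hX.symm.trans hX')
  rw [← hm, h1 0 (Nat.zero_le _), h1 d le_rfl]

/-- Otherwise choose among the remaining variables one of maximal span. Its partial derivative
vanishes, so it is not a variable of `P` after all. -/
theorem vars_log {s : GenBar} (hs : s ∈ P.vars) : ∃ r, s = .log r := by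
  classical
  by_contra hcon
  have hne : (P.vars.filter fun s => ¬ ∃ r, s = .log r).Nonempty :=
    ⟨s, Finset.mem_filter.mpr ⟨hs, hcon⟩⟩
  obtain ⟨s', hs', hmax⟩ := Finset.exists_max_image _ (spanLength Adm) hne
  rw [Finset.mem_filter] at hs'
  rcases H.vars s' hs'.1 with h | ⟨d, e, n, hd, he, hn, hX⟩
  · exact hs'.2 h
  obtain ⟨d, rfl⟩ : ∃ c, d = c + 1 := ⟨d - 1, by omega⟩
  refine notMem_vars_of_pderiv (H.pderiv_of_max (M := gap (e 0) (e (d + 1))) ?_ d (n d - 1) e n s'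
    he hn (by have := hn d; omega) rfl hX) hs'.1
  intro s1 hs1 d1 e1 n1 hd1 he1 hn1 hX1
  rw [← H.spanLength_eq hd he hn hX, ← H.spanLength_eq hd1 he1 hn1 hX1]
  refine hmax s1 (Finset.mem_filter.mpr ⟨hs1, ?_⟩)
  rintro ⟨r, rfl⟩
  have h1 := exists_gen hd1 (H.adm _ _ he1) hn1
  rcases H.adm _ _ he1 with h2 | h2
  · rw [bracketHBar_up hd1 h2 hn1] at hX1
    exact absurd (MvPolynomial.X_injective hX1) (by simp)
  · rw [bracketHBar_down hd1 h2 hn1] at hX1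
    exact absurd (MvPolynomial.X_injective hX1) (by simp)

theorem eq_C : ∃ c, P = MvPolynomial.C c := by
  have : P.vars = ∅ := by
    refine Finset.eq_empty_of_forall_notMem fun s hs => ?_
    obtain ⟨r, rfl⟩ := H.vars_log hs
    -- The step function between `r` and `r + 1` makes the derivation `1` on the logarithm of `x r`
    -- and `0` on the other logarithms.
    obtain ⟨o, ho, -⟩ := H.logs fun x => if r < x then 1 else 0
    refine notMem_vars_of_pderiv (pderiv_eq_zero_of_derivation ho ?_ fun s' hs' hne => ?_) hs
    · rw [dbar_log]; simp
    · obtain ⟨r', rfl⟩ := H.vars_log hs'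
      have : r ≠ r' := fun h => hne (by rw [h])
      rw [dbar_log]
      by_cases h1 : r < r'
      · rw [if_pos (by omega), if_pos h1]; simp
      · rw [if_neg (show ¬ r < r' + 1 by omega), if_neg h1]; simp
  exact ⟨_, (MvPolynomial.vars_eq_empty_iff_eq_C).mp this⟩

end Killed

/-- The constants of `ℍ̄` are the elements killed by all derivations. -/
theorem HBar.eq_C_of_dbar {P : HBar} (h : ∀ o l, dbar o l P = 0) : ∃ c, P = MvPolynomial.C c := by
  classical
  refine Killed.eq_C (Adm := fun d e => Up d e ∨ Down d e)
    ⟨fun _ _ h => h, fun _ _ k h => upDown_skip h k, fun s _ => ?_, fun e he => ?_,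
      fun l => ⟨0, h _ _, by simp⟩, fun p q hpq => ?_⟩
  · cases s with
    | log r => exact Or.inl ⟨r, rfl⟩
    | reg s => exact Or.inr ⟨_, _, _, s.depth_pos, Or.inl s.seq_up, s.wt_pos, X_reg_eq s⟩
    | inv s => exact Or.inr ⟨_, _, _, s.depth_pos,
        Or.inr fun a b hab hb => s.seq_up _ _ (by omega) (by omega), fun _ => s.wt_pos _,
        X_inv_eq s⟩
  · refine ⟨fun x y => if x = e 0 ∧ y = e 1 then 1 else 0, h _ _, if_pos ⟨rfl, rfl⟩,
      fun x y hxy => Or.inl (by by_contra hc; exact hxy (if_neg hc)), fun _ _ _ _ => if_neg ?_⟩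
    rintro ⟨h1, -⟩
    exact absurd (upDown_inj he le_rfl (Nat.zero_le _) h1) one_ne_zero
  · exact ⟨fun x y => if (x = p ∧ y = q) ∨ (x = q ∧ y = p) then 1 else 0, h _ _,
      if_pos (Or.inl ⟨rfl, rfl⟩), fun x y hxy => by by_contra hc; exact hxy (if_neg hc)⟩

/-- Scalars in place of `d[x_{a→b}]_1` in `ℍ`, extended to inverted arguments so that
`d[y⁻¹]_1 = d[y]_1 + d[y]_0`. -/
def ext (o : ℕ → ℕ → ℚ) (l : ℕ → ℚ) (a b : ℕ) : ℚ :=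
  if a < b then o a b else o b a + (l a - l b)

/-- The same for elements of `ℍ`, and the derivations of `ℍ`. -/
theorem HBar.eq_C_of_dbar_ext {P : HBar} (hreg : ∀ s ∈ P.vars, ∀ s', s ≠ .inv s')
    (h : ∀ o l, dbar (ext o l) l P = 0) : ∃ c, P = MvPolynomial.C c := by
  classical
  -- For `l = 0` the extension to inverted arguments is symmetric, so the indicator of one
  -- increasing pair becomes the indicator of both orientations.
  have hsymm : ∀ p q, p < q → dbar (fun x y => if (x = p ∧ y = q) ∨ (x = q ∧ y = p) then 1 else 0)
      0 P = 0 := by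
    intro p q hpq
    rw [← h (fun x y => if x = p ∧ y = q then 1 else 0) 0]
    congr 2
    funext x y
    unfold ext
    by_cases hxy : x < y
    · rw [if_pos hxy]
      exact if_congr (by omega) rfl rfl
    · rw [if_neg hxy]
      simp only [Pi.zero_apply, sub_self, add_zero]
      exact if_congr (by omega) rfl rfl
  refine Killed.eq_C (Adm := Up)
    ⟨fun _ _ h => Or.inl h, fun _ _ k h => h.skip k, fun s hs => ?_, fun e he => ?_,
      fun l => ⟨_, h 0 l, fun d e he k hk => ?_⟩, fun p q hpq => ?_⟩
  · cases s with
    | log r => exact Or.inl ⟨r, rfl⟩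
    | reg s => exact Or.inr ⟨_, _, _, s.depth_pos, s.seq_up, s.wt_pos, X_reg_eq s⟩
    | inv s => exact absurd rfl (hreg _ hs s)
  · have h01 := he 0 1 Nat.one_pos le_rfl
    refine ⟨_, hsymm (e 0) (e 1) h01, if_pos (Or.inl ⟨rfl, rfl⟩),
      fun x y hxy => by by_contra hc; exact hxy (if_neg hc), fun e' he' h0 h1 => ?_⟩
    have := he' 0 1 Nat.one_pos le_rfl
    omega
  · have h1 := he k (k + 1) (Nat.lt_succ_self k) hk
    unfold ext
    rw [if_pos h1, if_neg (show ¬ e (k + 1) < e k by omega)]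
    refine ⟨rfl, fun h2 h3 => h2 ?_⟩
    simp [h3]
  · rcases Nat.lt_or_gt_of_ne hpq with h1 | h1
    · exact ⟨_, hsymm p q h1, if_pos (Or.inl ⟨rfl, rfl⟩),
        fun x y hxy => by by_contra hc; exact hxy (if_neg hc)⟩
    · exact ⟨_, hsymm q p h1, if_pos (Or.inr ⟨rfl, rfl⟩),
        fun x y hxy => by by_contra hc; exact hxy (if_neg fun h => hc h.symm)⟩

end SymbPolylog

namespace SymbPolylog

/-! ### Hopf algebras from derivations -/

section slices

variable {A B C : Type} [AddCommGroup A] [Module ℚ A] [AddCommGroup B] [Module ℚ B]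
  [AddCommGroup C] [Module ℚ C]

/-- Evaluation of a functional on the left factor. -/
def slice (f : B →ₗ[ℚ] ℚ) : B ⊗[ℚ] A →ₗ[ℚ] A := TensorProduct.lid ℚ A ∘ₗ f.rTensor A

@[simp] theorem slice_tmul (f : B →ₗ[ℚ] ℚ) (b : B) (a : A) : slice f (b ⊗ₜ[ℚ] a) = f b • a := by
  simp [slice]

theorem slice_lTensor (f : B →ₗ[ℚ] ℚ) (L : A →ₗ[ℚ] C) (x : B ⊗[ℚ] A) :
    slice f (L.lTensor B x) = L (slice f x) := by
  induction x using TensorProduct.induction_on with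
  | zero => simp
  | add x y hx hy => simp only [map_add, hx, hy]
  | tmul b a => simp

/-- The coordinates of a tensor with respect to a basis of the left factor are slices. -/
theorem eq_zero_of_slice {x : B ⊗[ℚ] A} (h : ∀ f : B →ₗ[ℚ] ℚ, slice f x = 0) : x = 0 := by
  classical
  let b := Module.Basis.ofVectorSpace ℚ B
  refine (TensorProduct.equivFinsuppOfBasisLeft b).injective ?_
  rw [map_zero]
  ext j
  rw [TensorProduct.equivFinsuppOfBasisLeft_apply]
  exact h _

end slices

/-- The projection of a polynomial algebra to the constants. -/
def aug (σ : Type) : MvPolynomial σ ℚ →ₐ[ℚ] ℚ := MvPolynomial.aeval fun _ => 0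

@[simp] theorem aug_X {σ : Type} (s : σ) : aug σ (MvPolynomial.X s) = 0 := MvPolynomial.aeval_X _ _

@[simp] theorem aug_C {σ : Type} (c : ℚ) : aug σ (MvPolynomial.C c) = c :=
  MvPolynomial.algHom_C _ _

/-- A coproduct on a polynomial algebra with weighted generators, triangular and compatible with a
family of derivations that separates elements up to constants. -/
structure HopfData {σ ι : Type} (wt : σ → ℕ)
    (Δ : MvPolynomial σ ℚ →ₐ[ℚ] MvPolynomial σ ℚ ⊗[ℚ] MvPolynomial σ ℚ)
    (D : ι → Derivation ℚ (MvPolynomial σ ℚ) (MvPolynomial σ ℚ)) : Prop where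
  wt_pos : ∀ s, 0 < wt s
  counit_left : (aug σ).toLinearMap.rTensor _ ∘ₗ Δ.toLinearMap = TensorProduct.mk ℚ ℚ _ 1
  counit_right : (aug σ).toLinearMap.lTensor _ ∘ₗ Δ.toLinearMap = (TensorProduct.mk ℚ _ ℚ).flip 1
  comm : ∀ i, (D i : MvPolynomial σ ℚ →ₗ[ℚ] MvPolynomial σ ℚ).lTensor _ ∘ₗ Δ.toLinearMap =
    Δ.toLinearMap ∘ₗ (D i : MvPolynomial σ ℚ →ₗ[ℚ] MvPolynomial σ ℚ)
  ker : ∀ P, (∀ i, D i P = 0) → ∃ c, P = MvPolynomial.C c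
  low : ∀ i s, D i (MvPolynomial.X s) ∈ Submodule.span ℚ
    {P | (P = 1 ∧ wt s = 1) ∨ ∃ t, wt t + 1 = wt s ∧ P = MvPolynomial.X t}
  tri : ∀ s, Δ (MvPolynomial.X s) - MvPolynomial.X s ⊗ₜ 1 ∈ Submodule.span ℚ
    {x | ∃ m a, (m = 1 ∨ ∃ t, wt t < wt s ∧ m = MvPolynomial.X t) ∧ x = m ⊗ₜ a}

namespace HopfData

variable {σ ι : Type} {wt : σ → ℕ}
  {Δ : MvPolynomial σ ℚ →ₐ[ℚ] MvPolynomial σ ℚ ⊗[ℚ] MvPolynomial σ ℚ}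
  {D : ι → Derivation ℚ (MvPolynomial σ ℚ) (MvPolynomial σ ℚ)} (h : HopfData wt Δ D)
include h

/-- Slicing on the left commutes with all maps on the right factor. Hence each slice is a constant
by `ker`, and the counit shows that this constant is zero. -/
theorem eq_zero {B : Type} [AddCommGroup B] [Module ℚ B] {x : B ⊗[ℚ] MvPolynomial σ ℚ}
    (hD : ∀ i, (D i : MvPolynomial σ ℚ →ₗ[ℚ] MvPolynomial σ ℚ).lTensor B x = 0)
    (hε : (aug σ).toLinearMap.lTensor B x = 0) : x = 0 := by
  refine eq_zero_of_slice fun f => ?_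
  obtain ⟨c, hc⟩ := h.ker (slice f x) fun i => by
    have := slice_lTensor f (D i : MvPolynomial σ ℚ →ₗ[ℚ] MvPolynomial σ ℚ) x
    rw [hD, map_zero] at this
    exact this.symm
  have h1 := slice_lTensor f (aug σ).toLinearMap x
  rw [hε, map_zero, hc, AlgHom.toLinearMap_apply, aug_C] at h1
  rw [hc, ← h1, map_zero]

theorem counit_left_apply (x : MvPolynomial σ ℚ) :
    (aug σ).toLinearMap.rTensor _ (Δ x) = 1 ⊗ₜ x := LinearMap.congr_fun h.counit_left x

theorem counit_right_apply (x : MvPolynomial σ ℚ) :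
    (aug σ).toLinearMap.lTensor _ (Δ x) = x ⊗ₜ 1 := LinearMap.congr_fun h.counit_right x

theorem comm_apply (i : ι) (x : MvPolynomial σ ℚ) :
    (D i : MvPolynomial σ ℚ →ₗ[ℚ] MvPolynomial σ ℚ).lTensor _ (Δ x) = Δ (D i x) :=
  LinearMap.congr_fun (h.comm i) x

/-- Both iterated coproducts are algebra homomorphisms, both intertwine every `D i` with its action
on the last factor, and the counit on that factor sends both to `Δ x ⊗ 1`. Since derivatives of
generators have smaller weight, `eq_zero` and induction on the weight show that they agree. -/
theorem coassoc : (TensorProduct.assoc ℚ (MvPolynomial σ ℚ) (MvPolynomial σ ℚ)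
    (MvPolynomial σ ℚ)).toLinearMap ∘ₗ Δ.toLinearMap.rTensor _ ∘ₗ Δ.toLinearMap =
    Δ.toLinearMap.lTensor _ ∘ₗ Δ.toLinearMap := by
  let A := MvPolynomial σ ℚ
  let G₁ : A →ₐ[ℚ] (A ⊗[ℚ] A) ⊗[ℚ] A := (Algebra.TensorProduct.map Δ (AlgHom.id ℚ A)).comp Δ
  let G₂ : A →ₐ[ℚ] (A ⊗[ℚ] A) ⊗[ℚ] A :=
    ((Algebra.TensorProduct.assoc ℚ ℚ ℚ A A A).symm : A ⊗[ℚ] (A ⊗[ℚ] A) →ₐ[ℚ] _).comp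
      ((Algebra.TensorProduct.map (AlgHom.id ℚ A) Δ).comp Δ)
  have e₁ : ∀ x, G₁ x = Δ.toLinearMap.rTensor A (Δ x) := fun x => rfl
  have e₂ : ∀ x, G₂ x = (TensorProduct.assoc ℚ A A A).symm (Δ.toLinearMap.lTensor A (Δ x)) :=
    fun x => rfl
  have hl : ∀ {C : Type} [AddCommGroup C] [Module ℚ C] (L : A →ₗ[ℚ] C) (z : A ⊗[ℚ] (A ⊗[ℚ] A)),
      L.lTensor (A ⊗[ℚ] A) ((TensorProduct.assoc ℚ A A A).symm z) =
        (TensorProduct.assoc ℚ A A C).symm ((L.lTensor A).lTensor A z) := by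
    intro C _ _ L z
    have : L.lTensor (A ⊗[ℚ] A) ∘ₗ (TensorProduct.assoc ℚ A A A).symm.toLinearMap =
        (TensorProduct.assoc ℚ A A C).symm.toLinearMap ∘ₗ (L.lTensor A).lTensor A :=
      TensorProduct.ext_threefold' fun _ _ _ => rfl
    exact LinearMap.congr_fun this z
  have hr : ∀ {C : Type} [AddCommGroup C] [Module ℚ C] (L : A →ₗ[ℚ] C) (z : A ⊗[ℚ] A),
      L.lTensor (A ⊗[ℚ] A) (Δ.toLinearMap.rTensor A z) = Δ.toLinearMap.rTensor C (L.lTensor A z) := by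
    intro C _ _ L z
    rw [← LinearMap.comp_apply, LinearMap.lTensor_comp_rTensor, ← LinearMap.rTensor_comp_lTensor,
      LinearMap.comp_apply]
  have hD₁ : ∀ i x, (D i : A →ₗ[ℚ] A).lTensor (A ⊗[ℚ] A) (G₁ x) = G₁ (D i x) := by
    intro i x
    rw [e₁, hr, h.comm_apply, e₁]
  have hD₂ : ∀ i x, (D i : A →ₗ[ℚ] A).lTensor (A ⊗[ℚ] A) (G₂ x) = G₂ (D i x) := by
    intro i x
    rw [e₂, hl, ← LinearMap.comp_apply (LinearMap.lTensor _ _) (LinearMap.lTensor _ _),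
      ← LinearMap.lTensor_comp, h.comm, LinearMap.lTensor_comp, LinearMap.comp_apply, h.comm_apply,
      e₂]
  have hε₁ : ∀ x, (aug σ).toLinearMap.lTensor (A ⊗[ℚ] A) (G₁ x) = Δ x ⊗ₜ 1 := by
    intro x
    rw [e₁, hr, h.counit_right_apply]
    rfl
  have hε₂ : ∀ x, (aug σ).toLinearMap.lTensor (A ⊗[ℚ] A) (G₂ x) = Δ x ⊗ₜ 1 := by
    intro x
    rw [e₂, hl, ← LinearMap.comp_apply (LinearMap.lTensor _ _) (LinearMap.lTensor _ _),
      ← LinearMap.lTensor_comp, h.counit_right]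
    induction Δ x using TensorProduct.induction_on with
    | zero => simp
    | add a b ha hb => simp only [map_add, ha, hb, TensorProduct.add_tmul]
    | tmul a b => simp
  -- The derivative of a generator lies in the span of `1` and generators of smaller weight, where
  -- the two homomorphisms already agree.
  have key : ∀ n s, wt s < n → G₁ (MvPolynomial.X s) = G₂ (MvPolynomial.X s) := by
    intro n
    induction n with
    | zero => intro s hs; exact absurd hs (Nat.not_lt_zero _)
    | succ n ih =>
      intro s hs
      refine sub_eq_zero.mp (h.eq_zero (fun i => ?_) ?_)
      · rw [map_sub, hD₁, hD₂, sub_eq_zero]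
        have : Submodule.span ℚ {P | (P = 1 ∧ wt s = 1) ∨ ∃ t, wt t + 1 = wt s ∧
            P = MvPolynomial.X t} ≤ LinearMap.eqLocus G₁.toLinearMap G₂.toLinearMap := by
          rw [Submodule.span_le]
          rintro P (⟨rfl, -⟩ | ⟨t, ht, rfl⟩)
          · exact G₁.map_one'.trans G₂.map_one'.symm
          · exact ih t (by omega)
        exact this (h.low i s)
      · rw [map_sub, hε₁, hε₂, sub_self]
  have hG : G₁ = G₂ := MvPolynomial.algHom_ext fun s => key _ s (Nat.lt_succ_self _)
  refine LinearMap.ext fun x => ?_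
  have := DFunLike.congr_fun hG x
  rw [e₁, e₂, LinearEquiv.eq_symm_apply] at this
  exact this

end HopfData

end SymbPolylog

namespace SymbPolylog

/-! ### The antipode -/

section antipode

open LinearMap

variable {A : Type} [CommRing A] [Algebra ℚ A]

/-- A multiplicative left antipode makes a commutative bialgebra a Hopf algebra, and is the only
left antipode. -/
theorem isHopf_of_leftAntipode {Δ : A →ₐ[ℚ] A ⊗[ℚ] A} {ε : A →ₐ[ℚ] ℚ}
    (hc : (TensorProduct.assoc ℚ A A A).toLinearMap ∘ₗ Δ.toLinearMap.rTensor A ∘ₗ Δ.toLinearMap =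
      Δ.toLinearMap.lTensor A ∘ₗ Δ.toLinearMap)
    (hl : ε.toLinearMap.rTensor A ∘ₗ Δ.toLinearMap = TensorProduct.mk ℚ ℚ A 1)
    (hr : ε.toLinearMap.lTensor A ∘ₗ Δ.toLinearMap = (TensorProduct.mk ℚ A ℚ).flip 1)
    {S : A →ₐ[ℚ] A} (hS : IsLeftAntipode Δ ε S.toLinearMap) :
    IsHopf Δ ε S.toLinearMap ∧ ∀ S' : A →ₗ[ℚ] A, IsLeftAntipode Δ ε S' → S' = S.toLinearMap := by
  let : Coalgebra ℚ A :=
    { comul := Δ.toLinearMap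
      counit := ε.toLinearMap
      coassoc := hc
      rTensor_counit_comp_comul := hl
      lTensor_counit_comp_comul := hr }
  have h1 : ∀ S' : A →ₗ[ℚ] A, IsLeftAntipode Δ ε S' →
      WithConv.toConv S' * WithConv.toConv (LinearMap.id : A →ₗ[ℚ] A) = 1 :=
    fun S' hS' => congrArg WithConv.toConv hS'
  -- Applying the homomorphism `S` to `S * id = 1` gives `(S ∘ S) * S = 1`. Thus `S` has the left
  -- inverse `S ∘ S` and the right inverse `id` under convolution; these coincide, and so `id * S =
  -- 1`.
  have h2 : WithConv.toConv (S.toLinearMap ∘ₗ S.toLinearMap) * WithConv.toConv S.toLinearMap =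
      1 := by
    have h3 := algHom_comp_convMul_distrib S (WithConv.toConv S.toLinearMap)
      (WithConv.toConv (LinearMap.id : A →ₗ[ℚ] A))
    rw [h1 _ hS] at h3
    have h4 := congrArg WithConv.toConv h3
    refine h4.symm.trans ?_
    refine congrArg WithConv.toConv (LinearMap.ext fun x => ?_)
    exact S.commutes _
  have h5 : WithConv.toConv (LinearMap.id : A →ₗ[ℚ] A) * WithConv.toConv S.toLinearMap = 1 := by
    rw [← left_inv_eq_right_inv h2 (h1 _ hS)]
    exact h2
  refine ⟨⟨hc, hl, hr, hS, congrArg WithConv.ofConv h5⟩, fun S' hS' => ?_⟩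
  exact congrArg WithConv.ofConv (left_inv_eq_right_inv (h1 _ hS') h5)

/-- `μ ∘ (S ⊗ id)`. -/
def mulLeft (S : A →ₐ[ℚ] A) : A ⊗[ℚ] A →ₐ[ℚ] A :=
  Algebra.TensorProduct.lift S (AlgHom.id ℚ A) fun _ _ => Commute.all _ _

@[simp] theorem mulLeft_tmul (S : A →ₐ[ℚ] A) (a b : A) : mulLeft S (a ⊗ₜ b) = S a * b := by
  simp [mulLeft]

theorem isLeftAntipode_of_mulLeft {Δ : A →ₐ[ℚ] A ⊗[ℚ] A} {ε : A →ₐ[ℚ] ℚ} {S : A →ₐ[ℚ] A}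
    (h : (mulLeft S).comp Δ = (Algebra.ofId ℚ A).comp ε) : IsLeftAntipode Δ ε S.toLinearMap := by
  have h1 : LinearMap.mul' ℚ A ∘ₗ S.toLinearMap.rTensor A = (mulLeft S).toLinearMap :=
    TensorProduct.ext' fun a b => by simp
  refine LinearMap.ext fun x => ?_
  have h2 := DFunLike.congr_fun h x
  have h3 := LinearMap.congr_fun h1 (Δ x)
  exact h3.trans h2

end antipode

section recursion

variable {σ : Type} (wt : σ → ℕ)
  (Δ : MvPolynomial σ ℚ →ₐ[ℚ] MvPolynomial σ ℚ ⊗[ℚ] MvPolynomial σ ℚ)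

/-- Approximations of the antipode. -/
def antipodeAux : ℕ → (MvPolynomial σ ℚ →ₐ[ℚ] MvPolynomial σ ℚ)
  | 0 => MvPolynomial.aeval fun _ => 0
  | n + 1 => MvPolynomial.aeval fun s =>
      -mulLeft (antipodeAux n) (Δ (MvPolynomial.X s) - MvPolynomial.X s ⊗ₜ 1)

/-- The antipode of a triangular coproduct, by recursion on the weight of generators. -/
def antipode : MvPolynomial σ ℚ →ₐ[ℚ] MvPolynomial σ ℚ :=
  MvPolynomial.aeval fun s => antipodeAux Δ (wt s + 1) (MvPolynomial.X s)

end recursion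

namespace HopfData

variable {σ ι : Type} {wt : σ → ℕ}
  {Δ : MvPolynomial σ ℚ →ₐ[ℚ] MvPolynomial σ ℚ ⊗[ℚ] MvPolynomial σ ℚ}
  {D : ι → Derivation ℚ (MvPolynomial σ ℚ) (MvPolynomial σ ℚ)} (h : HopfData wt Δ D)
include h

/-- By triangularity only left factors of smaller weight, or `1`, occur after `X s ⊗ 1` has been
subtracted. -/
theorem mulLeft_congr {S S' : MvPolynomial σ ℚ →ₐ[ℚ] MvPolynomial σ ℚ} {s : σ}
    (hS : ∀ t, wt t < wt s → S (MvPolynomial.X t) = S' (MvPolynomial.X t)) :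
    mulLeft S (Δ (MvPolynomial.X s) - MvPolynomial.X s ⊗ₜ 1) =
      mulLeft S' (Δ (MvPolynomial.X s) - MvPolynomial.X s ⊗ₜ 1) := by
  have : Submodule.span ℚ {x | ∃ (m a : MvPolynomial σ ℚ), (m = 1 ∨ ∃ t, wt t < wt s ∧
      m = MvPolynomial.X t) ∧ x = m ⊗ₜ a} ≤
      LinearMap.eqLocus (mulLeft S).toLinearMap (mulLeft S').toLinearMap := by
    rw [Submodule.span_le]
    rintro _ ⟨m, a, rfl | ⟨t, ht, rfl⟩, rfl⟩
    · simp only [SetLike.mem_coe, LinearMap.mem_eqLocus, AlgHom.toLinearMap_apply, mulLeft_tmul,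
        map_one]
    · simp only [SetLike.mem_coe, LinearMap.mem_eqLocus, AlgHom.toLinearMap_apply, mulLeft_tmul,
        hS t ht]
  exact this (h.tri s)

/-- A recursion step evaluates the previous approximation on smaller weights only, so stage `n` is
already final on generators of weight below `n`. -/
theorem antipodeAux_eq (N : ℕ) : ∀ s, wt s < N → ∀ n m, wt s < n → wt s < m →
    antipodeAux Δ n (MvPolynomial.X s) = antipodeAux Δ m (MvPolynomial.X s) := by
  induction N with
  | zero => intro s hs; exact absurd hs (Nat.not_lt_zero _)
  | succ N ih =>
    intro s hs n m hn hm
    obtain ⟨n, rfl⟩ : ∃ k, n = k + 1 := ⟨n - 1, by omega⟩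
    obtain ⟨m, rfl⟩ : ∃ k, m = k + 1 := ⟨m - 1, by omega⟩
    rw [antipodeAux, antipodeAux, MvPolynomial.aeval_X, MvPolynomial.aeval_X]
    congr 1
    exact h.mulLeft_congr fun t ht => ih t (by omega) n m (by omega) (by omega)

theorem antipode_X (s : σ) : antipode wt Δ (MvPolynomial.X s) =
    -mulLeft (antipode wt Δ) (Δ (MvPolynomial.X s) - MvPolynomial.X s ⊗ₜ 1) := by
  have h1 : ∀ t, antipode wt Δ (MvPolynomial.X t) =
      antipodeAux Δ (wt t + 1) (MvPolynomial.X t) := fun t => MvPolynomial.aeval_X _ _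
  rw [h1, antipodeAux, MvPolynomial.aeval_X]
  congr 1
  refine h.mulLeft_congr fun t ht => ?_
  rw [h1]
  exact h.antipodeAux_eq _ t (Nat.lt_succ_self _) _ _ ht (Nat.lt_succ_self _)

theorem isHopf : IsHopf Δ (aug σ) (antipode wt Δ).toLinearMap ∧
    ∀ S' : MvPolynomial σ ℚ →ₗ[ℚ] MvPolynomial σ ℚ, IsLeftAntipode Δ (aug σ) S' →
      S' = (antipode wt Δ).toLinearMap := by
  refine isHopf_of_leftAntipode h.coassoc h.counit_left h.counit_right
    (isLeftAntipode_of_mulLeft (MvPolynomial.algHom_ext fun s => ?_))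
  have h1 : Δ (MvPolynomial.X s) = MvPolynomial.X s ⊗ₜ 1 +
      (Δ (MvPolynomial.X s) - MvPolynomial.X s ⊗ₜ 1) := by abel
  rw [AlgHom.comp_apply, h1, map_add, mulLeft_tmul, mul_one, AlgHom.comp_apply, aug_X, map_zero]
  nth_rewrite 1 [h.antipode_X s]
  exact neg_add_cancel _

/-! ### The derivation in terms of the coproduct -/

theorem aug_eq_zero_of_wt {s : σ} (hs : wt s ≠ 1) (i : ι) : aug σ (D i (MvPolynomial.X s)) = 0 := by
  have : Submodule.span ℚ {P : MvPolynomial σ ℚ | (P = 1 ∧ wt s = 1) ∨ ∃ t, wt t + 1 = wt s ∧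
      P = MvPolynomial.X t} ≤ LinearMap.ker (aug σ).toLinearMap := by
    rw [Submodule.span_le]
    rintro P (⟨-, h1⟩ | ⟨t, ht, rfl⟩)
    · exact absurd h1 hs
    · exact aug_X t
  exact this (h.low i s)

theorem aug_of_wt {s : σ} (hs : wt s = 1) (i : ι) :
    algebraMap ℚ _ (aug σ (D i (MvPolynomial.X s))) = D i (MvPolynomial.X s) := by
  have : Submodule.span ℚ {P : MvPolynomial σ ℚ | (P = 1 ∧ wt s = 1) ∨ ∃ t, wt t + 1 = wt s ∧
      P = MvPolynomial.X t} ≤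
      LinearMap.eqLocus ((Algebra.ofId ℚ _).comp (aug σ)).toLinearMap LinearMap.id := by
    rw [Submodule.span_le]
    rintro P (⟨rfl, h1⟩ | ⟨t, ht, rfl⟩)
    · exact map_one ((Algebra.ofId ℚ (MvPolynomial σ ℚ)).comp (aug σ))
    · have := h.wt_pos t
      omega
  exact this (h.low i s)

/-- All generators have positive weight, so the weight zero part is the augmentation, and a product
has weight one only if one factor contributes weight zero and the other weight one. -/
theorem weightOne_mul (x y : MvPolynomial σ ℚ) :
    MvPolynomial.weightedHomogeneousComponent wt 1 (x * y) =
      algebraMap ℚ _ (aug σ x) * MvPolynomial.weightedHomogeneousComponent wt 1 y +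
      algebraMap ℚ _ (aug σ y) * MvPolynomial.weightedHomogeneousComponent wt 1 x := by
  classical
  have hw : ∀ m : σ →₀ ℕ, Finsupp.weight wt m = 0 ↔ m = 0 := fun m =>
    ⟨fun h0 => by
      by_contra hm
      obtain ⟨s, hs⟩ := Finsupp.ne_iff.mp hm
      have h1 := Finsupp.le_weight_of_ne_zero' wt hs
      have := h.wt_pos s
      omega, fun h0 => by rw [h0, map_zero]⟩
  have hc : ∀ (m : σ →₀ ℕ) (c : ℚ), MvPolynomial.weightedHomogeneousComponent wt 1
      (MvPolynomial.monomial m c) =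
      if Finsupp.weight wt m = 1 then MvPolynomial.monomial m c else 0 := fun m c => by
    rw [MvPolynomial.weightedHomogeneousComponent_of_mem
      (MvPolynomial.isWeightedHomogeneous_monomial wt m c rfl)]
    exact if_congr eq_comm rfl rfl
  have ha : ∀ (m : σ →₀ ℕ) (c : ℚ), aug σ (MvPolynomial.monomial m c) =
      if m = 0 then c else 0 := fun m c => by
    unfold aug
    rw [MvPolynomial.aeval_monomial]
    split_ifs with hm
    · subst hm; simp
    · obtain ⟨s, hs⟩ := Finsupp.ne_iff.mp hm
      rw [Finsupp.prod, Finset.prod_eq_zero (Finsupp.mem_support_iff.mpr hs) (zero_pow hs), mul_zero]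
  induction x using MvPolynomial.induction_on' with
  | add p q hp hq => simp only [add_mul, map_add, hp, hq, mul_add]; ring
  | monomial m c =>
    induction y using MvPolynomial.induction_on' with
    | add p q hp hq => simp only [add_mul, map_add, hp, hq, mul_add]; ring
    | monomial n d =>
      rw [MvPolynomial.monomial_mul, hc, hc, hc, ha, ha, map_add]
      by_cases hm : m = 0
      · subst hm
        by_cases hn : n = 0
        · subst hn
          simp
        · simp [hn, MvPolynomial.algebraMap_eq, MvPolynomial.C_mul_monomial]
      · have hm' := mt (hw m).mp hm
        by_cases hn : n = 0
        · subst hn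
          simp [hm, MvPolynomial.algebraMap_eq, MvPolynomial.C_mul_monomial, mul_comm]
        · have hn' := mt (hw n).mp hn
          rw [if_neg hm, if_neg hn, if_neg (by omega)]
          simp

/-- Both sides are derivations over the augmentation, so generators suffice. In weight one the
derivative is a constant; in any other weight both sides vanish. -/
theorem derivation_weightOne (i : ι) (x : MvPolynomial σ ℚ) :
    D i (MvPolynomial.weightedHomogeneousComponent wt 1 x) = algebraMap ℚ _ (aug σ (D i x)) := by
  have := leibniz_ext ((Algebra.ofId ℚ (MvPolynomial σ ℚ)).comp (aug σ))
    (f := (D i : MvPolynomial σ ℚ →ₗ[ℚ] MvPolynomial σ ℚ) ∘ₗ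
      MvPolynomial.weightedHomogeneousComponent wt 1)
    (g := Algebra.linearMap ℚ _ ∘ₗ (aug σ).toLinearMap ∘ₗ
      (D i : MvPolynomial σ ℚ →ₗ[ℚ] MvPolynomial σ ℚ)) (fun a b => ?_) (fun a b => ?_) fun s => ?_
  · exact LinearMap.congr_fun this x
  · simp only [LinearMap.comp_apply, Derivation.coeFn_coe, h.weightOne_mul, map_add,
      Derivation.leibniz, Derivation.map_algebraMap, smul_eq_mul,
      AlgHom.comp_apply, mul_zero, add_zero]
    rfl
  · simp only [LinearMap.comp_apply, Derivation.coeFn_coe, map_add, Derivation.leibniz,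
      smul_eq_mul, AlgHom.toLinearMap_apply, map_mul, AlgHom.comp_apply, Algebra.linearMap_apply]
    rfl
  · simp only [LinearMap.comp_apply, Derivation.coeFn_coe, AlgHom.toLinearMap_apply,
      Algebra.linearMap_apply]
    classical
    rw [MvPolynomial.weightedHomogeneousComponent_of_mem
      (MvPolynomial.isWeightedHomogeneous_X ℚ wt s)]
    split_ifs with hs
    · rw [h.aug_of_wt hs.symm]
    · rw [map_zero, h.aug_eq_zero_of_wt (Ne.symm hs), map_zero]

/-- Write `D x` as `(id ⊗ ε)Δ(D x) = (id ⊗ εD)(Δ x)` and replace `εD` by `D` composed with the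
projection to weight one. This is the differential equation before coordinates are chosen. -/
theorem derivation_eq (i : ι) (x : MvPolynomial σ ℚ) :
    TensorProduct.lift (LinearMap.mul ℚ (MvPolynomial σ ℚ)) ((D i : MvPolynomial σ ℚ →ₗ[ℚ]
      MvPolynomial σ ℚ).lTensor _ ((MvPolynomial.weightedHomogeneousComponent wt 1).lTensor _
        (Δ x))) = D i x := by
  have h1 : ∀ z : MvPolynomial σ ℚ ⊗[ℚ] MvPolynomial σ ℚ,
      TensorProduct.lift (LinearMap.mul ℚ (MvPolynomial σ ℚ)) ((D i : MvPolynomial σ ℚ →ₗ[ℚ]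
      MvPolynomial σ ℚ).lTensor _ ((MvPolynomial.weightedHomogeneousComponent wt 1).lTensor _ z)) =
      TensorProduct.rid ℚ _ ((aug σ).toLinearMap.lTensor _ ((D i : MvPolynomial σ ℚ →ₗ[ℚ]
      MvPolynomial σ ℚ).lTensor _ z)) := by
    intro z
    induction z using TensorProduct.induction_on with
    | zero => simp
    | add a b ha hb => simp only [map_add, ha, hb]
    | tmul a b =>
      simp only [LinearMap.lTensor_tmul, Derivation.coeFn_coe, h.derivation_weightOne,
        TensorProduct.lift.tmul, TensorProduct.rid_tmul, AlgHom.toLinearMap_apply,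
        LinearMap.mul_apply']
      rw [Algebra.smul_def, mul_comm]
  rw [h1, h.comm_apply, h.counit_right_apply]
  simp

end HopfData

end SymbPolylog

namespace SymbPolylog

/-! ### The variation matrix -/

section expansion

variable {I A B : Type} [AddCommGroup A] [Module ℚ A] [AddCommGroup B] [Module ℚ B]

/-- Dual functionals recover the right factors. The predicate `T` is carried along in order to
control which columns of the matrix can be non-zero. -/
theorem expand_of_mem_span [DecidableEq I] {b : I → B} {f : I → B →ₗ[ℚ] ℚ}
    (hf : ∀ v w, f w (b v) = if v = w then 1 else 0) {T : I → Prop} {x : B ⊗[ℚ] A}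
    (hx : x ∈ Submodule.span ℚ {x | ∃ w a, T w ∧ x = b w ⊗ₜ[ℚ] a}) :
    {w | slice (f w) x ≠ 0}.Finite ∧ (∀ w, slice (f w) x ≠ 0 → T w) ∧
      x = ∑ᶠ w, b w ⊗ₜ[ℚ] slice (f w) x := by
  have hsupp : ∀ y : B ⊗[ℚ] A, {w | slice (f w) y ≠ 0}.Finite →
      (Function.support fun w => b w ⊗ₜ[ℚ] slice (f w) y).Finite := fun y hy =>
    hy.subset fun w hw h0 => hw (by simp only [h0, TensorProduct.tmul_zero])
  induction hx using Submodule.span_induction with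
  | mem x hx =>
    obtain ⟨w, a, hw, rfl⟩ := hx
    have h1 : ∀ w', slice (f w') (b w ⊗ₜ[ℚ] a) = if w = w' then a else 0 := fun w' => by
      rw [slice_tmul, hf]
      split_ifs <;> simp
    have h2 : ∀ w', slice (f w') (b w ⊗ₜ[ℚ] a) ≠ 0 → w = w' := fun w' h0 => by
      by_contra hne
      exact h0 (by rw [h1, if_neg hne])
    refine ⟨(Set.finite_singleton w).subset fun w' h0 => (h2 w' h0).symm,
      fun w' h0 => h2 w' h0 ▸ hw, ?_⟩
    rw [finsum_eq_single _ w]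
    · rw [h1, if_pos rfl]
    · intro w' hne
      rw [h1, if_neg hne.symm, TensorProduct.tmul_zero]
  | zero => simp
  | add x y _ _ hx hy =>
    refine ⟨(hx.1.union hy.1).subset fun w hw => ?_, fun w hw => ?_, ?_⟩
    · by_contra hc
      simp only [Set.mem_union, Set.mem_ofPred_eq, not_or, not_not] at hc
      exact hw (by rw [map_add, hc.1, hc.2, add_zero])
    · by_contra hc
      apply hw
      rw [map_add, not_not.mp (mt (hx.2.1 w) hc), not_not.mp (mt (hy.2.1 w) hc), add_zero]
    · simp only [map_add, TensorProduct.tmul_add]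
      rw [finsum_add_distrib (hsupp x hx.1) (hsupp y hy.1), ← hx.2.2, ← hy.2.2]
  | smul c x _ hx =>
    refine ⟨hx.1.subset fun w hw h0 => hw (by rw [map_smul, h0, smul_zero]),
      fun w hw => hx.2.1 w fun h0 => hw (by rw [map_smul, h0, smul_zero]), ?_⟩
    simp only [map_smul, TensorProduct.tmul_smul]
    rw [← smul_finsum' c (hsupp x hx.1), ← hx.2.2]

theorem slice_assoc {C : Type} [AddCommGroup C] [Module ℚ C] (f : B →ₗ[ℚ] ℚ) (z : B ⊗[ℚ] C)
    (a : A) : slice f (TensorProduct.assoc ℚ B C A (z ⊗ₜ a)) = slice f z ⊗ₜ a := by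
  induction z using TensorProduct.induction_on with
  | zero => simp
  | add x y hx hy => simp only [TensorProduct.add_tmul, map_add, hx, hy]
  | tmul b c => simp [TensorProduct.smul_tmul']

end expansion

section restriction

variable {A : Type} [CommRing A] [Algebra ℚ A]

/-- The rows in `J` have their non-zero entries in columns in `J`. -/
def RowClosed (V : Matrix Zinf Zinf A) (J : Set Zinf) : Prop :=
  ∀ v ∈ J, ∀ w, V v w ≠ 0 → w ∈ J

omit [Algebra ℚ A] in
theorem RowClosed.finsum_eq {V : Matrix Zinf Zinf A} {J : Set Zinf} (hJ : RowClosed V J)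
    {M : Type} [AddCommMonoid M] {v : Zinf} (hv : v ∈ J) {F : Zinf → M}
    (hF : ∀ u, V v u = 0 → F u = 0) : ∑ᶠ u : J, F u = ∑ᶠ u, F u := by
  rw [finsum_set_coe_eq_finsum_mem, finsum_mem_def]
  refine finsum_congr fun u => Set.indicator_apply_eq_self.mpr fun hu => hF u ?_
  by_contra h
  exact hu (hJ v hv u h)

/-- If the rows in `J` are supported in `J`, then restricting the summation index to `J` loses
nothing. The same argument serves the other two formulas. -/
theorem CoproductFormula.restrict {Δ : A →ₐ[ℚ] A ⊗[ℚ] A} {V : Matrix Zinf Zinf A}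
    (h : CoproductFormula Δ V) {J : Set Zinf} (hJ : RowClosed V J) :
    CoproductFormula Δ (SymbPolylog.restrict V J) := by
  ext w v
  refine (congrFun (congrFun h w) v).trans ?_
  exact (hJ.finsum_eq v.2 (F := fun u => V u w ⊗ₜ[ℚ] V v u) fun u hu => by
    rw [hu, TensorProduct.tmul_zero]).symm

theorem AntipodeFormula.restrict {S : A →ₗ[ℚ] A} {V : Matrix Zinf Zinf A}
    (h : AntipodeFormula S V) {J : Set Zinf} (hJ : RowClosed V J) :
    AntipodeFormula S (SymbPolylog.restrict V J) := by
  classical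
  have h1 : ∀ v w : J, (1 : Matrix Zinf Zinf A) v w = (1 : Matrix J J A) v w := fun v w => by
    rw [Matrix.one_apply, Matrix.one_apply]
    exact if_congr Subtype.ext_iff.symm rfl rfl
  refine ⟨Matrix.ext fun v w => ?_, Matrix.ext fun v w => ?_⟩
  · have h2 := congrFun (congrFun h.1 v) w
    refine ((hJ.finsum_eq v.2 (F := fun u => S (V v u) * V u w) fun u hu => by
      rw [hu, map_zero, zero_mul]).trans h2).trans ?_
    convert h1 v w
  · have h2 := congrFun (congrFun h.2 v) w
    refine ((hJ.finsum_eq v.2 (F := fun u => V v u * S (V u w)) fun u hu => by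
      rw [hu, zero_mul]).trans h2).trans ?_
    convert h1 v w

theorem DifferentialEquation.restrict {M : Type} [AddCommGroup M] [Module ℚ M] [Module A M]
    {D : Derivation ℚ A M} {pr : A →ₗ[ℚ] A} {V : Matrix Zinf Zinf A}
    (h : DifferentialEquation D pr V) {J : Set Zinf} (hJ : RowClosed V J) :
    DifferentialEquation D pr (SymbPolylog.restrict V J) := fun v w =>
  (h v w).trans (hJ.finsum_eq v.2 (F := fun u => V u w • D (pr (V v u))) fun u hu => by
    rw [hu, map_zero, map_zero, smul_zero]).symm

end restriction

namespace HopfData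

variable {σ ι : Type} {wt : σ → ℕ}
  {Δ : MvPolynomial σ ℚ →ₐ[ℚ] MvPolynomial σ ℚ ⊗[ℚ] MvPolynomial σ ℚ}
  {D : ι → Derivation ℚ (MvPolynomial σ ℚ) (MvPolynomial σ ℚ)}

/-- The variation matrix, in terms of functionals dual to the index vectors. -/
def variation (Δ : MvPolynomial σ ℚ →ₐ[ℚ] MvPolynomial σ ℚ ⊗[ℚ] MvPolynomial σ ℚ)
    (sym : Zinf → MvPolynomial σ ℚ) (f : Zinf → MvPolynomial σ ℚ →ₗ[ℚ] ℚ) :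
    Matrix Zinf Zinf (MvPolynomial σ ℚ) := fun v w => slice (f w) (Δ (sym v))

variable {sym : Zinf → MvPolynomial σ ℚ} {f : Zinf → MvPolynomial σ ℚ →ₗ[ℚ] ℚ}
 (hf : ∀ v w, f w (sym v) = if v = w then 1 else 0) {T : Zinf → Zinf → Prop}
  (hmem : ∀ v, Δ (sym v) ∈ Submodule.span ℚ {x | ∃ w a, T v w ∧ x = sym w ⊗ₜ[ℚ] a})

include hf hmem

theorem rel_of_variation_ne_zero {v w : Zinf} (h : variation Δ sym f v w ≠ 0) : T v w :=
  (expand_of_mem_span hf (hmem v)).2.1 w h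

theorem isVariationMatrix : IsVariationMatrix Δ sym (variation Δ sym f) := fun v =>
  ⟨(expand_of_mem_span hf (hmem v)).1, (expand_of_mem_span hf (hmem v)).2.2⟩

omit hmem in
theorem eq_variation {V : Matrix Zinf Zinf (MvPolynomial σ ℚ)} (hV : IsVariationMatrix Δ sym V) :
    V = variation Δ sym f := by
  ext1 v w
  have h1 : (Function.support fun w => sym w ⊗ₜ[ℚ] V v w).Finite :=
    (hV v).1.subset fun w hw h0 => hw (by simp only [h0, TensorProduct.tmul_zero])
  unfold variation
  rw [(hV v).2, ← LinearMap.toAddMonoidHom_coe, AddMonoidHom.map_finsum _ h1,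
    finsum_eq_single _ w]
  · simp [hf]
  · intro w' hne
    simp [hf, hne]

theorem coprod_sym (v : Zinf) : ∃ F : Finset Zinf, (∀ w, variation Δ sym f v w ≠ 0 → w ∈ F) ∧
    Δ (sym v) = ∑ w ∈ F, sym w ⊗ₜ[ℚ] variation Δ sym f v w := by
  obtain ⟨h1, h2⟩ := isVariationMatrix hf hmem v
  refine ⟨h1.toFinset, fun w hw => h1.mem_toFinset.mpr hw, h2.trans ?_⟩
  refine finsum_eq_sum_of_support_subset _ fun w hw => ?_
  rw [Finset.mem_coe, h1.mem_toFinset]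
  exact fun h0 => hw (by simp only [h0, TensorProduct.tmul_zero])

variable (h : HopfData wt Δ D)
include h

/-- Apply the functional dual to `w` on the first factor of the coassociativity identity for `sym
v`. The finite set `F` does not depend on `w`, so it can be used for entire rows. -/
theorem coprod_variation (v : Zinf) :
    ∃ F : Finset Zinf, (∀ w, variation Δ sym f v w ≠ 0 → w ∈ F) ∧ ∀ w,
    Δ (variation Δ sym f v w) =
      ∑ u ∈ F, variation Δ sym f u w ⊗ₜ[ℚ] variation Δ sym f v u := by
  obtain ⟨F, hF, hsum⟩ := coprod_sym hf hmem v
  refine ⟨F, hF, fun w => ?_⟩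
  have h1 := congrArg (slice (f w)) (LinearMap.congr_fun h.coassoc (sym v))
  simp only [LinearMap.comp_apply, AlgHom.toLinearMap_apply] at h1
  rw [slice_lTensor] at h1
  refine h1.symm.trans ?_
  rw [hsum]
  simp only [map_sum, LinearMap.rTensor_tmul, LinearEquiv.coe_coe, slice_assoc,
    AlgHom.toLinearMap_apply]
  rfl

-- The right counit law, sliced with the functional dual to `w`.
omit hmem in
theorem aug_variation (v w : Zinf) : aug σ (variation Δ sym f v w) = if v = w then 1 else 0 := by
  have h1 := slice_lTensor (f w) (aug σ).toLinearMap (Δ (sym v))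
  rw [h.counit_right_apply, slice_tmul, hf, smul_eq_mul, mul_one] at h1
  exact h1.symm

theorem coproductFormula : CoproductFormula Δ (variation Δ sym f) := by
  ext1 w v
  obtain ⟨F, hF, hsum⟩ := coprod_variation hf hmem h v
  refine (hsum w).trans (finsum_eq_sum_of_support_subset _ fun u hu => ?_).symm
  refine hF u fun h0 => hu ?_
  simp only [h0, TensorProduct.tmul_zero]

/-- Evaluate the antipode axioms on the entries of the matrix, whose augmentation is the identity
matrix. The coproduct formula is transposed, so the right antipode axiom gives `S(V)V` and the left
one gives `V S(V)`. -/
theorem antipodeFormula {S : MvPolynomial σ ℚ →ₗ[ℚ] MvPolynomial σ ℚ} (hS : IsHopf Δ (aug σ) S) :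
    AntipodeFormula S (variation Δ sym f) := by
  have h1 : ∀ v w, algebraMap ℚ (MvPolynomial σ ℚ) (aug σ (variation Δ sym f v w)) =
      if v = w then 1 else 0 := by
    intro v w
    rw [aug_variation hf h]
    split_ifs <;> simp
  constructor
  · ext1 v w
    obtain ⟨F, hF, hsum⟩ := coprod_variation hf hmem h v
    refine Eq.trans ?_ (@Matrix.one_apply _ _ (fun a b => Classical.propDecidable (a = b)) _ _
      v w).symm
    refine Eq.trans ?_ (Eq.trans (h1 v w) (by congr))
    refine Eq.trans ?_ (LinearMap.congr_fun hS.antipode_right (variation Δ sym f v w))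
    simp only [LinearMap.comp_apply, AlgHom.toLinearMap_apply, hsum, map_sum,
      LinearMap.lTensor_tmul, LinearMap.mul'_apply]
    refine (finsum_eq_sum_of_support_subset _ fun u hu => ?_).trans
      (Finset.sum_congr rfl fun u _ => mul_comm _ _)
    refine hF u fun h0 => hu ?_
    simp only [Matrix.map_apply, h0, map_zero, zero_mul]
  · ext1 v w
    obtain ⟨F, hF, hsum⟩ := coprod_variation hf hmem h v
    refine Eq.trans ?_ (@Matrix.one_apply _ _ (fun a b => Classical.propDecidable (a = b)) _ _
      v w).symm
    refine Eq.trans ?_ (Eq.trans (h1 v w) (by congr))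
    refine Eq.trans ?_ (LinearMap.congr_fun hS.antipode_left (variation Δ sym f v w))
    simp only [LinearMap.comp_apply, AlgHom.toLinearMap_apply, hsum, map_sum,
      LinearMap.rTensor_tmul, LinearMap.mul'_apply]
    refine (finsum_eq_sum_of_support_subset _ fun u hu => ?_).trans
      (Finset.sum_congr rfl fun u _ => mul_comm _ _)
    refine hF u fun h0 => hu ?_
    simp only [h0, zero_mul]

/-- Each coordinate of the module-valued derivation is one of the `D i`; apply `derivation_eq` to
the entries and insert their coproducts. -/
theorem differentialEquation {X : Type}
    {𝔻 : Derivation ℚ (MvPolynomial σ ℚ) (X →₀ MvPolynomial σ ℚ)}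
    (h𝔻 : ∀ β, ∃ i, ∀ a, 𝔻 a β = D i a) :
    DifferentialEquation 𝔻 (MvPolynomial.weightedHomogeneousComponent wt 1)
      (variation Δ sym f) := by
  intro v w
  obtain ⟨F, hF, hsum⟩ := coprod_variation hf hmem h v
  rw [finsum_eq_sum_of_support_subset (s := F) _ fun u hu => ?_]
  · ext1 β
    obtain ⟨i, hi⟩ := h𝔻 β
    rw [hi, ← h.derivation_eq i, hsum, Finsupp.finsetSum_apply]
    simp only [map_sum, LinearMap.lTensor_tmul, TensorProduct.lift.tmul, LinearMap.mul_apply',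
      Finsupp.smul_apply, smul_eq_mul, hi]
    rfl
  · refine hF u fun h0 => hu ?_
    simp only [h0, map_zero, smul_zero]

/-- All statements about the variation matrix, including those for submatrices. -/
theorem main {X : Type} {𝔻 : Derivation ℚ (MvPolynomial σ ℚ) (X →₀ MvPolynomial σ ℚ)}
    (h𝔻 : ∀ β, ∃ i, ∀ a, 𝔻 a β = D i a) (hfin : ∀ n : Zinf, n.IsPositive → n.finIndex.Finite)
    (hbox : ∀ n : Zinf, n.IsPositive → n.IsDecreasing → n.boxIndex.Finite)
    (hTfin : ∀ n : Zinf, n.IsPositive → ∀ v ∈ n.finIndex, ∀ w, T v w → w ∈ n.finIndex)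
    (hTbox : ∀ n : Zinf, n.IsPositive → n.IsDecreasing → ∀ v ∈ n.boxIndex, ∀ w, T v w →
      w ∈ n.boxIndex) :
    ∃ (V : Matrix Zinf Zinf (MvPolynomial σ ℚ)) (S : MvPolynomial σ ℚ →ₗ[ℚ] MvPolynomial σ ℚ),
      (IsVariationMatrix Δ sym V ∧ ∀ V' : Matrix Zinf Zinf (MvPolynomial σ ℚ),
        IsVariationMatrix Δ sym V' → V' = V) ∧
      (IsHopf Δ (aug σ) S ∧ ∀ S' : MvPolynomial σ ℚ →ₗ[ℚ] MvPolynomial σ ℚ,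
        IsLeftAntipode Δ (aug σ) S' → S' = S) ∧
      (CoproductFormula Δ V ∧ AntipodeFormula S V ∧
        DifferentialEquation 𝔻 (MvPolynomial.weightedHomogeneousComponent wt 1) V) ∧
      (∀ n : Zinf, n.IsPositive →
        n.finIndex.Finite ∧ CoproductFormula Δ (restrict V n.finIndex) ∧
          AntipodeFormula S (restrict V n.finIndex) ∧
          DifferentialEquation 𝔻 (MvPolynomial.weightedHomogeneousComponent wt 1)
            (restrict V n.finIndex)) ∧
      (∀ n : Zinf, n.IsPositive → n.IsDecreasing →
        n.boxIndex.Finite ∧ CoproductFormula Δ (restrict V n.boxIndex) ∧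
          AntipodeFormula S (restrict V n.boxIndex) ∧
          DifferentialEquation 𝔻 (MvPolynomial.weightedHomogeneousComponent wt 1)
            (restrict V n.boxIndex)) := by
  have h1 := coproductFormula hf hmem h
  have h2 := antipodeFormula hf hmem h h.isHopf.1
  have h3 := differentialEquation hf hmem h h𝔻
  refine ⟨variation Δ sym f, (antipode wt Δ).toLinearMap,
    ⟨isVariationMatrix hf hmem, fun V' hV' => eq_variation hf hV'⟩, h.isHopf, ⟨h1, h2, h3⟩,
    fun n hn => ?_, fun n hn hn' => ?_⟩
  · have hJ : RowClosed (variation Δ sym f) n.finIndex := fun v hv w hvw =>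
      hTfin n hn v hv w (rel_of_variation_ne_zero hf hmem hvw)
    exact ⟨hfin n hn, h1.restrict hJ, h2.restrict hJ, h3.restrict hJ⟩
  · have hJ : RowClosed (variation Δ sym f) n.boxIndex := fun v hv w hvw =>
      hTbox n hn hn' v hv w (rel_of_variation_ne_zero hf hmem hvw)
    exact ⟨hbox n hn hn', h1.restrict hJ, h2.restrict hJ, h3.restrict hJ⟩

end HopfData

end SymbPolylog

namespace SymbPolylog

open MvPowerSeries

/-! ### The Hopf algebra `ℍ̄` -/

theorem PolySymbol.weight_pos (s : PolySymbol) : 0 < s.weight := by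
  have := s.n_pos ⟨0, s.depth_pos⟩
  exact this.trans_le (Finset.single_le_sum (f := s.n) (fun _ _ => Nat.zero_le _)
    (Finset.mem_univ _))

theorem GenBar.weight_pos (g : GenBar) : 0 < g.weight := by
  cases g with
  | log r => exact Nat.one_pos
  | reg s => exact s.weight_pos
  | inv s => exact s.weight_pos

theorem upSymbol_weight {d : ℕ} (hd : 0 < d) {e : ℕ → ℕ} (he : Up d e) {n : ℕ → ℕ}
    (hn : ∀ k, 0 < n k) : (upSymbol hd he hn).weight = ∑ k ∈ Finset.range d, n k :=
  (Finset.sum_range n).symm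

theorem downSymbol_weight {d : ℕ} (hd : 0 < d) {e : ℕ → ℕ} (he : Down d e) {n : ℕ → ℕ}
    (hn : ∀ k, 0 < n k) : (downSymbol hd he hn).weight = ∑ k ∈ Finset.range d, n k := by
  rw [Finset.sum_range n]
  exact Equiv.sum_comp Fin.revPerm fun k : Fin d => n k

theorem GenBar.weight_eq {g : GenBar} {d : ℕ} (hd : 0 < d) {e n : ℕ → ℕ}
    (he : Up d e ∨ Down d e) (hn : ∀ k, 0 < n k)
    (hg : (MvPolynomial.X g : HBar) = bracketHBar d (fun a => e a) fun k => n k) :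
    g.weight = ∑ k ∈ Finset.range d, n k := by
  rcases he with he | he
  · rw [bracketHBar_up hd he hn] at hg
    rw [MvPolynomial.X_injective hg]
    exact upSymbol_weight hd he hn
  · rw [bracketHBar_down hd he hn] at hg
    rw [MvPolynomial.X_injective hg]
    exact downSymbol_weight hd he hn

theorem Interlaced.le_last {k : ℕ} {I J : ℕ → ℕ} (h : Interlaced k I J) {a : ℕ} (ha : a ≤ k) :
    I a ≤ I k := h.mono ha

theorem Interlaced.I_lt {k : ℕ} {I J : ℕ → ℕ} (h : Interlaced k I J) {a b : ℕ} (hab : a < b)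
    (hb : b ≤ k) : I a < I b := by
  have h1 := h a (by omega)
  have h2 : I (a + 1) ≤ I b := Interlaced.mono (n := b) (fun α hα => h α (by omega)) hab
  omega

theorem Interlaced.J_lt {k : ℕ} {I J : ℕ → ℕ} (h : Interlaced k I J) {a b : ℕ} (hab : a < b)
    (hb : b < k) : J a < J b := by
  have h1 := h a (by omega)
  have h2 := h b hb
  have h3 : I (a + 1) ≤ I b := Interlaced.mono (n := b) (fun α hα => h α (by omega)) hab
  omega

theorem Interlaced.upDown {k d : ℕ} {I J e : ℕ → ℕ} (h : Interlaced k I J) (hd : I k = d)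
    (he : Up d e ∨ Down d e) : Up k (fun a => e (I a)) ∨ Down k fun a => e (I a) :=
  he.imp (fun he _ _ hab hb => he _ _ (h.I_lt hab hb) (hd ▸ h.le_last hb))
    fun he _ _ hab hb => he _ _ (h.I_lt hab hb) (hd ▸ h.le_last hb)

/-- Merging letters lowers the weight, except for the trivial merge. -/
theorem Interlaced.sum_lt {k d : ℕ} {I J n n' : ℕ → ℕ} (h : Interlaced k I J) (hd : I k = d)
    (hn : ∀ a, 0 < n a) (hle : ∀ α < k, n' α ≤ n (J α)) (hlt : k = d → ∃ α < d, n' α < n (J α)) :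
    ∑ α ∈ Finset.range k, n' α < ∑ a ∈ Finset.range d, n a := by
  have hinj : Set.InjOn J (Finset.range k) := by
    intro a ha b hb hab
    rw [Finset.coe_range, Set.mem_Iio] at ha hb
    by_contra hne
    rcases Nat.lt_or_gt_of_ne hne with h1 | h1
    · have := h.J_lt h1 hb; omega
    · have := h.J_lt h1 ha; omega
  have hsub : (Finset.range k).image J ⊆ Finset.range d := by
    intro x hx
    obtain ⟨α, hα, rfl⟩ := Finset.mem_image.mp hx
    have hα := Finset.mem_range.mp hα
    have h1 := (h α hα).2
    have h2 : I (α + 1) ≤ I k := h.le_last hα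
    rw [Finset.mem_range]
    omega
  have h1 : ∑ α ∈ Finset.range k, n (J α) = ∑ a ∈ (Finset.range k).image J, n a :=
    (Finset.sum_image hinj).symm
  have h2 : ∑ α ∈ Finset.range k, n' α ≤ ∑ α ∈ Finset.range k, n (J α) :=
    Finset.sum_le_sum fun α hα => hle α (Finset.mem_range.mp hα)
  have h3 : ∑ a ∈ (Finset.range k).image J, n a ≤ ∑ a ∈ Finset.range d, n a :=
    Finset.sum_le_sum_of_subset hsub
  by_cases hk : k = d
  · obtain ⟨α, hα, hlt⟩ := hlt hk
    have h4 : ∑ α ∈ Finset.range k, n' α < ∑ α ∈ Finset.range k, n (J α) :=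
      Finset.sum_lt_sum (fun α hα => hle α (Finset.mem_range.mp hα))
        ⟨α, Finset.mem_range.mpr (by omega), hlt⟩
    omega
  · have hkd : k ≤ d := hd ▸ h.le_apply le_rfl
    -- There are fewer than `d` marks, so some letter is unmarked and its positive weight is lost.
    have hex : ∃ a ∈ Finset.range d, a ∉ (Finset.range k).image J := by
      by_contra hcon
      push Not at hcon
      have := Finset.card_le_card hcon
      have h5 := Finset.card_image_le (s := Finset.range k) (f := J)
      simp only [Finset.card_range] at this h5
      omega
    obtain ⟨a, ha, ha'⟩ := hex
    have h4 := Finset.sum_lt_sum_of_subset hsub ha ha' (hn a) fun _ _ _ => Nat.zero_le _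
    omega

/-- Symbols of smaller weight, and `1`. -/
theorem bracketHBar_eq_one_or {d N : ℕ} {e n : ℕ → ℕ} (he : Up d e ∨ Down d e)
    (hn : ∀ k, 0 < n k) (hN : ∑ k ∈ Finset.range d, n k = N) :
    (bracketHBar d (fun a => e a) (fun k => n k) = 1 ∧ N = 0) ∨ ∃ t : GenBar, t.weight = N ∧
      bracketHBar d (fun a => e a) (fun k => n k) = MvPolynomial.X t := by
  rcases Nat.eq_zero_or_pos d with rfl | hd
  · exact Or.inl ⟨bracketHBar_zero _ _, hN.symm⟩
  · obtain ⟨t, ht⟩ := exists_gen hd he hn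
    exact Or.inr ⟨t, (GenBar.weight_eq hd he hn ht).trans hN, ht.symm⟩

theorem counitL_eq (z : HBar ⊗[ℚ] HBar) :
    (TensorProduct.lid ℚ HBar) (counitHBar.toLinearMap.rTensor _ z) = counitL z := by
  induction z using TensorProduct.induction_on with
  | zero => simp
  | add x y hx hy => simp only [map_add, hx, hy]
  | tmul a b => simp [counitL, augBar, Algebra.smul_def]

theorem counitR_eq (z : HBar ⊗[ℚ] HBar) :
    (TensorProduct.rid ℚ HBar) (counitHBar.toLinearMap.lTensor _ z) = counitR z := by
  induction z using TensorProduct.induction_on with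
  | zero => simp
  | add x y hx hy => simp only [map_add, hx, hy]
  | tmul a b => simp [counitR, augBar, Algebra.smul_def, mul_comm]

/-- Assembles the compatibility with derivations, the separation property and the two triangularity
statements; all constructions for Hopf algebras and matrices are made from this data. -/
theorem hopfDataHBar : HopfData GenBar.weight coprodHBar
    fun p : (ℕ → ℕ → ℚ) × (ℕ → ℚ) => dbar p.1 p.2 where
  wt_pos := GenBar.weight_pos
  counit_left := LinearMap.ext fun x => (TensorProduct.lid ℚ HBar).injective <| by
    have := counitL_eq (coprodHBar x)
    rw [counitL_coprod] at this
    exact this.trans (by simp)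
  counit_right := LinearMap.ext fun x => (TensorProduct.rid ℚ HBar).injective <| by
    have := counitR_eq (coprodHBar x)
    rw [counitR_coprod] at this
    exact this.trans (by simp)
  comm p := lTensor_dbar_coprod p.1 p.2
  ker P hP := HBar.eq_C_of_dbar fun o l => hP (o, l)
  low p g := by
    refine HBar.induction_gen (P := fun x => ∀ g : GenBar, MvPolynomial.X g = x →
      dbar p.1 p.2 x ∈ Submodule.span ℚ {P | (P = 1 ∧ g.weight = 1) ∨
      ∃ t : GenBar, t.weight + 1 = g.weight ∧ P = MvPolynomial.X t}) (fun r g hg => ?_)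
      (fun d e n hd he hn g hg => ?_) g g rfl
    · rw [dbar_log, Algebra.algebraMap_eq_smul_one]
      refine Submodule.smul_mem _ _ (Submodule.subset_span (Or.inl ⟨rfl, ?_⟩))
      rw [MvPolynomial.X_injective hg]
      rfl
    · rw [GenBar.weight_eq hd he hn hg]
      refine dbar_bracket_mem p.1 p.2 hd he hn _ fun d' e' n' he' _ hn' hsum => ?_
      refine Submodule.subset_span ?_
      rcases bracketHBar_eq_one_or he' hn' rfl with ⟨h1, h2⟩ | ⟨t, h1, h2⟩
      · exact Or.inl ⟨h1, by omega⟩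
      · exact Or.inr ⟨t, by omega, h2⟩
  tri g := by
    refine HBar.induction_gen (P := fun x => ∀ g : GenBar, MvPolynomial.X g = x →
      coprodHBar x - x ⊗ₜ 1 ∈ Submodule.span ℚ {x | ∃ (m a : HBar), (m = 1 ∨
      ∃ t : GenBar, t.weight < g.weight ∧ m = MvPolynomial.X t) ∧ x = m ⊗ₜ[ℚ] a}) (fun r g hg => ?_)
      (fun d e n hd he hn g hg => ?_) g g rfl
    · rw [coprodHBar_log, add_sub_cancel_left]
      exact Submodule.subset_span ⟨1, _, Or.inl rfl, rfl⟩
    · rw [GenBar.weight_eq hd he hn hg]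
      refine coprod_bracket_mem hd he hn _ fun k I J n' hIJ hId hn' hle hlt a => ?_
      refine Submodule.subset_span ⟨_, a, ?_, rfl⟩
      rcases bracketHBar_eq_one_or (hIJ.upDown hId he) hn' rfl with ⟨h1, h2⟩ | ⟨t, h1, h2⟩
      · exact Or.inl h1
      · exact Or.inr ⟨t, h1 ▸ hIJ.sum_lt hId hn hle hlt, h2⟩

/-! ### Components of the derivations -/

theorem map_derivCoeff {A M : Type} [CommRing A] [Algebra ℚ A] [AddCommGroup M] [Module A M]
    (φ : M →ₗ[A] A) {br : ∀ d : ℕ, (Fin (d + 1) → ℕ) → (Fin d → ℕ) → A} {dlog done δ : ℕ → ℕ → M}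
    {o : ℕ → ℕ → ℚ} {l : ℕ → ℚ} {d : ℕ} {e : ℕ → ℕ}
    (h1 : ∀ k < d, φ (dlog (e k) (e (k + 1))) = algebraMap ℚ A (l (e (k + 1)) - l (e k)))
    (h2 : ∀ k < d, φ (done (e k) (e (k + 1))) = algebraMap ℚ A (o (e k) (e (k + 1))))
    (h3 : ∀ k < d, φ (δ (e k) (e (k + 1))) = algebraMap ℚ A (o (e (k + 1)) (e k))) (m : ℕ →₀ ℕ) :
    φ (derivCoeff br dlog done δ d e m) = scalarCoeff br o l d e m := by
  unfold scalarCoeff derivCoeff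
  simp only [map_sub φ, map_add φ, map_sum φ, map_smul φ]
  congr 1
  · congr 1 <;> refine Finset.sum_congr rfl fun k hk => ?_
    · rw [h1 k (Finset.mem_range.mp hk)]
    · rw [h2 k (Finset.mem_range.mp hk)]
  · refine Finset.sum_congr rfl fun k hk => ?_
    rw [h3 k (by have := Finset.mem_range.mp hk; omega)]

theorem sum_Ico_indicator {A : Type} [CommRing A] (r a b : ℕ) :
    ∑ i ∈ Finset.Ico a b, (if i = r then (1 : A) else 0)
      - ∑ i ∈ Finset.Ico b a, (if i = r then (1 : A) else 0) =
      (if r < b then 1 else 0) - if r < a then 1 else 0 := by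
  rw [Finset.sum_ite_eq', Finset.sum_ite_eq']
  simp only [Finset.mem_Ico]
  by_cases h1 : r < a <;> by_cases h2 : r < b
  · rw [if_neg (by omega), if_neg (by omega), if_pos h1, if_pos h2]; ring
  · rw [if_neg (by omega), if_pos (by omega), if_pos h1, if_neg h2]
  · rw [if_pos (by omega), if_neg (by omega), if_neg h1, if_pos h2]
  · rw [if_neg (by omega), if_neg (by omega), if_neg h1, if_neg h2]

theorem derivHBar_eq_dbar {φ : DHBar →ₗ[HBar] HBar} {o : ℕ → ℕ → ℚ} {l : ℕ → ℚ}
    (h1 : ∀ a b, φ (dOneBar a b) = algebraMap ℚ HBar (o a b))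
    (h2 : ∀ a b, φ (dLogBar a b) = algebraMap ℚ HBar (l b - l a)) (x : HBar) :
    φ (derivHBar x) = dbar o l x := by
  have h : φ.compDer derivHBar = dbar o l := by
    refine MvPolynomial.derivation_ext fun g => ?_
    change φ (derivHBar (MvPolynomial.X g)) = _
    rw [derivHBar, MvPolynomial.mkDerivation_X]
    cases g with
    | log r =>
      rw [dbar_log, ← h2 r (r + 1)]
      simp [dLogBar]
    | reg s =>
      rw [dbar_reg]
      exact map_derivCoeff φ (fun _ _ => h2 _ _) (fun _ _ => h1 _ _) (fun _ _ => h1 _ _) _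
    | inv s =>
      rw [dbar_inv]
      exact map_derivCoeff φ (fun _ _ => h2 _ _) (fun _ _ => h1 _ _) (fun _ _ => h1 _ _) _
  exact DFunLike.congr_fun h x

/-- The coordinate at `one a b` has the indicator of `(a, b)` as `o` and `l = 0`. The coordinate at
`log r` has `o = 0`, and `l` jumps between `r` and `r + 1`. -/
theorem derivHBar_component (β : DGenBar) :
    ∃ p : (ℕ → ℕ → ℚ) × (ℕ → ℚ), ∀ x, derivHBar x β = dbar p.1 p.2 x := by
  classical
  cases β with
  | one a b hab =>
    refine ⟨(fun x y => if x = a ∧ y = b then 1 else 0, 0), fun x =>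
      derivHBar_eq_dbar (φ := Finsupp.lapply (DGenBar.one a b hab)) (fun x y => ?_)
        (fun x y => ?_) x⟩
    · rw [Finsupp.lapply_apply, dOneBar]
      dsimp only
      by_cases hxy : x = a ∧ y = b
      · obtain ⟨rfl, rfl⟩ := hxy
        simp [hab]
      · rw [if_neg hxy]
        split_ifs
        · rw [Finsupp.single_eq_of_ne, map_zero]
          intro h
          simp only [DGenBar.one.injEq] at h
          exact hxy ⟨h.1.symm, h.2.symm⟩
        · simp
    · simp [dLogBar]
  | log r =>
    refine ⟨(0, fun x => if r < x then 1 else 0), fun x =>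
      derivHBar_eq_dbar (φ := Finsupp.lapply (DGenBar.log r)) (fun x y => ?_)
        (fun x y => ?_) x⟩
    · rw [Finsupp.lapply_apply, dOneBar]
      split_ifs <;> simp
    · have := sum_Ico_indicator (A := HBar) r x y
      simp only [dLogBar, Finsupp.lapply_apply, Finsupp.sub_apply, Finsupp.finsetSum_apply,
        Finsupp.single_apply, DGenBar.log.injEq]
      rw [this]
      split_ifs <;> simp

end SymbPolylog

namespace SymbPolylog

/-! ### Index vectors and symbols -/

namespace Zinf

/-- The number of non-zero entries. -/
def depth (v : Zinf) : ℕ := v.pos.length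

/-- The positions of the non-zero entries, followed by the dimension. -/
def brk (v : Zinf) (a : ℕ) : ℕ := (v.pos ++ [v.dim]).getD a 0

/-- The non-zero entries, continued by ones. -/
def wts (v : Zinf) (k : ℕ) : ℕ := if k < v.depth then v.entry (v.pos.getD k 0) else 1

theorem mem_pos {v : Zinf} {p : ℕ} : p ∈ v.pos ↔ v.entry p ≠ 0 := by
  unfold pos entry
  rw [List.mem_filter, List.mem_range, decide_eq_true_iff]
  refine ⟨fun h => h.2, fun h => ⟨?_, h⟩⟩
  by_contra hp
  exact h (List.getD_eq_default _ _ (by omega))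

theorem pos_pairwise (v : Zinf) : v.pos.Pairwise (· < ·) := List.Pairwise.filter _ List.pairwise_lt_range

theorem entry_eq_zero {v : Zinf} {p : ℕ} (h : v.dim ≤ p) : v.entry p = 0 :=
  List.getD_eq_default _ _ h

theorem brk_of_lt {v : Zinf} {a : ℕ} (h : a < v.depth) : v.brk a = v.pos.getD a 0 :=
  List.getD_append _ _ _ _ h

theorem brk_depth (v : Zinf) : v.brk v.depth = v.dim := by
  unfold brk depth
  rw [List.getD_append_right _ _ _ _ le_rfl, Nat.sub_self]
  rfl

theorem wts_eq {v : Zinf} {k : ℕ} (h : k < v.depth) : v.wts k = v.entry (v.brk k) := by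
  rw [wts, if_pos h, brk_of_lt h]

theorem entry_brk {v : Zinf} {a : ℕ} (h : a < v.depth) : v.entry (v.brk a) ≠ 0 := by
  rw [brk_of_lt h, List.getD_eq_getElem _ _ h]
  exact mem_pos.mp (List.getElem_mem h)

theorem exists_brk {v : Zinf} {p : ℕ} (h : v.entry p ≠ 0) : ∃ a < v.depth, v.brk a = p := by
  obtain ⟨a, ha, hp⟩ := List.getElem_of_mem (mem_pos.mpr h)
  refine ⟨a, ha, ?_⟩
  rw [brk_of_lt ha, List.getD_eq_getElem _ _ ha, hp]

theorem wts_pos (v : Zinf) (k : ℕ) : 0 < v.wts k := by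
  by_cases h : k < v.depth
  · rw [wts_eq h]
    exact Nat.pos_of_ne_zero (entry_brk h)
  · rw [wts, if_neg h]
    exact Nat.one_pos

theorem brk_up (v : Zinf) : Up v.depth v.brk := by
  intro a b hab hb
  rcases Nat.lt_or_ge b v.depth with h | h
  · rw [brk_of_lt h, brk_of_lt (hab.trans h), List.getD_eq_getElem _ _ h,
      List.getD_eq_getElem _ _ (hab.trans h)]
    exact List.pairwise_iff_getElem.mp v.pos_pairwise a b _ _ hab
  · obtain rfl : b = v.depth := le_antisymm hb h
    rw [brk_depth]
    by_contra hcon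
    exact entry_brk hab (entry_eq_zero (by omega))

theorem symbol_eq {A : Type} (br : ∀ d : ℕ, (Fin (d + 1) → ℕ) → (Fin d → ℕ) → A) (v : Zinf) :
    symbol br v = br v.depth (fun a => v.brk a) fun k => v.wts k := by
  unfold symbol depth brk
  congr 1
  funext k
  exact (if_pos k.2).symm

theorem depth_pos_of_ne {v : Zinf} (h : v ≠ zero) : 0 < v.depth := by
  obtain ⟨l, rfl | ⟨a, ha, h0⟩⟩ := v
  · exact absurd rfl h
  · obtain ⟨p, hp, rfl⟩ := List.getElem_of_mem ha
    refine List.length_pos_of_mem (a := p) (mem_pos.mpr ?_)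
    unfold entry
    rw [List.getD_eq_getElem _ _ hp]
    exact h0

theorem ext_entry {v w : Zinf} (hd : v.dim = w.dim) (h : ∀ p, v.entry p = w.entry p) : v = w := by
  refine Subtype.ext (List.ext_getElem hd fun p h1 h2 => ?_)
  have := h p
  unfold entry at this
  rwa [List.getD_eq_getElem _ _ h1, List.getD_eq_getElem _ _ h2] at this

theorem ext_symbol {v w : Zinf}
    (h : SameSymbol v.depth v.brk v.wts w.depth w.brk w.wts) : v = w := by
  obtain ⟨h1, h2, h3⟩ := h
  refine ext_entry ?_ fun p => ?_
  · rw [← brk_depth, ← brk_depth, h2 _ le_rfl, h1]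
  · by_cases hp : v.entry p = 0
    · by_contra hne
      obtain ⟨a, ha, rfl⟩ := exists_brk (v := w) (p := p) fun h => hne (hp.trans h.symm)
      rw [← h2 a (by omega)] at hp
      exact entry_brk (h1 ▸ ha) hp
    · obtain ⟨a, ha, rfl⟩ := exists_brk hp
      rw [← wts_eq ha, h3 a ha, wts_eq (h1 ▸ ha), h2 a ha.le]

theorem norm_eq (v : Zinf) : v.norm = ∑ k ∈ Finset.range v.depth, v.wts k := by
  have h1 : ∀ (l : List ℕ) (f : ℕ → ℕ), ((l.filter fun p => f p ≠ 0).map f).sum = (l.map f).sum := by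
    intro l f
    induction l with
    | nil => rfl
    | cons a l ih =>
      rw [List.filter_cons]
      by_cases h : f a = 0
      · simpa [h] using ih
      · simpa [h] using ih
  have h2 : v.1 = (List.range v.1.length).map fun p => v.1.getD p 0 :=
    List.ext_getElem (by simp) fun p h1 h2 => by
      rw [List.getElem_map, List.getElem_range, List.getD_eq_getElem _ _ h1]
  have h3 : v.norm = (v.pos.map v.entry).sum := by
    have := h1 (List.range v.1.length) fun p => v.1.getD p 0
    rw [← h2] at this
    exact this.symm
  have h4 : v.pos.map v.entry = (List.range v.depth).map v.wts := by
    refine List.ext_getElem (by simp [depth]) fun p h1 h2 => ?_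
    have hp : p < v.depth := by simpa using h2
    rw [List.getElem_map, List.getElem_map, List.getElem_range, wts_eq hp, brk_of_lt hp,
      List.getD_eq_getElem _ _ hp]
    rfl
  rw [h3, h4]
  rfl

/-- The index vector with given positions and values of the non-zero entries, and given
dimension. -/
theorem exists_of_seq {k : ℕ} {e n : ℕ → ℕ} (hk : 0 < k) (he : Up k e) (hn : ∀ a, 0 < n a) :
    ∃ w : Zinf, SameSymbol w.depth w.brk w.wts k e n := by
  classical
  let val : ℕ → ℕ := fun p => ∑ α ∈ Finset.range k, if e α = p then n α else 0
  have hval : ∀ α < k, val (e α) = n α := by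
    intro α hα
    have h1 : ∀ b ∈ Finset.range k, b ≠ α → (if e b = e α then n b else 0) = 0 := fun b hb hne =>
      if_neg fun h => hne (upDown_inj (Or.inl he) (Finset.mem_range.mp hb).le hα.le h)
    simp only [val]
    rw [Finset.sum_eq_single α h1 fun h => absurd (Finset.mem_range.mpr hα) h, if_pos rfl]
  have hval0 : ∀ p, val p ≠ 0 → ∃ α < k, e α = p := by
    intro p hp
    by_contra hcon
    push Not at hcon
    exact hp (Finset.sum_eq_zero fun α hα => if_neg (hcon α (Finset.mem_range.mp hα)))
  let l : List ℕ := (List.range (e k)).map val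
  have hl : ∀ p, l.getD p 0 = val p := by
    intro p
    by_cases hp : p < e k
    · rw [List.getD_eq_getElem _ _ (by simpa [l] using hp)]
      simp [l]
    · rw [List.getD_eq_default _ _ (by simpa [l] using hp)]
      by_contra hne
      obtain ⟨α, hα, rfl⟩ := hval0 p (Ne.symm hne)
      exact hp (he α k hα le_rfl)
  have hmem : ∃ a ∈ l, a ≠ 0 :=
    ⟨n 0, List.mem_map.mpr ⟨e 0, List.mem_range.mpr (he 0 k hk le_rfl), hval 0 hk⟩, (hn 0).ne'⟩
  let w : Zinf := ⟨l, Or.inr hmem⟩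
  have hentry : ∀ p, w.entry p = val p := hl
  have hpos : w.pos = (List.range k).map e := by
    refine List.Pairwise.eq_of_mem_iff (r := (· < ·)) w.pos_pairwise ?_ fun p => ?_
    · rw [List.pairwise_map]
      refine List.Pairwise.imp_of_mem ?_ (List.pairwise_lt_range (n := k))
      intro a b _ hb hab
      exact he a b hab (List.mem_range.mp hb).le
    · rw [mem_pos, hentry, List.mem_map]
      constructor
      · intro h
        obtain ⟨α, hα, rfl⟩ := hval0 p h
        exact ⟨α, List.mem_range.mpr hα, rfl⟩
      · rintro ⟨α, hα, rfl⟩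
        rw [hval α (List.mem_range.mp hα)]
        exact (hn α).ne'
  have hdepth : w.depth = k := by simp [depth, hpos]
  have hdim : w.dim = e k := by simp [dim, w, l]
  have hbrk : ∀ a < k, w.brk a = e a := by
    intro a ha
    have h1 : a < ((List.range k).map e).length := by simpa using ha
    rw [brk_of_lt (by omega), hpos, List.getD_eq_getElem _ _ h1]
    simp
  refine ⟨w, hdepth, fun a ha => ?_, fun a ha => ?_⟩
  · rcases Nat.lt_or_ge a k with h | h
    · exact hbrk a h
    · rw [hdepth] at ha
      obtain rfl : a = k := le_antisymm ha h
      rw [← hdim, ← brk_depth, hdepth]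
  · rw [wts_eq ha, hbrk a (hdepth ▸ ha), hentry, hval a (hdepth ▸ ha)]

/-! ### The columns of the variation matrix -/

/-- The condition on entries in the definition of `finIndex`. -/
def Bounded (w v : Zinf) : Prop := ∀ p, w.entry p ≠ 0 →
  ∃ r, p ≤ r ∧ (∀ q, p < q → q ≤ r → w.entry q = 0) ∧ w.entry p ≤ v.entry r

/-- The relation between the rows and the columns of the non-zero entries. -/
def Below (v w : Zinf) : Prop := w = v ∨ (w.norm < v.norm ∧ (w = zero ∨ w.dim = v.dim) ∧
  (∀ p, v.entry p = 0 → w.entry p = 0) ∧ w.Bounded v)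

/-- The non-zero entries of `w` sit at the block starts `v.brk (I α)`. Such an entry is bounded by
the entry of `v` at the mark `J α`, which lies in the same block, before the next non-zero entry of
`w`. -/
theorem below_of_interlaced {v w : Zinf} {k : ℕ} {I J n : ℕ → ℕ} (hI : Interlaced k I J)
    (hk : I k = v.depth) (hle : ∀ α < k, n α ≤ v.wts (J α))
    (hlt : k = v.depth → ∃ α < v.depth, n α < v.wts (J α))
    (hw : SameSymbol w.depth w.brk w.wts k (fun a => v.brk (I a)) n) : Below v w := by
  obtain ⟨h1, h2, h3⟩ := hw
  have hentry : ∀ p, w.entry p ≠ 0 → ∃ α < k, v.brk (I α) = p ∧ w.entry p = n α := by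
    intro p hp
    obtain ⟨a, ha, rfl⟩ := exists_brk hp
    exact ⟨a, h1 ▸ ha, (h2 a ha.le).symm, by rw [← wts_eq ha, h3 a ha]⟩
  have hIlt : ∀ α < k, I α < v.depth := fun α hα => hk ▸ hI.I_lt hα le_rfl
  refine Or.inr ⟨?_, Or.inr ?_, fun p hp => ?_, fun p hp => ?_⟩
  · rw [norm_eq, norm_eq, h1]
    refine (Finset.sum_congr rfl fun a ha => h3 a ?_).trans_lt (hI.sum_lt hk v.wts_pos hle hlt)
    rw [h1]; exact Finset.mem_range.mp ha
  · rw [← brk_depth, ← brk_depth, h2 _ le_rfl, h1]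
    exact congrArg v.brk hk
  · by_contra hne
    obtain ⟨α, hα, rfl, -⟩ := hentry p hne
    exact entry_brk (hIlt α hα) hp
  · obtain ⟨α, hα, rfl, h4⟩ := hentry p hp
    have h5 := hI α hα
    have hJ : J α < v.depth := hk ▸ hI.lt hα
    refine ⟨v.brk (J α), ?_, fun q hq hq' => ?_, ?_⟩
    · rcases Nat.eq_or_lt_of_le h5.1 with h6 | h6
      · rw [h6]
      · exact (v.brk_up _ _ h6 hJ.le).le
    -- No block starts strictly after the start of block `α` and not later than its mark.
    · by_contra hne
      obtain ⟨β, hβ, rfl, -⟩ := hentry q hne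
      rcases Nat.lt_or_ge α β with h6 | h6
      · have h7 : I (α + 1) ≤ I β := Interlaced.mono (n := β) (fun a ha => hI a (by omega)) h6
        have := v.brk_up (J α) (I β) (by omega) (hIlt β hβ).le
        omega
      · have h7 : I β ≤ I α := Interlaced.mono (n := α) (fun a ha => hI a (by omega)) h6
        rcases Nat.eq_or_lt_of_le h7 with h8 | h8
        · rw [h8] at hq; omega
        · have := v.brk_up _ _ h8 (hIlt α hα).le
          omega
    · rw [h4, ← wts_eq hJ]
      exact hle α hα

theorem norm_le_of_le {v n : Zinf} (h : v.Le n) : v.norm ≤ n.norm := by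
  rcases h with (h | ⟨h, -⟩ | ⟨h, -⟩) | rfl
  · exact h.le
  · exact h.le
  · exact h.le
  · exact le_rfl

theorem Below.index {v w n : Zinf} (h : Below v w) (hne : w ≠ v) (hv : v.Le n)
    (hdim : v = zero ∨ v.dim = n.dim) : w.Le n ∧ (w = zero ∨ w.dim = n.dim) := by
  rcases h with h | ⟨h1, h2, -⟩
  · exact absurd h hne
  · refine ⟨Or.inl (Or.inl (h1.trans_le (norm_le_of_le hv))), h2.imp id fun h2 => h2.trans ?_⟩
    rcases hdim with rfl | h3
    · exact absurd h1 (Nat.not_lt_zero _)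
    · exact h3

/-- The two bounds are chained: first move from `p` to a position `r` of `v`, then from `r` to a
position `r'` of `n`. Between them `w` vanishes, up to `r` by the first bound and beyond it because
its support lies in that of `v`. -/
theorem Below.mem_finIndex {v w n : Zinf} (hv : v ∈ n.finIndex) (h : Below v w) :
    w ∈ n.finIndex := by
  by_cases hne : w = v
  · exact hne ▸ hv
  obtain ⟨h1, h2, h3⟩ := hv
  obtain ⟨h4, h5⟩ := h.index hne h1 h2
  refine ⟨h4, h5, fun p hp => ?_⟩
  rcases h with h | ⟨-, -, h6, h7⟩
  · exact absurd h hne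
  · obtain ⟨r, hr, hr', hle⟩ := h7 p hp
    obtain ⟨r', hr1, hr1', hle'⟩ := h3 r (by omega)
    refine ⟨r', hr.trans hr1, fun q hq hq' => ?_, hle.trans hle'⟩
    rcases Nat.lt_or_ge r q with h8 | h8
    · exact h6 q (hr1' q h8 hq')
    · exact hr' q hq h8

/-- A bound by an entry at a later position `r` becomes a bound at `p`, because the entries of `n`
decrease. -/
theorem Below.mem_boxIndex {v w n : Zinf} (hn : n.IsDecreasing) (hv : v ∈ n.boxIndex)
    (h : Below v w) : w ∈ n.boxIndex := by
  by_cases hne : w = v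
  · exact hne ▸ hv
  obtain ⟨h1, h2, h3⟩ := hv
  obtain ⟨h4, h5⟩ := h.index hne h1 h2
  refine ⟨h4, h5, fun p => ?_⟩
  rcases h with h | ⟨-, -, h6, h7⟩
  · exact absurd h hne
  · by_cases hp : w.entry p = 0
    · rw [hp]; exact Nat.zero_le _
    · obtain ⟨r, hr, hr', hle⟩ := h7 p hp
      exact hle.trans ((h3 r).trans (hn p r hr))

/-- Apart from the zero vector the length is fixed, and every entry is at most the norm of `n`. -/
theorem finite_of_le (n : Zinf) : {v : Zinf | v.Le n ∧ (v = zero ∨ v.dim = n.dim)}.Finite := by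
  have h1 : {l : List ℕ | (∀ a ∈ l, a ≤ n.norm) ∧ (l = [] ∨ l.length = n.dim)}.Finite := by
    refine Set.Finite.subset (((List.finite_length_eq (Fin (n.norm + 1)) n.dim).image
      (List.map Fin.val)).union (Set.finite_singleton [])) ?_
    rintro l ⟨hl, rfl | hlen⟩
    · exact Or.inr rfl
    · refine Or.inl ⟨l.pmap (fun a h => (⟨a, h⟩ : Fin (n.norm + 1))) fun a ha =>
        Nat.lt_succ_of_le (hl a ha), by simpa using hlen, ?_⟩
      rw [List.map_pmap]
      simp
  refine Set.Finite.subset (h1.preimage (f := Subtype.val) Subtype.val_injective.injOn) ?_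
  rintro v ⟨hv, hd⟩
  refine ⟨fun a ha => (List.single_le_sum (fun _ _ => Nat.zero_le _) a ha).trans
    (norm_le_of_le hv), hd.imp (fun h => by rw [h]; rfl) id⟩

theorem finIndex_finite (n : Zinf) : n.finIndex.Finite :=
  (finite_of_le n).subset fun _ hv => ⟨hv.1, hv.2.1⟩

theorem boxIndex_finite (n : Zinf) : n.boxIndex.Finite :=
  (finite_of_le n).subset fun _ hv => ⟨hv.1, hv.2.1⟩

end Zinf

/-- Functionals dual to elements given by distinct monomials. -/
theorem exists_dual {σ : Type} {sym : Zinf → MvPolynomial σ ℚ} (hinj : Function.Injective sym)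
    (hmon : ∀ v, sym v = 1 ∨ ∃ s, sym v = MvPolynomial.X s) :
    ∃ f : Zinf → MvPolynomial σ ℚ →ₗ[ℚ] ℚ, ∀ v w, f w (sym v) = if v = w then 1 else 0 := by
  classical
  have h1 : ∀ v, ∃ m : σ →₀ ℕ, sym v = MvPolynomial.monomial m 1 := by
    intro v
    rcases hmon v with h | ⟨s, h⟩
    · exact ⟨0, h⟩
    · exact ⟨_, h⟩
  choose m hm using h1
  refine ⟨fun w => MvPolynomial.lcoeff ℚ (m w), fun v w => ?_⟩
  rw [MvPolynomial.lcoeff_apply, hm v, MvPolynomial.coeff_monomial]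
  refine if_congr ⟨fun h => hinj ?_, fun h => by rw [h]⟩ rfl rfl
  rw [hm v, hm w, h]

theorem symbol_injective : Function.Injective (Zinf.symbol bracketHBar) := by
  intro v w h
  rw [Zinf.symbol_eq, Zinf.symbol_eq] at h
  by_cases hv : v = Zinf.zero
  · by_cases hw : w = Zinf.zero
    · rw [hv, hw]
    · exact (Zinf.ext_symbol (sameSymbol_of_bracket (Zinf.depth_pos_of_ne hw) (Or.inl w.brk_up)
        w.wts_pos (Or.inl v.brk_up) v.wts_pos h.symm)).symm
  · exact Zinf.ext_symbol (sameSymbol_of_bracket (Zinf.depth_pos_of_ne hv) (Or.inl v.brk_up)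
      v.wts_pos (Or.inl w.brk_up) w.wts_pos h)

theorem symbol_zero : Zinf.symbol bracketHBar Zinf.zero = 1 := bracketHBar_zero _ _

/-- The left factors come from merging letters of an increasing string, which gives an increasing
string or the empty one. Each of them is therefore again given by an index vector. -/
theorem coprod_symbol_mem (v : Zinf) : coprodHBar (Zinf.symbol bracketHBar v) ∈
    Submodule.span ℚ {x | ∃ (w : Zinf) (a : HBar), Zinf.Below v w ∧
      x = Zinf.symbol bracketHBar w ⊗ₜ[ℚ] a} := by
  by_cases hv : v = Zinf.zero
  · subst hv
    refine Submodule.subset_span ⟨Zinf.zero, 1, Or.inl rfl, ?_⟩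
    rw [symbol_zero, map_one]
    rfl
  · have hd := Zinf.depth_pos_of_ne hv
    rw [Zinf.symbol_eq]
    refine (Submodule.sub_mem_iff_left _ (y := bracketHBar v.depth (fun a => v.brk a)
      (fun k => v.wts k) ⊗ₜ 1) ?_).mp (coprod_bracket_mem hd (Or.inl v.brk_up) v.wts_pos _
        fun k I J n hI hk hn hle hlt a => ?_)
    · exact Submodule.subset_span ⟨v, 1, Or.inl rfl, by rw [Zinf.symbol_eq]⟩
    · rcases Nat.eq_zero_or_pos k with rfl | hk0
      · refine Submodule.subset_span ⟨Zinf.zero, a, Or.inr ⟨?_, Or.inl rfl, fun _ _ => rfl,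
          fun p hp => absurd rfl hp⟩, by rw [symbol_zero, bracketHBar_zero]⟩
        rw [Zinf.norm_eq v]
        exact Finset.sum_pos (fun k _ => v.wts_pos k) ⟨0, Finset.mem_range.mpr hd⟩
      · have hup : Up k fun a => v.brk (I a) := fun _ _ hab hb =>
          v.brk_up _ _ (hI.I_lt hab hb) (hk ▸ hI.le_last hb)
        obtain ⟨w, hw⟩ := Zinf.exists_of_seq hk0 hup hn
        refine Submodule.subset_span ⟨w, a, Zinf.below_of_interlaced hI hk hle hlt hw, ?_⟩
        rw [Zinf.symbol_eq, bracketHBar_congr hw]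

theorem symbol_eq_one_or_X (v : Zinf) : Zinf.symbol bracketHBar v = 1 ∨
    ∃ s, Zinf.symbol bracketHBar v = MvPolynomial.X s := by
  rw [Zinf.symbol_eq]
  rcases bracketHBar_eq_one_or (Or.inl v.brk_up) v.wts_pos rfl with h | ⟨t, -, h⟩
  · exact Or.inl h.1
  · exact Or.inr ⟨t, h⟩

end SymbPolylog

/-! ### The variation matrix of ℍ̄, and derivations and inverted words for ℍ. -/

namespace SymbPolylog

open MvPowerSeries

/-- The variation matrix and the antipode of `ℍ̄`. -/
theorem variation_HBar : ∃ (V : Matrix Zinf Zinf HBar) (S : HBar →ₗ[ℚ] HBar),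
      (IsVariationMatrix coprodHBar (Zinf.symbol bracketHBar) V ∧
        ∀ V' : Matrix Zinf Zinf HBar,
          IsVariationMatrix coprodHBar (Zinf.symbol bracketHBar) V' → V' = V) ∧
      (IsHopf coprodHBar counitHBar S ∧
        ∀ S' : HBar →ₗ[ℚ] HBar, IsLeftAntipode coprodHBar counitHBar S' → S' = S) ∧
      (CoproductFormula coprodHBar V ∧ AntipodeFormula S V ∧
        DifferentialEquation derivHBar weightOneHBar V) ∧
      (∀ n : Zinf, n.IsPositive →
        n.finIndex.Finite ∧ CoproductFormula coprodHBar (restrict V n.finIndex) ∧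
          AntipodeFormula S (restrict V n.finIndex) ∧
          DifferentialEquation derivHBar weightOneHBar (restrict V n.finIndex)) ∧
      (∀ n : Zinf, n.IsPositive → n.IsDecreasing →
        n.boxIndex.Finite ∧ CoproductFormula coprodHBar (restrict V n.boxIndex) ∧
          AntipodeFormula S (restrict V n.boxIndex) ∧
          DifferentialEquation derivHBar weightOneHBar (restrict V n.boxIndex)) := by
  obtain ⟨f, hf⟩ := exists_dual symbol_injective symbol_eq_one_or_X
  exact HopfData.main hf coprod_symbol_mem hopfDataHBar derivHBar_component
    (fun n _ => Zinf.finIndex_finite n) (fun n _ _ => Zinf.boxIndex_finite n)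
    (fun n _ v hv w hvw => hvw.mem_finIndex hv) fun n _ hn v hv w hvw => hvw.mem_boxIndex hn hv

/-! ### Derivations of `ℍ` -/

/-- The derivation of `ℍ` with `o a b` in place of `d[x_{a→b}]_1` and `l b - l a` in place of
`d[x_{a→b}]_0`. -/
def dH (o : ℕ → ℕ → ℚ) (l : ℕ → ℚ) : Derivation ℚ H H :=
  MvPolynomial.mkDerivation ℚ fun g => match g with
    | .log r => algebraMap ℚ H (l (r + 1) - l r)
    | .reg s => scalarCoeff bracketH (ext o l) l s.depth s.seq (expVec s.n)

theorem dH_reg (o : ℕ → ℕ → ℚ) (l : ℕ → ℚ) (s : PolySymbol) :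
    dH o l (MvPolynomial.X (.reg s)) =
      scalarCoeff bracketH (ext o l) l s.depth s.seq (expVec s.n) :=
  MvPolynomial.mkDerivation_X _ _ _

theorem dH_log (o : ℕ → ℕ → ℚ) (l : ℕ → ℚ) (r : ℕ) :
    dH o l (MvPolynomial.X (.log r)) = algebraMap ℚ H (l (r + 1) - l r) :=
  MvPolynomial.mkDerivation_X _ _ _

theorem dH_bracket (o : ℕ → ℕ → ℚ) (l : ℕ → ℚ) {d : ℕ} (hd : 0 < d) {e : ℕ → ℕ}
    (he : Up d e) {n : ℕ → ℕ} (hn : ∀ k, 0 < n k) :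
    dH o l (bracketH d (fun a => e a) fun k => n k) =
      scalarCoeff bracketH (ext o l) l d e (ev d n) := by
  rw [bracketH_up hd he hn, dH_reg]
  exact scalarCoeff_congr bracketH _ l (d := d) (fun a ha => upSymbol_seq hd he hn ha) (ev d n)

theorem cm_dH_word (o : ℕ → ℕ → ℚ) (l : ℕ → ℚ) {d : ℕ} {e : ℕ → ℕ} (he : Up d e)
    (s : ℕ → Par) : cm (dH o l : H →ₗ[ℚ] H) (word bracketH d e s) =
      dRHS (ext o l) l (word bracketH) d e s := by
  rcases Nat.eq_zero_or_pos d with rfl | hd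
  · rw [word_zero bracketH bracketH_zero]
    ext m
    have : coeff m (1 : PS H) = if m = 0 then 1 else 0 := coeff_one ..
    rw [coeff_cm, this]
    split_ifs <;> simp [dRHS]
  · exact cm_word_eq_dRHS _ (fun n hn => dH_bracket o l hd he hn) s

theorem dH_logH (o : ℕ → ℕ → ℚ) (l : ℕ → ℚ) (a b : ℕ) :
    dH o l (logH a b) = algebraMap ℚ H (l b - l a) := by
  have h : ∀ a b, a ≤ b → ∑ r ∈ Finset.Ico a b, dH o l (MvPolynomial.X (.log r)) =
      algebraMap ℚ H (l b - l a) := by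
    intro a b hab
    rw [← Finset.sum_Ico_sub l hab, map_sum]
    refine Finset.sum_congr rfl fun r _ => ?_
    rw [dH_log]
  rw [logH, map_sub, map_sum, map_sum]
  rcases le_total a b with hab | hab
  · rw [h a b hab, Finset.Ico_eq_empty_of_le hab]; simp
  · rw [h b a hab, Finset.Ico_eq_empty_of_le hab]; simp

/-! ### The series of inverted symbols -/

theorem rep_rep {A : Type} [CommRing A] [Algebra ℚ A] (D : ℕ) (τ : ℕ → Par) (d : ℕ)
    (s : ℕ → Par) (g : PS A) : rep D τ (rep d s g) = rep d (fun k => (s k).rep D τ) g := by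
  simp only [rep_apply]
  rw [subst_comp_subst_apply ((hasSubst_truncPar d s).map _) ((hasSubst_truncPar D τ).map _)]
  congr 1
  funext k
  rw [← rep_apply]
  unfold truncPar
  split_ifs
  · exact rep_cast D τ (s k)
  · simp

theorem rep_congr {A : Type} [CommRing A] [Algebra ℚ A] {d : ℕ} {τ τ' : ℕ → Par}
    (h : ∀ k < d, τ k = τ' k) (g : PS A) : rep d τ g = rep d τ' g := by
  have : truncPar d τ = truncPar d τ' := by
    funext r
    unfold truncPar
    split_ifs with hr
    · rw [h r hr]
    · rfl
  rw [rep_apply, rep_apply, this]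

/-- The series `invSeries f d` with the parameters `τ 0, …, τ (d-1)`. -/
def invWord (d : ℕ) (f : ℕ → ℕ) (τ : ℕ → Par) : PS H := rep d τ (invSeries f d)

/-- The word with break points `f i, …, f d`. -/
def tailWord (d : ℕ) (f : ℕ → ℕ) (τ : ℕ → Par) (i : ℕ) : PS H :=
  word bracketH (d - i) (fun a => f (i + a)) fun a => τ (i + a)

/-- The first term of a fraction in the definition of `invSeries`. -/
def fracLeft (d : ℕ) (f : ℕ → ℕ) (τ : ℕ → Par) (j : ℕ) : PS H :=
  invWord j f τ * tailWord d f τ (j + 1)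

/-- The second term of a fraction in the definition of `invSeries`. -/
def fracRight (d : ℕ) (f : ℕ → ℕ) (τ : ℕ → Par) (j : ℕ) : PS H :=
  fracLeft d f (fun a => τ a - τ j) j * ex (logH (f 0) (f d)) (τ j)

/-- The alternating sum of the products of `invSeries` and words. -/
def altSum (d : ℕ) (f : ℕ → ℕ) (τ : ℕ → Par) : PS H :=
  ∑ j ∈ Finset.range (d + 1), (-1) ^ j * (invWord j f τ * tailWord d f τ j)

theorem invSeries_zero (f : ℕ → ℕ) : invSeries f 0 = 1 := by rw [invSeries, if_pos rfl]

theorem tailWord_eq (d : ℕ) (f : ℕ → ℕ) (i : ℕ) : genSeries bracketH (d - i)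
    (fun a => f (i + a)) (fun a => t (i + a)) = tailWord d f par i := by
  simp only [tailWord, word, cast_par]

theorem subst_shift_invSeries (f : ℕ → ℕ) (j : ℕ) :
    MvPowerSeries.subst (fun r : ℕ => if r < j then (t r : PS H) - t j else 0) (invSeries f j) =
      invWord j f fun a => par a - par j := by
  have h1 : (fun r : ℕ => if r < j then (t r : PS H) - t j else 0) =
      fun r => map (algebraMap ℚ H) (truncPar j (fun a => par a - par j) r) := by
    funext r
    unfold truncPar
    split_ifs
    · rw [← cast_par, ← cast_par, ← cast_sub]; rfl
    · simp
  rw [h1, invWord, rep_apply]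

theorem fracLeft_eq {f : ℕ → ℕ} {d j : ℕ} (hrep : rep j par (invSeries f j) = invSeries f j) :
    invSeries f j * genSeries bracketH (d - 1 - j) (fun a => f (j + 1 + a))
      (fun a => t (j + 1 + a)) = fracLeft d f par j := by
  have h : d - 1 - j = d - (j + 1) := by omega
  rw [fracLeft, invWord, hrep, ← tailWord_eq, h]

theorem fracRight_eq (f : ℕ → ℕ) (d j : ℕ) :
    MvPowerSeries.subst (fun r : ℕ => if r < j then t r - t j else 0) (invSeries f j)
            * expSeries (logH (f 0) (f d)) (t j)
            * genSeries bracketH (d - 1 - j) (fun a => f (j + 1 + a))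
                (fun a => t (j + 1 + a) - t j) = fracRight d f par j := by
  have h : d - 1 - j = d - (j + 1) := by omega
  have hw : genSeries bracketH (d - (j + 1)) (fun a => f (j + 1 + a))
      (fun a => t (j + 1 + a) - t j) = tailWord d f (fun a => par a - par j) (j + 1) := by
    simp only [tailWord, word, cast_sub, cast_par]
  rw [subst_shift_invSeries, fracRight, fracLeft, h, hw, ex, cast_par, mul_right_comm]

/-- Rewrites the recursion through specializable words. The hypothesis on smaller depths, that only
their own variables occur, is established later by `rep_invSeries`, whose induction uses the present
form. -/
theorem invSeries_eq {f : ℕ → ℕ} {d : ℕ} (hd : d ≠ 0)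
    (hrep : ∀ j < d, rep j par (invSeries f j) = invSeries f j) : invSeries f d =
    ∑ j ∈ Finset.range d, (-1) ^ (d + 1 + j) * (invWord j f par * tailWord d f par j)
    + ∑ j ∈ Finset.range d, (-1) ^ (d + j) *
      divT j (fracLeft d f par j - fracRight d f par j) := by
  rw [invSeries, if_neg hd, Finset.sum_range, Finset.sum_range]
  refine congrArg₂ (· + ·) (Finset.sum_congr rfl fun j _ => ?_) (Finset.sum_congr rfl fun j _ => ?_)
  · rw [invWord, hrep j j.2, mul_assoc, tailWord_eq]
  · rw [fracLeft_eq (hrep j j.2), fracRight_eq]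

end SymbPolylog

namespace SymbPolylog

open MvPowerSeries

/-! ### The fractions in the recursion for inverted symbols -/

theorem X_mul_cancel {A : Type} [CommRing A] {j : ℕ} {f g : PS A} (h : (X j : PS A) * f = X j * g) : f = g := by
  ext m
  have := congrArg (coeff (Finsupp.single j 1 + m)) h
  rwa [X_def, coeff_add_monomial_mul, coeff_add_monomial_mul, one_mul, one_mul] at this

/-- `divT` merely shifts coefficients; it is a genuine division once the monomials without `t_j` are
absent. -/
theorem X_mul_divT {A : Type} [CommRing A] {j : ℕ} {f : PS A} (h : ∀ m : ℕ →₀ ℕ, m j = 0 → coeff m f = 0) :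
    X j * divT j f = f := by
  classical
  ext m
  by_cases hm : m j = 0
  · rw [h m hm, X_def, coeff_monomial_mul, if_neg]
    intro hle
    have := hle j
    simp [hm] at this
  · have hle : Finsupp.single j 1 ≤ m := by
      intro k
      rw [Finsupp.single_apply]
      split_ifs with hk
      · subst hk; omega
      · exact Nat.zero_le _
    obtain ⟨n, rfl⟩ := exists_add_of_le hle
    rw [X_def, coeff_add_monomial_mul, one_mul, add_comm]
    rfl

section rep

variable {A : Type} [CommRing A] [Algebra ℚ A]

theorem ex_zero_right (a : A) : ex a 0 = 1 := by
  have h : rep 0 par (ex a (par 0)) = ex a 0 := by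
    rw [rep_ex, Par.rep_par_of_le _ le_rfl]
  rw [← h]
  ext m
  rw [coeff_rep_par]
  by_cases hm : m = 0
  · subst hm
    rw [if_pos (by simp), coeff_zero_one]
    exact constantCoeff_ex a _
  · have h1 : coeff m (1 : PS A) = 0 := by
      classical
      rw [coeff_one, if_neg hm]
    rw [if_neg, h1]
    intro hall
    obtain ⟨r, hr⟩ := Finsupp.support_nonempty_iff.mpr hm
    exact absurd (hall r hr) (by omega)

theorem rep_X {d k : ℕ} (τ : ℕ → Par) (h : k < d) : rep d τ (X k : PS A) = (τ k).cast A := by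
  have : (X k : PS A) = (par k).cast A := (cast_par k).symm
  rw [this, rep_cast, Par.rep_par τ h]

end rep

section congr

variable {f f' : ℕ → ℕ} {τ τ' : ℕ → Par} {d : ℕ}

theorem tailWord_congr {i : ℕ} (hf : ∀ a, i ≤ a → a ≤ d → f a = f' a)
    (hτ : ∀ a, i ≤ a → a < d → τ a = τ' a) (hi : i ≤ d) :
    tailWord d f τ i = tailWord d f' τ' i :=
  word_congr _ (fun a _ => hf _ (by omega) (by omega)) fun a _ => hτ _ (by omega) (by omega)

theorem rep_invWord (D : ℕ) (σ : ℕ → Par) :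
    rep D σ (invWord d f τ) = invWord d f fun k => (τ k).rep D σ := rep_rep ..

theorem rep_tailWord (D : ℕ) (σ : ℕ → Par) (i : ℕ) :
    rep D σ (tailWord d f τ i) = tailWord d f (fun k => (τ k).rep D σ) i := rep_word ..

theorem rep_fracLeft (D : ℕ) (σ : ℕ → Par) (j : ℕ) :
    rep D σ (fracLeft d f τ j) = fracLeft d f (fun k => (τ k).rep D σ) j := by
  simp only [fracLeft, map_mul, rep_invWord, rep_tailWord]

theorem rep_fracRight (D : ℕ) (σ : ℕ → Par) (j : ℕ) :
    rep D σ (fracRight d f τ j) = fracRight d f (fun k => (τ k).rep D σ) j := by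
  simp only [fracRight, map_mul, rep_fracLeft, rep_ex, Par.rep_sub]

theorem rep_altSum (D : ℕ) (σ : ℕ → Par) :
    rep D σ (altSum d f τ) = altSum d f fun k => (τ k).rep D σ := by
  simp only [altSum, map_sum, map_mul, rep_invWord, rep_tailWord, map_pow, map_neg, map_one]

theorem invWord_congr_par (hτ : ∀ a < d, τ a = τ' a) : invWord d f τ = invWord d f τ' :=
  rep_congr hτ _

theorem fracLeft_congr_par {j : ℕ} (hτ : ∀ a < d, τ a = τ' a) (hj : j < d) :
    fracLeft d f τ j = fracLeft d f τ' j := by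
  rw [fracLeft, fracLeft, invWord_congr_par fun a ha => hτ a (ha.trans hj),
    tailWord_congr (fun _ _ _ => rfl) (fun a _ ha => hτ a ha) hj]

theorem fracRight_congr_par {j : ℕ} (hτ : ∀ a < d, τ a = τ' a) (hj : j < d) :
    fracRight d f τ j = fracRight d f τ' j := by
  rw [fracRight, fracRight, hτ j hj, fracLeft_congr_par (fun a ha => by rw [hτ a ha]) hj]

theorem altSum_congr_par (hτ : ∀ a < d, τ a = τ' a) : altSum d f τ = altSum d f τ' := by
  refine Finset.sum_congr rfl fun j hj => ?_
  have := Finset.mem_range.mp hj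
  rw [invWord_congr_par fun a ha => hτ a (by omega),
    tailWord_congr (fun _ _ _ => rfl) (fun a _ ha => hτ a ha) (by omega)]

end congr

/-- A fraction in the recursion for the series of inverted symbols. -/
def quot (d : ℕ) (f : ℕ → ℕ) (j : ℕ) : PS H := divT j (fracLeft d f par j - fracRight d f par j)

variable {f : ℕ → ℕ} {d : ℕ}

theorem fracRight_of_eq_zero {τ : ℕ → Par} {j : ℕ} (h : τ j = 0) :
    fracRight d f τ j = fracLeft d f τ j := by
  simp only [fracRight, h, ex_zero_right, sub_zero, mul_one]

theorem rep_par_sub (d : ℕ) (f : ℕ → ℕ) {j : ℕ} (hj : j < d) (σ : ℕ → Par) :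
    rep d σ (fracLeft d f par j - fracRight d f par j) =
      fracLeft d f σ j - fracRight d f σ j := by
  have h : ∀ a < d, (par a).rep d σ = σ a := fun a ha => Par.rep_par σ ha
  rw [map_sub, rep_fracLeft, rep_fracRight, fracLeft_congr_par h hj, fracRight_congr_par h hj]

/-- For `t_j = 0` the shift of the parameters and the exponential become trivial, so the two terms
of the fraction agree and their difference is divisible by `t_j`. -/
theorem X_mul_quot {j : ℕ} (hj : j < d) :
    X j * quot d f j = fracLeft d f par j - fracRight d f par j := by
  refine X_mul_divT fun m hm => ?_
  classical
  have h := rep_par_sub d f hj fun r => if r ≠ j then par r else 0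
  rw [fracRight_of_eq_zero (τ := fun r => if r ≠ j then par r else 0)
    (if_neg (not_not.mpr rfl)), sub_self] at h
  have h1 := congrArg (coeff m) h
  rw [coeff_rep_indicator] at h1
  have h2 := congrArg (coeff m) (rep_par_sub d f hj par)
  rw [coeff_rep_par] at h2
  by_cases hs : ∀ r ∈ m.support, r < d
  · have hc : ∀ r ∈ m.support, r < d ∧ r ≠ j := fun r hr =>
      ⟨hs r hr, fun hrj => (Finsupp.mem_support_iff.mp hr) (hrj ▸ hm)⟩
    rwa [if_pos hc] at h1
  · rw [if_neg hs] at h2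
    exact h2.symm

/-- The multiplied identity survives specialization, while a direct division by the parameter would
have no meaning when that parameter is zero. -/
theorem cast_mul_rep_quot {j : ℕ} (hj : j < d) (σ : ℕ → Par) :
    (σ j).cast H * rep d σ (quot d f j) = fracLeft d f σ j - fracRight d f σ j := by
  rw [← rep_par_sub d f hj, ← X_mul_quot hj, map_mul, rep_X σ hj]

theorem rep_quot {j : ℕ} (hj : j < d) : rep d par (quot d f j) = quot d f j := by
  refine X_mul_cancel (j := j) ?_
  have := cast_mul_rep_quot (f := f) hj par
  rw [cast_par] at this
  rw [X_mul_quot hj, ← this]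
  rfl

/-- Only `t_0, …, t_{d-1}` occur in the recursion, and this property can be tested for a fraction
after multiplication by `t_j`. -/
theorem rep_invSeries (f : ℕ → ℕ) (d : ℕ) : rep d par (invSeries f d) = invSeries f d := by
  induction d using Nat.strong_induction_on with
  | _ d ih =>
    rcases Nat.eq_zero_or_pos d with rfl | hd
    · rw [invSeries_zero, map_one]
    · rw [invSeries_eq hd.ne' ih, map_add, map_sum, map_sum]
      have hpar : ∀ a < d, (par a).rep d par = par a := fun a ha => Par.rep_par par ha
      refine congrArg₂ (· + ·) (Finset.sum_congr rfl fun j hj => ?_)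
        (Finset.sum_congr rfl fun j hj => ?_)
      · have := Finset.mem_range.mp hj
        rw [map_mul, map_mul, map_pow, map_neg, map_one, rep_invWord, rep_tailWord,
          invWord_congr_par fun a ha => hpar a (ha.trans this),
          tailWord_congr (fun _ _ _ => rfl) (fun a _ ha => hpar a ha) this.le]
      · rw [map_mul, map_pow, map_neg, map_one]
        exact congrArg _ (rep_quot (Finset.mem_range.mp hj))

theorem invWord_par (d : ℕ) (f : ℕ → ℕ) : invWord d f par = invSeries f d := rep_invSeries f d

theorem invWord_zero (f : ℕ → ℕ) (τ : ℕ → Par) : invWord 0 f τ = 1 := by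
  rw [invWord, invSeries_zero, map_one]

theorem tailWord_self (d : ℕ) (f : ℕ → ℕ) (τ : ℕ → Par) : tailWord d f τ d = 1 := by
  rw [tailWord, Nat.sub_self, word_zero bracketH bracketH_zero]

/-- The summand `j = d` is `invSeries f d` up to sign. Inserting the recursion cancels all other
products and leaves the quotients. -/
theorem altSum_par (hd : d ≠ 0) :
    altSum d f par = ∑ j ∈ Finset.range d, (-1) ^ j * quot d f j := by
  have h2 : ∀ n : ℕ, ((-1 : PS H)) ^ n * (-1) ^ n = 1 := fun n => by
    rw [← mul_pow, neg_mul_neg, one_mul, one_pow]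
  rw [altSum, Finset.sum_range_succ, tailWord_self, mul_one, invWord_par,
    invSeries_eq hd fun j _ => rep_invSeries f j, mul_add, ← add_assoc, Finset.mul_sum,
    Finset.mul_sum, ← Finset.sum_add_distrib, Finset.sum_eq_zero, zero_add]
  · refine Finset.sum_congr rfl fun j _ => ?_
    rw [pow_add, ← mul_assoc, ← mul_assoc, h2, one_mul]
    rfl
  · intro j _
    have h3 : (-1 : PS H) ^ d * (-1) ^ (d + 1 + j) = -(-1) ^ j := by
      rw [pow_add, pow_add, pow_one, ← mul_assoc, ← mul_assoc, h2, one_mul, neg_one_mul]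
    rw [← mul_assoc ((-1 : PS H) ^ d), h3, neg_mul, add_neg_cancel]

theorem altSum_eq (hd : d ≠ 0) (σ : ℕ → Par) :
    altSum d f σ = ∑ j ∈ Finset.range d, (-1) ^ j * rep d σ (quot d f j) := by
  have h := congrArg (rep d σ) (altSum_par (f := f) hd)
  rw [rep_altSum, altSum_congr_par fun a ha => Par.rep_par σ ha] at h
  rw [h, map_sum]
  refine Finset.sum_congr rfl fun j _ => ?_
  rw [map_mul, map_pow, map_neg, map_one]

theorem invSeries_congr {f f' : ℕ → ℕ} {d : ℕ} (hf : ∀ a ≤ d, f a = f' a) :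
    invSeries f d = invSeries f' d := by
  induction d using Nat.strong_induction_on with
  | _ d ih =>
    rcases Nat.eq_zero_or_pos d with rfl | hd
    · rw [invSeries_zero, invSeries_zero]
    · have hK : ∀ j < d, ∀ τ, invWord j f τ = invWord j f' τ := fun j hj τ => by
        rw [invWord, invWord, ih j hj fun a ha => hf a (by omega)]
      have hW : ∀ i ≤ d, ∀ τ, tailWord d f τ i = tailWord d f' τ i := fun i hi τ =>
        tailWord_congr (fun a _ ha => hf a ha) (fun _ _ _ => rfl) hi
      have hA : ∀ j < d, ∀ τ, fracLeft d f τ j = fracLeft d f' τ j := fun j hj τ => by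
        rw [fracLeft, fracLeft, hK j hj, hW (j + 1) hj]
      rw [invSeries_eq hd.ne' fun j _ => rep_invSeries f j,
        invSeries_eq hd.ne' fun j _ => rep_invSeries f' j]
      refine congrArg₂ (· + ·) (Finset.sum_congr rfl fun j hj => ?_)
        (Finset.sum_congr rfl fun j hj => ?_)
      · have := Finset.mem_range.mp hj
        rw [hK j this, hW j this.le]
      · have := Finset.mem_range.mp hj
        rw [fracRight, fracRight, hA j this, hA j this, hf 0 d.zero_le, hf d le_rfl]

theorem invWord_congr {f f' : ℕ → ℕ} {τ τ' : ℕ → Par} {d : ℕ} (hf : ∀ a ≤ d, f a = f' a)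
    (hτ : ∀ a < d, τ a = τ' a) : invWord d f τ = invWord d f' τ' := by
  rw [invWord_congr_par hτ, invWord, invWord, invSeries_congr hf]

end SymbPolylog

namespace SymbPolylog

open MvPowerSeries

/-! ### Derivatives of the fractions -/

theorem cm_cast {A : Type} [CommRing A] [Algebra ℚ A] (D : Derivation ℚ A A) (s : Par) :
    cm (D : A →ₗ[ℚ] A) (s.cast A) = 0 := by
  ext m
  rw [coeff_cm, Par.cast, coeff_map]
  simp

/-- The expected derivative of `invWord j f τ` for `j ≤ d`, with scalars `c r`, `p r`, `q r` in
place of `d[y_r]_0`, `d[y_r⁻¹]_1`, `d[y_r]_1`. -/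
def invRHS (c p q : ℕ → ℚ) (d j : ℕ) (f : ℕ → ℕ) (τ : ℕ → Par) : PS H :=
  invWord j f τ * ∑ r ∈ Finset.range d, (if r < j then c r • (τ r).cast H else 0)
    + ∑ r ∈ Finset.range d,
      (if r < j then p r • invWord (j - 1) (skip (r + 1) f) (skip r τ) else 0)
    - ∑ r ∈ Finset.range d,
      (if r ≠ 0 ∧ r < j then q r • invWord (j - 1) (skip r f) (skip r τ) else 0)

/-- The expected derivative of `tailWord d f τ i`. -/
def tailRHS (c p q : ℕ → ℚ) (d i : ℕ) (f : ℕ → ℕ) (τ : ℕ → Par) : PS H :=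
  tailWord d f τ i * ∑ r ∈ Finset.range d, (if i ≤ r then c r • (τ r).cast H else 0)
    + ∑ r ∈ Finset.range d,
      (if i ≤ r then q r • tailWord (d - 1) (skip r f) (skip r τ) i else 0)
    - ∑ r ∈ Finset.range d,
      (if i ≤ r ∧ r + 1 < d then p r • tailWord (d - 1) (skip (r + 1) f) (skip r τ) i else 0)

/-- The sign of a letter in front of or behind the letter `j`. -/
def sgn (r j : ℕ) : PS H := if r < j then 1 else -1

theorem skip_pull {α : Type} (τ : ℕ → α) {r j : ℕ} (h : r ≠ j) : skip r τ (pull r j) = τ j := by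
  unfold skip pull
  split_ifs <;> first | rfl | omega | (congr 1; omega)

section frac

variable {f : ℕ → ℕ} {τ : ℕ → Par} {d : ℕ}

theorem fracLeft_skip_of_lt {r j k : ℕ} (hk : k = r ∨ k = r + 1) (hr : r < j) (hj : j < d) :
    fracLeft (d - 1) (skip k f) (skip r τ) (pull r j) =
      invWord (j - 1) (skip k f) (skip r τ) * tailWord d f τ (j + 1) := by
  have hp : pull r j = j - 1 := if_neg (by omega)
  rw [fracLeft, hp, show j - 1 + 1 = j by omega]
  congr 1
  unfold tailWord
  rw [show d - 1 - j = d - (j + 1) by omega]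
  refine word_congr _ (fun a _ => ?_) fun a _ => ?_
  · rw [skip_of_le f (by omega)]; congr 1; omega
  · rw [skip_of_le τ (by omega)]; congr 1; omega

theorem invWord_skip {r j k : ℕ} (hj : j < k) (hr : j ≤ r) :
    invWord j (skip k f) (skip r τ) = invWord j f τ :=
  invWord_congr (fun a _ => skip_of_lt f (by omega)) fun a _ => skip_of_lt τ (by omega)

theorem fracLeft_skip_of_gt {r j k : ℕ} (hk : k = r ∨ k = r + 1) (hr : j < r) :
    fracLeft (d - 1) (skip k f) (skip r τ) (pull r j) =
      invWord j f τ * tailWord (d - 1) (skip k f) (skip r τ) (j + 1) := by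
  have hp : pull r j = j := if_pos (by omega)
  rw [fracLeft, hp, invWord_skip (by omega) (by omega)]

variable (D : Derivation ℚ H H) {c p q : ℕ → ℚ}

/-- Leibniz rule. Letters before `j` occur in the inverted word and letters behind it in the
ordinary word, where `p` and `q` enter with opposite signs; this is recorded by `sgn`. The letter
`j` itself is absent. -/
theorem cm_fracLeft {j : ℕ} (hj : j < d)
    (hK : cm (D : H →ₗ[ℚ] H) (invWord j f τ) = invRHS c p q d j f τ)
    (hW : cm (D : H →ₗ[ℚ] H) (tailWord d f τ (j + 1)) = tailRHS c p q d (j + 1) f τ) :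
    cm (D : H →ₗ[ℚ] H) (fracLeft d f τ j) =
      fracLeft d f τ j * ∑ r ∈ Finset.range d, (if r ≠ j then c r • (τ r).cast H else 0)
      + ∑ r ∈ Finset.range d, (if r ≠ j ∧ r + 1 < d then
          sgn r j * (p r • fracLeft (d - 1) (skip (r + 1) f) (skip r τ) (pull r j)) else 0)
      - ∑ r ∈ Finset.range d, (if r ≠ j ∧ r ≠ 0 then
          sgn r j * (q r • fracLeft (d - 1) (skip r f) (skip r τ) (pull r j)) else 0) := by
  have hS : ∑ r ∈ Finset.range d, (if r ≠ j then c r • (τ r).cast H else 0) =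
      ∑ r ∈ Finset.range d, (if r < j then c r • (τ r).cast H else 0) +
      ∑ r ∈ Finset.range d, (if j + 1 ≤ r then c r • (τ r).cast H else 0) := by
    rw [← Finset.sum_add_distrib]
    refine Finset.sum_congr rfl fun r _ => ?_
    rcases lt_trichotomy r j with h | h | h
    · rw [if_pos h.ne, if_pos h, if_neg (by omega), add_zero]
    · rw [if_neg (by omega), if_neg (by omega), if_neg (by omega), add_zero]
    · rw [if_pos h.ne', if_neg (by omega), if_pos (Nat.succ_le_of_lt h), zero_add]
  have hP : ∑ r ∈ Finset.range d, (if r ≠ j ∧ r + 1 < d then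
        sgn r j * (p r • fracLeft (d - 1) (skip (r + 1) f) (skip r τ) (pull r j)) else 0) =
      (∑ r ∈ Finset.range d,
        (if r < j then p r • invWord (j - 1) (skip (r + 1) f) (skip r τ) else 0)) *
        tailWord d f τ (j + 1) - invWord j f τ * ∑ r ∈ Finset.range d,
        (if j + 1 ≤ r ∧ r + 1 < d then
          p r • tailWord (d - 1) (skip (r + 1) f) (skip r τ) (j + 1) else 0) := by
    rw [Finset.sum_mul, Finset.mul_sum, ← Finset.sum_sub_distrib]
    refine Finset.sum_congr rfl fun r _ => ?_
    rcases lt_trichotomy r j with h | h | h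
    · rw [if_pos ⟨h.ne, by omega⟩, if_pos h, if_neg (by omega), mul_zero, sub_zero,
        fracLeft_skip_of_lt (Or.inr rfl) h hj, sgn, if_pos h, one_mul, smul_mul_assoc]
    · rw [if_neg (by omega), if_neg (by omega), if_neg (by omega), mul_zero, zero_mul, sub_zero]
    · by_cases hd : r + 1 < d
      · rw [if_pos ⟨h.ne', hd⟩, if_neg (by omega), if_pos ⟨h, hd⟩, zero_mul, zero_sub,
          fracLeft_skip_of_gt (Or.inr rfl) h, sgn, if_neg (by omega), neg_one_mul, mul_smul_comm]
      · rw [if_neg (by omega), if_neg (by omega), if_neg (by omega), mul_zero, zero_mul, sub_zero]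
  have hQ : ∑ r ∈ Finset.range d, (if r ≠ j ∧ r ≠ 0 then
        sgn r j * (q r • fracLeft (d - 1) (skip r f) (skip r τ) (pull r j)) else 0) =
      (∑ r ∈ Finset.range d,
        (if r ≠ 0 ∧ r < j then q r • invWord (j - 1) (skip r f) (skip r τ) else 0)) *
        tailWord d f τ (j + 1) - invWord j f τ * ∑ r ∈ Finset.range d,
        (if j + 1 ≤ r then
          q r • tailWord (d - 1) (skip r f) (skip r τ) (j + 1) else 0) := by
    rw [Finset.sum_mul, Finset.mul_sum, ← Finset.sum_sub_distrib]
    refine Finset.sum_congr rfl fun r _ => ?_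
    rcases lt_trichotomy r j with h | h | h
    · by_cases hr : r = 0
      · rw [if_neg (by omega), if_neg (by omega), if_neg (by omega), mul_zero, zero_mul, sub_zero]
      · rw [if_pos ⟨h.ne, hr⟩, if_pos ⟨hr, h⟩, if_neg (by omega), mul_zero, sub_zero,
          fracLeft_skip_of_lt (Or.inl rfl) h hj, sgn, if_pos h, one_mul, smul_mul_assoc]
    · rw [if_neg (by omega), if_neg (by omega), if_neg (by omega), mul_zero, zero_mul, sub_zero]
    · rw [if_pos ⟨h.ne', by omega⟩, if_neg (by omega),
        if_pos (Nat.succ_le_of_lt h), zero_mul, zero_sub, fracLeft_skip_of_gt (Or.inl rfl) h, sgn, if_neg (by omega), neg_one_mul, mul_smul_comm]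
  rw [hS, hP, hQ]
  unfold fracLeft
  rw [cm_mul, hK, hW]
  unfold invRHS tailRHS
  ring

theorem fracRight_skip {r j k : ℕ} (hk0 : 0 < k) (hkd : k < d)
    (hrj : r ≠ j) :
    fracLeft (d - 1) (skip k f) (skip r fun a => τ a - τ j) (pull r j) *
      ex (logH (f 0) (f d)) (τ j) = fracRight (d - 1) (skip k f) (skip r τ) (pull r j) := by
  have h : (skip r fun a => τ a - τ j) = fun a => skip r τ a - skip r τ (pull r j) := by
    funext a
    rw [skip_pull τ hrj]
    unfold skip
    split_ifs <;> rfl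
  rw [fracRight, h, skip_pull τ hrj, skip_of_lt f hk0, skip_of_le f (show k ≤ d - 1 by omega),
    show d - 1 + 1 = d by omega]

/-- The exponential contributes the full sum of the `c r`, multiplied by `τ j`. This undoes the
shift of the parameters by `τ j` and restores the term of the letter `j`, which is missing for the
unshifted fraction. -/
theorem cm_fracRight {j : ℕ} (hj : j < d)
    (hK : ∀ τ, cm (D : H →ₗ[ℚ] H) (invWord j f τ) = invRHS c p q d j f τ)
    (hW : ∀ τ, cm (D : H →ₗ[ℚ] H) (tailWord d f τ (j + 1)) = tailRHS c p q d (j + 1) f τ)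
    (hE : D (logH (f 0) (f d)) = algebraMap ℚ H (∑ r ∈ Finset.range d, c r)) :
    cm (D : H →ₗ[ℚ] H) (fracRight d f τ j) =
      fracRight d f τ j * ∑ r ∈ Finset.range d, c r • (τ r).cast H
      + ∑ r ∈ Finset.range d, (if r ≠ j ∧ r + 1 < d then
          sgn r j * (p r • fracRight (d - 1) (skip (r + 1) f) (skip r τ) (pull r j)) else 0)
      - ∑ r ∈ Finset.range d, (if r ≠ j ∧ r ≠ 0 then
          sgn r j * (q r • fracRight (d - 1) (skip r f) (skip r τ) (pull r j)) else 0) := by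
  set E := ex (logH (f 0) (f d)) (τ j) with hEdef
  set τ' : ℕ → Par := fun a => τ a - τ j with hτ'
  have hP : ∑ r ∈ Finset.range d, (if r ≠ j ∧ r + 1 < d then
        sgn r j * (p r • fracRight (d - 1) (skip (r + 1) f) (skip r τ) (pull r j)) else 0) =
      (∑ r ∈ Finset.range d, (if r ≠ j ∧ r + 1 < d then
        sgn r j * (p r • fracLeft (d - 1) (skip (r + 1) f) (skip r τ') (pull r j)) else 0)) *
        E := by
    rw [Finset.sum_mul]
    refine Finset.sum_congr rfl fun r _ => ?_
    split_ifs with h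
    · rw [← fracRight_skip (by omega) h.2 h.1, mul_assoc, smul_mul_assoc]
    · rw [zero_mul]
  have hQ : ∑ r ∈ Finset.range d, (if r ≠ j ∧ r ≠ 0 then
        sgn r j * (q r • fracRight (d - 1) (skip r f) (skip r τ) (pull r j)) else 0) =
      (∑ r ∈ Finset.range d, (if r ≠ j ∧ r ≠ 0 then
        sgn r j * (q r • fracLeft (d - 1) (skip r f) (skip r τ') (pull r j)) else 0)) *
        E := by
    rw [Finset.sum_mul]
    refine Finset.sum_congr rfl fun r hr => ?_
    split_ifs with h
    · rw [← fracRight_skip (by omega) (Finset.mem_range.mp hr) h.1, mul_assoc,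
        smul_mul_assoc]
    · rw [zero_mul]
  have hS : ∑ r ∈ Finset.range d, c r • (τ r).cast H =
      ∑ r ∈ Finset.range d, (if r ≠ j then c r • (τ' r).cast H else 0) +
      (∑ r ∈ Finset.range d, c r) • (τ j).cast H := by
    rw [Finset.sum_smul, ← Finset.sum_add_distrib]
    refine Finset.sum_congr rfl fun r _ => ?_
    split_ifs with h
    · rw [hτ', cast_sub, smul_sub, sub_add_cancel]
    · rw [not_not.mp h, zero_add]
  rw [hP, hQ, hS]
  have h0 : fracRight d f τ j = fracLeft d f τ' j * E := rfl
  rw [h0, cm_mul, cm_fracLeft D hj (hK τ') (hW τ'), cm_ex D hE, ← mul_smul_comm]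
  ring

end frac

end SymbPolylog

/-! ### Derivatives of the quotients and of their alternating sum. -/

namespace SymbPolylog

open MvPowerSeries

section deriv

variable {f : ℕ → ℕ} {d : ℕ} (D : Derivation ℚ H H) {c p q : ℕ → ℚ}

theorem X_mul_rep_quot {r j k : ℕ} (hr : r < d) (hj : j < d) (hrj : r ≠ j) :
    X j * rep (d - 1) (skip r par) (quot (d - 1) (skip k f) (pull r j)) =
      fracLeft (d - 1) (skip k f) (skip r par) (pull r j) -
        fracRight (d - 1) (skip k f) (skip r par) (pull r j) := by
  have hp : pull r j < d - 1 := by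
    unfold pull
    split_ifs <;> omega
  have h : (X j : PS H) = (skip r par (pull r j)).cast H := by
    rw [skip_pull _ hrj, cast_par]
    rfl
  rw [← cast_mul_rep_quot hp, h]

/-- After multiplication by `t_j` this is the difference of the derivatives of the two terms of the
fraction. The first lacks the logarithmic term of letter `j`; the defect contains the factor `t_j`
and leaves `c j` times the first term. -/
theorem cm_quot {j : ℕ} (hj : j < d)
    (hK : ∀ τ, cm (D : H →ₗ[ℚ] H) (invWord j f τ) = invRHS c p q d j f τ)
    (hW : ∀ τ, cm (D : H →ₗ[ℚ] H) (tailWord d f τ (j + 1)) = tailRHS c p q d (j + 1) f τ)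
    (hE : D (logH (f 0) (f d)) = algebraMap ℚ H (∑ r ∈ Finset.range d, c r)) :
    cm (D : H →ₗ[ℚ] H) (quot d f j) =
      quot d f j * ∑ r ∈ Finset.range d, c r • (par r).cast H
      - c j • fracLeft d f par j
      + ∑ r ∈ Finset.range d, (if r ≠ j ∧ r + 1 < d then
          sgn r j * (p r • rep (d - 1) (skip r par) (quot (d - 1) (skip (r + 1) f) (pull r j)))
          else 0)
      - ∑ r ∈ Finset.range d, (if r ≠ j ∧ r ≠ 0 then
          sgn r j * (q r • rep (d - 1) (skip r par) (quot (d - 1) (skip r f) (pull r j)))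
          else 0) := by
  have hX : cm (D : H →ₗ[ℚ] H) (X j : PS H) = 0 := by
    have := cm_cast D (par j)
    rwa [cast_par] at this
  have hS : ∑ r ∈ Finset.range d, c r • (par r).cast H =
      ∑ r ∈ Finset.range d, (if r ≠ j then c r • (par r).cast H else 0) + c j • (X j : PS H) := by
    have h1 : c j • (X j : PS H) =
        ∑ r ∈ Finset.range d, if r = j then c r • (par r).cast H else 0 := by
      rw [Finset.sum_ite_eq' _ j, if_pos (Finset.mem_range.mpr hj), cast_par]
      rfl
    rw [h1, ← Finset.sum_add_distrib]
    refine Finset.sum_congr rfl fun r _ => ?_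
    by_cases h : r = j
    · rw [if_neg (not_not.mpr h), if_pos h, zero_add]
    · rw [if_pos h, if_neg h, add_zero]
  have hP : X j * ∑ r ∈ Finset.range d, (if r ≠ j ∧ r + 1 < d then
          sgn r j * (p r • rep (d - 1) (skip r par) (quot (d - 1) (skip (r + 1) f) (pull r j)))
          else 0) =
      ∑ r ∈ Finset.range d, (if r ≠ j ∧ r + 1 < d then
          sgn r j * (p r • fracLeft (d - 1) (skip (r + 1) f) (skip r par) (pull r j)) else 0) -
      ∑ r ∈ Finset.range d, (if r ≠ j ∧ r + 1 < d then
          sgn r j * (p r • fracRight (d - 1) (skip (r + 1) f) (skip r par) (pull r j)) else 0) := by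
    rw [Finset.mul_sum, ← Finset.sum_sub_distrib]
    refine Finset.sum_congr rfl fun r hr => ?_
    split_ifs with h
    · rw [mul_left_comm, mul_smul_comm, X_mul_rep_quot (Finset.mem_range.mp hr) hj h.1, smul_sub,
        mul_sub]
    · rw [mul_zero, sub_zero]
  have hQ : X j * ∑ r ∈ Finset.range d, (if r ≠ j ∧ r ≠ 0 then
          sgn r j * (q r • rep (d - 1) (skip r par) (quot (d - 1) (skip r f) (pull r j)))
          else 0) =
      ∑ r ∈ Finset.range d, (if r ≠ j ∧ r ≠ 0 then
          sgn r j * (q r • fracLeft (d - 1) (skip r f) (skip r par) (pull r j)) else 0) -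
      ∑ r ∈ Finset.range d, (if r ≠ j ∧ r ≠ 0 then
          sgn r j * (q r • fracRight (d - 1) (skip r f) (skip r par) (pull r j)) else 0) := by
    rw [Finset.mul_sum, ← Finset.sum_sub_distrib]
    refine Finset.sum_congr rfl fun r hr => ?_
    split_ifs with h
    · rw [mul_left_comm, mul_smul_comm, X_mul_rep_quot (Finset.mem_range.mp hr) hj h.1, smul_sub,
        mul_sub]
    · rw [mul_zero, sub_zero]
  refine X_mul_cancel (j := j) ?_
  have h1 : X j * cm (D : H →ₗ[ℚ] H) (quot d f j) =
      cm (D : H →ₗ[ℚ] H) (fracLeft d f par j) - cm (D : H →ₗ[ℚ] H) (fracRight d f par j) := by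
    have h2 := congrArg (cm (D : H →ₗ[ℚ] H)) (X_mul_quot (f := f) hj)
    rwa [cm_mul, hX, zero_mul, zero_add, map_sub] at h2
  rw [h1, cm_fracLeft D hj (hK par) (hW par), cm_fracRight D hj hK hW hE, mul_sub, mul_add, hP, hQ,
    mul_sub, ← mul_assoc, X_mul_quot hj, hS, mul_smul_comm, ← smul_mul_assoc]
  ring

/-- Closing the gap at `r` shifts the indices behind it by one, which changes the alternating sign;
in front of `r` the same minus sign is supplied by `sgn`. -/
theorem sum_sgn {r : ℕ} (hr : r < d) (g : ℕ → PS H) :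
    ∑ j ∈ Finset.range d, (if r ≠ j then (-1) ^ j * (sgn r j * g (pull r j)) else 0) =
      -∑ i ∈ Finset.range (d - 1), (-1) ^ i * g i := by
  obtain ⟨b, rfl⟩ : ∃ b, d = r + 1 + b := ⟨d - (r + 1), by omega⟩
  rw [show r + 1 + b - 1 = r + b by omega, Finset.sum_range_add, Finset.sum_range_succ,
    Finset.sum_range_add, if_neg (not_not.mpr rfl), add_zero, neg_add, ← Finset.sum_neg_distrib,
    ← Finset.sum_neg_distrib]
  refine congrArg₂ (· + ·) (Finset.sum_congr rfl fun j hj => ?_) (Finset.sum_congr rfl fun j _ => ?_)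
  · have := Finset.mem_range.mp hj
    rw [if_pos (by omega), sgn, if_neg (by omega), pull, if_pos (by omega)]
    ring
  · rw [if_pos (by omega), sgn, if_pos (by omega), pull, if_neg (by omega),
      show r + 1 + j - 1 = r + j by omega]
    ring

/-- Differentiates the alternating sum through its expression by quotients. For each deleted letter,
the quotients form the alternating sum of the shortened string. -/
theorem cm_altSum_par (hd : d ≠ 0)
    (hK : ∀ j < d, ∀ τ, cm (D : H →ₗ[ℚ] H) (invWord j f τ) = invRHS c p q d j f τ)
    (hW : ∀ i ≤ d, ∀ τ, cm (D : H →ₗ[ℚ] H) (tailWord d f τ i) = tailRHS c p q d i f τ)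
    (hE : D (logH (f 0) (f d)) = algebraMap ℚ H (∑ r ∈ Finset.range d, c r)) :
    cm (D : H →ₗ[ℚ] H) (altSum d f par) =
      altSum d f par * ∑ r ∈ Finset.range d, c r • (par r).cast H
      - ∑ j ∈ Finset.range d, (-1) ^ j * (c j • fracLeft d f par j)
      - ∑ r ∈ Finset.range d, (if r + 1 < d then
          p r • altSum (d - 1) (skip (r + 1) f) (skip r par) else 0)
      + ∑ r ∈ Finset.range d, (if r ≠ 0 then
          q r • altSum (d - 1) (skip r f) (skip r par) else 0) := by
  have hneg : ∀ (j : ℕ) (g : PS H), cm (D : H →ₗ[ℚ] H) ((-1) ^ j * g) =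
      (-1) ^ j * cm (D : H →ₗ[ℚ] H) g := by
    intro j g
    rcases neg_one_pow_eq_or (PS H) j with h | h <;> simp [h]
  have hP : ∑ j ∈ Finset.range d, (-1) ^ j * ∑ r ∈ Finset.range d,
      (if r ≠ j ∧ r + 1 < d then
        sgn r j * (p r • rep (d - 1) (skip r par) (quot (d - 1) (skip (r + 1) f) (pull r j)))
        else 0) = -∑ r ∈ Finset.range d, (if r + 1 < d then
          p r • altSum (d - 1) (skip (r + 1) f) (skip r par) else 0) := by
    simp only [Finset.mul_sum]
    rw [Finset.sum_comm, ← Finset.sum_neg_distrib]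
    refine Finset.sum_congr rfl fun r hr => ?_
    split_ifs with h
    · rw [altSum_eq (by omega), Finset.smul_sum]
      simp only [← mul_smul_comm]
      rw [← sum_sgn (Finset.mem_range.mp hr) fun i =>
        p r • rep (d - 1) (skip r par) (quot (d - 1) (skip (r + 1) f) i)]
      refine Finset.sum_congr rfl fun j _ => ?_
      by_cases hj : r ≠ j
      · rw [if_pos ⟨hj, h⟩, if_pos hj]
      · rw [if_neg fun hc => hj hc.1, if_neg hj, mul_zero]
    · rw [neg_zero]
      refine Finset.sum_eq_zero fun j _ => ?_
      rw [if_neg fun hc => h hc.2, mul_zero]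
  have hQ : ∑ j ∈ Finset.range d, (-1) ^ j * ∑ r ∈ Finset.range d,
      (if r ≠ j ∧ r ≠ 0 then
        sgn r j * (q r • rep (d - 1) (skip r par) (quot (d - 1) (skip r f) (pull r j)))
        else 0) = -∑ r ∈ Finset.range d, (if r ≠ 0 then
          q r • altSum (d - 1) (skip r f) (skip r par) else 0) := by
    simp only [Finset.mul_sum]
    rw [Finset.sum_comm, ← Finset.sum_neg_distrib]
    refine Finset.sum_congr rfl fun r hr => ?_
    have := Finset.mem_range.mp hr
    split_ifs with h
    · rw [altSum_eq (by omega), Finset.smul_sum]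
      simp only [← mul_smul_comm]
      rw [← sum_sgn (Finset.mem_range.mp hr) fun i =>
        q r • rep (d - 1) (skip r par) (quot (d - 1) (skip r f) i)]
      refine Finset.sum_congr rfl fun j _ => ?_
      by_cases hj : r ≠ j
      · rw [if_pos ⟨hj, h⟩, if_pos hj]
      · rw [if_neg fun hc => hj hc.1, if_neg hj, mul_zero]
    · rw [neg_zero]
      refine Finset.sum_eq_zero fun j _ => ?_
      rw [if_neg fun hc => h hc.2, mul_zero]
  have hsum : cm (D : H →ₗ[ℚ] H) (altSum d f par) = ∑ j ∈ Finset.range d, (-1) ^ j *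
      cm (D : H →ₗ[ℚ] H) (quot d f j) := by
    rw [altSum_par hd, map_sum]
    exact Finset.sum_congr rfl fun j _ => hneg j _
  have hterm : ∀ j ∈ Finset.range d, (-1) ^ j * cm (D : H →ₗ[ℚ] H) (quot d f j) =
      (-1) ^ j * quot d f j * (∑ r ∈ Finset.range d, c r • (par r).cast H)
      - (-1) ^ j * (c j • fracLeft d f par j)
      + (-1) ^ j * (∑ r ∈ Finset.range d, (if r ≠ j ∧ r + 1 < d then
          sgn r j * (p r • rep (d - 1) (skip r par) (quot (d - 1) (skip (r + 1) f) (pull r j)))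
          else 0))
      - (-1) ^ j * (∑ r ∈ Finset.range d, (if r ≠ j ∧ r ≠ 0 then
          sgn r j * (q r • rep (d - 1) (skip r par) (quot (d - 1) (skip r f) (pull r j)))
          else 0)) := by
    intro j hj
    have := Finset.mem_range.mp hj
    rw [cm_quot D this (hK j this) (hW (j + 1) this) hE, mul_sub, mul_add, mul_sub, mul_assoc]
  rw [hsum, Finset.sum_congr rfl hterm, Finset.sum_sub_distrib, Finset.sum_add_distrib,
    Finset.sum_sub_distrib, hP, hQ, ← Finset.sum_mul, altSum_par hd, sub_neg_eq_add,
    ← sub_eq_add_neg]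

end deriv

end SymbPolylog

/-! ### The alternating sum differentiated formally, as a sum of products. -/

namespace SymbPolylog

open MvPowerSeries

section formal

variable {f : ℕ → ℕ} {τ : ℕ → Par} {d : ℕ} {c p q : ℕ → ℚ}

theorem ite_smul_zero_eq (P : Prop) [Decidable P] (a : ℚ) (x : PS H) :
    a • (if P then x else 0) = if P then a • x else 0 := by
  split_ifs <;> simp

theorem tailWord_skip {r k j : ℕ} (hr : r < j) (hk : k ≤ j) :
    tailWord (d - 1) (skip k f) (skip r τ) j = tailWord d f τ (j + 1) := by
  unfold tailWord
  rw [show d - 1 - j = d - (j + 1) by omega]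
  refine word_congr _ (fun a _ => ?_) fun a _ => ?_
  · rw [skip_of_le f (by omega)]; congr 1; omega
  · rw [skip_of_le τ (by omega)]; congr 1; omega

theorem tailWord_skip_self (r : ℕ) :
    tailWord (d - 1) (skip r f) (skip r τ) r = tailWord d f τ (r + 1) := by
  unfold tailWord
  rw [show d - 1 - r = d - (r + 1) by omega]
  refine word_congr _ (fun a _ => ?_) fun a _ => ?_
  · rw [skip_of_le f (by omega)]; congr 1; omega
  · rw [skip_of_le τ (by omega)]; congr 1; omega

/-- A deletion in the inverted word of summand `j + 1` and one in the ordinary word of summand `j`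
give the same product up to sign, so they form the alternating sum of the shortened string. The
summand `j = r + 1` is left over and gives the correction. -/
theorem sum_plus {r : ℕ} (hr : r < d) :
    ∑ j ∈ Finset.range (d + 1), (-1) ^ j *
      ((if r < j then invWord (j - 1) (skip (r + 1) f) (skip r τ) else 0) * tailWord d f τ j -
        invWord j f τ * (if j ≤ r ∧ r + 1 < d then
          tailWord (d - 1) (skip (r + 1) f) (skip r τ) j else 0)) =
      -(if r + 1 < d then altSum (d - 1) (skip (r + 1) f) (skip r τ) else 0)
        - (-1) ^ r * fracLeft d f τ r := by
  obtain ⟨b, rfl⟩ : ∃ b, d = r + 1 + b := ⟨d - (r + 1), by omega⟩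
  have hA : fracLeft (r + 1 + b) f τ r =
      invWord r (skip (r + 1) f) (skip r τ) * tailWord (r + 1 + b) f τ (r + 1) := by
    rw [fracLeft, invWord_skip (Nat.lt_succ_self r) le_rfl]
  rw [add_right_comm, Finset.sum_range_add, Finset.sum_range_succ _ (r + 1)]
  have hmid : (-1 : PS H) ^ (r + 1) * ((if r < r + 1 then
      invWord (r + 1 - 1) (skip (r + 1) f) (skip r τ) else 0) * tailWord (r + 1 + b) f τ (r + 1) -
        invWord (r + 1) f τ * (if r + 1 ≤ r ∧ r + 1 < r + 1 + b then
          tailWord (r + 1 + b - 1) (skip (r + 1) f) (skip r τ) (r + 1) else 0)) =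
      -((-1) ^ r * fracLeft (r + 1 + b) f τ r) := by
    rw [if_pos (Nat.lt_succ_self r), if_neg (by omega), hA, Nat.add_sub_cancel]
    ring
  rw [hmid]
  by_cases hb : b = 0
  · subst hb
    rw [if_neg (by omega), Finset.sum_range_zero, Finset.sum_eq_zero]
    · ring
    · intro j hj
      have := Finset.mem_range.mp hj
      rw [if_neg (by omega), if_neg (by omega)]
      ring
  · rw [if_pos (by omega), altSum, show r + 1 + b - 1 + 1 = r + 1 + b by omega,
      Finset.sum_range_add _ (r + 1) b]
    have h1 : ∀ j ∈ Finset.range (r + 1), (-1 : PS H) ^ j *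
        ((if r < j then invWord (j - 1) (skip (r + 1) f) (skip r τ) else 0) *
          tailWord (r + 1 + b) f τ j -
          invWord j f τ * (if j ≤ r ∧ r + 1 < r + 1 + b then
            tailWord (r + 1 + b - 1) (skip (r + 1) f) (skip r τ) j else 0)) =
        -((-1) ^ j * (invWord j (skip (r + 1) f) (skip r τ) *
          tailWord (r + 1 + b - 1) (skip (r + 1) f) (skip r τ) j)) := by
      intro j hj
      have := Finset.mem_range.mp hj
      rw [if_neg (by omega), if_pos (by omega), invWord_skip (by omega) (by omega)]
      ring
    have h2 : ∀ x ∈ Finset.range b, (-1 : PS H) ^ (r + 1 + 1 + x) *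
        ((if r < r + 1 + 1 + x then invWord (r + 1 + 1 + x - 1) (skip (r + 1) f) (skip r τ) else 0) *
          tailWord (r + 1 + b) f τ (r + 1 + 1 + x) -
          invWord (r + 1 + 1 + x) f τ * (if r + 1 + 1 + x ≤ r ∧ r + 1 < r + 1 + b then
            tailWord (r + 1 + b - 1) (skip (r + 1) f) (skip r τ) (r + 1 + 1 + x) else 0)) =
        -((-1) ^ (r + 1 + x) * (invWord (r + 1 + x) (skip (r + 1) f) (skip r τ) *
          tailWord (r + 1 + b - 1) (skip (r + 1) f) (skip r τ) (r + 1 + x))) := by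
      intro x _
      rw [if_pos (by omega), if_neg (by omega), tailWord_skip (by omega) (by omega),
        show r + 1 + 1 + x - 1 = r + 1 + x by omega, show r + 1 + 1 + x = r + 1 + x + 1 by omega]
      ring
    rw [Finset.sum_congr rfl h1, Finset.sum_congr rfl h2, Finset.sum_neg_distrib,
      Finset.sum_neg_distrib]
    ring

/-- As in `sum_plus`, with the break in front of the deleted letter removed. Now the summand `j = r`
is left over, and it gives the same correction. -/
theorem sum_minus {r : ℕ} (hr : r < d) :
    ∑ j ∈ Finset.range (d + 1), (-1) ^ j *
      ((if r ≠ 0 ∧ r < j then invWord (j - 1) (skip r f) (skip r τ) else 0) * tailWord d f τ j -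
        invWord j f τ * (if j ≤ r then tailWord (d - 1) (skip r f) (skip r τ) j else 0)) =
      -(if r ≠ 0 then altSum (d - 1) (skip r f) (skip r τ) else 0)
        - (-1) ^ r * fracLeft d f τ r := by
  obtain ⟨b, rfl⟩ : ∃ b, d = r + 1 + b := ⟨d - (r + 1), by omega⟩
  have hA : fracLeft (r + 1 + b) f τ r =
      invWord r f τ * tailWord (r + 1 + b - 1) (skip r f) (skip r τ) r := by
    rw [fracLeft, tailWord_skip_self]
  rw [show r + 1 + b + 1 = r + 1 + (b + 1) by omega, Finset.sum_range_add,
    Finset.sum_range_succ _ r]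
  have hmid : (-1 : PS H) ^ r * ((if r ≠ 0 ∧ r < r then
      invWord (r - 1) (skip r f) (skip r τ) else 0) * tailWord (r + 1 + b) f τ r -
        invWord r f τ * (if r ≤ r then
          tailWord (r + 1 + b - 1) (skip r f) (skip r τ) r else 0)) =
      -((-1) ^ r * fracLeft (r + 1 + b) f τ r) := by
    rw [if_neg (by omega), if_pos le_rfl, hA]
    ring
  rw [hmid]
  by_cases hr0 : r = 0
  · subst hr0
    rw [if_neg (by omega), Finset.sum_range_zero, Finset.sum_eq_zero]
    · ring
    · intro x _
      rw [if_neg (by omega), if_neg (by omega)]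
      ring
  · rw [if_pos hr0, altSum, show r + 1 + b - 1 + 1 = r + (b + 1) by omega,
      Finset.sum_range_add _ r (b + 1)]
    have h1 : ∀ j ∈ Finset.range r, (-1 : PS H) ^ j *
        ((if r ≠ 0 ∧ r < j then invWord (j - 1) (skip r f) (skip r τ) else 0) *
          tailWord (r + 1 + b) f τ j -
          invWord j f τ * (if j ≤ r then
            tailWord (r + 1 + b - 1) (skip r f) (skip r τ) j else 0)) =
        -((-1) ^ j * (invWord j (skip r f) (skip r τ) *
          tailWord (r + 1 + b - 1) (skip r f) (skip r τ) j)) := by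
      intro j hj
      have := Finset.mem_range.mp hj
      rw [if_neg (by omega), if_pos (by omega), invWord_skip (by omega) (by omega)]
      ring
    have h2 : ∀ x ∈ Finset.range (b + 1), (-1 : PS H) ^ (r + 1 + x) *
        ((if r ≠ 0 ∧ r < r + 1 + x then invWord (r + 1 + x - 1) (skip r f) (skip r τ) else 0) *
          tailWord (r + 1 + b) f τ (r + 1 + x) -
          invWord (r + 1 + x) f τ * (if r + 1 + x ≤ r then
            tailWord (r + 1 + b - 1) (skip r f) (skip r τ) (r + 1 + x) else 0)) =
        -((-1) ^ (r + x) * (invWord (r + x) (skip r f) (skip r τ) *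
          tailWord (r + 1 + b - 1) (skip r f) (skip r τ) (r + x))) := by
      intro x _
      have hW : tailWord (r + 1 + b - 1) (skip r f) (skip r τ) (r + x) =
          tailWord (r + 1 + b) f τ (r + x + 1) := by
        rcases Nat.eq_zero_or_pos x with rfl | hx
        · exact tailWord_skip_self r
        · exact tailWord_skip (by omega) (by omega)
      rw [if_pos ⟨hr0, by omega⟩, if_neg (by omega), hW,
        show r + 1 + x - 1 = r + x by omega, show r + 1 + x = r + x + 1 by omega]
      ring
    rw [Finset.sum_congr rfl h1, Finset.sum_congr rfl h2, Finset.sum_neg_distrib,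
      Finset.sum_neg_distrib]
    ring

/-- The corrections from the two kinds of deletion carry the factors `p r` and `q r` with opposite
signs. Since `p r = q r + c r`, which expresses d[y⁻¹]_1 = d[y]_1 + d[y]_0, they leave exactly the
`c r` terms found for the quotients. -/
theorem sum_formal (hpq : ∀ r < d, p r = q r + c r) :
    ∑ j ∈ Finset.range (d + 1), (-1) ^ j *
      (invRHS c p q d j f τ * tailWord d f τ j + invWord j f τ * tailRHS c p q d j f τ) =
      altSum d f τ * ∑ r ∈ Finset.range d, c r • (τ r).cast H
      - ∑ j ∈ Finset.range d, (-1) ^ j * (c j • fracLeft d f τ j)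
      - ∑ r ∈ Finset.range d, (if r + 1 < d then
          p r • altSum (d - 1) (skip (r + 1) f) (skip r τ) else 0)
      + ∑ r ∈ Finset.range d, (if r ≠ 0 then
          q r • altSum (d - 1) (skip r f) (skip r τ) else 0) := by
  have hterm : ∀ j ∈ Finset.range (d + 1), (-1) ^ j *
      (invRHS c p q d j f τ * tailWord d f τ j + invWord j f τ * tailRHS c p q d j f τ) =
      (-1) ^ j * (invWord j f τ * tailWord d f τ j) * (∑ r ∈ Finset.range d, c r • (τ r).cast H)
      + ∑ r ∈ Finset.range d, p r • ((-1) ^ j *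
      ((if r < j then invWord (j - 1) (skip (r + 1) f) (skip r τ) else 0) * tailWord d f τ j -
        invWord j f τ * (if j ≤ r ∧ r + 1 < d then
          tailWord (d - 1) (skip (r + 1) f) (skip r τ) j else 0)))
      - ∑ r ∈ Finset.range d, q r • ((-1) ^ j *
      ((if r ≠ 0 ∧ r < j then invWord (j - 1) (skip r f) (skip r τ) else 0) * tailWord d f τ j -
        invWord j f τ * (if j ≤ r then tailWord (d - 1) (skip r f) (skip r τ) j else 0))) := by
    intro j _
    have hS : ∑ r ∈ Finset.range d, c r • (τ r).cast H =
        ∑ r ∈ Finset.range d, (if r < j then c r • (τ r).cast H else 0) +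
        ∑ r ∈ Finset.range d, (if j ≤ r then c r • (τ r).cast H else 0) := by
      rw [← Finset.sum_add_distrib]
      refine Finset.sum_congr rfl fun r _ => ?_
      rcases lt_or_ge r j with h | h
      · rw [if_pos h, if_neg h.not_ge, add_zero]
      · rw [if_neg h.not_gt, if_pos h, zero_add]
    have hP : ∑ r ∈ Finset.range d, p r • ((-1) ^ j *
      ((if r < j then invWord (j - 1) (skip (r + 1) f) (skip r τ) else 0) * tailWord d f τ j -
        invWord j f τ * (if j ≤ r ∧ r + 1 < d then
          tailWord (d - 1) (skip (r + 1) f) (skip r τ) j else 0))) =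
        (-1) ^ j * ((∑ r ∈ Finset.range d,
          (if r < j then p r • invWord (j - 1) (skip (r + 1) f) (skip r τ) else 0)) *
          tailWord d f τ j) - (-1) ^ j * (invWord j f τ * ∑ r ∈ Finset.range d,
          (if j ≤ r ∧ r + 1 < d then
            p r • tailWord (d - 1) (skip (r + 1) f) (skip r τ) j else 0)) := by
      rw [Finset.sum_mul, Finset.mul_sum, Finset.mul_sum, Finset.mul_sum, ← Finset.sum_sub_distrib]
      refine Finset.sum_congr rfl fun r _ => ?_
      rw [← ite_smul_zero_eq, ← ite_smul_zero_eq, smul_mul_assoc, mul_smul_comm, mul_smul_comm,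
        mul_smul_comm, mul_sub, smul_sub]
    have hQ : ∑ r ∈ Finset.range d, q r • ((-1) ^ j *
      ((if r ≠ 0 ∧ r < j then invWord (j - 1) (skip r f) (skip r τ) else 0) * tailWord d f τ j -
        invWord j f τ * (if j ≤ r then tailWord (d - 1) (skip r f) (skip r τ) j else 0))) =
        (-1) ^ j * ((∑ r ∈ Finset.range d,
          (if r ≠ 0 ∧ r < j then q r • invWord (j - 1) (skip r f) (skip r τ) else 0)) *
          tailWord d f τ j) - (-1) ^ j * (invWord j f τ * ∑ r ∈ Finset.range d,
          (if j ≤ r then q r • tailWord (d - 1) (skip r f) (skip r τ) j else 0)) := by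
      rw [Finset.sum_mul, Finset.mul_sum, Finset.mul_sum, Finset.mul_sum, ← Finset.sum_sub_distrib]
      refine Finset.sum_congr rfl fun r _ => ?_
      rw [← ite_smul_zero_eq, ← ite_smul_zero_eq, smul_mul_assoc, mul_smul_comm, mul_smul_comm,
        mul_smul_comm, mul_sub, smul_sub]
    rw [hS, hP, hQ]
    unfold invRHS tailRHS
    ring
  rw [Finset.sum_congr rfl hterm, Finset.sum_sub_distrib, Finset.sum_add_distrib,
    Finset.sum_comm (s := Finset.range (d + 1)), Finset.sum_comm (s := Finset.range (d + 1)),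
    ← Finset.sum_mul]
  simp only [← Finset.smul_sum]
  have hPs : ∀ r ∈ Finset.range d, p r • ∑ j ∈ Finset.range (d + 1), (-1) ^ j *
      ((if r < j then invWord (j - 1) (skip (r + 1) f) (skip r τ) else 0) * tailWord d f τ j -
        invWord j f τ * (if j ≤ r ∧ r + 1 < d then
          tailWord (d - 1) (skip (r + 1) f) (skip r τ) j else 0)) =
      -(if r + 1 < d then p r • altSum (d - 1) (skip (r + 1) f) (skip r τ) else 0) -
        ((-1) ^ r * (c r • fracLeft d f τ r) + q r • ((-1) ^ r * fracLeft d f τ r)) := by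
    intro r hr
    have hr' := Finset.mem_range.mp hr
    rw [sum_plus hr', smul_sub, smul_neg, ite_smul_zero_eq, hpq r hr', add_smul _ _ (_ * _),
      mul_smul_comm, add_comm (q r • ((-1) ^ r * fracLeft d f τ r))]
  have hQs : ∀ r ∈ Finset.range d, q r • ∑ j ∈ Finset.range (d + 1), (-1) ^ j *
      ((if r ≠ 0 ∧ r < j then invWord (j - 1) (skip r f) (skip r τ) else 0) * tailWord d f τ j -
        invWord j f τ * (if j ≤ r then tailWord (d - 1) (skip r f) (skip r τ) j else 0)) =
      -(if r ≠ 0 then q r • altSum (d - 1) (skip r f) (skip r τ) else 0) -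
        q r • ((-1) ^ r * fracLeft d f τ r) := by
    intro r hr
    rw [sum_minus (Finset.mem_range.mp hr), smul_sub, smul_neg, ite_smul_zero_eq]
  rw [Finset.sum_congr rfl hPs, Finset.sum_congr rfl hQs, Finset.sum_sub_distrib,
    Finset.sum_sub_distrib, Finset.sum_neg_distrib, Finset.sum_neg_distrib, Finset.sum_add_distrib,
    altSum]
  ring

end formal

end SymbPolylog

namespace SymbPolylog

open MvPowerSeries

/-! ### Derivatives of the series of inverted symbols -/

theorem sum_range_ite_le {M : Type} [AddCommMonoid M] {i d : ℕ} (hi : i ≤ d) (g : ℕ → M) :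
    ∑ r ∈ Finset.range d, (if i ≤ r then g r else 0) =
      ∑ x ∈ Finset.range (d - i), g (i + x) := by
  obtain ⟨b, rfl⟩ := Nat.exists_eq_add_of_le hi
  rw [Finset.sum_range_add, Finset.sum_eq_zero, zero_add, Nat.add_sub_cancel_left]
  · exact Finset.sum_congr rfl fun x _ => if_pos (Nat.le_add_right _ _)
  · intro r hr
    exact if_neg (Finset.mem_range.mp hr).not_ge

theorem sum_range_ite_le_and {M : Type} [AddCommMonoid M] {i d : ℕ} (hi : i ≤ d) (g : ℕ → M) :
    ∑ r ∈ Finset.range d, (if i ≤ r ∧ r + 1 < d then g r else 0) =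
      ∑ x ∈ Finset.range (d - i - 1), g (i + x) := by
  have h : ∀ r ∈ Finset.range d, (if i ≤ r ∧ r + 1 < d then g r else 0) =
      if i ≤ r then (if r + 1 < d then g r else 0) else 0 := fun r _ => ite_and ..
  rw [Finset.sum_congr rfl h, sum_range_ite_le hi]
  symm
  refine Finset.sum_subset_zero_on_sdiff (Finset.range_subset_range.mpr (Nat.sub_le _ _))
    (fun x hx => ?_) fun x hx => ?_
  · simp only [Finset.mem_sdiff, Finset.mem_range] at hx
    exact if_neg (by omega)
  · have := Finset.mem_range.mp hx
    exact (if_pos (by omega)).symm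

theorem sum_range_ite_lt {M : Type} [AddCommMonoid M] {j d : ℕ} (hj : j ≤ d) (P : ℕ → Prop)
    [DecidablePred P] (g : ℕ → M) :
    ∑ r ∈ Finset.range d, (if P r ∧ r < j then g r else 0) =
      ∑ r ∈ Finset.range j, if P r ∧ r < j then g r else 0 := by
  symm
  refine Finset.sum_subset (Finset.range_subset_range.mpr hj) fun r _ hr => ?_
  rw [Finset.mem_range] at hr
  exact if_neg fun h => hr h.2

/-- Letters from `j` on contribute nothing. The longer summation range lets summands of different
depth share their indices. -/
theorem invRHS_pad (c p q : ℕ → ℚ) {j d : ℕ} (hj : j ≤ d) (f : ℕ → ℕ) (τ : ℕ → Par) :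
    invRHS c p q d j f τ = invRHS c p q j j f τ := by
  have h1 := sum_range_ite_lt hj (fun _ => True) fun r => c r • (τ r).cast H
  have h2 := sum_range_ite_lt hj (fun _ => True)
    fun r => p r • invWord (j - 1) (skip (r + 1) f) (skip r τ)
  have h3 := sum_range_ite_lt hj (fun r => r ≠ 0)
    fun r => q r • invWord (j - 1) (skip r f) (skip r τ)
  simp only [true_and] at h1 h2
  rw [invRHS, invRHS, h1, h2, h3]

theorem rep_invRHS (c p q : ℕ → ℚ) (d : ℕ) (f : ℕ → ℕ) (τ : ℕ → Par) :
    rep d τ (invRHS c p q d d f par) = invRHS c p q d d f τ := by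
  have h : ∀ k r, rep d τ (invWord (d - 1) (skip k f) (skip r par)) =
      invWord (d - 1) (skip k f) (skip r τ) := fun k r => by
    rw [rep_invWord]
    exact invWord_congr_par fun a ha => Par.rep_skip τ (by omega)
  unfold invRHS
  simp only [map_sub, map_add, map_mul, map_sum, apply_ite (rep d τ), map_zero, rep_rat_smul, h,
    rep_cast, rep_invWord]
  rw [invWord_congr_par fun a ha => Par.rep_par τ ha]
  refine congrArg₂ _ (congrArg₂ _ (congrArg _ (Finset.sum_congr rfl fun r hr => ?_)) rfl) rfl
  rw [Par.rep_par τ (Finset.mem_range.mp hr)]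

variable (o : ℕ → ℕ → ℚ) (l : ℕ → ℚ)

theorem ext_of_lt {a b : ℕ} (h : a < b) : ext o l a b = o a b := if_pos h

theorem ext_of_gt {a b : ℕ} (h : b < a) : ext o l a b = o b a + (l a - l b) := if_neg h.not_gt

theorem tailWord_skip_eq (d : ℕ) (f : ℕ → ℕ) (τ : ℕ → Par) (i k x : ℕ) :
    word bracketH (d - i - 1) (skip k fun a => f (i + a)) (skip x fun a => τ (i + a)) =
      tailWord (d - 1) (skip (i + k) f) (skip (i + x) τ) i := by
  unfold tailWord
  rw [Nat.sub_right_comm]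
  refine word_congr _ (fun a _ => ?_) fun a _ => ?_
  · unfold skip
    split_ifs <;> first | rfl | omega
  · unfold skip
    split_ifs <;> first | rfl | omega

theorem cm_tailWord {d : ℕ} {f : ℕ → ℕ} (hf : Up d f) {i : ℕ} (hi : i ≤ d) (τ : ℕ → Par) :
    cm (dH o l : H →ₗ[ℚ] H) (tailWord d f τ i) =
      tailRHS (fun r => l (f (r + 1)) - l (f r)) (fun r => ext o l (f (r + 1)) (f r))
        (fun r => ext o l (f r) (f (r + 1))) d i f τ := by
  rw [tailRHS, sum_range_ite_le hi, sum_range_ite_le hi, sum_range_ite_le_and hi, tailWord,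
    cm_dH_word o l fun a b hab hb => hf _ _ (by omega) (by omega), dRHS]
  simp only [tailWord_skip_eq]
  rfl

/-- Strong induction on `d`. The derivative of the alternating sum computed from quotients equals
the formal one computed from products. By induction the summands `j < d` agree, so the summand `j =
d`, which is the inverted word up to sign, has the expected derivative as well. -/
theorem cm_invWord {d : ℕ} {f : ℕ → ℕ} (hf : Up d f) (τ : ℕ → Par) :
    cm (dH o l : H →ₗ[ℚ] H) (invWord d f τ) =
      invRHS (fun r => l (f (r + 1)) - l (f r)) (fun r => ext o l (f (r + 1)) (f r))
        (fun r => ext o l (f r) (f (r + 1))) d d f τ := by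
  induction d using Nat.strong_induction_on generalizing τ with
  | _ d ih =>
  set c : ℕ → ℚ := fun r => l (f (r + 1)) - l (f r) with hc
  set p : ℕ → ℚ := fun r => ext o l (f (r + 1)) (f r) with hp
  set q : ℕ → ℚ := fun r => ext o l (f r) (f (r + 1)) with hq
  rcases Nat.eq_zero_or_pos d with rfl | hd
  · have h1 : cm (dH o l : H →ₗ[ℚ] H) (1 : PS H) = 0 := by
      have := cm_mul (dH o l) (1 : PS H) 1
      simpa using this
    rw [invWord_zero, h1]
    simp [invRHS]
  have hK : ∀ j < d, ∀ τ, cm (dH o l : H →ₗ[ℚ] H) (invWord j f τ) = invRHS c p q d j f τ := by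
    intro j hj τ
    rw [invRHS_pad c p q hj.le]
    exact ih j hj (fun a b hab hb => hf a b hab (by omega)) τ
  have hW : ∀ i ≤ d, ∀ τ, cm (dH o l : H →ₗ[ℚ] H) (tailWord d f τ i) = tailRHS c p q d i f τ :=
    fun i hi τ => cm_tailWord o l hf hi τ
  have hE : dH o l (logH (f 0) (f d)) = algebraMap ℚ H (∑ r ∈ Finset.range d, c r) := by
    rw [dH_logH, Finset.sum_range_sub fun r => l (f r)]
  have hpq : ∀ r < d, p r = q r + c r := by
    intro r hr
    have := hf r (r + 1) (by omega) hr
    simp only [hp, hq, hc]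
    rw [ext_of_gt o l this, ext_of_lt o l this]
  have hneg : ∀ (j : ℕ) (g : PS H), cm (dH o l : H →ₗ[ℚ] H) ((-1) ^ j * g) =
      (-1) ^ j * cm (dH o l : H →ₗ[ℚ] H) g := by
    intro j g
    rcases neg_one_pow_eq_or (PS H) j with h | h <;> simp [h]
  have hpar : cm (dH o l : H →ₗ[ℚ] H) (invWord d f par) = invRHS c p q d d f par := by
    have h1 := cm_altSum_par (dH o l) hd.ne' hK hW hE
    rw [← sum_formal hpq, altSum, map_sum, Finset.sum_range_succ, Finset.sum_range_succ] at h1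
    have h2 : ∀ j ∈ Finset.range d, cm (dH o l : H →ₗ[ℚ] H)
        ((-1) ^ j * (invWord j f par * tailWord d f par j)) = (-1) ^ j *
        (invRHS c p q d j f par * tailWord d f par j + invWord j f par * tailRHS c p q d j f par) := by
      intro j hj
      have hj := Finset.mem_range.mp hj
      rw [hneg, cm_mul, hK j hj, hW j hj.le]
    -- The summands `j < d` cancel. In the summand `j = d` the ordinary word is `1`, so its part of
    -- the Leibniz rule is the same on both sides.
    rw [Finset.sum_congr rfl h2, add_right_inj, hneg, cm_mul, hW d le_rfl, tailWord_self, mul_one,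
      mul_one] at h1
    have h3 : ((-1 : PS H)) ^ d * (-1) ^ d = 1 := by
      rw [← mul_pow, neg_mul_neg, one_mul, one_pow]
    have h4 := congrArg (fun x => (-1 : PS H) ^ d * x) h1
    simp only [← mul_assoc, h3, one_mul] at h4
    exact add_right_cancel h4
  have h5 : invWord d f τ = rep d τ (invWord d f par) := by
    rw [rep_invWord]
    exact invWord_congr_par fun a ha => (Par.rep_par τ ha).symm
  rw [h5, cm_rep, hpar, rep_invRHS]

/-- The series of inverted symbols, for decreasing break points. -/
def revWord (d : ℕ) (e : ℕ → ℕ) (s : ℕ → Par) : PS H :=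
  invWord d (fun a => e (d - a)) fun a => -s (d - 1 - a)

theorem revWord_skip {d : ℕ} (e : ℕ → ℕ) (s : ℕ → Par) {j k : ℕ} (hk : k < d) (hj : j ≤ d)  :
    revWord (d - 1) (skip j e) (skip k s) =
      invWord (d - 1) (skip (d - j) fun a => e (d - a))
        (skip (d - 1 - k) fun a => -s (d - 1 - a)) := by
  refine invWord_congr (fun a ha => ?_) fun a ha => ?_
  · unfold skip
    split_ifs <;> first | omega | (congr 1; omega)
  · unfold skip
    split_ifs <;> first | omega | (congr 2; omega)

/-- Reading the letters backwards turns `p` and `q` into the scalars of the reversed string. The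
reversed logarithms change sign, and so do the parameters, so these signs cancel. -/
theorem cm_revWord {d : ℕ} {e : ℕ → ℕ} (he : Down d e) (s : ℕ → Par) :
    cm (dH o l : H →ₗ[ℚ] H) (revWord d e s) = dRHS (ext o l) l revWord d e s := by
  rw [revWord, cm_invWord o l fun a b hab hb => he _ _ (by omega) (by omega), invRHS, dRHS]
  refine congrArg₂ _ (congrArg₂ _ (congrArg _ ?_) ?_) ?_
  · rw [← Finset.sum_range_reflect]
    refine Finset.sum_congr rfl fun k hk => ?_
    have hk := Finset.mem_range.mp hk
    rw [if_pos (by omega), cast_neg, show d - (d - 1 - k + 1) = k by omega,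
      show d - (d - 1 - k) = k + 1 by omega, show d - 1 - (d - 1 - k) = k by omega]
    module
  · rw [← Finset.sum_range_reflect]
    refine Finset.sum_congr rfl fun k hk => ?_
    have hk := Finset.mem_range.mp hk
    rw [if_pos (by omega), revWord_skip e s hk hk.le, show d - (d - 1 - k + 1) = k by omega,
      show d - (d - 1 - k) = k + 1 by omega, show d - 1 - k + 1 = d - k by omega]
  · rcases Nat.eq_zero_or_pos d with rfl | hd
    · rfl
    obtain ⟨b, rfl⟩ : ∃ b, d = b + 1 := ⟨d - 1, by omega⟩
    rw [Finset.sum_range_succ', if_neg (by omega), add_zero, Nat.add_sub_cancel,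
      ← Finset.sum_range_reflect]
    refine Finset.sum_congr rfl fun k hk => ?_
    have hk := Finset.mem_range.mp hk
    have h := revWord_skip e s (d := b + 1) (j := k + 1) (k := k) (by omega) (by omega)
    rw [Nat.add_sub_cancel] at h
    rw [if_pos (by omega), h, show b + 1 - (b - 1 - k + 1 + 1) = k by omega,
      show b + 1 - (b - 1 - k + 1) = k + 1 by omega, show b - 1 - k + 1 = b - k by omega,
      show b + 1 - (k + 1) = b - k by omega]

end SymbPolylog

namespace SymbPolylog

open MvPowerSeries

/-! ### The inversion map -/

theorem monomial_ev {A : Type} [CommRing A] (d : ℕ) (n : ℕ → ℕ) :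
    monomial (ev d fun r => n r + 1) (1 : A) = ∏ r ∈ Finset.range d, (X r : PS A) ^ n r := by
  rw [monomial_one_eq, Finsupp.prod_of_support_subset (s := Finset.range d)]
  · refine Finset.prod_congr rfl fun r hr => ?_
    rw [ev_apply, if_pos (Finset.mem_range.mp hr), Nat.add_sub_cancel]
  · intro r hr
    rw [Finset.mem_range]
    by_contra h
    rw [Finsupp.mem_support_iff, ev_apply, if_neg h] at hr
    exact hr rfl
  · simp

/-- Reversal of the order and of the signs of the parameters. -/
theorem coeff_rep_neg_rev {A : Type} [CommRing A] [Algebra ℚ A] (d : ℕ) (g : PS A)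
    (n : ℕ → ℕ) : coeff (ev d n) (rep d (fun a => -par (d - 1 - a)) g) =
      (-1) ^ (∑ k ∈ Finset.range d, (n k - 1)) * coeff (ev d fun k => n (d - 1 - k)) g := by
  classical
  rw [rep_apply, coeff_subst ((hasSubst_truncPar d _).map _)]
  have key : ∀ k : ℕ →₀ ℕ, (k.prod fun r e => (map (algebraMap ℚ A)
      (truncPar d (fun a => -par (d - 1 - a)) r)) ^ e) =
      if ∀ r ∈ k.support, r < d then (-1) ^ (∑ r ∈ Finset.range d, k r) *
        monomial (ev d fun r => k (d - 1 - r) + 1) (1 : A) else 0 := by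
    intro k
    split_ifs with h
    · rw [monomial_ev, Finsupp.prod_of_support_subset (s := Finset.range d)]
      · rw [← Finset.prod_range_reflect, ← Finset.prod_pow_eq_pow_sum,
          ← Finset.prod_range_reflect (fun i => (-1 : PS A) ^ k i), ← Finset.prod_mul_distrib]
        refine Finset.prod_congr rfl fun r hr => ?_
        have hr := Finset.mem_range.mp hr
        have h1 : map (algebraMap ℚ A) (truncPar d (fun a => -par (d - 1 - a)) (d - 1 - r)) =
            -(X r : PS A) := by
          unfold truncPar
          rw [if_pos (by omega)]
          dsimp only
          rw [show d - 1 - (d - 1 - r) = r by omega]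
          simp [par]
        rw [h1, neg_pow]
      · intro r hr
        exact Finset.mem_range.mpr (h r hr)
      · simp
    · push Not at h
      obtain ⟨r, hr, h⟩ := h
      refine Finset.prod_eq_zero hr ?_
      have : k r ≠ 0 := Finsupp.mem_support_iff.mp hr
      simp [truncPar, h.not_gt, this]
  have hsign : ∀ (a : ℕ) (x : PS A) (m : ℕ →₀ ℕ), coeff m ((-1) ^ a * x) =
      (-1) ^ a * coeff m x := by
    intro a x m
    rcases Nat.even_or_odd a with h | h
    · rw [h.neg_one_pow, h.neg_one_pow, one_mul, one_mul]
    · rw [h.neg_one_pow, h.neg_one_pow, neg_one_mul, neg_one_mul, map_neg]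
  simp only [key]
  have hs : ∀ r ∈ (ev d fun k => n (d - 1 - k)).support, r < d := by
    intro r hr
    by_contra h
    rw [Finsupp.mem_support_iff, ev_apply, if_neg h] at hr
    exact hr rfl
  have hev : ∀ k : ℕ →₀ ℕ, (∀ r ∈ k.support, r < d) →
      (ev d n = ev d fun r => k (d - 1 - r) + 1) → k = ev d fun k => n (d - 1 - k) := by
    intro k hk h
    ext r
    rw [ev_apply]
    split_ifs with hr
    · have := DFunLike.congr_fun h (d - 1 - r)
      rw [ev_apply, ev_apply, if_pos (by omega), if_pos (by omega),
        show d - 1 - (d - 1 - r) = r by omega] at this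
      omega
    · by_contra h0
      exact hr (hk r (Finsupp.mem_support_iff.mpr h0))
  rw [finsum_eq_single _ (ev d fun k => n (d - 1 - k))]
  · have h1 : (ev d fun r => (ev d fun k => n (d - 1 - k)) (d - 1 - r) + 1) = ev d n := by
      ext r
      simp only [ev_apply]
      by_cases hr : r < d
      · rw [if_pos hr, if_pos hr, if_pos (by omega), show d - 1 - (d - 1 - r) = r by omega]
        rfl
      · rw [if_neg hr, if_neg hr]
    have h2 : ∑ r ∈ Finset.range d, (ev d fun k => n (d - 1 - k)) r =
        ∑ k ∈ Finset.range d, (n k - 1) := by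
      rw [← Finset.sum_range_reflect]
      refine Finset.sum_congr rfl fun r hr => ?_
      have hr := Finset.mem_range.mp hr
      rw [ev_apply, if_pos (by omega), show d - 1 - (d - 1 - r) = r by omega]
    rw [if_pos hs, h1, h2, hsign, coeff_monomial_same, mul_one, smul_eq_mul, mul_comm]
  · intro k hk
    split_ifs with h
    · rw [hsign, coeff_monomial_ne fun h1 => hk (hev k h h1), mul_zero, smul_zero]
    · simp

theorem INV_log (r : ℕ) : INV (MvPolynomial.X (.log r)) = MvPolynomial.X (.log r) :=
  MvPolynomial.aeval_X _ _

theorem INV_reg (s : PolySymbol) : INV (MvPolynomial.X (.reg s)) = MvPolynomial.X (.reg s) :=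
  MvPolynomial.aeval_X _ _

theorem INV_inv (s : PolySymbol) : INV (MvPolynomial.X (.inv s)) =
    (-1) ^ (∑ k, (s.n k - 1)) * coeff (expVec s.n) (invSeries s.seq s.depth) :=
  MvPolynomial.aeval_X _ _

theorem INV_bracket_up {d : ℕ} {e n : ℕ → ℕ} (he : Up d e) (hn : ∀ k, 0 < n k) :
    INV (bracketHBar d (fun a => e a) fun k => n k) = bracketH d (fun a => e a) fun k => n k := by
  rcases Nat.eq_zero_or_pos d with rfl | hd
  · rw [bracketHBar_zero, bracketH_zero, map_one]
  · rw [bracketHBar_up hd he hn, bracketH_up hd he hn, INV_reg]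

theorem map_INV_word_up {d : ℕ} {e : ℕ → ℕ} (he : Up d e) (s : ℕ → Par) :
    map INV.toRingHom (word bracketHBar d e s) = word bracketH d e s := by
  have h : map INV.toRingHom (word bracketHBar d e par) = word bracketH d e par := by
    refine ext_ev (d := d) ?_ (rep_word_par _ le_rfl par e) fun n hn => ?_
    · rw [← rep_map, rep_word_par _ le_rfl par e]
    · rw [coeff_map, coeff_word_par _ d e n hn, coeff_word_par _ d e n hn]
      exact INV_bracket_up he hn
  rw [← rep_word_par bracketHBar le_rfl s, ← rep_word_par bracketH le_rfl s, ← h, rep_map]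

/-- The sign in `INV` and the reversed weights are the effect on coefficients of replacing the
variables by their negatives in reverse order. -/
theorem INV_bracket_down {d : ℕ} {e n : ℕ → ℕ} (he : Down d e) (hn : ∀ k, 0 < n k) :
    INV (bracketHBar d (fun a => e a) fun k => n k) = coeff (ev d n) (revWord d e par) := by
  rw [revWord, invWord, coeff_rep_neg_rev]
  rcases Nat.eq_zero_or_pos d with rfl | hd
  · rw [bracketHBar_zero, map_one, invSeries_zero]
    have : (ev 0 fun k => n (0 - 1 - k)) = 0 := by
      ext r; simp [ev_apply]
    rw [this, Finset.sum_range_zero, pow_zero, one_mul, coeff_zero_one]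
  · rw [bracketHBar_down hd he hn, INV_inv]
    have h1 : expVec (downSymbol hd he hn).n = ev d fun k => n (d - 1 - k) := by
      change expVec (fun k : Fin d => n (k.rev : Fin d)) = expVec fun k : Fin d => n (d - 1 - k)
      congr 1
      funext k
      rw [Fin.val_rev, Nat.sub_sub, Nat.add_comm]
    have h2 : ∑ k, ((downSymbol hd he hn).n k - 1) = ∑ k ∈ Finset.range d, (n k - 1) := by
      rw [Finset.sum_range fun k => n k - 1]
      exact Equiv.sum_comp Fin.revPerm fun k : Fin d => n k - 1
    rw [h1, h2]
    refine congrArg _ (congrArg _ ?_)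
    exact invSeries_congr fun a ha => downSymbol_seq hd he hn ha

theorem rep_revWord (d : ℕ) (e : ℕ → ℕ) (s : ℕ → Par) :
    rep d s (revWord d e par) = revWord d e s := by
  rw [revWord, rep_invWord, revWord]
  refine invWord_congr_par fun a ha => ?_
  have h : ∀ x : Par, (-x).rep d s = -x.rep d s := fun x => by
    have h1 := Par.rep_sub d s 0 x
    have h2 : (0 : Par).rep d s = 0 := by
      have h3 := Par.rep_sub d s 0 0
      rwa [sub_self, sub_self] at h3
    rwa [h2, zero_sub, zero_sub] at h1
  rw [h, Par.rep_par s (by omega)]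

theorem map_INV_word_down {d : ℕ} {e : ℕ → ℕ} (he : Down d e) (s : ℕ → Par) :
    map INV.toRingHom (word bracketHBar d e s) = revWord d e s := by
  have h : map INV.toRingHom (word bracketHBar d e par) = revWord d e par := by
    refine ext_ev (d := d) ?_ (rep_revWord d e par) fun n hn => ?_
    · rw [← rep_map, rep_word_par _ le_rfl par e]
    · rw [coeff_map, coeff_word_par _ d e n hn]
      exact INV_bracket_down he hn
  rw [← rep_word_par bracketHBar le_rfl s, ← rep_revWord, ← h, rep_map]

theorem map_INV_dRHS (o : ℕ → ℕ → ℚ) (l : ℕ → ℚ) (F : ℕ → (ℕ → ℕ) → (ℕ → Par) → PS HBar)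
    (G : ℕ → (ℕ → ℕ) → (ℕ → Par) → PS H) (d : ℕ) (e : ℕ → ℕ) (s : ℕ → Par)
    (h0 : map INV.toRingHom (F d e s) = G d e s)
    (h1 : ∀ j k, map INV.toRingHom (F (d - 1) (skip j e) (skip k s)) =
      G (d - 1) (skip j e) (skip k s)) :
    map INV.toRingHom (dRHS o l F d e s) = dRHS o l G d e s := by
  unfold dRHS
  simp only [map_sub, map_add, map_mul, map_sum, map_rat_smul, h0, h1, map_cast]

theorem cm_map_INV_word (o : ℕ → ℕ → ℚ) (l : ℕ → ℚ) {d : ℕ} {e : ℕ → ℕ} (he : Up d e ∨ Down d e)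
    (s : ℕ → Par) : cm (dH o l : H →ₗ[ℚ] H) (map INV.toRingHom (word bracketHBar d e s)) =
      map INV.toRingHom (cm (dbar (ext o l) l : HBar →ₗ[ℚ] HBar) (word bracketHBar d e s)) := by
  rw [cm_dbar_word _ l he]
  rcases he with he | he
  · rw [map_INV_dRHS _ _ _ (word bracketH) _ _ _ (map_INV_word_up he s) fun j k =>
      map_INV_word_up (he.skip j) _, map_INV_word_up he, cm_dH_word o l he]
  · rw [map_INV_dRHS _ _ _ revWord _ _ _ (map_INV_word_down he s) fun j k =>
      map_INV_word_down (he.skip j) _, map_INV_word_down he, cm_revWord o l he]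

/-- Regular words and the reversed series of inverted words satisfy the same derivative formula as
words of ℍ̄, with the scalars extended by `ext`. The Leibniz rule over `INV` extends the agreement
from generators. -/
theorem dH_INV (o : ℕ → ℕ → ℚ) (l : ℕ → ℚ) (x : HBar) :
    dH o l (INV x) = INV (dbar (ext o l) l x) := by
  have := leibniz_ext INV (f := (dH o l : H →ₗ[ℚ] H) ∘ₗ INV.toLinearMap)
    (g := INV.toLinearMap ∘ₗ (dbar (ext o l) l : HBar →ₗ[ℚ] HBar)) (fun a b => ?_) (fun a b => ?_)
    fun g => ?_
  · exact LinearMap.congr_fun this x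
  · simp only [LinearMap.comp_apply, AlgHom.toLinearMap_apply, map_mul, Derivation.coeFn_coe,
      Derivation.leibniz, smul_eq_mul]
  · simp only [LinearMap.comp_apply, AlgHom.toLinearMap_apply, map_mul, Derivation.coeFn_coe,
      Derivation.leibniz, smul_eq_mul, map_add]
  · simp only [LinearMap.comp_apply, AlgHom.toLinearMap_apply, Derivation.coeFn_coe]
    refine HBar.induction_gen (P := fun x => dH o l (INV x) = INV (dbar (ext o l) l x))
      (fun r => ?_) (fun d e n _ he hn => ?_) g
    · rw [INV_log, dH_log, dbar_log, AlgHom.commutes]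
    · have h := congrArg (coeff (ev d n)) (cm_map_INV_word o l he par)
      rw [coeff_cm, coeff_map, coeff_map, coeff_cm, coeff_word_par _ d e n hn] at h
      exact h

theorem INV_incl (x : H) : INV (incl x) = x := by
  have : INV.comp incl = AlgHom.id ℚ H := by
    refine MvPolynomial.algHom_ext fun g => ?_
    rw [AlgHom.comp_apply, incl, MvPolynomial.aeval_X]
    cases g with
    | log r => exact INV_log r
    | reg s => exact INV_reg s
  exact AlgHom.congr_fun this x

theorem incl_bracket {d : ℕ} {e n : ℕ → ℕ} (he : Up d e) (hn : ∀ k, 0 < n k) :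
    incl (bracketH d (fun a => e a) fun k => n k) = bracketHBar d (fun a => e a) fun k => n k := by
  rcases Nat.eq_zero_or_pos d with rfl | hd
  · rw [bracketHBar_zero, bracketH_zero, map_one]
  · rw [bracketHBar_up hd he hn, bracketH_up hd he hn, incl, MvPolynomial.aeval_X]

end SymbPolylog

namespace SymbPolylog

open MvPowerSeries

/-! ### The Hopf algebra `ℍ` -/

theorem aug_bracketH {d : ℕ} (hd : 0 < d) (e : Fin (d + 1) → ℕ) (n : Fin d → ℕ) :
    aug Gen (bracketH d e n) = 0 := by
  unfold bracketH
  rw [if_neg hd.ne']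
  split_ifs
  · exact aug_X _
  · exact map_zero _

theorem map_aug_tailWord (d : ℕ) (f : ℕ → ℕ) (τ : ℕ → Par) (i : ℕ) :
    map (aug Gen).toRingHom (tailWord d f τ i) = if d - i = 0 then 1 else 0 :=
  map_word_eq_ite (aug Gen) (fun _ _ => bracketH_zero _ _) (fun _ hd _ _ => aug_bracketH hd _ _) _ _ _

/-- In depth one both terms of the fraction have augmentation `1` and cancel; in greater depth both
vanish by induction. The remaining products contain a word of positive depth. -/
theorem map_aug_invWord {f : ℕ → ℕ} {d : ℕ} (hd : d ≠ 0) (τ : ℕ → Par) :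
    map (aug Gen).toRingHom (invWord d f τ) = 0 := by
  induction d using Nat.strong_induction_on generalizing τ with
  | _ d ih =>
  have hA : ∀ j < d, ∀ τ, map (aug Gen).toRingHom (fracLeft d f τ j) =
      if d = 1 then 1 else 0 := by
    intro j hj τ
    rw [fracLeft, map_mul, map_aug_tailWord]
    rcases Nat.eq_zero_or_pos j with rfl | hj0
    · rw [invWord_zero, map_one, one_mul]
      exact if_congr (by omega) rfl rfl
    · rw [ih j hj hj0.ne', zero_mul, if_neg (by omega)]
  have hlog : ∀ a b, aug Gen (logH a b) = 0 := by
    intro a b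
    simp [logH, map_sub, map_sum]
  have hB : ∀ j < d, map (aug Gen).toRingHom (fracRight d f par j) = if d = 1 then 1 else 0 := by
    intro j hj
    rw [fracRight, map_mul, hA j hj, map_ex, hlog, ex_zero_left, mul_one]
  have hpar : map (aug Gen).toRingHom (invSeries f d) = 0 := by
    rw [invSeries_eq hd fun j _ => rep_invSeries f j, map_add, map_sum, map_sum,
      Finset.sum_eq_zero, Finset.sum_eq_zero, zero_add]
    · intro j hj
      have hj := Finset.mem_range.mp hj
      have h0 : map (aug Gen).toRingHom (fracLeft d f par j - fracRight d f par j) = 0 := by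
        rw [map_sub, hA j hj, hB j hj, sub_self]
      have h1 : map (aug Gen).toRingHom (divT j (fracLeft d f par j - fracRight d f par j)) = 0 := by
        ext m
        exact congrArg (coeff (m + Finsupp.single j 1)) h0
      rw [map_mul, h1, mul_zero]
    · intro j hj
      have hj := Finset.mem_range.mp hj
      rw [map_mul, map_mul, map_aug_tailWord, if_neg (by omega), mul_zero, mul_zero]
  rw [invWord, rep_map, hpar, map_zero]

theorem aug_INV (x : HBar) : aug Gen (INV x) = aug GenBar x := by
  have : (aug Gen).comp INV = aug GenBar := by
    refine MvPolynomial.algHom_ext fun g => ?_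
    rw [AlgHom.comp_apply, aug_X]
    cases g with
    | log r => rw [INV_log, aug_X]
    | reg s => rw [INV_reg, aug_X]
    | inv s =>
      have h := map_aug_invWord (f := s.seq) s.depth_pos.ne' par
      rw [invWord_par] at h
      have h1 : aug Gen (coeff (expVec s.n) (invSeries s.seq s.depth)) = 0 :=
        congrArg (coeff (expVec s.n)) h
      rw [INV_inv, map_mul, h1, mul_zero]
  exact AlgHom.congr_fun this x

/-- Deletions in an increasing string stay increasing, so differentiating a regular symbol of ℍ̄
never leaves the regular symbols. -/
theorem incl_dH (o : ℕ → ℕ → ℚ) (l : ℕ → ℚ) (x : H) :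
    incl (dH o l x) = dbar (ext o l) l (incl x) := by
  have hF : ∀ {d : ℕ} {e : ℕ → ℕ}, Up d e → ∀ s,
      map incl.toRingHom (word bracketH d e s) = word bracketHBar d e s := by
    intro d e he s
    have h : map incl.toRingHom (word bracketH d e par) = word bracketHBar d e par := by
      refine ext_ev (d := d) ?_ (rep_word_par _ le_rfl par e) fun n hn => ?_
      · rw [← rep_map, rep_word_par _ le_rfl par e]
      · rw [coeff_map, coeff_word_par _ d e n hn, coeff_word_par _ d e n hn]
        exact incl_bracket he hn
    rw [← rep_word_par bracketHBar le_rfl s, ← rep_word_par bracketH le_rfl s, ← h, rep_map]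
  have := leibniz_ext incl (f := incl.toLinearMap ∘ₗ (dH o l : H →ₗ[ℚ] H))
    (g := (dbar (ext o l) l : HBar →ₗ[ℚ] HBar) ∘ₗ incl.toLinearMap) (fun a b => ?_) (fun a b => ?_)
    fun g => ?_
  · exact LinearMap.congr_fun this x
  · simp only [LinearMap.comp_apply, AlgHom.toLinearMap_apply, map_mul, Derivation.coeFn_coe,
      Derivation.leibniz, smul_eq_mul, map_add]
  · simp only [LinearMap.comp_apply, AlgHom.toLinearMap_apply, map_mul, Derivation.coeFn_coe,
      Derivation.leibniz, smul_eq_mul]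
  · simp only [LinearMap.comp_apply, AlgHom.toLinearMap_apply, Derivation.coeFn_coe]
    cases g with
    | log r =>
      have h : incl (MvPolynomial.X (.log r)) = MvPolynomial.X (.log r) := MvPolynomial.aeval_X _ _
      rw [h, dH_log, dbar_log, AlgHom.commutes]
    | reg s =>
      have he := s.seq_up
      have hs : map incl.toRingHom (dRHS (ext o l) l (word bracketH) s.depth s.seq par) =
          dRHS (ext o l) l (word bracketHBar) s.depth s.seq par := by
        unfold dRHS
        simp only [map_sub, map_add, map_mul, map_sum, map_rat_smul, hF he, hF (he.skip _),
          map_cast]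
      rw [X_reg_eqH, incl_bracket he s.wt_pos, dH_bracket o l s.depth_pos he s.wt_pos,
        dbar_bracket _ l s.depth_pos (Or.inl he) s.wt_pos, scalarCoeff_eq, scalarCoeff_eq, ← hs,
        coeff_map]
      rfl

/-- The map `INV ⊗ INV`. -/
def INV₂ : HBar ⊗[ℚ] HBar →ₐ[ℚ] H ⊗[ℚ] H := Algebra.TensorProduct.map INV INV

theorem coprodH_apply (x : H) : coprodH x = INV₂ (coprodHBar (incl x)) := rfl

theorem INV₂_tmul (a b : HBar) : INV₂ (a ⊗ₜ b) = INV a ⊗ₜ INV b := rfl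

theorem aug_rTensor_INV₂ (z : HBar ⊗[ℚ] HBar) : (aug Gen).toLinearMap.rTensor H (INV₂ z) =
    INV.toLinearMap.lTensor ℚ ((aug GenBar).toLinearMap.rTensor HBar z) := by
  induction z using TensorProduct.induction_on with
  | zero => simp only [map_zero]
  | add x y hx hy => simp only [map_add, hx, hy]
  | tmul a b =>
    rw [INV₂_tmul, LinearMap.rTensor_tmul, LinearMap.rTensor_tmul, LinearMap.lTensor_tmul,
      AlgHom.toLinearMap_apply, AlgHom.toLinearMap_apply, aug_INV]
    rfl

theorem aug_lTensor_INV₂ (z : HBar ⊗[ℚ] HBar) : (aug Gen).toLinearMap.lTensor H (INV₂ z) =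
    INV.toLinearMap.rTensor ℚ ((aug GenBar).toLinearMap.lTensor HBar z) := by
  induction z using TensorProduct.induction_on with
  | zero => simp only [map_zero]
  | add x y hx hy => simp only [map_add, hx, hy]
  | tmul a b =>
    rw [INV₂_tmul, LinearMap.lTensor_tmul, LinearMap.lTensor_tmul, LinearMap.rTensor_tmul,
      AlgHom.toLinearMap_apply, AlgHom.toLinearMap_apply, aug_INV]
    rfl

theorem dH_lTensor_INV₂ (o : ℕ → ℕ → ℚ) (l : ℕ → ℚ) (z : HBar ⊗[ℚ] HBar) :
    (dH o l : H →ₗ[ℚ] H).lTensor H (INV₂ z) =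
      INV₂ ((dbar (ext o l) l : HBar →ₗ[ℚ] HBar).lTensor HBar z) := by
  induction z using TensorProduct.induction_on with
  | zero => simp only [map_zero]
  | add x y hx hy => simp only [map_add, hx, hy]
  | tmul a b =>
    rw [INV₂_tmul, LinearMap.lTensor_tmul, LinearMap.lTensor_tmul, INV₂_tmul,
      Derivation.coeFn_coe, Derivation.coeFn_coe, dH_INV]

theorem Gen.weight_pos (g : Gen) : 0 < g.weight := by
  cases g with
  | log r => exact Nat.one_pos
  | reg s => exact s.weight_pos

theorem PolySymbol.weight_eq (s : PolySymbol) :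
    s.weight = ∑ k ∈ Finset.range s.depth, s.wt k := by
  have h := upSymbol_weight s.depth_pos s.seq_up s.wt_pos
  rwa [s.upSymbol_eq] at h

theorem bracketH_eq_one_or {d N : ℕ} {e n : ℕ → ℕ} (he : Up d e)
    (hn : ∀ k, 0 < n k) (hN : ∑ k ∈ Finset.range d, n k = N) :
    (bracketH d (fun a => e a) (fun k => n k) = 1 ∧ N = 0) ∨ ∃ t : Gen, t.weight = N ∧
      bracketH d (fun a => e a) (fun k => n k) = MvPolynomial.X t := by
  rcases Nat.eq_zero_or_pos d with rfl | hd
  · exact Or.inl ⟨bracketH_zero _ _, hN.symm⟩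
  · exact Or.inr ⟨.reg (upSymbol hd he hn), (upSymbol_weight hd he hn).trans hN, bracketH_up hd he hn⟩

theorem incl_eq_C {P : H} {c : ℚ} (h : incl P = MvPolynomial.C c) : P = MvPolynomial.C c := by
  rw [← INV_incl P, h]
  exact MvPolynomial.algHom_C _ _

theorem vars_incl (P : H) : ∀ s ∈ (incl P).vars, ∀ s', s ≠ .inv s' := by
  classical
  let φ : Gen → GenBar := fun g => match g with
    | .log r => .log r
    | .reg s => .reg s
  have h : incl = MvPolynomial.rename φ := by
    refine MvPolynomial.algHom_ext fun g => ?_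
    rw [MvPolynomial.rename_X, incl, MvPolynomial.aeval_X]
    cases g <;> rfl
  intro s hs s' h'
  rw [h] at hs
  obtain ⟨g, -, hg⟩ := Finset.mem_image.mp (MvPolynomial.vars_rename φ P hs)
  rw [← hg] at h'
  cases g <;> simp [φ] at h'

/-- Everything is transported through `incl` and `INV`: counits by `aug_INV`, derivations by
`dH_INV` and `incl_dH`. Coassociativity is not transported but follows again from this data, so
`INV` need not be known to respect coproducts. -/
theorem hopfDataH : HopfData Gen.weight coprodH
    fun p : (ℕ → ℕ → ℚ) × (ℕ → ℚ) => dH p.1 p.2 where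
  wt_pos := Gen.weight_pos
  counit_left := LinearMap.ext fun x => by
    change (aug Gen).toLinearMap.rTensor H (coprodH x) = 1 ⊗ₜ x
    rw [coprodH_apply, aug_rTensor_INV₂, hopfDataHBar.counit_left_apply, LinearMap.lTensor_tmul,
      AlgHom.toLinearMap_apply, INV_incl]
  counit_right := LinearMap.ext fun x => by
    change (aug Gen).toLinearMap.lTensor H (coprodH x) = x ⊗ₜ 1
    rw [coprodH_apply, aug_lTensor_INV₂, hopfDataHBar.counit_right_apply, LinearMap.rTensor_tmul,
      AlgHom.toLinearMap_apply, INV_incl]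
  comm p := LinearMap.ext fun x => by
    change (dH p.1 p.2 : H →ₗ[ℚ] H).lTensor H (coprodH x) = coprodH (dH p.1 p.2 x)
    rw [coprodH_apply, coprodH_apply, dH_lTensor_INV₂, incl_dH]
    exact congrArg _ (hopfDataHBar.comm_apply (ext p.1 p.2, p.2) (incl x))
  ker P hP := by
    obtain ⟨c, hc⟩ := HBar.eq_C_of_dbar_ext (vars_incl P) fun o l => by
      rw [← incl_dH, hP (o, l), map_zero]
    exact ⟨c, incl_eq_C hc⟩
  low p g := by
    cases g with
    | log r =>
      rw [dH_log, Algebra.algebraMap_eq_smul_one]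
      exact Submodule.smul_mem _ _ (Submodule.subset_span (Or.inl ⟨rfl, rfl⟩))
    | reg s =>
      have h1 : dH p.1 p.2 (MvPolynomial.X (.reg s)) = INV (dbar (ext p.1 p.2) p.2
          (bracketHBar s.depth (fun a => s.seq a) fun k => s.wt k)) := by
        rw [← dH_INV, INV_bracket_up s.seq_up s.wt_pos, X_reg_eqH]
      rw [h1, ← AlgHom.toLinearMap_apply, ← Submodule.mem_comap]
      refine dbar_bracket_mem _ _ s.depth_pos (Or.inl s.seq_up) s.wt_pos _
        fun d' e' n' _ he' hn' hsum => ?_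
      rw [Submodule.mem_comap, AlgHom.toLinearMap_apply, INV_bracket_up (he' s.seq_up) hn']
      have hw : (Gen.reg s).weight = ∑ k ∈ Finset.range d', n' k + 1 := s.weight_eq.trans hsum.symm
      refine Submodule.subset_span ?_
      rcases bracketH_eq_one_or (he' s.seq_up) hn' rfl with ⟨h2, h3⟩ | ⟨t, h2, h3⟩
      · exact Or.inl ⟨h2, by omega⟩
      · exact Or.inr ⟨t, by omega, h3⟩
  tri g := by
    cases g with
    | log r =>
      have h : incl (MvPolynomial.X (.log r)) = MvPolynomial.X (.log r) := MvPolynomial.aeval_X _ _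
      rw [coprodH_apply, h, coprodHBar_log, map_add, INV₂_tmul, INV₂_tmul, map_one, INV_log,
        add_sub_cancel_left]
      exact Submodule.subset_span ⟨1, _, Or.inl rfl, rfl⟩
    | reg s =>
      have h1 : coprodH (MvPolynomial.X (.reg s)) - MvPolynomial.X (.reg s) ⊗ₜ 1 =
          INV₂ (coprodHBar (bracketHBar s.depth (fun a => s.seq a) fun k => s.wt k) -
            bracketHBar s.depth (fun a => s.seq a) (fun k => s.wt k) ⊗ₜ 1) := by
        rw [map_sub, INV₂_tmul, INV_bracket_up s.seq_up s.wt_pos, map_one, coprodH_apply,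
          X_reg_eqH, incl_bracket s.seq_up s.wt_pos]
      rw [h1, ← AlgHom.toLinearMap_apply, ← Submodule.mem_comap]
      refine coprod_bracket_mem s.depth_pos (Or.inl s.seq_up) s.wt_pos _
        fun k I J n' hIJ hId hn' hle hlt a => ?_
      have hup : Up k fun x => s.seq (I x) := fun x y hxy hy =>
        s.seq_up _ _ (hIJ.I_lt hxy hy) (hId ▸ hIJ.le_last hy)
      rw [Submodule.mem_comap, AlgHom.toLinearMap_apply, INV₂_tmul, INV_bracket_up hup hn']
      refine Submodule.subset_span ⟨_, INV a, ?_, rfl⟩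
      rcases bracketH_eq_one_or hup hn' rfl with ⟨h2, h3⟩ | ⟨t, h2, h3⟩
      · exact Or.inl h2
      · refine Or.inr ⟨t, ?_, h3⟩
        rw [h2]
        exact (hIJ.sum_lt hId s.wt_pos hle hlt).trans_eq s.weight_eq.symm

/-! ### The derivation of `ℍ` -/

/-- For an increasing string `δ` is evaluated on a letter `x_{a→b}`, and its image is the value of
`ext` at the reversed pair. -/
theorem derivH_eq_dH {φ : DH →ₗ[H] H} {o : ℕ → ℕ → ℚ} {l : ℕ → ℚ}
    (h1 : ∀ a b, a < b → φ (dOne a b) = algebraMap ℚ H (o a b))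
    (h2 : ∀ a b, φ (dLog a b) = algebraMap ℚ H (l b - l a)) (x : H) :
    φ (derivH x) = dH o l x := by
  have h : φ.compDer derivH = dH o l := by
    refine MvPolynomial.derivation_ext fun g => ?_
    change φ (derivH (MvPolynomial.X g)) = _
    rw [derivH, MvPolynomial.mkDerivation_X]
    cases g with
    | log r =>
      rw [dH_log, ← h2 r (r + 1)]
      simp [dLog]
    | reg s =>
      have hs : ∀ k < s.depth, s.seq k < s.seq (k + 1) := fun k hk =>
        s.seq_up _ _ (Nat.lt_succ_self k) hk
      rw [dH_reg]
      refine map_derivCoeff φ (fun _ _ => h2 _ _) (fun k hk => ?_) (fun k hk => ?_) _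
      · rw [h1 _ _ (hs k hk), ext_of_lt o l (hs k hk)]
      · rw [map_add, h1 _ _ (hs k hk), h2, ← map_add, ext_of_gt o l (hs k hk)]
  exact DFunLike.congr_fun h x

theorem derivH_component (β : DGen) :
    ∃ p : (ℕ → ℕ → ℚ) × (ℕ → ℚ), ∀ x, derivH x β = dH p.1 p.2 x := by
  classical
  cases β with
  | one a b hab =>
    refine ⟨(fun x y => if x = a ∧ y = b then 1 else 0, 0), fun x =>
      derivH_eq_dH (φ := Finsupp.lapply (DGen.one a b hab)) (fun x y hlt => ?_)
        (fun x y => ?_) x⟩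
    · rw [Finsupp.lapply_apply, dOne, dif_pos hlt]
      dsimp only
      by_cases hxy : x = a ∧ y = b
      · obtain ⟨rfl, rfl⟩ := hxy
        simp
      · rw [if_neg hxy, Finsupp.single_eq_of_ne, map_zero]
        intro h
        simp only [DGen.one.injEq] at h
        exact hxy ⟨h.1.symm, h.2.symm⟩
    · simp [dLog]
  | log r =>
    refine ⟨(0, fun x => if r < x then 1 else 0), fun x =>
      derivH_eq_dH (φ := Finsupp.lapply (DGen.log r)) (fun x y hlt => ?_)
        (fun x y => ?_) x⟩
    · rw [Finsupp.lapply_apply, dOne, dif_pos hlt]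
      simp
    · have := sum_Ico_indicator (A := H) r x y
      simp only [dLog, Finsupp.lapply_apply, Finsupp.sub_apply, Finsupp.finsetSum_apply,
        Finsupp.single_apply, DGen.log.injEq]
      rw [this]
      split_ifs <;> simp

/-! ### Index vectors -/

theorem incl_symbol (v : Zinf) : incl (Zinf.symbol bracketH v) = Zinf.symbol bracketHBar v := by
  rw [Zinf.symbol_eq, Zinf.symbol_eq]
  exact incl_bracket v.brk_up v.wts_pos

theorem INV_symbol (v : Zinf) : INV (Zinf.symbol bracketHBar v) = Zinf.symbol bracketH v := by
  rw [← incl_symbol, INV_incl]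

theorem symbolH_injective : Function.Injective (Zinf.symbol bracketH) := fun v w h =>
  symbol_injective (by rw [← incl_symbol, h, incl_symbol])

theorem symbolH_eq_one_or_X (v : Zinf) : Zinf.symbol bracketH v = 1 ∨
    ∃ s, Zinf.symbol bracketH v = MvPolynomial.X s := by
  rw [Zinf.symbol_eq]
  rcases bracketH_eq_one_or v.brk_up v.wts_pos rfl with h | ⟨t, -, h⟩
  · exact Or.inl h.1
  · exact Or.inr ⟨t, h⟩

/-- The left factors are regular symbols, which `INV` fixes; it changes only the right factors, so
the columns obey the same restriction as for ℍ̄. -/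
theorem coprodH_symbol_mem (v : Zinf) : coprodH (Zinf.symbol bracketH v) ∈
    Submodule.span ℚ {x | ∃ (w : Zinf) (a : H), Zinf.Below v w ∧
      x = Zinf.symbol bracketH w ⊗ₜ[ℚ] a} := by
  rw [coprodH_apply, incl_symbol, ← AlgHom.toLinearMap_apply, ← Submodule.mem_comap]
  refine (Submodule.span_le.mpr ?_) (coprod_symbol_mem v)
  rintro _ ⟨w, a, hw, rfl⟩
  exact Submodule.subset_span ⟨w, INV a, hw, by
    rw [AlgHom.toLinearMap_apply, INV₂_tmul, INV_symbol]⟩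

end SymbPolylog

/-! ### The variation matrix of ℍ. -/

namespace SymbPolylog

/-- The variation matrix and the antipode of `ℍ`. -/
theorem variation_H : ∃ (V : Matrix Zinf Zinf H) (S : H →ₗ[ℚ] H),
      (IsVariationMatrix coprodH (Zinf.symbol bracketH) V ∧
        ∀ V' : Matrix Zinf Zinf H,
          IsVariationMatrix coprodH (Zinf.symbol bracketH) V' → V' = V) ∧
      (IsHopf coprodH counitH S ∧
        ∀ S' : H →ₗ[ℚ] H, IsLeftAntipode coprodH counitH S' → S' = S) ∧
      (CoproductFormula coprodH V ∧ AntipodeFormula S V ∧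
        DifferentialEquation derivH weightOneH V) ∧
      (∀ n : Zinf, n.IsPositive →
        n.finIndex.Finite ∧ CoproductFormula coprodH (restrict V n.finIndex) ∧
          AntipodeFormula S (restrict V n.finIndex) ∧
          DifferentialEquation derivH weightOneH (restrict V n.finIndex)) ∧
      (∀ n : Zinf, n.IsPositive → n.IsDecreasing →
        n.boxIndex.Finite ∧ CoproductFormula coprodH (restrict V n.boxIndex) ∧
          AntipodeFormula S (restrict V n.boxIndex) ∧
          DifferentialEquation derivH weightOneH (restrict V n.boxIndex)) := by
  obtain ⟨f, hf⟩ := exists_dual symbolH_injective symbolH_eq_one_or_X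
  exact HopfData.main hf coprodH_symbol_mem hopfDataH derivH_component
    (fun n _ => Zinf.finIndex_finite n) (fun n _ _ => Zinf.boxIndex_finite n)
    (fun n _ v hv w hvw => hvw.mem_finIndex hv) fun n _ hn v hv w hvw => hvw.mem_boxIndex hn hv

end SymbPolylog

end

theorem mainTheorem6 :
    (∃ (V : Matrix Zinf Zinf H) (S : H →ₗ[ℚ] H),
      (IsVariationMatrix coprodH (Zinf.symbol bracketH) V ∧
        ∀ V' : Matrix Zinf Zinf H,
          IsVariationMatrix coprodH (Zinf.symbol bracketH) V' → V' = V) ∧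
      (IsHopf coprodH counitH S ∧
        ∀ S' : H →ₗ[ℚ] H, IsLeftAntipode coprodH counitH S' → S' = S) ∧
      (CoproductFormula coprodH V ∧ AntipodeFormula S V ∧
        DifferentialEquation derivH weightOneH V) ∧
      (∀ n : Zinf, n.IsPositive →
        n.finIndex.Finite ∧ CoproductFormula coprodH (restrict V n.finIndex) ∧
          AntipodeFormula S (restrict V n.finIndex) ∧
          DifferentialEquation derivH weightOneH (restrict V n.finIndex)) ∧
      (∀ n : Zinf, n.IsPositive → n.IsDecreasing →
        n.boxIndex.Finite ∧ CoproductFormula coprodH (restrict V n.boxIndex) ∧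
          AntipodeFormula S (restrict V n.boxIndex) ∧
          DifferentialEquation derivH weightOneH (restrict V n.boxIndex))) ∧
    (∃ (V : Matrix Zinf Zinf HBar) (S : HBar →ₗ[ℚ] HBar),
      (IsVariationMatrix coprodHBar (Zinf.symbol bracketHBar) V ∧
        ∀ V' : Matrix Zinf Zinf HBar,
          IsVariationMatrix coprodHBar (Zinf.symbol bracketHBar) V' → V' = V) ∧
      (IsHopf coprodHBar counitHBar S ∧
        ∀ S' : HBar →ₗ[ℚ] HBar, IsLeftAntipode coprodHBar counitHBar S' → S' = S) ∧
      (CoproductFormula coprodHBar V ∧ AntipodeFormula S V ∧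
        DifferentialEquation derivHBar weightOneHBar V) ∧
      (∀ n : Zinf, n.IsPositive →
        n.finIndex.Finite ∧ CoproductFormula coprodHBar (restrict V n.finIndex) ∧
          AntipodeFormula S (restrict V n.finIndex) ∧
          DifferentialEquation derivHBar weightOneHBar (restrict V n.finIndex)) ∧
      (∀ n : Zinf, n.IsPositive → n.IsDecreasing →
        n.boxIndex.Finite ∧ CoproductFormula coprodHBar (restrict V n.boxIndex) ∧
          AntipodeFormula S (restrict V n.boxIndex) ∧
          DifferentialEquation derivHBar weightOneHBar (restrict V n.boxIndex))) :=
  ⟨variation_H, variation_HBar⟩
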